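/- Let $d\ge 0$. Consider a spike-and-slab model on $\mathbb{R}^d$ with prior $\prod_{i=1}^d\{(1-p)\,\delta_0(x_i)+p\,\pi_{\mathrm{slab}}(x_i)\}$, where $p\in(0,1)$ and $\pi_{\mathrm{slab}}$ is a positive probability density on $\mathbb{R}$, and with a positive likelihood $L(x)$. Assume that the density part of the posterior, $e^{-U(x)}:=L(x)\prod_i p\,\pi_{\mathrm{slab}}(x_i)$, is twice continuously differentiable on $\mathbb{R}^d$. Put $w=(1-p)/\{p\,\pi_{\mathrm{slab}}(0)\}$. *Original sticky zig-zag sampler.* The state consists of a position $x\in\mathbb{R}^d$, a velocity $v\in\{\pm1\}^d$ and the set of stuck coordinates. Unstuck coordinates move with velocity $v_i$, and $v_i$ flips its sign at the Poisson rate $\max\{0,v_i\,\partial_iU(x)\}$. On reaching $0$, a coordinate becomes stuck: it stays at $0$, without changing $v_i$, for an independent exponential time with mean $w$, and then moves on with velocity $v_i$. *Latent sticky sampler with partial position refreshment at rate $r$.* Let $c:\mathbb{R}\to\mathbb{R}$ be the collapsing map, $c(t)=0$ if $|t|\le w/2$ and $c(t)=t-\operatorname{sign}(t)\,w/2$ otherwise,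 applied coordinatewise on $\mathbb{R}^d$. The latent density is $e^{-\tilde U(y)}=L(c(y))\prod_i p\,\pi_{\mathrm{slab}}(c(y_i))$. In the latent space run the zig-zag sampler $(y_t,v_t)$ for this density (all coordinates move with velocity $v_i\in\{\pm1\}$, which flips at rate $\max\{0,v_i\,\partial_i\tilde U(y)\}$), where in addition each coordinate is, at rate $r\,\mathbf 1\{|y_i|<w/2\}$, resampled from $\mathrm{Unif}(-w/2,w/2)$. The latent sticky sampler is $(x^{\mathrm L,r}_t,v^{\mathrm L,r}_t)=(c(y_t),v_t)$. *Skorokhod metric.* For paths $z,z'$ on $[0,T]$, $$\rho_T(z,z')=\inf_\kappa\max\Big\{\sup_{t_1\ne t_2}\Big|\log\frac{\kappa(t_1)-\kappa(t_2)}{t_1-t_2}\Big|,\ \sup_{t\in[0,T]}\|z(t)-z'(\kappa(t))\|\Big\},$$ the infimum being over the strictly increasing $\kappa:[0,T]\to[0,T]$ with $\kappa(0)=0$ and $\kappa(T)=T$. **Theorem.** Let $y_0\in\mathbb{R}^d$ and $v_0\in\{\pm1\}^d$. There is a probability space that carries an original sticky zig-zag sampler $(x^{\mathrm O}_t,v^{\mathrm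 O}_t)_{t\ge0}$ started from position $c(y_0)$ and velocity $v_0$, with coordinate $i$ initially stuck exactly when $|y_{0,i}|\le w/2$ and $y_{0,i}\ne v_{0,i}\,w/2$, and, for every $r>0$, a latent sticky sampler $(x^{\mathrm L,r}_t,v^{\mathrm L,r}_t)_{t\ge0}$ with partial position refreshment at rate $r$ whose latent zig-zag starts from $(y_0,v_0)$, such that for all $T>0$ and $\varepsilon>0$ $$\lim_{r\to\infty}P\big[\rho_T\{(x^{\mathrm L,r}_t,v^{\mathrm L,r}_t),(x^{\mathrm O}_t,v^{\mathrm O}_t)\}>\varepsilon\big]=0 .$$ -/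

import Mathlib

open MeasureTheory ProbabilityTheory Filter Topology Set
open scoped ENNReal

noncomputable section

/-! ### The spike-and-slab posterior and its latent density -/

/-- A spike-and-slab model on `ℝᵈ`: the prior is the product over the coordinates of
`(1 - p) δ₀ + p · slab`, and `lik x` is the likelihood of the (fixed) data at the parameter `x`. -/
structure SpikeSlab (d : ℕ) where
  /-- the likelihood `x ↦ L(y ∣ x)` -/
  lik : (Fin d → ℝ) → ℝ
  /-- the slab density -/
  slab : ℝ → ℝ
  /-- the prior weight of the slab -/
  p : ℝ
  lik_pos : ∀ x, 0 < lik x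
  slab_pos : ∀ t, 0 < slab t
  integral_slab : ∫ t, slab t = 1
  p_pos : 0 < p
  p_lt_one : p < 1

namespace SpikeSlab

variable {d : ℕ} (M : SpikeSlab d)

/-- The (unnormalized) density of the continuous part of the posterior. -/
def densityPart (x : Fin d → ℝ) : ℝ := M.lik x * ∏ i, (M.p * M.slab (x i))

/-- The potential `U` with `densityPart = exp (-U)`. -/
def potential (x : Fin d → ℝ) : ℝ := -Real.log (M.densityPart x)

/-- The mean sticking time, which is also the width of the latent universe. -/
def width : ℝ := (1 - M.p) / (M.p * M.slab 0)

/-- The map that collapses the latent universe `[-w/2, w/2]` of one coordinate to `0`. -/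
def collapse₁ (t : ℝ) : ℝ :=
  if |t| ≤ M.width / 2 then 0 else t - Real.sign t * (M.width / 2)

/-- The collapsing map on `ℝᵈ`. -/
def collapse (y : Fin d → ℝ) : Fin d → ℝ := fun i => M.collapse₁ (y i)

/-- The continuous density on the latent line that represents the spike-and-slab prior of one
coordinate: the spike is spread over `[-w/2, w/2]` with constant height `p * slab 0`
(total mass `1 - p`), and the two halves of the slab part are shifted outwards by `w/2`. -/
def latentPrior (t : ℝ) : ℝ := M.p * M.slab (M.collapse₁ t)

/-- The (unnormalized) posterior density on the latent space. -/
def latentDensity (y : Fin d → ℝ) : ℝ := M.lik (M.collapse y) * ∏ i, M.latentPrior (y i)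

/-- The potential of the latent posterior density. -/
def latentPotential (y : Fin d → ℝ) : ℝ := -Real.log (M.latentDensity y)

end SpikeSlab

/-- The `i`-th zig-zag bounce rate `max {0, vᵢ ∂ᵢU(x)}` for the potential `U`. -/
def bounceRate {d : ℕ} (U : (Fin d → ℝ) → ℝ) (i : Fin d) (x v : Fin d → ℝ) : ℝ :=
  max 0 (v i * lineDeriv ℝ U x (Pi.single i 1))

/-- The counting function of a point process on `[0, ∞)` with successive gaps `e 0, e 1, …`:
the number of points in `[0, a]`. With independent `Exp(1)` gaps this is a unit-rate Poisson
process `N`, and then `t ↦ N (∫₀ᵗ λ)` is the counting process of Poisson events which occur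
according to the (state-dependent) rate `λ`. -/
def pointCount (e : ℕ → ℝ) (a : ℝ) : ℕ :=
  {n : ℕ | ∑ k ∈ Finset.range (n + 1), e k ≤ a}.ncard

/-! ### The original sticky zig-zag sampler -/

/-- The number of bounces of coordinate `i` up to time `t`, for the original sticky sampler:
a bounce of a coordinate occurs at the zig-zag rate while the coordinate is not stuck. -/
def origBounces {d : ℕ} (M : SpikeSlab d) (e : Fin d → ℕ → ℝ)
    (x v : ℝ → Fin d → ℝ) (stuck : ℝ → Fin d → Prop) (i : Fin d) (t : ℝ) : ℕ :=
  open Classical in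
  pointCount (e i)
    (∫ s in (0 : ℝ)..t, if stuck s i then 0 else bounceRate M.potential i (x s) (v s))

/-- The number of unsticking events of coordinate `i` up to time `t`: the `k`-th of them occurs
when the total time for which the coordinate has been stuck reaches `ς i 0 + ⋯ + ς i k`, so that
the `k`-th sticking of coordinate `i` lasts for the time `ς i k`. -/
def origUnsticks {d : ℕ} (ς : Fin d → ℕ → ℝ) (stuck : ℝ → Fin d → Prop) (i : Fin d) (t : ℝ) : ℕ :=
  open Classical in
  pointCount (ς i) (∫ s in (0 : ℝ)..t, if stuck s i then 1 else 0)

/-- `(x, v)`, with the indicator `stuck` of the stuck coordinates, is the trajectory over `[0, ∞)`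
of the original sticky zig-zag sampler that starts at position `x₀` with velocity `v₀` and stuck
coordinates `stuck₀`, has the gaps `e i k` between the integrated rates at successive bounces, and
the sticking times `ς i k`. -/
structure IsOriginalPath {d : ℕ} (M : SpikeSlab d) (x₀ v₀ : Fin d → ℝ) (stuck₀ : Fin d → Prop)
    (e ς : Fin d → ℕ → ℝ) (x v : ℝ → Fin d → ℝ) (stuck : ℝ → Fin d → Prop) : Prop where
  /-- the path is right-continuous -/
  right_cts_v : ∀ t, 0 ≤ t → ContinuousWithinAt v (Ici t) t
  right_cts_stuck : ∀ i t, 0 ≤ t → ∀ᶠ s in 𝓝[≥] t, (stuck s i ↔ stuck t i)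
  /-- each bounce flips the sign of the velocity component, which is otherwise constant (also
  during sticking, so that a coordinate unsticks with the velocity with which it got stuck) -/
  velocity : ∀ i t, 0 ≤ t → v t i = (-1) ^ origBounces M e x v stuck i t * v₀ i
  /-- unstuck coordinates move with their velocity, stuck ones do not move -/
  position : ∀ i t, 0 ≤ t →
    x t i = x₀ i + ∫ s in (0 : ℝ)..t, (open Classical in if stuck s i then 0 else v s i)
  stuck_zero : ∀ i, stuck 0 i ↔ stuck₀ i
  /-- a coordinate is stuck exactly when it is at `0`, except at the instants of its unsticking
  events (from which on it moves on with its velocity, by right-continuity) -/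
  stuck_iff : ∀ i t, 0 < t → (stuck t i ↔
    x t i = 0 ∧ ∃ s, 0 ≤ s ∧ s < t ∧ origUnsticks ς stuck i s = origUnsticks ς stuck i t)

/-- `(X, V)` is an original sticky zig-zag sampler on the probability space `(Ω, P)`: the integrated
bounce rates are exhausted at the points of independent unit-rate Poisson processes, and the
sticking times are independent, exponentially distributed with mean `width`. -/
def IsOriginalSticky {d : ℕ} (M : SpikeSlab d) (x₀ v₀ : Fin d → ℝ) (stuck₀ : Fin d → Prop)
    {Ω : Type} [MeasurableSpace Ω] (P : Measure Ω) (X V : Ω → ℝ → Fin d → ℝ) : Prop :=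
  ∃ e ς : Fin d → ℕ → Ω → ℝ,
    (∀ i k, HasLaw (e i k) (expMeasure 1) P) ∧
    (∀ i k, HasLaw (ς i k) (expMeasure (1 / M.width)) P) ∧
    iIndepFun (fun q : (Fin d × ℕ) ⊕ (Fin d × ℕ) =>
      Sum.elim (fun a => e a.1 a.2) (fun a => ς a.1 a.2) q) P ∧
    ∀ᵐ ω ∂P, ∃ stuck : ℝ → Fin d → Prop,
      IsOriginalPath M x₀ v₀ stuck₀ (fun i k => e i k ω) (fun i k => ς i k ω) (X ω) (V ω) stuck

/-! ### The latent zig-zag sampler with partial position refreshment -/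

/-- The number of bounces of coordinate `i` up to time `t`, for the zig-zag sampler on the latent
density. -/
def latentBounces {d : ℕ} (M : SpikeSlab d) (e : Fin d → ℕ → ℝ)
    (y v : ℝ → Fin d → ℝ) (i : Fin d) (t : ℝ) : ℕ :=
  pointCount (e i) (∫ s in (0 : ℝ)..t, bounceRate M.latentPotential i (y s) (v s))

/-- The number of position refreshments of coordinate `i` up to time `t`: these occur at rate `r`
while the coordinate is inside the latent universe. -/
def refreshes {d : ℕ} (M : SpikeSlab d) (r : ℝ) (f : Fin d → ℕ → ℝ)
    (y : ℝ → Fin d → ℝ) (i : Fin d) (t : ℝ) : ℕ :=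
  open Classical in
  pointCount (f i) (∫ s in (0 : ℝ)..t, if |y s i| < M.width / 2 then r else 0)

/-- `(y, v)` is the trajectory over `[0, ∞)`, in the latent space, of the zig-zag sampler on the
latent density with partial position refreshment at rate `r` that starts at `(y₀, v₀)`, where
`e i k` and `f i k` are the gaps between the integrated rates at successive bounces and at
successive refreshments, and `u i k` is the new position of coordinate `i` at its `k`-th
refreshment. -/
structure IsLatentPath {d : ℕ} (M : SpikeSlab d) (r : ℝ) (y₀ v₀ : Fin d → ℝ)
    (e f u : Fin d → ℕ → ℝ) (y v : ℝ → Fin d → ℝ) : Prop where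
  /-- the path is right-continuous -/
  right_cts_y : ∀ t, 0 ≤ t → ContinuousWithinAt y (Ici t) t
  right_cts_v : ∀ t, 0 ≤ t → ContinuousWithinAt v (Ici t) t
  /-- each bounce flips the sign of the velocity component, which is otherwise constant -/
  velocity : ∀ i t, 0 ≤ t → v t i = (-1) ^ latentBounces M e y v i t * v₀ i
  position_zero : y 0 = y₀
  /-- between its refreshments a coordinate moves with its velocity -/
  position : ∀ i s t, 0 ≤ s → s ≤ t → refreshes M r f y i s = refreshes M r f y i t →
    y t i = y s i + ∫ a in s..t, v a i
  /-- at its `n`-th refreshment, coordinate `i` jumps to `u i n` -/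
  refresh : ∀ i t n, 0 < t → (∀ s, 0 ≤ s → s < t → refreshes M r f y i s ≤ n) →
    refreshes M r f y i t = n + 1 → y t i = u i n

/-- `(X, V)` is a latent sticky sampler with partial position refreshment at rate `r`, on the
probability space `(Ω, P)`: it is the image under the collapsing map of the zig-zag sampler on the
latent density with additional refreshment events, whose new positions are uniform on the
universe. -/
def IsLatentSticky {d : ℕ} (M : SpikeSlab d) (r : ℝ) (y₀ v₀ : Fin d → ℝ)
    {Ω : Type} [MeasurableSpace Ω] (P : Measure Ω) (X V : Ω → ℝ → Fin d → ℝ) : Prop :=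
  ∃ e f u : Fin d → ℕ → Ω → ℝ,
    (∀ i k, HasLaw (e i k) (expMeasure 1) P) ∧
    (∀ i k, HasLaw (f i k) (expMeasure 1) P) ∧
    (∀ i k, HasLaw (u i k) (cond volume (Ioo (-(M.width / 2)) (M.width / 2))) P) ∧
    iIndepFun (fun q : (Fin d × ℕ) ⊕ (Fin d × ℕ) ⊕ (Fin d × ℕ) =>
      Sum.elim (fun a => e a.1 a.2)
        (Sum.elim (fun a => f a.1 a.2) (fun a => u a.1 a.2)) q) P ∧
    ∀ᵐ ω ∂P, ∃ y : ℝ → Fin d → ℝ,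
      IsLatentPath M r y₀ v₀ (fun i k => e i k ω) (fun i k => f i k ω) (fun i k => u i k ω)
        y (V ω) ∧
      ∀ t, 0 ≤ t → X ω t = M.collapse (y t)

/-- A coordinate with latent position `t` and velocity `c` is about to spend time in the universe
`[-w/2, w/2]`, i.e. it is in the universe and not at the end at which the velocity points out. -/
def SpikeSlab.startsStuck {d : ℕ} (M : SpikeSlab d) (t c : ℝ) : Prop :=
  |t| ≤ M.width / 2 ∧ t ≠ c * (M.width / 2)

/-! ### The Skorokhod metric -/

/-- The time dilations of `[0, T]`. -/
def IsDilation (T : ℝ) (κ : ℝ → ℝ) : Prop :=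
  StrictMonoOn κ (Icc 0 T) ∧ κ 0 = 0 ∧ κ T = T

/-- The size `sup |log ((κ t₁ - κ t₂) / (t₁ - t₂))|` of a time dilation of `[0, T]`. -/
def dilationSize (T : ℝ) (κ : ℝ → ℝ) : ℝ≥0∞ :=
  ⨆ (t₁ ∈ Icc 0 T) (t₂ ∈ Icc 0 T) (_ : t₁ ≠ t₂),
    ENNReal.ofReal |Real.log ((κ t₁ - κ t₂) / (t₁ - t₂))|

/-- The Skorokhod distance on `[0, T]`. -/
def skorokhodDist {E : Type*} [PseudoEMetricSpace E] (T : ℝ) (z z' : ℝ → E) : ℝ≥0∞ :=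
  ⨅ (κ : ℝ → ℝ) (_ : IsDilation T κ),
    max (dilationSize T κ) (⨆ t ∈ Icc 0 T, edist (z t) (z' (κ t)))

end

/-! Write `h = w / 2`. A coordinate that is refreshed to a uniform position `u` of the universe,
with the next refreshment due after time `l ≤ h`, can leave before that only if `|u| > h - l`. Such
a refreshment is called an escape (`Escapes`); given `l` it has probability `l / h`, so in the time
scale of the universe escapes occur approximately at rate `1 / h`. At an escape the coordinate
really leaves exactly when the sign of `u` agrees with its velocity. Halving the rate `1 / h` gives
the rate `1 / w`, so the time spent in the universe is approximately exponential with mean `w`, the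
law of the sticking time.

The samplers are realized as deterministic systems driven by clocks (`ClockSystem`). The sticky
system has for each coordinate a mark clock that runs while the coordinate is stuck; a mark carries
a sign and releases the coordinate if that sign is its velocity. If the mark gaps are the gaps
between the escapes of a latent path and the signs are those of the escaping positions, then the
latent path collapses exactly to the sticky path up to time `T`, provided that the relevant gaps
between refreshments are short and no bounce falls on the hitting time of `0`
(`collapse_latent_path`, with the invariant `CoordCoupled`).

All rates `r` share one source of marks. A mark `ξ`, uniform on `(-h, h)`, encodes a fair sign and
the gap `-h log (|ξ| / h)`, which is exponential with mean `h`. At a refreshment let `c = 1 - l /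
h`. If `|ξ| > c h`, the new position is `ξ`, an escape; otherwise it is `c φ` with a fresh uniform
`φ`, and `ξ` is replaced by `ξ / c`, which is uniform again. Hence the positions are independent and
uniform (`measurePreserving_refreshStep`), while a time `l` without escape lowers the pending gap by
`-h log (1 - l / h)`, which is nearly `l`. By the law of large numbers all relevant `l` become
small, and the escape gaps tend almost surely to the mark gaps as `r → ∞` (`tendsto_escapeGap`).

The states at the events depend continuously on the gaps where clocks do not tie
(`IsContinuous.tendsto_run`), ties have probability zero (`ae_tieFree`), and a piecewise linear time
change that matches the event times bounds the Skorokhod distance (`skorokhodDist_run_le`).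

Finally, the sticky system with independent exponential mark gaps is the original sampler. The
velocity at a mark is determined before its sign is used, so the signs that meet a negative velocity
may be reversed without changing the law (`measurePreserving_flipSigns`). Thereafter positive marks
release, and a geometric number of exponential gaps of mean `h` sums to an exponential time of mean
`w` (`measurePreserving_stickStep`). -/

noncomputable section

set_option linter.unusedSectionVars false
set_option linter.unusedVariables false

/-! ### Piecewise deterministic systems driven by clocks -/

/-- A piecewise deterministic system with finitely many clocks: between events the position follows
`flow`, clock `q` runs at speed `rate q`, and at an event of clock `q` with mark `m` the position
is transformed by `jump q m`. -/
structure ClockSystem (Q Z : Type) where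
  /-- the deterministic motion -/
  flow : ℝ → Z → Z
  /-- the speeds of the clocks -/
  rate : Q → Z → ℝ
  /-- the effects of the events -/
  jump : Q → ℝ → Z → Z

/-- The state of a clock system right after an event. -/
structure ClockState (Q Z : Type) where
  /-- the time of the event -/
  time : ℝ
  /-- the position -/
  pos : Z
  /-- the clock amounts that remain until the next events -/
  resid : Q → ℝ
  /-- the numbers of previous events -/
  count : Q → ℕ

namespace ClockSystem

variable {Q Z : Type} (S : ClockSystem Q Z)

/-- The amount by which clock `q` advances in time `h`, starting from `z`. -/
def hazard (q : Q) (z : Z) (h : ℝ) : ℝ := ∫ s in (0 : ℝ)..h, S.rate q (S.flow s z)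

/-- The standing assumptions on a clock system. -/
structure Regular : Prop where
  flow_add : ∀ s t z, 0 ≤ s → 0 ≤ t → S.flow t (S.flow s z) = S.flow (s + t) z
  rate_nonneg : ∀ q z, 0 ≤ S.rate q z
  rate_integrable : ∀ q z h, 0 ≤ h →
    IntervalIntegrable (fun s => S.rate q (S.flow s z)) volume 0 h
  exists_tick : ∃ q, ∀ z, S.rate q z = 1

section hazard

variable {S}

lemma hazard_zero (q : Q) (z : Z) : S.hazard q z 0 = 0 := by simp [hazard]

lemma Regular.rate_integrable' (hS : S.Regular) (q : Q) (z : Z) {h k : ℝ} (hh : 0 ≤ h)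
    (hk : 0 ≤ k) : IntervalIntegrable (fun s => S.rate q (S.flow s z)) volume h k :=
  (hS.rate_integrable q z h hh).symm.trans (hS.rate_integrable q z k hk)

lemma Regular.hazard_mono (hS : S.Regular) (q : Q) (z : Z) {h k : ℝ} (hh : 0 ≤ h) (hk : h ≤ k) :
    S.hazard q z h ≤ S.hazard q z k := by
  have := intervalIntegral.integral_add_adjacent_intervals (hS.rate_integrable q z h hh)
    (hS.rate_integrable' q z hh (hh.trans hk))
  have h2 : 0 ≤ ∫ s in h..k, S.rate q (S.flow s z) :=
    intervalIntegral.integral_nonneg hk fun s _ => hS.rate_nonneg _ _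
  unfold hazard; linarith

lemma Regular.hazard_nonneg (hS : S.Regular) (q : Q) (z : Z) {h : ℝ} (hh : 0 ≤ h) :
    0 ≤ S.hazard q z h := by
  have := hS.hazard_mono q z le_rfl hh
  rwa [hazard_zero] at this

lemma Regular.hazard_continuousOn (hS : S.Regular) (q : Q) (z : Z) :
    ContinuousOn (S.hazard q z) (Ici 0) := by
  intro t ht
  have ht : 0 ≤ t := ht
  have h1 : ContinuousOn (S.hazard q z) (uIcc 0 (t + 1)) := by
    apply intervalIntegral.continuousOn_primitive_interval
    rw [uIcc_of_le (by linarith)]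
    exact (intervalIntegrable_iff_integrableOn_Icc_of_le (by linarith)).1
      (hS.rate_integrable q z (t + 1) (by linarith))
  rw [uIcc_of_le (by linarith)] at h1
  refine (h1 t ⟨ht, by linarith⟩).mono_of_mem_nhdsWithin ?_
  rw [mem_nhdsWithin]
  exact ⟨Iio (t + 1), isOpen_Iio, by simp, fun x hx => ⟨hx.2, hx.1.le⟩⟩

lemma Regular.hazard_add (hS : S.Regular) (q : Q) (z : Z) {h k : ℝ} (hh : 0 ≤ h) (hk : 0 ≤ k) :
    S.hazard q z (h + k) = S.hazard q z h + S.hazard q (S.flow h z) k := by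
  have h1 := intervalIntegral.integral_add_adjacent_intervals (hS.rate_integrable q z h hh)
    (hS.rate_integrable' q z hh (add_nonneg hh hk))
  have h2 : ∫ s in (0 : ℝ)..k, S.rate q (S.flow s (S.flow h z)) =
      ∫ s in (0 : ℝ)..k, S.rate q (S.flow (h + s) z) := by
    apply intervalIntegral.integral_congr
    intro s hs
    rw [uIcc_of_le hk] at hs
    simp only [hS.flow_add h s z hh hs.1]
  have h3 : ∫ s in (0 : ℝ)..k, S.rate q (S.flow (h + s) z) =
      ∫ s in h..h + k, S.rate q (S.flow s z) := by
    have := intervalIntegral.integral_comp_add_left (a := 0) (b := k)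
      (fun s => S.rate q (S.flow s z)) h
    simpa using this
  unfold hazard
  rw [h2, h3, h1]

end hazard

/-- The times at which some clock has exhausted its remaining amount. -/
def ringTimes (z : Z) (a : Q → ℝ) : Set ℝ := {h | 0 ≤ h ∧ ∃ q, a q ≤ S.hazard q z h}

/-- The waiting time until the next event. -/
def wait (z : Z) (a : Q → ℝ) : ℝ := sInf (S.ringTimes z a)

/-- An enumeration of the clocks, by which ties are broken. -/
def clockRank (Q : Type) [Fintype Q] (q : Q) : ℕ := (Fintype.equivFin Q q).val

lemma clockRank_injective (Q : Type) [Fintype Q] : Function.Injective (clockRank Q) :=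
  fun _ _ h => (Fintype.equivFin Q).injective (Fin.ext h)

variable [Fintype Q] [DecidableEq Q]

/-- The clock `q` is the one that causes the next event. -/
def IsFirst (z : Z) (a : Q → ℝ) (q : Q) : Prop :=
  a q ≤ S.hazard q z (S.wait z a) ∧
    ∀ p, a p ≤ S.hazard p z (S.wait z a) → clockRank Q q ≤ clockRank Q p

variable [Nonempty Q]

/-- The clock that causes the next event. -/
def first (z : Z) (a : Q → ℝ) : Q := Classical.epsilon (S.IsFirst z a)

/-- The transition from one event to the next. -/
def step (g mk : Q → ℕ → ℝ) (s : ClockState Q Z) : ClockState Q Z where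
  time := s.time + S.wait s.pos s.resid
  pos := S.jump (S.first s.pos s.resid) (mk (S.first s.pos s.resid) (s.count (S.first s.pos s.resid)))
    (S.flow (S.wait s.pos s.resid) s.pos)
  -- The ringing clock has nothing left and receives its next gap. Gap `0` is handed out at the
  -- start, so this has index `count + 1`.
  resid := fun p => s.resid p - S.hazard p s.pos (S.wait s.pos s.resid) +
    if p = S.first s.pos s.resid then g p (s.count p + 1) else 0
  count := fun p => s.count p + if p = S.first s.pos s.resid then 1 else 0

/-- The states after the successive events, for the gaps `g` and the marks `mk`. -/
def run (g mk : Q → ℕ → ℝ) (z₀ : Z) : ℕ → ClockState Q Z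
  | 0 => ⟨0, z₀, fun q => g q 0, fun _ => 0⟩
  | n + 1 => S.step g mk (run g mk z₀ n)

/-- The number of events up to time `t`. -/
def runIndex (g mk : Q → ℕ → ℝ) (z₀ : Z) (t : ℝ) : ℕ := sInf {n | t < (S.run g mk z₀ (n + 1)).time}

/-- The position at time `t`. -/
def path (g mk : Q → ℕ → ℝ) (z₀ : Z) (t : ℝ) : Z :=
  S.flow (t - (S.run g mk z₀ (S.runIndex g mk z₀ t)).time)
    (S.run g mk z₀ (S.runIndex g mk z₀ t)).pos

variable {S}

section wait

lemma Regular.ringTimes_nonempty (hS : S.Regular) (z : Z) (a : Q → ℝ) :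
    (S.ringTimes z a).Nonempty := by
  obtain ⟨q, hq⟩ := hS.exists_tick
  refine ⟨max 0 (a q), le_max_left _ _, q, ?_⟩
  simp [hazard, hq]

lemma ringTimes_bddBelow (z : Z) (a : Q → ℝ) : BddBelow (S.ringTimes z a) :=
  ⟨0, fun _ h => h.1⟩

lemma wait_nonneg (z : Z) (a : Q → ℝ) : 0 ≤ S.wait z a :=
  Real.sInf_nonneg fun _ h => h.1

lemma lt_of_lt_wait {z : Z} {a : Q → ℝ} {h : ℝ} (h0 : 0 ≤ h) (hh : h < S.wait z a) (q : Q) :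
    S.hazard q z h < a q := by
  by_contra hc
  exact absurd (csInf_le (ringTimes_bddBelow z a) ⟨h0, q, not_lt.1 hc⟩) (not_le.2 hh)

lemma Regular.ringTimes_isClosed (hS : S.Regular) (z : Z) (a : Q → ℝ) :
    IsClosed (S.ringTimes z a) := by
  have : S.ringTimes z a = ⋃ q, {h | h ∈ Ici (0 : ℝ) ∧ a q ≤ S.hazard q z h} := by
    ext h; simp [ringTimes]
  rw [this]
  refine isClosed_iUnion_of_finite fun q => ?_
  exact isClosed_Ici.isClosed_le continuousOn_const (hS.hazard_continuousOn q z)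

lemma Regular.wait_mem (hS : S.Regular) (z : Z) (a : Q → ℝ) : S.wait z a ∈ S.ringTimes z a :=
  (hS.ringTimes_isClosed z a).csInf_mem (hS.ringTimes_nonempty z a) (ringTimes_bddBelow z a)

/-- The infimum is attained because the hazards are continuous, and a clock that has rung stays so
because they are monotone. Comparisons of waiting times thereby become inequalities between hazards.
-/
lemma Regular.wait_le_iff (hS : S.Regular) (z : Z) (a : Q → ℝ) {h : ℝ} (h0 : 0 ≤ h) :
    S.wait z a ≤ h ↔ ∃ q, a q ≤ S.hazard q z h := by
  constructor
  · intro hh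
    obtain ⟨h1, q, hq⟩ := hS.wait_mem z a
    exact ⟨q, hq.trans (hS.hazard_mono q z h1 hh)⟩
  · rintro ⟨q, hq⟩
    exact csInf_le (ringTimes_bddBelow z a) ⟨h0, q, hq⟩

lemma Regular.first_spec (hS : S.Regular) (z : Z) (a : Q → ℝ) : S.IsFirst z a (S.first z a) := by
  apply Classical.epsilon_spec (p := S.IsFirst z a)
  classical
  obtain ⟨_, q, hq⟩ := hS.wait_mem z a
  obtain ⟨p, hp, hp'⟩ := Finset.exists_min_image
    (Finset.univ.filter fun q => a q ≤ S.hazard q z (S.wait z a)) (clockRank Q)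
    ⟨q, by simpa using hq⟩
  exact ⟨p, by simpa using hp, fun r hr => hp' r (by simpa using hr)⟩

lemma Regular.first_eq_iff (hS : S.Regular) (z : Z) (a : Q → ℝ) (q : Q) :
    S.first z a = q ↔ S.IsFirst z a q := by
  constructor
  · rintro rfl; exact hS.first_spec z a
  · intro h
    have h' := hS.first_spec z a
    exact clockRank_injective Q (le_antisymm (h'.2 _ h.1) (h.2 _ h'.1))

/-- Before the waiting time every hazard is below its amount, and continuity carries this to the
limit. If the waiting time is zero, there is no earlier time and the sign of the amounts is used
instead. -/
lemma Regular.hazard_wait_le (hS : S.Regular) (z : Z) (a : Q → ℝ) (ha : ∀ q, 0 ≤ a q) (q : Q) :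
    S.hazard q z (S.wait z a) ≤ a q := by
  rcases (wait_nonneg (S := S) z a).eq_or_lt with h | h
  · rw [← h, hazard_zero]; exact ha q
  · have hc := (hS.hazard_continuousOn q z (S.wait z a) h.le).mono (s := Ico 0 (S.wait z a))
      (fun x hx => hx.1)
    have : (𝓝[Ico 0 (S.wait z a)] (S.wait z a)).NeBot := by
      rw [← mem_closure_iff_nhdsWithin_neBot, closure_Ico h.ne]
      exact ⟨h.le, le_rfl⟩
    refine le_of_tendsto hc ?_
    filter_upwards [self_mem_nhdsWithin] with s hs
    exact (lt_of_lt_wait hs.1 hs.2 q).le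

lemma Regular.hazard_first (hS : S.Regular) (z : Z) (a : Q → ℝ) (ha : ∀ q, 0 ≤ a q) :
    S.hazard (S.first z a) z (S.wait z a) = a (S.first z a) :=
  le_antisymm (hS.hazard_wait_le z a ha _) (hS.first_spec z a).1

end wait

section run

variable {g mk : Q → ℕ → ℝ} {z₀ : Z}

lemma run_succ (n : ℕ) : S.run g mk z₀ (n + 1) = S.step g mk (S.run g mk z₀ n) := rfl

lemma run_time_mono : Monotone fun n => (S.run g mk z₀ n).time :=
  monotone_nat_of_le_succ fun n => by
    simp only [run_succ, step]
    linarith [wait_nonneg (S := S) (S.run g mk z₀ n).pos (S.run g mk z₀ n).resid]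

lemma run_time_nonneg (n : ℕ) : 0 ≤ (S.run g mk z₀ n).time :=
  run_time_mono (S := S) (g := g) (mk := mk) (z₀ := z₀) (Nat.zero_le n)

lemma run_count_mono (q : Q) : Monotone fun n => (S.run g mk z₀ n).count q :=
  monotone_nat_of_le_succ fun n => by simp only [run_succ, step]; omega

/-- The two bounds place each clock within its current gap; this later identifies its count with a
`pointCount`. -/
lemma Regular.run_resid (hS : S.Regular) (hg : ∀ q k, 0 ≤ g q k) (n : ℕ) (q : Q) :
    0 ≤ (S.run g mk z₀ n).resid q ∧
      (S.run g mk z₀ n).resid q ≤ g q ((S.run g mk z₀ n).count q) := by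
  induction n generalizing q with
  | zero => exact ⟨hg q 0, le_rfl⟩
  | succ n ih =>
    have h1 := hS.hazard_wait_le (S.run g mk z₀ n).pos _ (fun p => (ih p).1)
    have h2 := hS.hazard_first (S.run g mk z₀ n).pos _ (fun p => (ih p).1)
    have h3 := hS.hazard_nonneg q (S.run g mk z₀ n).pos
      (wait_nonneg (S := S) (S.run g mk z₀ n).pos (S.run g mk z₀ n).resid)
    simp only [run_succ, step]
    split_ifs with hq
    · rw [← hq] at h2
      rw [h2]
      simp [hg]
    · have := h1 q
      have := (ih q).2
      simp only [add_zero]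
      constructor <;> linarith

lemma runIndex_eq {t : ℝ} {n : ℕ} (h1 : (S.run g mk z₀ n).time ≤ t)
    (h2 : t < (S.run g mk z₀ (n + 1)).time) : S.runIndex g mk z₀ t = n := by
  apply le_antisymm (Nat.sInf_le h2)
  by_contra! hc
  change S.runIndex g mk z₀ t < n at hc
  have hne : {n | t < (S.run g mk z₀ (n + 1)).time}.Nonempty := ⟨n, h2⟩
  have h3 := Nat.sInf_mem hne
  have h4 : (S.run g mk z₀ (S.runIndex g mk z₀ t + 1)).time ≤ (S.run g mk z₀ n).time :=
    run_time_mono (by omega : S.runIndex g mk z₀ t + 1 ≤ n)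
  exact absurd (lt_of_lt_of_le h3 (h4.trans h1)) (lt_irrefl _)

lemma path_eq {t : ℝ} {n : ℕ} (h1 : (S.run g mk z₀ n).time ≤ t)
    (h2 : t < (S.run g mk z₀ (n + 1)).time) :
    S.path g mk z₀ t = S.flow (t - (S.run g mk z₀ n).time) (S.run g mk z₀ n).pos := by
  rw [path, runIndex_eq h1 h2]

lemma exists_run_index (ht : Tendsto (fun n => (S.run g mk z₀ n).time) atTop atTop) {t : ℝ}
    (h0 : 0 ≤ t) : ∃ n, (S.run g mk z₀ n).time ≤ t ∧ t < (S.run g mk z₀ (n + 1)).time := by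
  have hex : ∃ n, t < (S.run g mk z₀ (n + 1)).time := by
    obtain ⟨n, hn⟩ := (ht.eventually_gt_atTop t).exists
    exact ⟨n, hn.trans_le (run_time_mono (Nat.le_succ n))⟩
  classical
  refine ⟨Nat.find hex, ?_, Nat.find_spec hex⟩
  rcases h : Nat.find hex with _ | m
  · exact h0
  · exact not_lt.1 (Nat.find_min hex (m := m) (by omega))

lemma run_resid_pos_of_lt (hS : S.Regular) {n : ℕ}
    (h : (S.run g mk z₀ n).time < (S.run g mk z₀ (n + 1)).time) {s : ℝ} (h0 : 0 ≤ s)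
    (hs : s < (S.run g mk z₀ (n + 1)).time - (S.run g mk z₀ n).time) (q : Q) :
    S.hazard q (S.run g mk z₀ n).pos s < (S.run g mk z₀ n).resid q := by
  apply lt_of_lt_wait h0
  simp only [run_succ, step] at hs
  linarith

/-- A functional of the path is integrated by integrating it between the events. -/
lemma Regular.path_integral (hS : S.Regular) (F : Z → ℝ)
    (hF : ∀ z h, 0 ≤ h → IntervalIntegrable (fun s => F (S.flow s z)) volume 0 h)
    (n : ℕ) {t : ℝ} (h1 : (S.run g mk z₀ n).time ≤ t)
    (h2 : t ≤ (S.run g mk z₀ (n + 1)).time) :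
    IntervalIntegrable (fun s => F (S.path g mk z₀ s)) volume 0 t ∧
    ∫ s in (0 : ℝ)..t, F (S.path g mk z₀ s) =
      ∑ j ∈ Finset.range n, (∫ s in (0 : ℝ)..S.wait (S.run g mk z₀ j).pos (S.run g mk z₀ j).resid,
        F (S.flow s (S.run g mk z₀ j).pos)) +
      ∫ s in (0 : ℝ)..t - (S.run g mk z₀ n).time, F (S.flow s (S.run g mk z₀ n).pos) := by
  -- Between two events the path is a translate of the flow, except possibly at `t` itself, where
  -- the next event may already have happened. A single point does not affect the integral.
  have key : ∀ n t, (S.run g mk z₀ n).time ≤ t → t ≤ (S.run g mk z₀ (n + 1)).time →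
      IntervalIntegrable (fun s => F (S.path g mk z₀ s)) volume (S.run g mk z₀ n).time t ∧
      ∫ s in (S.run g mk z₀ n).time..t, F (S.path g mk z₀ s) =
        ∫ s in (0 : ℝ)..t - (S.run g mk z₀ n).time, F (S.flow s (S.run g mk z₀ n).pos) := by
    intro n t h1 h2
    set τ := (S.run g mk z₀ n).time
    have hcongr : ∀ᵐ s ∂volume, s ∈ uIoc τ t → F (S.flow (s - τ) (S.run g mk z₀ n).pos) =
        F (S.path g mk z₀ s) := by
      have : ∀ᵐ s ∂(volume : Measure ℝ), s ≠ t := by simp [ae_iff, measure_singleton]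
      filter_upwards [this] with s hs hs'
      rw [uIoc_of_le h1] at hs'
      rw [path_eq (n := n) hs'.1.le (lt_of_lt_of_le (lt_of_le_of_ne hs'.2 hs) h2)]
    constructor
    · have h3 := (hF (S.run g mk z₀ n).pos (t - τ) (by linarith)).comp_sub_right τ
      simp only [zero_add, sub_add_cancel] at h3
      exact h3.congr_ae ((ae_restrict_iff' measurableSet_uIoc).2 hcongr)
    · rw [← intervalIntegral.integral_congr_ae hcongr]
      have := intervalIntegral.integral_comp_sub_right (a := τ) (b := t)
        (fun s => F (S.flow s (S.run g mk z₀ n).pos)) τ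
      simpa using this
  have hstart : ∀ n, IntervalIntegrable (fun s => F (S.path g mk z₀ s)) volume 0
      (S.run g mk z₀ n).time ∧ ∫ s in (0 : ℝ)..(S.run g mk z₀ n).time, F (S.path g mk z₀ s) =
      ∑ j ∈ Finset.range n, (∫ s in (0 : ℝ)..S.wait (S.run g mk z₀ j).pos (S.run g mk z₀ j).resid,
        F (S.flow s (S.run g mk z₀ j).pos)) := by
    intro n
    induction n with
    | zero => simp [run]
    | succ n ih =>
      obtain ⟨k1, k2⟩ := key n _ (run_time_mono (Nat.le_succ n)) le_rfl
      refine ⟨ih.1.trans k1, ?_⟩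
      rw [Finset.sum_range_succ, ← ih.2,
        ← intervalIntegral.integral_add_adjacent_intervals ih.1 k1, k2]
      congr 2
      simp [run_succ, step]
  obtain ⟨k1, k2⟩ := key n t h1 h2
  refine ⟨(hstart n).1.trans k1, ?_⟩
  rw [← (hstart n).2, ← k2, intervalIntegral.integral_add_adjacent_intervals (hstart n).1 k1]

/-- The total advance of a clock up to an event, in terms of its gaps. -/
lemma sum_hazard (n : ℕ) (q : Q) :
    ∑ j ∈ Finset.range n, S.hazard q (S.run g mk z₀ j).pos
      (S.wait (S.run g mk z₀ j).pos (S.run g mk z₀ j).resid) =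
    ∑ k ∈ Finset.range ((S.run g mk z₀ n).count q + 1), g q k - (S.run g mk z₀ n).resid q := by
  induction n with
  | zero => simp [run]
  | succ n ih =>
    rw [Finset.sum_range_succ, ih]
    simp only [run_succ, step]
    split_ifs with h
    · rw [Finset.sum_range_succ _ ((S.run g mk z₀ n).count q + 1)]; ring
    · simp; ring

lemma Regular.integral_rate (hS : S.Regular) (n : ℕ) (q : Q) {t : ℝ}
    (h1 : (S.run g mk z₀ n).time ≤ t) (h2 : t ≤ (S.run g mk z₀ (n + 1)).time) :
    ∫ s in (0 : ℝ)..t, S.rate q (S.path g mk z₀ s) =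
      ∑ k ∈ Finset.range ((S.run g mk z₀ n).count q + 1), g q k - (S.run g mk z₀ n).resid q +
        S.hazard q (S.run g mk z₀ n).pos (t - (S.run g mk z₀ n).time) := by
  rw [(hS.path_integral (S.rate q) (hS.rate_integrable q) n h1 h2).2, ← sum_hazard]
  rfl

end run

end ClockSystem

lemma pointCount_eq {e : ℕ → ℝ} (he : ∀ k, 0 < e k) {a : ℝ} {m : ℕ}
    (h1 : ∑ k ∈ Finset.range m, e k ≤ a) (h2 : a < ∑ k ∈ Finset.range (m + 1), e k) :
    pointCount e a = m := by
  have hmono : Monotone fun n => ∑ k ∈ Finset.range n, e k :=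
    monotone_nat_of_le_succ fun n => by rw [Finset.sum_range_succ]; linarith [he n]
  have : {n : ℕ | ∑ k ∈ Finset.range (n + 1), e k ≤ a} = (Finset.range m : Set ℕ) := by
    ext n
    simp only [mem_ofPred_eq, Finset.coe_range, mem_Iio]
    constructor
    · intro h
      by_contra hc
      have := hmono (show m + 1 ≤ n + 1 by omega)
      simp only at this
      linarith
    · intro h
      exact (hmono (show n + 1 ≤ m by omega)).trans h1
  rw [pointCount, this, ncard_coe_finset, Finset.card_range]

namespace ClockSystem

variable {Q Z : Type} {S : ClockSystem Q Z} [Fintype Q] [DecidableEq Q] [Nonempty Q]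
  {g mk : Q → ℕ → ℝ} {z₀ : Z}

lemma Regular.integral_rate_bounds (hS : S.Regular) (hg : ∀ q k, 0 ≤ g q k) {n : ℕ} (q : Q) {t : ℝ}
    (h1 : (S.run g mk z₀ n).time ≤ t) (h2 : t < (S.run g mk z₀ (n + 1)).time) :
    ∑ k ∈ Finset.range ((S.run g mk z₀ n).count q), g q k ≤
      ∫ s in (0 : ℝ)..t, S.rate q (S.path g mk z₀ s) ∧
    ∫ s in (0 : ℝ)..t, S.rate q (S.path g mk z₀ s) <
      ∑ k ∈ Finset.range ((S.run g mk z₀ n).count q + 1), g q k := by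
  have hr := hS.run_resid (mk := mk) (z₀ := z₀) hg n q
  have hh := hS.hazard_nonneg q (S.run g mk z₀ n).pos (sub_nonneg.2 h1)
  have hlt := run_resid_pos_of_lt hS (h1.trans_lt h2) (sub_nonneg.2 h1) (by linarith) q
  rw [hS.integral_rate n q h1 h2.le]
  refine ⟨?_, by linarith⟩
  rw [Finset.sum_range_succ]
  linarith

/-- The events of a clock are the points of the process with the given gaps, in the time scale of
the clock. -/
lemma Regular.pointCount_path (hS : S.Regular) (hg : ∀ q k, 0 < g q k) {n : ℕ} (q : Q) {t : ℝ}
    (h1 : (S.run g mk z₀ n).time ≤ t) (h2 : t < (S.run g mk z₀ (n + 1)).time) :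
    pointCount (g q) (∫ s in (0 : ℝ)..t, S.rate q (S.path g mk z₀ s)) =
      (S.run g mk z₀ n).count q :=
  have h := hS.integral_rate_bounds (fun q k => (hg q k).le) q h1 h2
  pointCount_eq (hg q) h.1 h.2

/-- If the size of the position is controlled and the clock speeds are bounded for positions of
bounded size, then there are only finitely many events in bounded time. -/
lemma Regular.tendsto_run_time (hS : S.Regular) (hg : ∀ q k, 0 < g q k)
    (hsum : ∀ q, Tendsto (fun n => ∑ k ∈ Finset.range n, g q k) atTop atTop)
    (size : Z → ℝ) (hflow : ∀ s z, 0 ≤ s → size (S.flow s z) ≤ size z + s)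
    (hjump : ∀ q k z, size (S.jump q (mk q k) z) ≤ size z)
    (hbdd : ∀ K, ∃ R, ∀ q z h, 0 ≤ h → size z + h ≤ K → S.hazard q z h ≤ R * h) :
    Tendsto (fun n => (S.run g mk z₀ n).time) atTop atTop := by
  refine (tendsto_atTop_of_monotone (run_time_mono (S := S) (g := g) (mk := mk)
    (z₀ := z₀))).resolve_right ?_
  -- If the event times stayed below `T`, the size would stay bounded and each clock would advance
  -- by at most `R * T`. Its gaps sum to infinity, so it would ring only boundedly often, whereas
  -- the total number of events is unbounded.
  rintro ⟨T, hT⟩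
  have hle : ∀ n, (S.run g mk z₀ n).time ≤ T := fun n => run_time_mono.ge_of_tendsto hT n
  have hsize : ∀ n, size (S.run g mk z₀ n).pos ≤ size z₀ + (S.run g mk z₀ n).time := by
    intro n
    induction n with
    | zero => simp [run]
    | succ n ih =>
      simp only [run_succ, step]
      refine (hjump _ _ _).trans ((hflow _ _ (wait_nonneg _ _)).trans ?_)
      linarith
  obtain ⟨R, hR⟩ := hbdd (size z₀ + T)
  have hbound : ∀ n q, ∑ k ∈ Finset.range ((S.run g mk z₀ n).count q), g q k ≤ R * T ⊔ 0 := by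
    intro n q
    have h1 : ∀ m, ∑ j ∈ Finset.range m, S.hazard q (S.run g mk z₀ j).pos
        (S.wait (S.run g mk z₀ j).pos (S.run g mk z₀ j).resid) ≤
        R * (S.run g mk z₀ m).time := by
      intro m
      induction m with
      | zero => simp [run]
      | succ m ih =>
        rw [Finset.sum_range_succ]
        have h2 := hle (m + 1)
        have h3 := hsize m
        simp only [run_succ, step] at h2 ⊢
        have := hR q (S.run g mk z₀ m).pos (S.wait (S.run g mk z₀ m).pos (S.run g mk z₀ m).resid)
          (wait_nonneg _ _) (by linarith)
        linarith
    have h2 := h1 n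
    rw [sum_hazard, Finset.sum_range_succ] at h2
    have h3 := (hS.run_resid (mk := mk) (z₀ := z₀) (fun q k => (hg q k).le) n q).2
    rcases le_total 0 R with hR0 | hR0
    · exact le_max_of_le_left (by nlinarith [hle n])
    · exact le_max_of_le_right
        (by nlinarith [run_time_nonneg (S := S) (g := g) (mk := mk) (z₀ := z₀) n])
  have hcount : ∀ n, ∑ q, (S.run g mk z₀ n).count q = n := by
    intro n
    induction n with
    | zero => simp [run]
    | succ n ih =>
      simp only [run_succ, step, Finset.sum_add_distrib, ih]
      simp
  have hN : ∀ q, ∃ N, ∀ n, (S.run g mk z₀ n).count q ≤ N := by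
    intro q
    obtain ⟨N, hN⟩ := ((hsum q).eventually_gt_atTop (R * T ⊔ 0)).exists
    refine ⟨N, fun n => ?_⟩
    by_contra hc
    have : ∑ k ∈ Finset.range N, g q k ≤ ∑ k ∈ Finset.range ((S.run g mk z₀ n).count q), g q k :=
      Finset.sum_le_sum_of_subset_of_nonneg (Finset.range_subset_range.2 (by omega))
        fun k _ _ => (hg q k).le
    linarith [hbound n q]
  choose N hN using hN
  have := hcount (∑ q, N q + 1)
  have h4 : ∑ q, (S.run g mk z₀ (∑ q, N q + 1)).count q ≤ ∑ q, N q :=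
    Finset.sum_le_sum fun q _ => hN q _
  omega

end ClockSystem

/-! ### Dependence of a clock system on its gaps: measurability, continuity, absence of ties -/

/-- Meant for quantities selected by a discrete random index, such as the ringing clock or a count.
The pieces have to cover the space but may overlap. -/
lemma measurable_of_pieces {Ω β ι : Type*} [MeasurableSpace Ω] [MeasurableSpace β] [Countable ι]
    {E : ι → Set Ω} (hE : ∀ i, MeasurableSet (E i)) (hcov : ∀ ω, ∃ i, ω ∈ E i) {f : Ω → β}
    {F : ι → Ω → β} (hF : ∀ i, Measurable (F i)) (h : ∀ i ω, ω ∈ E i → f ω = F i ω) :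
    Measurable f := by
  intro B hB
  have : f ⁻¹' B = ⋃ i, E i ∩ F i ⁻¹' B := by
    ext ω
    simp only [mem_preimage, mem_iUnion, mem_inter_iff]
    constructor
    · intro hω
      obtain ⟨i, hi⟩ := hcov ω
      exact ⟨i, hi, by rwa [← h i ω hi]⟩
    · rintro ⟨i, hi, hω⟩
      rwa [h i ω hi]
  rw [this]
  exact MeasurableSet.iUnion fun i => (hE i).inter (hF i hB)

namespace ClockSystem

variable {Q Z : Type} (S : ClockSystem Q Z) [Fintype Q] [DecidableEq Q] [Nonempty Q]

/-- Continuity properties of a clock system. -/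
structure IsContinuous [TopologicalSpace Z] [MeasurableSpace Z] : Prop where
  -- The cutoff avoids negative times, at which nothing is assumed about the hazard.
  hazard_cont : ∀ q, Continuous fun p : Z × ℝ => S.hazard q p.1 (max p.2 0)
  flow_cont : Continuous fun p : ℝ × Z => S.flow p.1 p.2
  jump_cont : ∀ q m, Continuous (S.jump q m)
  jump_meas : ∀ q, Measurable fun p : ℝ × Z => S.jump q p.1 p.2

/-- Exactly one clock rings at the next event, and it does not come to a halt there. -/
def TieFree (z : Z) (a : Q → ℝ) : Prop :=
  (∀ p, p ≠ S.first z a → S.hazard p z (S.wait z a) < a p) ∧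
    ∀ h, S.wait z a < h → a (S.first z a) < S.hazard (S.first z a) z h

variable {S}

/-! ### Measurability of a run in its gaps and marks -/

section measurability

variable [TopologicalSpace Z] [MeasurableSpace Z] [BorelSpace Z] [SecondCountableTopology Z]
  {Ω : Type*} [MeasurableSpace Ω]

lemma IsContinuous.measurable_hazard (hC : S.IsContinuous) {z : Ω → Z} (hz : Measurable z)
    {h : Ω → ℝ} (hh : Measurable h) (h0 : ∀ ω, 0 ≤ h ω) (q : Q) :
    Measurable fun ω => S.hazard q (z ω) (h ω) := by
  have := (hC.hazard_cont q).measurable.comp (hz.prodMk hh)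
  simpa [Function.comp_def, max_eq_left (h0 _)] using this

lemma IsContinuous.measurable_wait (hC : S.IsContinuous) (hS : S.Regular) {z : Ω → Z}
    (hz : Measurable z) {a : Ω → Q → ℝ} (ha : ∀ q, Measurable fun ω => a ω q) :
    Measurable fun ω => S.wait (z ω) (a ω) := by
  refine measurable_of_Iic fun c => ?_
  rcases lt_or_ge c 0 with hc | hc
  · convert MeasurableSet.empty
    ext ω
    simpa using hc.trans_le (wait_nonneg (S := S) (z ω) (a ω))
  · have : (fun ω => S.wait (z ω) (a ω)) ⁻¹' Iic c = ⋃ q, {ω | a ω q ≤ S.hazard q (z ω) c} := by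
      ext ω
      simp [hS.wait_le_iff _ _ hc]
    rw [this]
    exact MeasurableSet.iUnion fun q =>
      measurableSet_le (ha q) (hC.measurable_hazard hz measurable_const (fun _ => hc) q)

lemma IsContinuous.measurableSet_first (hC : S.IsContinuous) (hS : S.Regular) {z : Ω → Z}
    (hz : Measurable z) {a : Ω → Q → ℝ} (ha : ∀ q, Measurable fun ω => a ω q) (q : Q) :
    MeasurableSet {ω | S.first (z ω) (a ω) = q} := by
  have hw := hC.measurable_wait hS hz ha
  have hr : ∀ p, MeasurableSet {ω | a ω p ≤ S.hazard p (z ω) (S.wait (z ω) (a ω))} := fun p =>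
    measurableSet_le (ha p) (hC.measurable_hazard hz hw (fun _ => wait_nonneg _ _) p)
  simp only [hS.first_eq_iff, IsFirst]
  refine (hr q).inter ?_
  have : {ω | ∀ p, a ω p ≤ S.hazard p (z ω) (S.wait (z ω) (a ω)) →
      clockRank Q q ≤ clockRank Q p} = ⋂ p, ({ω | a ω p ≤ S.hazard p (z ω) (S.wait (z ω) (a ω))}ᶜ ∪
        {_ω | clockRank Q q ≤ clockRank Q p}) := by
    ext ω
    simp [imp_iff_not_or]
  change MeasurableSet {ω | ∀ p, a ω p ≤ S.hazard p (z ω) (S.wait (z ω) (a ω)) →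
    clockRank Q q ≤ clockRank Q p}
  rw [this]
  exact MeasurableSet.iInter fun p => (hr p).compl.union (MeasurableSet.const _)

lemma IsContinuous.measurable_run (hC : S.IsContinuous) (hS : S.Regular)
    {g mk : Ω → Q → ℕ → ℝ} (hg : ∀ q k, Measurable fun ω => g ω q k)
    (hm : ∀ q k, Measurable fun ω => mk ω q k) (z₀ : Z) (n : ℕ) :
    (Measurable fun ω => (S.run (g ω) (mk ω) z₀ n).time) ∧
    (Measurable fun ω => (S.run (g ω) (mk ω) z₀ n).pos) ∧
    (∀ q, Measurable fun ω => (S.run (g ω) (mk ω) z₀ n).resid q) ∧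
    (∀ q, Measurable fun ω => (S.run (g ω) (mk ω) z₀ n).count q) := by
  induction n with
  | zero => exact ⟨measurable_const, measurable_const, fun q => hg q 0, fun _ => measurable_const⟩
  | succ n ih =>
    obtain ⟨ht, hp, hr, hc⟩ := ih
    have hw := hC.measurable_wait hS hp hr
    have hf := hC.measurableSet_first hS hp hr
    have hcq : ∀ q k, MeasurableSet {ω | (S.run (g ω) (mk ω) z₀ n).count q = k} := fun q k =>
      hc q (measurableSet_singleton k)
    simp only [run_succ, step]
    refine ⟨ht.add hw, ?_, fun q => ?_, fun q => ?_⟩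
    -- Both the ringing clock and its count, which select the jump and the mark, are random; there
    -- are countably many cases.
    · refine measurable_of_pieces (ι := Q × ℕ)
        (E := fun i => {ω | S.first (S.run (g ω) (mk ω) z₀ n).pos (S.run (g ω) (mk ω) z₀ n).resid
          = i.1} ∩ {ω | (S.run (g ω) (mk ω) z₀ n).count i.1 = i.2})
        (F := fun i ω => S.jump i.1 (mk ω i.1 i.2) (S.flow
          (S.wait (S.run (g ω) (mk ω) z₀ n).pos (S.run (g ω) (mk ω) z₀ n).resid)
          (S.run (g ω) (mk ω) z₀ n).pos))
        (fun i => (hf i.1).inter (hcq i.1 i.2)) (fun ω => ⟨(S.first (S.run (g ω) (mk ω) z₀ n).pos (S.run (g ω) (mk ω) z₀ n).resid,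
          (S.run (g ω) (mk ω) z₀ n).count
            (S.first (S.run (g ω) (mk ω) z₀ n).pos (S.run (g ω) (mk ω) z₀ n).resid)), rfl, rfl⟩)
        (fun i => (hC.jump_meas i.1).comp
          ((hm i.1 i.2).prodMk (hC.flow_cont.measurable.comp (hw.prodMk hp)))) ?_
      rintro ⟨q, k⟩ ω ⟨h1, h2⟩
      simp only [mem_ofPred_eq] at h1 h2
      rw [h1, h2]
    · refine ((hr q).sub (hC.measurable_hazard hp hw (fun _ => wait_nonneg _ _) q)).add ?_
      simp only [eq_comm (a := q)]
      refine Measurable.ite (hf q) ?_ measurable_const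
      exact measurable_of_pieces (E := fun k => {ω | (S.run (g ω) (mk ω) z₀ n).count q = k})
        (hcq q) (fun ω => ⟨_, rfl⟩) (F := fun k ω => g ω q (k + 1)) (fun k => hg q (k + 1))
        fun k ω h => by rw [← h]
    · refine (hc q).add ?_
      simp only [eq_comm (a := q)]
      exact Measurable.ite (hf q) measurable_const measurable_const

end measurability

/-! ### Continuity of a run in its gaps -/

section continuity

variable [TopologicalSpace Z] [MeasurableSpace Z] {ι : Type*} {l : Filter ι}

lemma IsContinuous.tendsto_hazard (hC : S.IsContinuous) {z : ι → Z} {z' : Z}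
    (hz : Tendsto z l (𝓝 z')) {h : ι → ℝ} {h' : ℝ} (hh : Tendsto h l (𝓝 h')) (h0 : ∀ i, 0 ≤ h i)
    (h0' : 0 ≤ h') (q : Q) : Tendsto (fun i => S.hazard q (z i) (h i)) l (𝓝 (S.hazard q z' h')) := by
  have := ((hC.hazard_cont q).tendsto (z', h')).comp (hz.prodMk_nhds hh)
  simpa [Function.comp_def, max_eq_left (h0 _), max_eq_left h0'] using this

/-- Before the limiting waiting time all hazards are strictly below their amounts, which persists
under perturbation. Right after it the hazard of the ringing clock exceeds its amount strictly, by
the second clause of `TieFree`, so the perturbed clock cannot ring much later. -/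
lemma IsContinuous.tendsto_wait (hC : S.IsContinuous) (hS : S.Regular) {z : ι → Z} {z' : Z}
    (hz : Tendsto z l (𝓝 z')) {a : ι → Q → ℝ} {a' : Q → ℝ}
    (ha : ∀ q, Tendsto (fun i => a i q) l (𝓝 (a' q))) (htf : S.TieFree z' a') :
    Tendsto (fun i => S.wait (z i) (a i)) l (𝓝 (S.wait z' a')) := by
  have hw := wait_nonneg (S := S) z' a'
  refine tendsto_order.2 ⟨fun b hb => ?_, fun b hb => ?_⟩
  · rcases lt_or_ge b 0 with hb0 | hb0
    · exact Eventually.of_forall fun i => hb0.trans_le (wait_nonneg _ _)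
    · have : ∀ q, ∀ᶠ i in l, S.hazard q (z i) b < a i q := fun q =>
        (hC.tendsto_hazard hz tendsto_const_nhds (fun _ => hb0) hb0 q).eventually_lt (ha q)
          (lt_of_lt_wait hb0 hb q)
      filter_upwards [eventually_all.2 this] with i hi
      rw [← not_le, hS.wait_le_iff _ _ hb0]
      push Not
      exact hi
  · obtain ⟨c, hc1, hc2⟩ := exists_between hb
    have hc0 : 0 ≤ c := hw.trans hc1.le
    filter_upwards [(ha (S.first z' a')).eventually_lt
      (hC.tendsto_hazard hz tendsto_const_nhds (fun _ => hc0) hc0 _) (htf.2 c hc1)] with i hi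
    exact ((hS.wait_le_iff _ _ hc0).2 ⟨_, hi.le⟩).trans_lt hc2

/-- The other clocks fall strictly short at the limiting waiting time, hence also at the perturbed
one, where some clock has to ring. -/
lemma IsContinuous.eventually_first (hC : S.IsContinuous) (hS : S.Regular) {z : ι → Z} {z' : Z}
    (hz : Tendsto z l (𝓝 z')) {a : ι → Q → ℝ} {a' : Q → ℝ}
    (ha : ∀ q, Tendsto (fun i => a i q) l (𝓝 (a' q))) (htf : S.TieFree z' a') :
    ∀ᶠ i in l, S.first (z i) (a i) = S.first z' a' := by
  have hw := hC.tendsto_wait hS hz ha htf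
  have : ∀ q, q ≠ S.first z' a' → ∀ᶠ i in l, S.hazard q (z i) (S.wait (z i) (a i)) < a i q :=
    fun q hq => (hC.tendsto_hazard hz hw (fun _ => wait_nonneg _ _)
      (wait_nonneg _ _) q).eventually_lt (ha q) (htf.1 q hq)
  have : ∀ᶠ i in l, ∀ q, q ≠ S.first z' a' → S.hazard q (z i) (S.wait (z i) (a i)) < a i q :=
    eventually_all.2 fun q => by
      by_cases hq : q = S.first z' a'
      · exact Eventually.of_forall fun i h => absurd hq h
      · filter_upwards [this q hq] with i hi _ using hi
  filter_upwards [this] with i hi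
  by_contra hc
  exact absurd (hS.first_spec (z i) (a i)).1 (not_le.2 (hi _ hc))

/-- The state after `n` events depends continuously on the gaps wherever there are no ties. -/
lemma IsContinuous.tendsto_run (hC : S.IsContinuous) (hS : S.Regular) {g : ι → Q → ℕ → ℝ}
    {g' mk : Q → ℕ → ℝ} (hg : ∀ q k, Tendsto (fun i => g i q k) l (𝓝 (g' q k))) (z₀ : Z) (n : ℕ)
    (htf : ∀ j < n, S.TieFree (S.run g' mk z₀ j).pos (S.run g' mk z₀ j).resid) :
    Tendsto (fun i => (S.run (g i) mk z₀ n).time) l (𝓝 (S.run g' mk z₀ n).time) ∧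
    Tendsto (fun i => (S.run (g i) mk z₀ n).pos) l (𝓝 (S.run g' mk z₀ n).pos) ∧
    (∀ q, Tendsto (fun i => (S.run (g i) mk z₀ n).resid q) l (𝓝 ((S.run g' mk z₀ n).resid q))) ∧
    ∀ᶠ i in l, (S.run (g i) mk z₀ n).count = (S.run g' mk z₀ n).count := by
  induction n with
  | zero => exact ⟨tendsto_const_nhds, tendsto_const_nhds, fun q => hg q 0,
      Eventually.of_forall fun _ => rfl⟩
  | succ n ih =>
    obtain ⟨ht, hp, hr, hc⟩ := ih fun j hj => htf j (hj.trans n.lt_succ_self)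
    have htn := htf n n.lt_succ_self
    have hw := hC.tendsto_wait hS hp hr htn
    have hf := hC.eventually_first hS hp hr htn
    simp only [run_succ, step]
    refine ⟨ht.add hw, ?_, fun q => ?_, ?_⟩
    · have h1 := (hC.flow_cont.tendsto (S.wait (S.run g' mk z₀ n).pos (S.run g' mk z₀ n).resid,
        (S.run g' mk z₀ n).pos)).comp (hw.prodMk_nhds hp)
      have h2 := ((hC.jump_cont (S.first (S.run g' mk z₀ n).pos (S.run g' mk z₀ n).resid)
        (mk (S.first (S.run g' mk z₀ n).pos (S.run g' mk z₀ n).resid)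
          ((S.run g' mk z₀ n).count (S.first (S.run g' mk z₀ n).pos
          (S.run g' mk z₀ n).resid)))).tendsto _).comp h1
      refine h2.congr' ?_
      filter_upwards [hf, hc] with i h3 h4
      simp only [Function.comp, h3, h4]
    · refine ((hr q).sub (hC.tendsto_hazard hp hw (fun _ => wait_nonneg _ _)
        (wait_nonneg _ _) q)).add ?_
      have h1 : Tendsto (fun i => if q = S.first (S.run g' mk z₀ n).pos (S.run g' mk z₀ n).resid
          then g i q ((S.run g' mk z₀ n).count q + 1) else 0) l
          (𝓝 (if q = S.first (S.run g' mk z₀ n).pos (S.run g' mk z₀ n).resid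
          then g' q ((S.run g' mk z₀ n).count q + 1) else 0)) := by
        split_ifs
        · exact hg _ _
        · exact tendsto_const_nhds
      refine h1.congr' ?_
      filter_upwards [hf, hc] with i h3 h4
      simp only [h3, h4]
    · filter_upwards [hf, hc] with i h3 h4
      simp only [h3, h4]

end continuity

/-! ### Almost sure absence of ties -/

section atomless

variable {g g' mk : Q → ℕ → ℝ} {z₀ : Z}

/-- As long as the `k`-th gap of clock `q` is not used up, it influences only the remaining amount
of that clock. -/
lemma run_agree (hS : S.Regular) {q : Q} {k : ℕ}
    (hgg : ∀ p j, ¬ (p = q ∧ j = k) → g p j = g' p j) (n : ℕ)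
    (h : (S.run g mk z₀ n).count q ≤ k) (h' : (S.run g' mk z₀ n).count q ≤ k) :
    (S.run g mk z₀ n).time = (S.run g' mk z₀ n).time ∧
    (S.run g mk z₀ n).pos = (S.run g' mk z₀ n).pos ∧
    (S.run g mk z₀ n).count = (S.run g' mk z₀ n).count ∧
    (∀ p, p ≠ q → (S.run g mk z₀ n).resid p = (S.run g' mk z₀ n).resid p) ∧
    ((S.run g mk z₀ n).count q < k → (S.run g mk z₀ n).resid q = (S.run g' mk z₀ n).resid q) ∧
    ((S.run g mk z₀ n).count q = k →
      (S.run g mk z₀ n).resid q - g q k = (S.run g' mk z₀ n).resid q - g' q k) := by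
  induction n with
  | zero =>
    refine ⟨rfl, rfl, rfl, fun p hp => hgg p 0 fun h => hp h.1, fun hk => ?_, fun hk => ?_⟩
    · simp only [run] at hk
      exact hgg q 0 fun h => hk.ne h.2
    · simp only [run] at hk
      subst hk
      simp [run]
  | succ n ih =>
    have hm := run_count_mono (S := S) (g := g) (mk := mk) (z₀ := z₀) q (Nat.le_succ n)
    have hm' := run_count_mono (S := S) (g := g') (mk := mk) (z₀ := z₀) q (Nat.le_succ n)
    obtain ⟨ht, hp, hc, hr, hlt, heq⟩ := ih (hm.trans h) (hm'.trans h')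
    have hcq := congrFun hc q
    simp only [run_succ, step] at h h' hm hm' ⊢
    generalize S.run g mk z₀ n = s at *
    generalize S.run g' mk z₀ n = s' at *
    obtain ⟨t, z, a, c⟩ := s
    obtain ⟨t', z', a', c'⟩ := s'
    simp only at *
    subst ht hp hc
    -- If the count is below `k`, the exceptional gap has not been handed out and the two states
    -- agree. If it equals `k`, clock `q` is running on that gap and, since its count must not
    -- increase, it rings next in neither run; the remaining clocks then decide the step.
    rcases (hm.trans h).lt_or_eq with hk | hk
    · have haa : a = a' := by
        ext p
        by_cases hpq : p = q
        · rw [hpq, hlt hk]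
        · exact hr p hpq
      subst haa
      refine ⟨rfl, rfl, rfl, fun p hp => ?_, fun hk' => ?_, fun hk' => ?_⟩
      · rw [hgg p _ fun h => hp h.1]
      · split_ifs with hq
        · rw [if_pos hq] at hk'
          rw [hgg q _ fun h => hk'.ne h.2]
        · rfl
      · split_ifs at hk' ⊢ with hq
        · rw [hk']; ring
        · omega
    · have hq1 : q ≠ S.first z a := fun hq => by rw [if_pos hq] at h; omega
      have hq2 : q ≠ S.first z a' := fun hq => by rw [if_pos hq] at h'; omega
      have hw : S.wait z a = S.wait z a' := by
        apply le_antisymm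
        · rw [hS.wait_le_iff _ _ (wait_nonneg _ _)]
          exact ⟨S.first z a', by rw [hr _ hq2.symm]; exact (hS.first_spec z a').1⟩
        · rw [hS.wait_le_iff _ _ (wait_nonneg _ _)]
          exact ⟨S.first z a, by rw [← hr _ hq1.symm]; exact (hS.first_spec z a).1⟩
      have hf : S.first z a = S.first z a' := by
        have h1 := hS.first_spec z a
        have h2 := hS.first_spec z a'
        apply clockRank_injective Q
        apply le_antisymm
        · apply h1.2
          rw [hr _ hq2.symm, hw]; exact h2.1
        · apply h2.2
          rw [← hr _ hq1.symm, ← hw]; exact h1.1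
      rw [← hf, ← hw]
      refine ⟨rfl, rfl, rfl, fun p hp => ?_, fun hk' => ?_, fun hk' => ?_⟩
      · rw [hr p hp, hgg p _ fun h => hp h.1]
      · rw [if_neg hq1] at hk'; omega
      · have := heq hk
        rw [if_neg hq1, if_neg hq1]; linarith

/-- Resampling one member of an independent family does not change the law. In this form a single
gap can be integrated out by Fubini. -/
lemma measurePreserving_update {ι : Type*} [DecidableEq ι] (μ : ι → Measure ℝ)
    [∀ i, IsProbabilityMeasure (μ i)] (a : ι) :
    MeasurePreserving (fun p : ℝ × (ι → ℝ) => Function.update p.2 a p.1)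
      ((μ a).prod (Measure.infinitePi μ)) (Measure.infinitePi μ) := by
  have hmeas : Measurable (fun p : ℝ × (ι → ℝ) => Function.update p.2 a p.1) := by
    refine measurable_pi_lambda _ fun i => ?_
    by_cases h : i = a
    · subst h; simpa using measurable_fst
    · simp only [Function.update_of_ne h]
      exact (measurable_pi_apply i).comp measurable_snd
  refine ⟨hmeas, ?_⟩
  refine Measure.eq_infinitePi μ fun s t ht => ?_
  rw [Measure.map_apply hmeas (MeasurableSet.pi s.countable_toSet fun i _ => ht i)]
  have : (fun p : ℝ × (ι → ℝ) => Function.update p.2 a p.1) ⁻¹' ((s : Set ι).pi t) =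
      (if a ∈ s then t a else univ) ×ˢ (((s.erase a : Finset ι) : Set ι).pi t) := by
    ext ⟨x, ω⟩
    simp only [mem_preimage, Set.mem_pi, Finset.mem_coe, mem_prod, Finset.mem_erase]
    constructor
    · intro h
      refine ⟨?_, fun i hi => ?_⟩
      · split_ifs with ha
        · simpa using h a ha
        · trivial
      · simpa [Function.update_of_ne hi.1] using h i hi.2
    · rintro ⟨h1, h2⟩ i hi
      by_cases hia : i = a
      · subst hia; simpa [hi] using h1
      · simpa [Function.update_of_ne hia] using h2 i ⟨hia, hi⟩
  rw [this, Measure.prod_prod, Measure.infinitePi_pi _ (fun i _ => ht i)]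
  split_ifs with ha
  · rw [← Finset.mul_prod_erase _ _ ha]
  · simp [Finset.erase_eq_of_notMem ha]

/-- The remaining amount of a clock with atomless gaps almost surely avoids any value that is
determined by the rest of the state. -/
lemma ae_resid_ne (hS : S.Regular) {ι : Type*} [DecidableEq ι] (μ : ι → Measure ℝ)
    [∀ i, IsProbabilityMeasure (μ i)] {G MK : (ι → ℝ) → Q → ℕ → ℝ} {q : Q} (src : ℕ → ι)
    [∀ k, NullSingletonClass (μ (src k))]
    (hG : ∀ ω k x p j, G (Function.update ω (src k) x) p j =
      if p = q ∧ j = k then x else G ω p j)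
    (hMK : ∀ ω k x, MK (Function.update ω (src k) x) = MK ω) (z₀ : Z)
    (Φ : ClockState Q Z → ℝ)
    (hΦ : ∀ s s' : ClockState Q Z, s.time = s'.time → s.pos = s'.pos → s.count = s'.count →
      (∀ p, p ≠ q → s.resid p = s'.resid p) → Φ s = Φ s') (n : ℕ)
    (hmeas : Measurable fun ω => Φ (S.run (G ω) (MK ω) z₀ n))
    (hr : Measurable fun ω => (S.run (G ω) (MK ω) z₀ n).resid q)
    (hc : Measurable fun ω => (S.run (G ω) (MK ω) z₀ n).count q) :
    ∀ᵐ ω ∂Measure.infinitePi μ,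
      (S.run (G ω) (MK ω) z₀ n).resid q ≠ Φ (S.run (G ω) (MK ω) z₀ n) := by
  have hk : ∀ k, ∀ᵐ ω ∂Measure.infinitePi μ, ¬ ((S.run (G ω) (MK ω) z₀ n).count q = k ∧
      (S.run (G ω) (MK ω) z₀ n).resid q = Φ (S.run (G ω) (MK ω) z₀ n)) := by
    intro k
    have hB : MeasurableSet {ω | (S.run (G ω) (MK ω) z₀ n).count q = k ∧
      (S.run (G ω) (MK ω) z₀ n).resid q = Φ (S.run (G ω) (MK ω) z₀ n)} :=
      (hc (measurableSet_singleton k)).inter (measurableSet_eq_fun hr hmeas)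
    have hup := measurePreserving_update μ (src k)
    rw [ae_iff]
    simp only [not_not]
    rw [← hup.measure_preimage hB.nullMeasurableSet,
      Measure.prod_apply_symm (hup.measurable hB)]
    refine (lintegral_congr fun ω => ?_).trans lintegral_zero
    -- The resampled gap is the one on which clock `q` is running. By `run_agree` it leaves `Φ`
    -- unchanged and enters the remaining amount as a summand, so at most one of its values gives
    -- the equality, and the law has no atoms.
    refine Set.Subsingleton.measure_zero (fun x hx y hy => ?_) _
    simp only [mem_preimage, mem_ofPred_eq, hMK] at hx hy
    obtain ⟨-, h2, h3, h4, -, h6⟩ := run_agree (S := S)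
      (g := G (Function.update ω (src k) x)) (g' := G (Function.update ω (src k) y)) (mk := MK ω)
      (z₀ := z₀) hS (q := q) (k := k) (fun p j hpj => by rw [hG, hG, if_neg hpj, if_neg hpj]) n
      hx.1.le hy.1.le
    have h1 := (run_agree (S := S)
      (g := G (Function.update ω (src k) x)) (g' := G (Function.update ω (src k) y)) (mk := MK ω)
      (z₀ := z₀) hS (q := q) (k := k) (fun p j hpj => by rw [hG, hG, if_neg hpj, if_neg hpj]) n
      hx.1.le hy.1.le).1
    have h7 := h6 hx.1
    rw [hx.2, hy.2, hΦ _ _ h1 h2 h3 h4, hG, hG] at h7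
    simpa using h7
  filter_upwards [ae_all_iff.2 hk] with ω hω h
  exact hω _ ⟨rfl, h⟩

/-- For clocks with independent atomless gaps there are almost surely no ties. -/
lemma ae_tieFree [TopologicalSpace Z] [MeasurableSpace Z] [BorelSpace Z]
    [SecondCountableTopology Z] (hS : S.Regular) (hC : S.IsContinuous) {ι : Type*} [DecidableEq ι]
    (μ : ι → Measure ℝ) [∀ i, IsProbabilityMeasure (μ i)]
    {G MK : (ι → ℝ) → Q → ℕ → ℝ} (src : Q → ℕ → ι) (hμ : ∀ q k, NullSingletonClass (μ (src q k)))
    (hG : ∀ ω q k x p j, G (Function.update ω (src q k) x) p j =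
      if p = q ∧ j = k then x else G ω p j)
    (hMK : ∀ ω q k x, MK (Function.update ω (src q k) x) = MK ω)
    (hGm : ∀ q k, Measurable fun ω => G ω q k) (hMKm : ∀ q k, Measurable fun ω => MK ω q k)
    (hG0 : ∀ᵐ ω ∂Measure.infinitePi μ, ∀ q k, 0 ≤ G ω q k) (z₀ : Z) :
    ∀ᵐ ω ∂Measure.infinitePi μ, ∀ n,
      S.TieFree (S.run (G ω) (MK ω) z₀ n).pos (S.run (G ω) (MK ω) z₀ n).resid := by
  obtain ⟨tick, htick⟩ := hS.exists_tick
  have hhz : ∀ z h, S.hazard tick z h = h := fun z h => by simp [hazard, htick]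
  -- Clock `q` is disabled: its new amount is not reached before the tick clock rings. The resulting
  -- waiting time no longer depends on the remaining amount of `q`.
  let alt : Q → Z → (Q → ℝ) → Q → ℝ := fun q z a =>
    Function.update a q (S.hazard q z (max 0 (a tick)) + 1)
  have h1 : ∀ᵐ ω ∂Measure.infinitePi μ, ∀ n q, q ≠ tick → (S.run (G ω) (MK ω) z₀ n).resid q ≠
      S.hazard q (S.run (G ω) (MK ω) z₀ n).pos (S.wait (S.run (G ω) (MK ω) z₀ n).pos
        (alt q (S.run (G ω) (MK ω) z₀ n).pos (S.run (G ω) (MK ω) z₀ n).resid)) := by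
    rw [ae_all_iff]; intro n
    rw [ae_all_iff]; intro q
    by_cases hq : q = tick
    · exact Eventually.of_forall fun ω h => absurd hq h
    obtain ⟨-, hp, hr, hc⟩ := hC.measurable_run hS hGm hMKm z₀ n
    have := fun k => hμ q k
    have halt : ∀ p, Measurable fun ω =>
        alt q (S.run (G ω) (MK ω) z₀ n).pos (S.run (G ω) (MK ω) z₀ n).resid p := by
      intro p
      by_cases hpq : p = q
      · subst hpq
        simp only [alt, Function.update_self]
        exact (hC.measurable_hazard hp (measurable_const.max (hr tick))
          (fun _ => le_max_left _ _) p).add_const 1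
      · simp only [alt, Function.update_of_ne hpq]
        exact hr p
    filter_upwards [ae_resid_ne hS μ (src q) (fun ω k x p j => hG ω q k x p j)
      (fun ω k x => hMK ω q k x) z₀
      (fun s => S.hazard q s.pos (S.wait s.pos (alt q s.pos s.resid)))
      (fun s s' _ hpos _ hres => by
        have : alt q s.pos s.resid = alt q s'.pos s'.resid := by
          ext p
          by_cases hpq : p = q
          · subst hpq; simp [alt, hpos, hres tick (Ne.symm hq)]
          · simp [alt, Function.update_of_ne hpq, hres p hpq]
        rw [this, hpos]) n
      (hC.measurable_hazard hp (hC.measurable_wait hS hp halt) (fun _ => wait_nonneg _ _) q)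
      (hr q) (hc q)] with ω hω _ using hω
  -- Rational times suffice: if the ringing clock came to a halt, its hazard would equal its amount
  -- on an interval.
  have h2 : ∀ᵐ ω ∂Measure.infinitePi μ, ∀ n q, ∀ ρ : ℚ, 0 ≤ ρ →
      (S.run (G ω) (MK ω) z₀ n).resid q ≠ S.hazard q (S.run (G ω) (MK ω) z₀ n).pos ρ := by
    rw [ae_all_iff]; intro n
    rw [ae_all_iff]; intro q
    rw [ae_all_iff]; intro ρ
    by_cases hρ : 0 ≤ ρ
    swap
    · exact Eventually.of_forall fun ω h => absurd h hρ
    obtain ⟨-, hp, hr, hc⟩ := hC.measurable_run hS hGm hMKm z₀ n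
    have := fun k => hμ q k
    filter_upwards [ae_resid_ne hS μ (src q) (fun ω k x p j => hG ω q k x p j)
      (fun ω k x => hMK ω q k x) z₀ (fun s => S.hazard q s.pos ρ)
      (fun s s' _ hpos _ _ => by simp only [hpos]) n
      (hC.measurable_hazard hp measurable_const (fun _ => by exact_mod_cast hρ) q)
      (hr q) (hc q)] with ω hω _ using hω
  filter_upwards [h1, h2, hG0] with ω h1 h2 h0 n
  have hres := fun q => (hS.run_resid (mk := MK ω) (z₀ := z₀) h0 n q).1
  specialize h1 n
  specialize h2 n
  generalize (S.run (G ω) (MK ω) z₀ n).pos = z at *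
  generalize (S.run (G ω) (MK ω) z₀ n).resid = a at *
  have hw0 := wait_nonneg (S := S) z a
  have hwt : S.wait z a ≤ a tick := by
    have := hS.hazard_wait_le z a hres tick
    rwa [hhz] at this
  -- If `p` rings together with `q`, disabling `q` does not change the waiting time. The remaining
  -- amount of `q` is then a value that the rest of the state determines, which is excluded.
  have key : ∀ q p, q ≠ tick → p ≠ q → a q ≤ S.hazard q z (S.wait z a) →
      a p ≤ S.hazard p z (S.wait z a) → False := by
    intro q p hq hpq hqr hpr
    apply h1 q hq
    have : S.wait z (alt q z a) = S.wait z a := by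
      apply le_antisymm
      · rw [hS.wait_le_iff _ _ hw0]
        exact ⟨p, by simpa [alt, Function.update_of_ne hpq] using hpr⟩
      · by_contra! hlt
        have hw0' := wait_nonneg (S := S) z (alt q z a)
        obtain ⟨-, p', hp'⟩ := hS.wait_mem z (alt q z a)
        by_cases hp'q : p' = q
        · subst hp'q
          simp only [alt, Function.update_self] at hp'
          have := hS.hazard_mono p' z hw0' (hlt.le.trans (hwt.trans (le_max_right 0 _)))
          simp only [alt] at this
          linarith
        · have h3 := lt_of_lt_wait hw0' hlt p'
          simp only [alt, Function.update_of_ne hp'q] at hp' h3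
          linarith
    rw [this]
    exact le_antisymm hqr (hS.hazard_wait_le z a hres q)
  have hf := (hS.first_spec z a).1
  refine ⟨fun p hp => ?_, fun h hh => ?_⟩
  · by_contra! hc
    -- Of two ringing clocks at least one is not the tick clock; that one takes the role of `q` in
    -- `key`.
    by_cases hpt : p = tick
    · exact key (S.first z a) p (fun h => hp (hpt.trans h.symm)) hp hf hc
    · exact key p (S.first z a) hpt hp.symm hc hf
  · by_contra! hc
    obtain ⟨ρ, hρ1, hρ2⟩ := exists_rat_btwn hh
    have hρ0 : (0 : ℝ) ≤ ρ := hw0.trans hρ1.le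
    refine h2 (S.first z a) ρ (by exact_mod_cast hρ0) (le_antisymm ?_ ?_)
    · exact hf.trans (hS.hazard_mono _ z hw0 hρ1.le)
    · exact (hS.hazard_mono _ z hρ0 hρ2.le).trans hc

end atomless

end ClockSystem

/-! ### The sticky zig-zag process as a clock system -/

/-- The clocks of the samplers: one that ticks at constant speed, and, for each coordinate, the
clocks for its bounces, for the marks on its sticking time, and for its refreshments. -/
inductive Clock (d : ℕ) : Type
  | tick : Clock d
  | bounce (i : Fin d) : Clock d
  | mark (i : Fin d) : Clock d
  | refresh (i : Fin d) : Clock d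
  deriving DecidableEq, Fintype

instance (d : ℕ) : Nonempty (Clock d) := ⟨.tick⟩

/-- The velocity that is encoded by a Boolean. -/
def boolSign (b : Bool) : ℝ := if b then 1 else -1

lemma boolSign_not (b : Bool) : boolSign (!b) = -boolSign b := by cases b <;> simp [boolSign]

lemma boolSign_mul_self (b : Bool) : boolSign b * boolSign b = 1 := by
  cases b <;> simp [boolSign]

lemma abs_boolSign (b : Bool) : |boolSign b| = 1 := by cases b <;> simp [boolSign]

lemma boolSign_decide {x : ℝ} (h : x = 1 ∨ x = -1) : boolSign (decide (x = 1)) = x := by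
  rcases h with rfl | rfl <;> norm_num [boolSign]

lemma continuous_ite_bool {X Y : Type*} [TopologicalSpace X] [TopologicalSpace Y] {b : X → Bool}
    (hb : Continuous b) {f g : X → Y} (hf : Continuous f) (hg : Continuous g) :
    Continuous fun x => if b x = true then f x else g x := by
  refine Continuous.if ?_ hf hg
  intro x hx
  have : IsClopen {x | b x = true} := (isClopen_discrete {true}).preimage hb
  rw [this.frontier_eq] at hx
  exact absurd hx (notMem_empty x)

section potential

variable {d : ℕ} (M : SpikeSlab d)

lemma SpikeSlab.densityPart_pos (x : Fin d → ℝ) : 0 < M.densityPart x :=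
  mul_pos (M.lik_pos x) (Finset.prod_pos fun i _ => mul_pos M.p_pos (M.slab_pos _))

lemma SpikeSlab.width_pos : 0 < M.width :=
  div_pos (sub_pos.2 M.p_lt_one) (mul_pos M.p_pos (M.slab_pos 0))

variable {M}

lemma SpikeSlab.contDiff_potential (hM : ContDiff ℝ 2 M.densityPart) :
    ContDiff ℝ 2 M.potential :=
  (hM.log fun x => (M.densityPart_pos x).ne').neg

lemma SpikeSlab.continuous_bounceRate (hM : ContDiff ℝ 2 M.densityPart) (i : Fin d) :
    Continuous fun p : (Fin d → ℝ) × (Fin d → ℝ) => bounceRate M.potential i p.1 p.2 := by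
  have h1 := M.contDiff_potential hM
  have h2 : ∀ x, lineDeriv ℝ M.potential x (Pi.single i 1) =
      fderiv ℝ M.potential x (Pi.single i 1) := fun x =>
    ((h1.differentiable (by norm_num)) x).lineDeriv_eq_fderiv
  have h3 : Continuous fun x => fderiv ℝ M.potential x (Pi.single i 1) :=
    (h1.continuous_fderiv (by norm_num)).clm_apply continuous_const
  unfold bounceRate
  simp only [h2]
  exact continuous_const.max (((continuous_apply i).comp continuous_snd).mul
    (h3.comp continuous_fst))

lemma bounceRate_nonneg (U : (Fin d → ℝ) → ℝ) (i : Fin d) (x v : Fin d → ℝ) :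
    0 ≤ bounceRate U i x v := le_max_left _ _

/-- A continuous function is bounded on a compact set. The sum of the bounds of the coordinates
serves them all, also when there are none. -/
lemma SpikeSlab.exists_bounceRate_le (hM : ContDiff ℝ 2 M.densityPart) (K : ℝ) :
    ∃ R, 0 ≤ R ∧ ∀ i x v, ‖x‖ ≤ K → ‖v‖ ≤ 1 → bounceRate M.potential i x v ≤ R := by
  have : ∀ i, ∃ R, ∀ x v, ‖x‖ ≤ K → ‖v‖ ≤ 1 → bounceRate M.potential i x v ≤ R := by
    intro i
    obtain ⟨R, hR⟩ := ((isCompact_closedBall (0 : Fin d → ℝ) K).prod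
      (isCompact_closedBall (0 : Fin d → ℝ) 1)).bddAbove_image
      (M.continuous_bounceRate hM i).continuousOn
    exact ⟨R, fun x v hx hv => hR ⟨(x, v), ⟨by simpa using hx, by simpa using hv⟩, rfl⟩⟩
  choose R hR using this
  refine ⟨∑ i, |R i|, Finset.sum_nonneg fun i _ => abs_nonneg _, fun i x v hx hv => ?_⟩
  exact (hR i x v hx hv).trans ((le_abs_self _).trans
    (Finset.single_le_sum (f := fun i => |R i|) (fun i _ => abs_nonneg _) (Finset.mem_univ i)))

end potential

/-- The state of the sticky process. A coordinate is described by its position relative to its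
velocity, by its velocity, and by whether it is moving away from `0`, rather than moving towards
`0` or being stuck there. -/
abbrev StickyState (d : ℕ) : Type := Fin d → ℝ × Bool × Bool

namespace StickyState

variable {d : ℕ}

/-- The position. -/
def position (z : StickyState d) (i : Fin d) : ℝ := boolSign (z i).2.1 * (z i).1

/-- The velocity. -/
def velocity (z : StickyState d) (i : Fin d) : ℝ := boolSign (z i).2.1

/-- A coordinate is stuck when it has reached `0` and is not moving away. -/
def IsStuck (z : StickyState d) (i : Fin d) : Prop := (z i).2.2 = false ∧ 0 ≤ (z i).1

/-- The motion between events. -/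
def flow (s : ℝ) (z : StickyState d) : StickyState d := fun i =>
  -- A coordinate in the second mode moves up to `0` and stays there. The outer maximum leaves
  -- positive values, which consistent states do not have in this mode, at rest; so the semigroup
  -- property holds for all states.
  (if (z i).2.2 then (z i).1 + s else max (z i).1 (min ((z i).1 + s) 0), (z i).2)

/-- The part of the time span `h` during which coordinate `i` is not stuck. -/
def freeTime (i : Fin d) (z : StickyState d) (h : ℝ) : ℝ :=
  if (z i).2.2 then h else min h (max (-(z i).1) 0)

lemma flow_mode (s : ℝ) (z : StickyState d) (i : Fin d) : (flow s z i).2 = (z i).2 := rfl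

lemma velocity_flow (s : ℝ) (z : StickyState d) : velocity (flow s z) = velocity z := rfl

lemma flow_zero (z : StickyState d) : flow 0 z = z := by
  ext i
  · simp [flow]
  all_goals rfl

lemma flow_add {s t : ℝ} (z : StickyState d) (hs : 0 ≤ s) (ht : 0 ≤ t) :
    flow t (flow s z) = flow (s + t) z := by
  ext i
  · simp only [flow]
    split_ifs
    · ring
    · rcases le_total (z i).1 0 with h | h
      · rw [max_eq_right (le_min (by linarith) h), max_eq_right (le_min (by linarith) h)]
        rcases le_total ((z i).1 + s) 0 with h2 | h2
        · rw [min_eq_left h2, max_eq_right (le_min (by linarith) h2), add_assoc]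
        · rw [min_eq_right h2, min_eq_right (by linarith), min_eq_right (by linarith)]
          simp
      · have : ∀ u : ℝ, max (z i).1 (min u 0) = (z i).1 := fun u =>
          max_eq_left ((min_le_right _ _).trans h)
        simp only [this]
  all_goals rfl

lemma isStuck_flow_iff {s : ℝ} (z : StickyState d) (i : Fin d) (hs : 0 ≤ s) :
    IsStuck (flow s z) i ↔ (z i).2.2 = false ∧ 0 ≤ (z i).1 + s := by
  simp only [IsStuck, flow]
  constructor
  · rintro ⟨h1, h2⟩
    refine ⟨h1, ?_⟩
    simp only [h1, Bool.false_eq_true, if_false, le_max_iff, le_min_iff] at h2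
    rcases h2 with h2 | h2
    · linarith
    · exact h2.1
  · rintro ⟨h1, h2⟩
    refine ⟨h1, ?_⟩
    simp only [h1, Bool.false_eq_true, if_false, le_max_iff, le_min_iff]
    exact Or.inr ⟨h2, le_rfl⟩

lemma freeTime_nonneg (i : Fin d) (z : StickyState d) {h : ℝ} (hh : 0 ≤ h) :
    0 ≤ freeTime i z h := by
  unfold freeTime; split_ifs
  · exact hh
  · exact le_min hh (le_max_right _ _)

lemma freeTime_le (i : Fin d) (z : StickyState d) (h : ℝ) : freeTime i z h ≤ h := by
  unfold freeTime; split_ifs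
  · exact le_rfl
  · exact min_le_left _ _

lemma not_isStuck_flow {i : Fin d} {z : StickyState d} {h s : ℝ} (hs : 0 ≤ s)
    (hs' : s < freeTime i z h) : ¬ IsStuck (flow s z) i := by
  rw [isStuck_flow_iff z i hs]
  rintro ⟨h1, h2⟩
  simp only [freeTime, h1, Bool.false_eq_true, if_false, lt_min_iff, lt_max_iff] at hs'
  rcases hs'.2 with h3 | h3 <;> linarith

lemma isStuck_flow {i : Fin d} {z : StickyState d} {h s : ℝ} (hs : 0 ≤ s)
    (hs' : freeTime i z h < s) (hh : s ≤ h) : IsStuck (flow s z) i := by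
  rw [isStuck_flow_iff z i hs]
  unfold freeTime at hs'
  split_ifs at hs' with h1
  · linarith
  · refine ⟨by simpa using h1, ?_⟩
    rcases min_lt_iff.1 hs' with h2 | h2
    · linarith
    · have := (le_max_left (-(z i).1) 0).trans_lt h2
      linarith

open Classical in
/-- Integration over a piece of motion, up to and after the time at which a coordinate gets
stuck. -/
lemma integral_ite_isStuck (i : Fin d) (z : StickyState d) {h : ℝ} (hh : 0 ≤ h) {F : ℝ → ℝ}
    (hF : Continuous F) (c : ℝ) :
    IntervalIntegrable (fun s => if IsStuck (flow s z) i then c else F s) volume 0 h ∧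
    ∫ s in (0 : ℝ)..h, (if IsStuck (flow s z) i then c else F s) =
      (∫ s in (0 : ℝ)..freeTime i z h, F s) + c * (h - freeTime i z h) := by
  have hl0 := freeTime_nonneg i z hh
  have hl1 := freeTime_le i z h
  have hne : ∀ᵐ s ∂(volume : Measure ℝ), s ≠ freeTime i z h := by
    simp [ae_iff, measure_singleton]
  have e1 : ∀ᵐ s ∂volume, s ∈ uIoc 0 (freeTime i z h) →
      F s = (if IsStuck (flow s z) i then c else F s) := by
    filter_upwards [hne] with s hs hs'
    rw [uIoc_of_le hl0] at hs'
    rw [if_neg (not_isStuck_flow hs'.1.le (lt_of_le_of_ne hs'.2 hs))]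
  have e2 : ∀ᵐ s ∂volume, s ∈ uIoc (freeTime i z h) h →
      c = (if IsStuck (flow s z) i then c else F s) := by
    refine Eventually.of_forall fun s hs' => ?_
    rw [uIoc_of_le hl1] at hs'
    rw [if_pos (isStuck_flow (hl0.trans hs'.1.le) hs'.1 hs'.2)]
  have i1 : IntervalIntegrable (fun s => if IsStuck (flow s z) i then c else F s) volume 0
      (freeTime i z h) := (hF.intervalIntegrable 0 _).congr_ae
        ((ae_restrict_iff' measurableSet_uIoc).2 e1)
  have i2 : IntervalIntegrable (fun s => if IsStuck (flow s z) i then c else F s) volume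
      (freeTime i z h) h := (intervalIntegrable_const (c := c)).congr_ae
        ((ae_restrict_iff' measurableSet_uIoc).2 e2)
  refine ⟨i1.trans i2, ?_⟩
  rw [← intervalIntegral.integral_add_adjacent_intervals i1 i2,
    ← intervalIntegral.integral_congr_ae e1, ← intervalIntegral.integral_congr_ae e2]
  simp [mul_comm]

lemma continuous_flow : Continuous fun p : ℝ × StickyState d => flow p.1 p.2 := by
  refine continuous_pi fun i => ?_
  simp only [flow]
  refine Continuous.prodMk (continuous_ite_bool ?_ ?_ ?_) ?_ <;> fun_prop

lemma continuous_freeTime (i : Fin d) :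
    Continuous fun p : StickyState d × ℝ => freeTime i p.1 p.2 := by
  simp only [freeTime]
  refine continuous_ite_bool ?_ ?_ ?_ <;> fun_prop

lemma continuous_boolSign : Continuous boolSign := continuous_of_discreteTopology

lemma continuous_position : Continuous (position (d := d)) := by
  refine continuous_pi fun i => ?_
  unfold position
  exact (continuous_boolSign.comp (by fun_prop)).mul (by fun_prop)

lemma continuous_velocity : Continuous (velocity (d := d)) := by
  refine continuous_pi fun i => ?_
  unfold velocity
  exact continuous_boolSign.comp (by fun_prop)

/-- The size of the position. -/
def size (z : StickyState d) : ℝ := ‖fun i => (z i).1‖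

lemma size_flow {s : ℝ} (z : StickyState d) (hs : 0 ≤ s) : size (flow s z) ≤ size z + s := by
  have h0 : 0 ≤ size z := norm_nonneg _
  refine (pi_norm_le_iff_of_nonneg (by linarith)).2 fun i => ?_
  have hi : |(z i).1| ≤ size z := norm_le_pi_norm (fun i => (z i).1) i
  rw [abs_le] at hi
  rw [Real.norm_eq_abs, abs_le]
  simp only [flow]
  split_ifs
  · constructor <;> linarith
  · constructor
    · exact le_max_of_le_left (by linarith)
    · exact max_le (by linarith) ((min_le_left _ _).trans (by linarith))

lemma norm_position (z : StickyState d) : ‖position z‖ = size z := by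
  have : ∀ i, ‖position z i‖ = ‖(z i).1‖ := fun i => by
    simp [position, abs_boolSign]
  simp only [size, Pi.norm_def]
  congr 2
  ext i
  simpa using this i

lemma norm_velocity_le (z : StickyState d) : ‖velocity z‖ ≤ 1 :=
  (pi_norm_le_iff_of_nonneg zero_le_one).2 fun i => by simp [velocity, abs_boolSign]

end StickyState

open StickyState

open Classical in
/-- The sticky zig-zag process: bounces flip the velocity, and a mark releases a stuck coordinate
if it is the velocity of that coordinate. The refreshment clocks have no effect. -/
def stickySystem {d : ℕ} (M : SpikeSlab d) (r : ℝ) : ClockSystem (Clock d) (StickyState d) where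
  flow := StickyState.flow
  rate q z := match q with
    | .tick => 1
    | .bounce i => if IsStuck z i then 0 else bounceRate M.potential i (position z) (velocity z)
    | .mark i => if IsStuck z i then 1 else 0
    -- Dummy clocks, which give this system the same events as the latent one.
    | .refresh i => if IsStuck z i then r else 0
  jump q m z := match q with
    | .tick => z
    -- The position stays while the velocity is reversed: the position relative to the velocity
    -- changes its sign, and approaching `0` becomes moving away or conversely.
    | .bounce i => Function.update z i (-(z i).1, !(z i).2.1, !(z i).2.2)
    | .mark i => if m = velocity z i then Function.update z i ((z i).1, (z i).2.1, true) else z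
    | .refresh _ => z

section stickySystem

variable {d : ℕ} {M : SpikeSlab d} {r : ℝ}

lemma continuous_bounceRate_flow (hM : ContDiff ℝ 2 M.densityPart) (i : Fin d) :
    Continuous fun p : StickyState d × ℝ => bounceRate M.potential i
      (position (StickyState.flow p.2 p.1)) (velocity (StickyState.flow p.2 p.1)) :=
  (M.continuous_bounceRate hM i).comp
    (((continuous_position.comp continuous_flow).prodMk
      (continuous_velocity.comp continuous_flow)).comp continuous_swap)

lemma stickySystem_bounce (hM : ContDiff ℝ 2 M.densityPart) (i : Fin d) (z : StickyState d)
    {h : ℝ} (hh : 0 ≤ h) :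
    IntervalIntegrable (fun s => (stickySystem M r).rate (.bounce i) ((stickySystem M r).flow s z))
      volume 0 h ∧ (stickySystem M r).hazard (.bounce i) z h =
      ∫ s in (0 : ℝ)..freeTime i z h, bounceRate M.potential i
        (position (StickyState.flow s z)) (velocity (StickyState.flow s z)) := by
  have := integral_ite_isStuck i z hh (F := fun s => bounceRate M.potential i
        (position (StickyState.flow s z)) (velocity (StickyState.flow s z)))
    ((continuous_bounceRate_flow hM i).comp (by fun_prop : Continuous fun s : ℝ => (z, s))) 0
  refine ⟨this.1, this.2.trans ?_⟩
  ring

lemma stickySystem_mark (i : Fin d) (z : StickyState d) {h : ℝ} (hh : 0 ≤ h) :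
    IntervalIntegrable (fun s => (stickySystem M r).rate (.mark i) ((stickySystem M r).flow s z))
      volume 0 h ∧ (stickySystem M r).hazard (.mark i) z h = h - freeTime i z h := by
  have := integral_ite_isStuck i z hh (F := fun _ => 0) continuous_const 1
  refine ⟨this.1, this.2.trans ?_⟩
  simp

lemma stickySystem_refresh (i : Fin d) (z : StickyState d) {h : ℝ} (hh : 0 ≤ h) :
    IntervalIntegrable (fun s => (stickySystem M r).rate (.refresh i) ((stickySystem M r).flow s z))
      volume 0 h ∧ (stickySystem M r).hazard (.refresh i) z h = r * (h - freeTime i z h) := by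
  have := integral_ite_isStuck i z hh (F := fun _ => 0) continuous_const r
  refine ⟨this.1, this.2.trans ?_⟩
  simp

lemma stickySystem_tick (z : StickyState d) (h : ℝ) :
    (stickySystem M r).hazard .tick z h = h := by
  simp [ClockSystem.hazard, stickySystem]

lemma stickySystem_regular (hM : ContDiff ℝ 2 M.densityPart) (hr : 0 ≤ r) :
    (stickySystem M r).Regular where
  flow_add _ _ z hs ht := StickyState.flow_add z hs ht
  rate_nonneg q z := by
    rcases q with _ | i | i | i <;> simp only [stickySystem]
    · exact zero_le_one
    all_goals split_ifs <;> first | exact le_rfl | exact zero_le_one | exact hr |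
      exact bounceRate_nonneg _ _ _ _
  rate_integrable q z h hh := by
    rcases q with _ | i | i | i
    · exact intervalIntegrable_const
    · exact (stickySystem_bounce hM i z hh).1
    · exact (stickySystem_mark i z hh).1
    · exact (stickySystem_refresh i z hh).1
  exists_tick := ⟨.tick, fun _ => rfl⟩

lemma continuous_not : Continuous Bool.not := continuous_of_discreteTopology

/-- The rates jump when a coordinate gets stuck, but the hazards see this only through `freeTime`,
which is continuous in the state. The jumps distinguish cases only by discrete components of the
state. -/
lemma stickySystem_isContinuous (hM : ContDiff ℝ 2 M.densityPart) :
    (stickySystem M r).IsContinuous where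
  hazard_cont q := by
    have hf : ∀ i, Continuous fun p : StickyState d × ℝ => freeTime i p.1 (max p.2 0) := fun i =>
      (continuous_freeTime i).comp (by fun_prop : Continuous fun p : StickyState d × ℝ =>
        (p.1, max p.2 0))
    rcases q with _ | i | i | i
    · simp only [stickySystem_tick]; fun_prop
    · simp only [fun p : StickyState d × ℝ =>
        (stickySystem_bounce (r := r) hM i p.1 (le_max_right p.2 0)).2]
      exact (intervalIntegral.continuous_parametric_primitive_of_continuous (a₀ := 0)
        (f := fun (z : StickyState d) s => bounceRate M.potential i
          (position (StickyState.flow s z)) (velocity (StickyState.flow s z)))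
        (continuous_bounceRate_flow hM i)).comp (continuous_fst.prodMk (hf i))
    · simp only [fun p : StickyState d × ℝ =>
        (stickySystem_mark (M := M) (r := r) i p.1 (le_max_right p.2 0)).2]
      exact (by fun_prop : Continuous fun p : StickyState d × ℝ => max p.2 0).sub (hf i)
    · simp only [fun p : StickyState d × ℝ =>
        (stickySystem_refresh (M := M) (r := r) i p.1 (le_max_right p.2 0)).2]
      exact continuous_const.mul
        ((by fun_prop : Continuous fun p : StickyState d × ℝ => max p.2 0).sub (hf i))
  flow_cont := continuous_flow
  jump_cont q m := by
    rcases q with _ | i | i | i <;> simp only [stickySystem]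
    · exact continuous_id
    · refine continuous_id.update i (Continuous.prodMk (by fun_prop) (Continuous.prodMk ?_ ?_))
      · exact continuous_not.comp (by fun_prop : Continuous fun z : StickyState d => (z i).2.1)
      · exact continuous_not.comp (by fun_prop : Continuous fun z : StickyState d => (z i).2.2)
    · have : ∀ z : StickyState d, (m = velocity z i) = (decide (m = boolSign (z i).2.1) = true) :=
        fun z => by simp [velocity]
      simp only [this]
      have h1 : Continuous fun z : StickyState d => decide (m = boolSign (z i).2.1) :=
        (continuous_of_discreteTopology (f := fun b => decide (m = boolSign b))).comp
          (by fun_prop : Continuous fun z : StickyState d => (z i).2.1)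
      exact continuous_ite_bool h1 (continuous_id.update i
        (by fun_prop : Continuous fun z : StickyState d => ((z i).1, (z i).2.1, true)))
        continuous_id
    · exact continuous_id
  jump_meas q := by
    have hup : ∀ (i : Fin d) (f : StickyState d → ℝ × Bool × Bool), Measurable f →
        Measurable fun p : ℝ × StickyState d => Function.update p.2 i (f p.2) := by
      intro i f hf
      refine measurable_pi_lambda _ fun j => ?_
      by_cases hj : j = i
      · subst hj
        simp only [Function.update_self]
        exact hf.comp measurable_snd
      · simp only [Function.update_of_ne hj]
        exact (measurable_pi_apply j).comp measurable_snd
    rcases q with _ | i | i | i <;> simp only [stickySystem]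
    · exact measurable_snd
    · exact hup i (fun z => (-(z i).1, !(z i).2.1, !(z i).2.2)) (Continuous.measurable (by
        refine Continuous.prodMk (by fun_prop) (Continuous.prodMk ?_ ?_)
        · exact continuous_not.comp (by fun_prop : Continuous fun z : StickyState d => (z i).2.1)
        · exact continuous_not.comp (by fun_prop : Continuous fun z : StickyState d => (z i).2.2)))
    · refine Measurable.ite ?_ (hup i (fun z => ((z i).1, (z i).2.1, true))
        (Continuous.measurable (by fun_prop))) measurable_snd
      exact measurableSet_eq_fun measurable_fst
        ((measurable_pi_apply i).comp (continuous_velocity.measurable.comp measurable_snd))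
    · exact measurable_snd

lemma stickySystem_jump_size (q : Clock d) (m : ℝ) (z : StickyState d) :
    size ((stickySystem M r).jump q m z) = size z := by
  rcases q with _ | i | i | i <;> simp only [stickySystem, size]
  · simp only [Pi.norm_def]
    congr 2
    ext j
    by_cases hj : j = i
    · subst hj; simp
    · simp [Function.update_of_ne hj]
  · split_ifs
    · congr 1
      ext j
      by_cases hj : j = i
      · subst hj; simp
      · simp [Function.update_of_ne hj]
    · rfl

/-- Coordinates have at most unit speed, jumps keep the size, and bounce rates are bounded on
bounded sets, so explosion is excluded. -/
lemma stickySystem_tendsto_time (hM : ContDiff ℝ 2 M.densityPart) (hr : 0 ≤ r)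
    {g : Clock d → ℕ → ℝ} (mk : Clock d → ℕ → ℝ) (z₀ : StickyState d) (hg : ∀ q k, 0 < g q k)
    (hsum : ∀ q, Tendsto (fun n => ∑ k ∈ Finset.range n, g q k) atTop atTop) :
    Tendsto (fun n => ((stickySystem M r).run g mk z₀ n).time) atTop atTop := by
  refine (stickySystem_regular hM hr).tendsto_run_time hg hsum size
    (fun s z hs => StickyState.size_flow z hs)
    (fun q k z => (stickySystem_jump_size q _ z).le) fun K => ?_
  obtain ⟨R, hR0, hR⟩ := M.exists_bounceRate_le hM K
  refine ⟨R + 1 + r, fun q z h hh hK => ?_⟩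
  rcases q with _ | i | i | i
  · rw [stickySystem_tick]; nlinarith
  · rw [(stickySystem_bounce hM i z hh).2]
    have h1 := freeTime_nonneg i z hh
    have h2 := freeTime_le i z h
    calc _ ≤ ∫ s in (0 : ℝ)..freeTime i z h, R := by
          refine intervalIntegral.integral_mono_on h1 ?_ intervalIntegrable_const fun s hs => ?_
          · exact ((continuous_bounceRate_flow hM i).comp
              (by fun_prop : Continuous fun s : ℝ => (z, s))).intervalIntegrable _ _
          · refine hR i _ _ ?_ (norm_velocity_le _)
            rw [norm_position]
            exact (StickyState.size_flow z hs.1).trans (by linarith [hs.2])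
      _ ≤ _ := by
          rw [intervalIntegral.integral_const, smul_eq_mul]
          nlinarith
  · rw [(stickySystem_mark i z hh).2]
    nlinarith [freeTime_nonneg i z hh]
  · rw [(stickySystem_refresh i z hh).2]
    nlinarith [freeTime_nonneg i z hh]

end stickySystem

/-! ### The sticky clock system produces paths of the original sampler -/

namespace ClockSystem

variable {Q Z : Type} {S : ClockSystem Q Z} [Fintype Q] [DecidableEq Q] [Nonempty Q]
  {g mk : Q → ℕ → ℝ} {z₀ : Z}

/-- Without ties only the ringing clock is exhausted, and it receives a positive gap. -/
lemma Regular.run_resid_pos (hS : S.Regular) (hg : ∀ q k, 0 < g q k)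
    (htf : ∀ n, S.TieFree (S.run g mk z₀ n).pos (S.run g mk z₀ n).resid) (n : ℕ) (q : Q) :
    0 < (S.run g mk z₀ n).resid q := by
  cases n with
  | zero => exact hg q 0
  | succ n =>
    have h0 := fun q => (hS.run_resid (mk := mk) (z₀ := z₀) (fun q k => (hg q k).le) n q).1
    simp only [run_succ, step]
    split_ifs with h
    · have := hS.hazard_wait_le (S.run g mk z₀ n).pos (S.run g mk z₀ n).resid h0 q
      linarith [hg q ((S.run g mk z₀ n).count q + 1)]
    · linarith [(htf n).1 q h]

lemma Regular.wait_pos (hS : S.Regular) {z : Z} {a : Q → ℝ} (ha : ∀ q, 0 < a q) :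
    0 < S.wait z a := by
  refine (wait_nonneg z a).lt_of_ne fun h => ?_
  have := (hS.first_spec z a).1
  rw [← h, hazard_zero] at this
  exact absurd (ha _) (not_lt.2 this)

end ClockSystem

/-- The gaps between those points of a point process which have the property `χ`. -/
def compoundGap (e : ℕ → ℝ) (χ : ℕ → Prop) (k : ℕ) : ℝ :=
  ∑ j ∈ Finset.range (Nat.nth χ k + 1), e j -
    if k = 0 then 0 else ∑ j ∈ Finset.range (Nat.nth χ (k - 1) + 1), e j

lemma sum_compoundGap (e : ℕ → ℝ) (χ : ℕ → Prop) (k : ℕ) :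
    ∑ l ∈ Finset.range (k + 1), compoundGap e χ l =
      ∑ j ∈ Finset.range (Nat.nth χ k + 1), e j := by
  induction k with
  | zero => simp [compoundGap]
  | succ k ih => rw [Finset.sum_range_succ, ih]; simp [compoundGap]

lemma compoundGap_pos {e : ℕ → ℝ} (he : ∀ k, 0 < e k) {χ : ℕ → Prop} (hχ : {m | χ m}.Infinite)
    (k : ℕ) : 0 < compoundGap e χ k := by
  unfold compoundGap
  cases k with
  | zero => simpa using Finset.sum_pos (fun j _ => he j) ⟨0, by simp⟩
  | succ k =>
    simp only [Nat.succ_ne_zero, if_false, Nat.add_sub_cancel, sub_pos]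
    have hlt : Nat.nth χ k < Nat.nth χ (k + 1) := Nat.nth_strictMono hχ k.lt_succ_self
    exact Finset.sum_lt_sum_of_subset (i := Nat.nth χ (k + 1))
      (Finset.range_subset_range.2 (by omega)) (by simp) (by simp; omega) (he _)
      (fun j _ _ => (he j).le)

/-- Merging gaps deletes the points without `χ`. Of the `m` points up to `c`, those that remain are
counted by `Nat.count`, the adjoint of `Nat.nth`. -/
lemma pointCount_compoundGap {e : ℕ → ℝ} (he : ∀ k, 0 < e k) {χ : ℕ → Prop} [DecidablePred χ]
    (hχ : {m | χ m}.Infinite) {c : ℝ} {m : ℕ} (h1 : ∑ k ∈ Finset.range m, e k ≤ c)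
    (h2 : c < ∑ k ∈ Finset.range (m + 1), e k) :
    pointCount (compoundGap e χ) c = Nat.count χ m := by
  have hmono : Monotone fun n => ∑ k ∈ Finset.range n, e k :=
    monotone_nat_of_le_succ fun n => by rw [Finset.sum_range_succ]; linarith [he n]
  have hc : 0 ≤ c := (Finset.sum_nonneg fun k _ => (he k).le).trans h1
  apply pointCount_eq (compoundGap_pos he hχ)
  · rcases hm : Nat.count χ m with _ | l
    · simpa using hc
    · rw [sum_compoundGap]
      have : Nat.nth χ l < m := Nat.nth_lt_of_lt_count (by omega)
      exact (hmono (show Nat.nth χ l + 1 ≤ m by omega)).trans h1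
  · rw [sum_compoundGap]
    have : m ≤ Nat.nth χ (Nat.count χ m) := Nat.le_nth_count hχ m
    exact h2.trans_le (hmono (show m + 1 ≤ Nat.nth χ (Nat.count χ m) + 1 by omega))

namespace StickyState

variable {d : ℕ}

/-- Moving away from `0` happens on the side of the velocity, otherwise it is the other side. -/
def Consistent (z : StickyState d) : Prop :=
  ∀ i, ((z i).2.2 = true → 0 ≤ (z i).1) ∧ ((z i).2.2 = false → (z i).1 ≤ 0)

lemma Consistent.flow {z : StickyState d} (hz : z.Consistent) {s : ℝ} (hs : 0 ≤ s) :
    (StickyState.flow s z).Consistent := by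
  intro i
  simp only [StickyState.flow]
  constructor <;> intro h
  · rw [if_pos h]; linarith [(hz i).1 h]
  · simp only [h, Bool.false_eq_true, if_false]
    exact max_le ((hz i).2 h) (min_le_right _ _)

lemma position_flow {z : StickyState d} (hz : z.Consistent) {s : ℝ} (hs : 0 ≤ s) (i : Fin d) :
    position (StickyState.flow s z) i = position z i + velocity z i * freeTime i z s := by
  simp only [position, velocity, StickyState.flow, freeTime]
  split_ifs with h
  · ring
  · have h0 := (hz i).2 (by simpa using h)
    rw [max_eq_right (le_min (by linarith) h0), max_eq_left (by linarith : 0 ≤ -(z i).1)]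
    rw [← mul_add]
    congr 1
    rcases le_total ((z i).1 + s) 0 with h1 | h1
    · rw [min_eq_left h1, min_eq_left (by linarith)]
    · rw [min_eq_right h1, min_eq_right (by linarith)]; ring

/-- The time until a coordinate that moves towards `0` gets there. -/
def hitTime (i : Fin d) (z : StickyState d) : ℝ := max (-(z i).1) 0

end StickyState

section jump

variable {d : ℕ} {M : SpikeSlab d} {r : ℝ}

lemma stickySystem_position_jump (q : Clock d) (m : ℝ) (z : StickyState d) :
    position ((stickySystem M r).jump q m z) = position z := by
  ext j
  rcases q with _ | i | i | i <;> simp only [stickySystem, position]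
  · by_cases hj : j = i
    · subst hj; simp [boolSign_not]
    · simp [Function.update_of_ne hj]
  · split_ifs
    · by_cases hj : j = i
      · subst hj; simp
      · simp [Function.update_of_ne hj]
    · rfl

lemma stickySystem_velocity_jump (q : Clock d) (m : ℝ) (z : StickyState d) (i : Fin d) :
    velocity ((stickySystem M r).jump q m z) i =
      (if q = .bounce i then -1 else 1) * velocity z i := by
  rcases q with _ | j | j | j <;> simp only [stickySystem, velocity]
  · simp
  · by_cases hj : j = i
    · subst hj; simp [boolSign_not]
    · simp [Function.update_of_ne (Ne.symm hj), hj]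
  · split_ifs with h1 <;> simp_all
    by_cases hj : i = j
    · subst hj; simp
    · simp [Function.update_of_ne hj]
  · simp

lemma stickySystem_jump_of_ne {q : Clock d} {i : Fin d} (h1 : q ≠ .bounce i) (h2 : q ≠ .mark i)
    (m : ℝ) (z : StickyState d) : (stickySystem M r).jump q m z i = z i := by
  rcases q with _ | j | j | j <;> simp only [stickySystem]
  · rw [Function.update_of_ne fun h => h1 (by rw [h])]
  · split_ifs
    · rw [Function.update_of_ne fun h => h2 (by rw [h])]
    · rfl

lemma stickySystem_jump_bounce (i : Fin d) (m : ℝ) (z : StickyState d) :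
    (stickySystem M r).jump (.bounce i) m z i = (-(z i).1, !(z i).2.1, !(z i).2.2) := by
  simp [stickySystem]

lemma stickySystem_jump_mark_of_ne {i : Fin d} {m : ℝ} {z : StickyState d}
    (h : m ≠ velocity z i) : (stickySystem M r).jump (.mark i) m z = z := by
  simp [stickySystem, h]

lemma stickySystem_release (i : Fin d) (h : ℝ) (z : StickyState d) :
    ((stickySystem M r).jump (.mark i) (velocity z i) ((stickySystem M r).flow h z) i).2.2 =
      true := by
  have : velocity z i = velocity (StickyState.flow h z) i := rfl
  rw [this]
  simp [stickySystem]

end jump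

section original

variable {d : ℕ} {M : SpikeSlab d} {r : ℝ} {g mk : Clock d → ℕ → ℝ} {z₀ : StickyState d}

/-- No bounce of a coordinate happens at the time at which it reaches `0`. -/
def NoBounceAtHit (M : SpikeSlab d) (r : ℝ) (g mk : Clock d → ℕ → ℝ) (z₀ : StickyState d) : Prop :=
  ∀ n i, ((stickySystem M r).run g mk z₀ n).resid (.bounce i) ≠
    (stickySystem M r).hazard (.bounce i) ((stickySystem M r).run g mk z₀ n).pos
      (hitTime i ((stickySystem M r).run g mk z₀ n).pos)

/-- A stuck coordinate does not bounce, so its hazard has not grown since it reached `0`. -/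
lemma hazard_bounce_of_isStuck (hM : ContDiff ℝ 2 M.densityPart) {z : StickyState d} {h : ℝ}
    (hh : 0 ≤ h) {i : Fin d} (hst : IsStuck (StickyState.flow h z) i) :
    (stickySystem M r).hazard (.bounce i) z h =
      (stickySystem M r).hazard (.bounce i) z (hitTime i z) := by
  rw [isStuck_flow_iff z i hh] at hst
  have h0 : hitTime i z ≤ h := max_le (by linarith) hh
  have h1 : 0 ≤ hitTime i z := le_max_right _ _
  rw [(stickySystem_bounce hM i z hh).2, (stickySystem_bounce hM i z h1).2]
  congr 1
  simp only [freeTime, hst.1, Bool.false_eq_true, if_false]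
  rw [← hitTime, min_eq_right h0, min_self]

/-- A bounce due while the coordinate is stuck would have exhausted its clock exactly at the hitting
time. -/
lemma not_isStuck_of_first_bounce (hM : ContDiff ℝ 2 M.densityPart) (hr : 0 ≤ r)
    (hg : ∀ q k, 0 ≤ g q k) (hexo : NoBounceAtHit M r g mk z₀) {n : ℕ} {i : Fin d}
    (hf : (stickySystem M r).first ((stickySystem M r).run g mk z₀ n).pos
      ((stickySystem M r).run g mk z₀ n).resid = .bounce i) :
    ¬ IsStuck (StickyState.flow ((stickySystem M r).wait ((stickySystem M r).run g mk z₀ n).pos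
      ((stickySystem M r).run g mk z₀ n).resid) ((stickySystem M r).run g mk z₀ n).pos) i := by
  intro hst
  have hS := stickySystem_regular (M := M) (r := r) hM hr
  have := hS.hazard_first ((stickySystem M r).run g mk z₀ n).pos _
    (fun q => (hS.run_resid (mk := mk) (z₀ := z₀) hg n q).1)
  rw [hf, hazard_bounce_of_isStuck hM (ClockSystem.wait_nonneg _ _) hst] at this
  exact hexo n i this.symm

/-- The mark clock advances only while the coordinate is stuck, and it had a positive amount to use
up. -/
lemma isStuck_of_first_mark (hM : ContDiff ℝ 2 M.densityPart) (hr : 0 ≤ r)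
    {z : StickyState d} {a : Clock d → ℝ} (ha : ∀ q, 0 < a q) {i : Fin d}
    (hf : (stickySystem M r).first z a = .mark i) :
    IsStuck (StickyState.flow ((stickySystem M r).wait z a) z) i := by
  have hS := stickySystem_regular (M := M) (r := r) hM hr
  have h1 := hS.hazard_first z a (fun q => (ha q).le)
  have hw := ClockSystem.wait_nonneg (S := stickySystem M r) z a
  rw [hf, (stickySystem_mark i z hw).2] at h1
  exact isStuck_flow (h := (stickySystem M r).wait z a) hw (by linarith [ha (.mark i)]) le_rfl

/-- A bounce reverses both the side and the mode. A release changes the mode alone, but it happens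
at a stuck coordinate, whose position is admissible for the new mode. -/
lemma consistent_run (hM : ContDiff ℝ 2 M.densityPart) (hr : 0 ≤ r)
    (hres : ∀ n q, 0 < ((stickySystem M r).run g mk z₀ n).resid q)
    (hz₀ : z₀.Consistent) (n : ℕ) : ((stickySystem M r).run g mk z₀ n).pos.Consistent := by
  induction n with
  | zero => exact hz₀
  | succ n ih =>
    have hmark := fun i => isStuck_of_first_mark (M := M) (r := r) hM hr (hres n) (i := i)
      (z := ((stickySystem M r).run g mk z₀ n).pos)
    simp only [ClockSystem.run_succ, ClockSystem.step]
    have hw := ih.flow (ClockSystem.wait_nonneg (S := stickySystem M r)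
      ((stickySystem M r).run g mk z₀ n).pos ((stickySystem M r).run g mk z₀ n).resid)
    generalize (stickySystem M r).wait ((stickySystem M r).run g mk z₀ n).pos
      ((stickySystem M r).run g mk z₀ n).resid = h at *
    change StickyState.Consistent ((stickySystem M r).jump _ _ (StickyState.flow h _))
    generalize StickyState.flow h ((stickySystem M r).run g mk z₀ n).pos = w at *
    generalize (stickySystem M r).first ((stickySystem M r).run g mk z₀ n).pos
      ((stickySystem M r).run g mk z₀ n).resid = q at *
    intro j
    rcases q with _ | i | i | i
    · exact hw j
    · simp only [stickySystem]
      by_cases hj : j = i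
      · subst hj
        have := hw j
        simp only [Function.update_self, Bool.not_eq_true', Bool.not_eq_false']
        constructor <;> intro h
        · linarith [this.2 h]
        · linarith [this.1 h]
      · rw [Function.update_of_ne hj]; exact hw j
    · simp only [stickySystem]
      split_ifs
      · by_cases hj : j = i
        · subst hj
          have := (hmark _ rfl).2
          simp [this]
        · rw [Function.update_of_ne hj]; exact hw j
      · exact hw j
    · exact hw j

/-- The initial state of the sticky process that corresponds to the latent position `y₀` and the
velocity `v₀`. -/
def stickyInit (M : SpikeSlab d) (y₀ v₀ : Fin d → ℝ) : StickyState d := fun i =>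
  (v₀ i * M.collapse₁ (y₀ i), decide (v₀ i = 1), decide (M.width / 2 ≤ v₀ i * y₀ i))

/-- The collapsing map is odd, so in coordinates relative to the velocity both directions of motion
are treated alike. -/
lemma SpikeSlab.mul_collapse₁ (M : SpikeSlab d) {v y : ℝ} (hv : v = 1 ∨ v = -1) :
    (|y| ≤ M.width / 2 → v * M.collapse₁ y = 0) ∧
    (M.width / 2 < v * y → v * M.collapse₁ y = v * y - M.width / 2) ∧
    (v * y < -(M.width / 2) → v * M.collapse₁ y = v * y + M.width / 2) := by
  have hw := M.width_pos
  have key : ∀ y, (|y| ≤ M.width / 2 → M.collapse₁ y = 0) ∧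
      (M.width / 2 < y → M.collapse₁ y = y - M.width / 2) ∧
      (y < -(M.width / 2) → M.collapse₁ y = y + M.width / 2) := by
    intro y
    refine ⟨fun h => if_pos h, fun h => ?_, fun h => ?_⟩
    · rw [SpikeSlab.collapse₁, if_neg (by rw [abs_of_pos (by linarith)]; linarith),
        Real.sign_of_pos (by linarith), one_mul]
    · rw [SpikeSlab.collapse₁, if_neg (by rw [abs_of_neg (by linarith)]; linarith),
        Real.sign_of_neg (by linarith)]; ring
  obtain ⟨k1, k2, k3⟩ := key y
  rcases hv with rfl | rfl
  · exact ⟨fun h => by rw [k1 h]; ring, fun h => by rw [k2 (by linarith)]; ring,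
      fun h => by rw [k3 (by linarith)]; ring⟩
  · exact ⟨fun h => by rw [k1 h]; ring, fun h => by rw [k3 (by linarith)]; ring,
      fun h => by rw [k2 (by linarith)]; ring⟩

lemma abs_eq_of_sign {v y : ℝ} (hv : v = 1 ∨ v = -1) : |y| = |v * y| := by
  rcases hv with rfl | rfl <;> simp

lemma stickyInit_consistent {y₀ v₀ : Fin d → ℝ} (hv₀ : ∀ i, v₀ i = 1 ∨ v₀ i = -1) :
    (stickyInit M y₀ v₀).Consistent := by
  intro i
  obtain ⟨k1, k2, k3⟩ := M.mul_collapse₁ (y := y₀ i) (hv₀ i)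
  rw [abs_eq_of_sign (hv₀ i), abs_le] at k1
  have hw := M.width_pos
  simp only [stickyInit, decide_eq_true_eq, decide_eq_false_iff_not, not_le]
  constructor <;> intro h
  · rcases h.eq_or_lt with h' | h'
    · exact (k1 ⟨by linarith, h'.ge⟩).ge
    · rw [k2 h']; linarith
  · rcases lt_or_ge (v₀ i * y₀ i) (-(M.width / 2)) with h' | h'
    · rw [k3 h']; linarith
    · exact (k1 ⟨h', h.le⟩).le

lemma isStuck_stickyInit {y₀ v₀ : Fin d → ℝ} (hv₀ : ∀ i, v₀ i = 1 ∨ v₀ i = -1) (i : Fin d) :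
    IsStuck (stickyInit M y₀ v₀) i ↔ M.startsStuck (y₀ i) (v₀ i) := by
  obtain ⟨k1, k2, k3⟩ := M.mul_collapse₁ (y := y₀ i) (hv₀ i)
  have hw := M.width_pos
  have hne : y₀ i = v₀ i * (M.width / 2) ↔ v₀ i * y₀ i = M.width / 2 := by
    rcases hv₀ i with h | h <;> rw [h] <;> constructor <;> intro h <;> linarith
  simp only [IsStuck, stickyInit, SpikeSlab.startsStuck, decide_eq_false_iff_not, not_le, ne_eq, hne]
  constructor
  · rintro ⟨h1, h2⟩
    refine ⟨?_, h1.ne⟩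
    rw [abs_eq_of_sign (hv₀ i), abs_le]
    refine ⟨?_, h1.le⟩
    by_contra! hc
    rw [k3 hc] at h2
    linarith
  · rintro ⟨h1, h2⟩
    refine ⟨lt_of_le_of_ne ?_ h2, (k1 h1).ge⟩
    rw [abs_eq_of_sign (hv₀ i), abs_le] at h1
    exact h1.2

lemma position_stickyInit {y₀ v₀ : Fin d → ℝ} (hv₀ : ∀ i, v₀ i = 1 ∨ v₀ i = -1) :
    position (stickyInit M y₀ v₀) = M.collapse y₀ := by
  ext i
  simp only [position, stickyInit, boolSign_decide (hv₀ i), SpikeSlab.collapse, ← mul_assoc]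
  rcases hv₀ i with h | h <;> rw [h] <;> ring

lemma velocity_run {y₀ v₀ : Fin d → ℝ} (hv₀ : ∀ i, v₀ i = 1 ∨ v₀ i = -1) (n : ℕ) (i : Fin d) :
    velocity ((stickySystem M r).run g mk (stickyInit M y₀ v₀) n).pos i =
      (-1) ^ ((stickySystem M r).run g mk (stickyInit M y₀ v₀) n).count (.bounce i) * v₀ i := by
  induction n with
  | zero => simp [ClockSystem.run, velocity, stickyInit, boolSign_decide (hv₀ i)]
  | succ n ih =>
    simp only [ClockSystem.run_succ, ClockSystem.step]
    rw [stickySystem_velocity_jump]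
    change _ * velocity (((stickySystem M r).run g mk (stickyInit M y₀ v₀) n).pos) i = _
    rw [ih]
    by_cases h : (stickySystem M r).first ((stickySystem M r).run g mk (stickyInit M y₀ v₀) n).pos
      ((stickySystem M r).run g mk (stickyInit M y₀ v₀) n).resid = .bounce i
    · rw [if_pos h, if_pos h.symm, pow_succ]; ring
    · rw [if_neg h, if_neg (Ne.symm h)]; simp

open Classical in
lemma position_path (hM : ContDiff ℝ 2 M.densityPart) (hr : 0 ≤ r)
    (hcons : ∀ n, ((stickySystem M r).run g mk z₀ n).pos.Consistent) (i : Fin d) {n : ℕ} {t : ℝ}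
    (h1 : ((stickySystem M r).run g mk z₀ n).time ≤ t)
    (h2 : t < ((stickySystem M r).run g mk z₀ (n + 1)).time) :
    position ((stickySystem M r).path g mk z₀ t) i = position z₀ i + ∫ s in (0 : ℝ)..t,
      (if IsStuck ((stickySystem M r).path g mk z₀ s) i then 0 else
        velocity ((stickySystem M r).path g mk z₀ s) i) := by
  have hS := stickySystem_regular (M := M) (r := r) hM hr
  have hint : ∀ z h, 0 ≤ h → IntervalIntegrable (fun s =>
      if IsStuck ((stickySystem M r).flow s z) i then 0 else
        velocity ((stickySystem M r).flow s z) i) volume 0 h ∧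
      ∫ s in (0 : ℝ)..h, (if IsStuck ((stickySystem M r).flow s z) i then 0 else
        velocity ((stickySystem M r).flow s z) i) = velocity z i * freeTime i z h := by
    intro z h hh
    have := integral_ite_isStuck i z hh (F := fun _ => velocity z i) continuous_const 0
    refine ⟨this.1, this.2.trans ?_⟩
    simp [mul_comm]
  rw [(hS.path_integral (fun z => if IsStuck z i then 0 else velocity z i)
    (fun z h hh => (hint z h hh).1) n h1 h2.le).2, (hint _ _ (sub_nonneg.2 h1)).2,
    ClockSystem.path_eq h1 h2]
  change position (StickyState.flow _ _) i = _
  rw [position_flow (hcons n) (sub_nonneg.2 h1)]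
  have hsum : ∀ m, position ((stickySystem M r).run g mk z₀ m).pos i = position z₀ i +
      ∑ j ∈ Finset.range m, ∫ s in (0 : ℝ)..(stickySystem M r).wait
        ((stickySystem M r).run g mk z₀ j).pos ((stickySystem M r).run g mk z₀ j).resid,
        (if IsStuck ((stickySystem M r).flow s ((stickySystem M r).run g mk z₀ j).pos) i then 0 else
        velocity ((stickySystem M r).flow s ((stickySystem M r).run g mk z₀ j).pos) i) := by
    intro m
    induction m with
    | zero => simp [ClockSystem.run]
    | succ m ih =>
      rw [Finset.sum_range_succ, ← add_assoc, ← ih,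
        (hint _ _ (ClockSystem.wait_nonneg _ _)).2]
      simp only [ClockSystem.run_succ, ClockSystem.step]
      rw [stickySystem_position_jump]
      exact position_flow (hcons m) (ClockSystem.wait_nonneg _ _) i
  rw [hsum n]
  ring

/-- The property `χ` singles out the marks that agree with the velocity at the time of their use.
These are the releases, so the sticking times are the compound gaps. The delicate clause is
`stuck_iff`, where a bounce at the hitting time of `0` must be excluded. -/
lemma isOriginalPath_sticky (hM : ContDiff ℝ 2 M.densityPart) (hr : 0 ≤ r) {y₀ v₀ : Fin d → ℝ}
    (hv₀ : ∀ i, v₀ i = 1 ∨ v₀ i = -1) (hg : ∀ q k, 0 < g q k)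
    (htime : Tendsto (fun n => ((stickySystem M r).run g mk (stickyInit M y₀ v₀) n).time)
      atTop atTop)
    (htf : ∀ n, (stickySystem M r).TieFree
      ((stickySystem M r).run g mk (stickyInit M y₀ v₀) n).pos
      ((stickySystem M r).run g mk (stickyInit M y₀ v₀) n).resid)
    (hexo : NoBounceAtHit M r g mk (stickyInit M y₀ v₀)) {χ : Fin d → ℕ → Prop}
    (hχ : ∀ i, {m | χ i m}.Infinite)
    (hmark : ∀ n i, (stickySystem M r).first
      ((stickySystem M r).run g mk (stickyInit M y₀ v₀) n).pos
      ((stickySystem M r).run g mk (stickyInit M y₀ v₀) n).resid = .mark i →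
      (χ i (((stickySystem M r).run g mk (stickyInit M y₀ v₀) n).count (.mark i)) ↔
        mk (.mark i) (((stickySystem M r).run g mk (stickyInit M y₀ v₀) n).count (.mark i)) =
          velocity ((stickySystem M r).run g mk (stickyInit M y₀ v₀) n).pos i)) :
    IsOriginalPath M (M.collapse y₀) v₀ (fun i => M.startsStuck (y₀ i) (v₀ i))
      (fun i => g (.bounce i)) (fun i => compoundGap (g (.mark i)) (χ i))
      (fun t => position ((stickySystem M r).path g mk (stickyInit M y₀ v₀) t))
      (fun t => velocity ((stickySystem M r).path g mk (stickyInit M y₀ v₀) t))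
      (fun t i => IsStuck ((stickySystem M r).path g mk (stickyInit M y₀ v₀) t) i) := by
  classical
  set z₀ := stickyInit M y₀ v₀ with hz₀
  have hS := stickySystem_regular (M := M) (r := r) hM hr
  have hres := hS.run_resid_pos hg htf
  have hcons := consistent_run hM hr hres (stickyInit_consistent hv₀)
  have hwait : ∀ n, ((stickySystem M r).run g mk z₀ n).time <
      ((stickySystem M r).run g mk z₀ (n + 1)).time := fun n =>
    lt_add_of_pos_right _ (hS.wait_pos (hres n))
  have hpath : ∀ {t : ℝ} {n : ℕ}, ((stickySystem M r).run g mk z₀ n).time ≤ t →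
      t < ((stickySystem M r).run g mk z₀ (n + 1)).time → (stickySystem M r).path g mk z₀ t =
      StickyState.flow (t - ((stickySystem M r).run g mk z₀ n).time)
        ((stickySystem M r).run g mk z₀ n).pos := fun h1 h2 => ClockSystem.path_eq h1 h2
  have hright : ∀ {t : ℝ} {n : ℕ}, ((stickySystem M r).run g mk z₀ n).time ≤ t →
      t < ((stickySystem M r).run g mk z₀ (n + 1)).time → ∀ᶠ s in 𝓝[≥] t,
      t ≤ s ∧ (stickySystem M r).path g mk z₀ s =
      StickyState.flow (s - ((stickySystem M r).run g mk z₀ n).time)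
        ((stickySystem M r).run g mk z₀ n).pos := by
    intro t n h1 h2
    filter_upwards [Ico_mem_nhdsGE h2] with s hs
    exact ⟨hs.1, hpath (h1.trans hs.1) hs.2⟩
  -- The mark clock measures the time spent stuck, so the unsticking events are the used marks with
  -- the property `χ`.
  have hun : ∀ i {t : ℝ} {n : ℕ}, ((stickySystem M r).run g mk z₀ n).time ≤ t →
      t < ((stickySystem M r).run g mk z₀ (n + 1)).time →
      origUnsticks (fun i => compoundGap (g (.mark i)) (χ i))
        (fun t i => IsStuck ((stickySystem M r).path g mk z₀ t) i) i t =
      Nat.count (χ i) (((stickySystem M r).run g mk z₀ n).count (.mark i)) := by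
    intro i t n h1 h2
    have h := hS.integral_rate_bounds (mk := mk) (z₀ := z₀) (fun q k => (hg q k).le) (.mark i) h1 h2
    exact pointCount_compoundGap (hg _) (hχ i) h.1 h.2
  refine ⟨fun t ht => ?_, fun i t ht => ?_, fun i t ht => ?_, fun i t ht => ?_, fun i => ?_,
    fun i t ht => ?_⟩
  · obtain ⟨n, h1, h2⟩ := ClockSystem.exists_run_index htime ht
    have : (fun s => velocity ((stickySystem M r).path g mk z₀ s)) =ᶠ[𝓝[≥] t]
        fun _ => velocity ((stickySystem M r).run g mk z₀ n).pos := by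
      filter_upwards [hright h1 h2] with s hs
      rw [hs.2, velocity_flow]
    refine ContinuousWithinAt.congr_of_eventuallyEq continuousWithinAt_const this ?_
    rw [hpath h1 h2, velocity_flow]
  · obtain ⟨n, h1, h2⟩ := ClockSystem.exists_run_index htime ht
    set w := ((stickySystem M r).run g mk z₀ n).pos
    set τ := ((stickySystem M r).run g mk z₀ n).time
    -- Between events stuckness persists. Its absence persists for a short time, because an
    -- approaching coordinate is still strictly away from `0`.
    by_cases hst : (w i).2.2 = false ∧ 0 ≤ (w i).1 + (t - τ)
    · filter_upwards [hright h1 h2] with s hs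
      rw [hs.2, hpath h1 h2, isStuck_flow_iff _ _ (by linarith [hs.1]),
        isStuck_flow_iff _ _ (by linarith)]
      exact iff_of_true ⟨hst.1, by linarith [hs.1, hst.2]⟩ hst
    · have : ∀ᶠ s in 𝓝[≥] t, ¬ ((w i).2.2 = false ∧ 0 ≤ (w i).1 + (s - τ)) := by
        by_cases hb : (w i).2.2 = false
        · have hlt : (w i).1 + (t - τ) < 0 := by
            by_contra hc; exact hst ⟨hb, not_lt.1 hc⟩
          have : ∀ᶠ s in 𝓝 t, (w i).1 + (s - τ) < 0 :=
            (by fun_prop : Continuous fun s : ℝ => (w i).1 + (s - τ)).continuousAt.eventually_lt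
              continuousAt_const hlt
          filter_upwards [this.filter_mono nhdsWithin_le_nhds] with s hs h
          linarith [h.2]
        · exact Eventually.of_forall fun s h => hb h.1
      filter_upwards [hright h1 h2, this] with s hs hs'
      rw [hs.2, hpath h1 h2, isStuck_flow_iff _ _ (by linarith [hs.1]),
        isStuck_flow_iff _ _ (by linarith)]
      exact iff_of_false hs' hst
  · obtain ⟨n, h1, h2⟩ := ClockSystem.exists_run_index htime ht
    have : origBounces M (fun i => g (.bounce i))
        (fun t => position ((stickySystem M r).path g mk z₀ t))
        (fun t => velocity ((stickySystem M r).path g mk z₀ t))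
        (fun t i => IsStuck ((stickySystem M r).path g mk z₀ t) i) i t =
        ((stickySystem M r).run g mk z₀ n).count (.bounce i) :=
      hS.pointCount_path hg (.bounce i) h1 h2
    rw [this, hpath h1 h2, velocity_flow]
    exact velocity_run hv₀ n i
  · obtain ⟨n, h1, h2⟩ := ClockSystem.exists_run_index htime ht
    rw [← position_stickyInit hv₀]
    exact position_path hM hr hcons i h1 h2
  · have h0 : (stickySystem M r).path g mk z₀ 0 = z₀ := by
      rw [hpath (n := 0) (t := 0) le_rfl (hwait 0)]
      exact (congrArg (fun s => StickyState.flow s z₀) (sub_self 0)).trans (StickyState.flow_zero z₀)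
    rw [h0]
    exact isStuck_stickyInit hv₀ i
  · obtain ⟨n, h1, h2⟩ := ClockSystem.exists_run_index htime ht.le
    have hcont : StickyState.Consistent ((stickySystem M r).path g mk z₀ t) := by
      rw [hpath h1 h2]; exact (hcons n).flow (by linarith)
    have hzero : position ((stickySystem M r).path g mk z₀ t) i = 0 ↔
        ((stickySystem M r).path g mk z₀ t i).1 = 0 := by
      simp only [position, mul_eq_zero, or_iff_right_iff_imp]
      intro h
      have := abs_boolSign ((stickySystem M r).path g mk z₀ t i).2.1
      rw [h] at this; norm_num at this
    rw [hzero]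
    constructor
    · intro hst
      refine ⟨le_antisymm ((hcont i).2 hst.1) hst.2, ?_⟩
      -- At an event time the comparison is with the preceding event: the present one did not
      -- release the coordinate, which is stuck afterwards. Otherwise the current event time serves
      -- as `s`.
      rcases h1.eq_or_lt with h | h
      · obtain ⟨m, rfl⟩ : ∃ m, n = m + 1 := Nat.exists_eq_succ_of_ne_zero (by
          rintro rfl
          exact ht.ne h)
        refine ⟨_, ClockSystem.run_time_nonneg m, (hwait m).trans_le h1, ?_⟩
        rw [hun i le_rfl (hwait m), hun i h1 h2, ClockSystem.run_succ]
        simp only [ClockSystem.step]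
        split_ifs with hf
        · rw [Nat.count_succ, if_neg, add_zero]
          rw [hmark m i hf.symm]
          intro hv
          rw [hpath h1 h2, isStuck_flow_iff _ _ (by linarith)] at hst
          have h3 := hst.1
          simp only [ClockSystem.run_succ, ClockSystem.step] at h3
          rw [← hf, hv] at h3
          rw [stickySystem_release] at h3
          exact absurd h3 (by simp)
        · simp
      · exact ⟨_, ClockSystem.run_time_nonneg n, h, by rw [hun i le_rfl (hwait n), hun i h1 h2]⟩
    · rintro ⟨ha, s, hs0, hst, hU⟩
      by_contra hns
      have hout : ((stickySystem M r).path g mk z₀ t i).2.2 = true := by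
        by_contra hc
        exact hns ⟨by simpa using hc, ha.ge⟩
      rw [hpath h1 h2] at hout ha
      change (((stickySystem M r).run g mk z₀ n).pos i).2.2 = true at hout
      have han := (hcons n i).1 hout
      simp only [StickyState.flow, hout, if_true] at ha
      have htn : ((stickySystem M r).run g mk z₀ n).time = t := by linarith
      obtain ⟨m, rfl⟩ : ∃ m, n = m + 1 := Nat.exists_eq_succ_of_ne_zero (by
        rintro rfl
        exact ht.ne htn)
      have han0 : (((stickySystem M r).run g mk z₀ (m + 1)).pos i).1 = 0 := by linarith
      have hnb := not_isStuck_of_first_bounce (n := m) (i := i) hM hr (fun q k => (hg q k).le) hexo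
      have hms := isStuck_of_first_mark (i := i) hM hr (hres m)
        (z := ((stickySystem M r).run g mk z₀ m).pos)
      have hw := hS.wait_pos (z := ((stickySystem M r).run g mk z₀ m).pos) (hres m)
      have hcm := hcons m i
      have hcnt : ((stickySystem M r).run g mk z₀ (m + 1)).count (.mark i) =
        ((stickySystem M r).run g mk z₀ m).count (.mark i) + if .mark i =
          (stickySystem M r).first ((stickySystem M r).run g mk z₀ m).pos
          ((stickySystem M r).run g mk z₀ m).resid then 1 else 0 := rfl
      have hmk := hmark m i
      simp only [ClockSystem.run_succ, ClockSystem.step] at han0 hout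
      change ((stickySystem M r).jump _ _ (StickyState.flow _ _) i).1 = 0 at han0
      change ((stickySystem M r).jump _ _ (StickyState.flow _ _) i).2.2 = true at hout
      generalize (stickySystem M r).first ((stickySystem M r).run g mk z₀ m).pos
        ((stickySystem M r).run g mk z₀ m).resid = q at *
      by_cases hqb : q = .bounce i
      · subst hqb
        apply hnb rfl
        rw [stickySystem_jump_bounce] at han0 hout
        exact ⟨by simpa using hout, by linarith⟩
      · by_cases hqm : q = .mark i
        · subst hqm
          by_cases hχm : χ i (((stickySystem M r).run g mk z₀ m).count (.mark i))
          · obtain ⟨l, hl1, hl2⟩ := ClockSystem.exists_run_index htime hs0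
            have hlm : l ≤ m := by
              by_contra hc
              have := ClockSystem.run_time_mono (S := stickySystem M r) (g := g) (mk := mk)
                (z₀ := z₀) (show m + 1 ≤ l by omega)
              simp only at this
              linarith
            have hle := Nat.count_monotone (χ i) (ClockSystem.run_count_mono (S := stickySystem M r)
              (g := g) (mk := mk) (z₀ := z₀) (.mark i) hlm)
            simp only at hle
            rw [hun i hl1 hl2, hun i h1 h2, hcnt, if_pos rfl, Nat.count_succ, if_pos hχm] at hU
            omega
          · rw [hmk rfl] at hχm
            have h3 := (hms rfl).1
            rw [stickySystem_jump_mark_of_ne (by exact hχm)] at hout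
            rw [hout] at h3
            exact absurd h3 (by simp)
        · rw [stickySystem_jump_of_ne hqb hqm] at han0 hout
          have h4 := hcm.1 hout
          rw [flow_mode] at hout
          simp only [StickyState.flow, hout, if_true] at han0
          linarith

end original

/-! ### The latent zig-zag process as a clock system -/

namespace SpikeSlab

variable {d : ℕ} (M : SpikeSlab d)

/-- The map subtracts the projection to the universe, which shows its continuity. -/
lemma collapse₁_eq (t : ℝ) :
    M.collapse₁ t = t - max (-(M.width / 2)) (min t (M.width / 2)) := by
  have hw := M.width_pos
  unfold collapse₁
  split_ifs with h
  · rw [abs_le] at h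
    rw [min_eq_left h.2, max_eq_right h.1, sub_self]
  · rcases le_total 0 t with h0 | h0
    · rw [abs_of_nonneg h0, not_le] at h
      rw [min_eq_right h.le, max_eq_right (by linarith), Real.sign_of_pos (by linarith), one_mul]
    · rw [abs_of_nonpos h0, not_le] at h
      rw [min_eq_left (by linarith), max_eq_left (by linarith), Real.sign_of_neg (by linarith)]
      ring

lemma continuous_collapse₁ : Continuous M.collapse₁ := by
  simp only [funext M.collapse₁_eq]; fun_prop

lemma continuous_collapse : Continuous M.collapse :=
  continuous_pi fun i => M.continuous_collapse₁.comp (continuous_apply i)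

lemma abs_collapse₁_le (t : ℝ) : |M.collapse₁ t| ≤ |t| := by
  have hw := M.width_pos
  rw [collapse₁_eq]
  rcases le_total t (M.width / 2) with h | h
  · rw [min_eq_left h]
    rcases le_total (-(M.width / 2)) t with h1 | h1
    · rw [max_eq_right h1, sub_self, abs_zero]; exact abs_nonneg _
    · rw [max_eq_left h1, abs_of_nonpos (by linarith), abs_of_nonpos (by linarith)]; linarith
  · rw [min_eq_right h, max_eq_right (by linarith), abs_of_nonneg (by linarith),
      abs_of_nonneg (by linarith)]; linarith

lemma norm_collapse_le (y : Fin d → ℝ) : ‖M.collapse y‖ ≤ ‖y‖ :=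
  (pi_norm_le_iff_of_nonneg (norm_nonneg _)).2 fun i =>
    (M.abs_collapse₁_le (y i)).trans (norm_le_pi_norm y i)

lemma collapse_update (y : Fin d → ℝ) (i : Fin d) (t : ℝ) :
    M.collapse (y + t • Pi.single i 1) =
      Function.update (M.collapse y) i (M.collapse₁ (y i + t)) := by
  ext j
  by_cases h : j = i
  · subst h; simp [collapse]
  · simp [collapse, h]

/-- Inside the universe small displacements of the coordinate are invisible after collapsing. -/
lemma lineDeriv_latentPotential_of_lt {y : Fin d → ℝ} {i : Fin d} (h : |y i| < M.width / 2) :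
    lineDeriv ℝ M.latentPotential y (Pi.single i 1) = 0 := by
  have : (fun t : ℝ => M.latentPotential (y + t • Pi.single i 1)) =ᶠ[𝓝 0]
      fun _ => M.latentPotential y := by
    have hc : ∀ᶠ t : ℝ in 𝓝 0, |y i + t| < M.width / 2 :=
      (by fun_prop : Continuous fun t : ℝ => |y i + t|).continuousAt.eventually_lt
        continuousAt_const (by simpa using h)
    filter_upwards [hc] with t ht
    change M.potential (M.collapse _) = M.potential (M.collapse _)
    rw [collapse_update]
    have h1 : M.collapse₁ (y i + t) = M.collapse y i := by
      rw [collapse, collapse₁, collapse₁, if_pos ht.le, if_pos h.le]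
    rw [h1, Function.update_eq_self]
  rw [lineDeriv, this.deriv_eq, deriv_const]

/-- Away from the closed universe the collapsing map is locally a translation. -/
lemma lineDeriv_latentPotential_of_gt {y : Fin d → ℝ} {i : Fin d} (h : M.width / 2 < |y i|) :
    lineDeriv ℝ M.latentPotential y (Pi.single i 1) =
      lineDeriv ℝ M.potential (M.collapse y) (Pi.single i 1) := by
  have hw := M.width_pos
  have : (fun t : ℝ => M.latentPotential (y + t • Pi.single i 1)) =ᶠ[𝓝 0]
      fun t => M.potential (M.collapse y + t • Pi.single i 1) := by
    have hc : ∀ᶠ t : ℝ in 𝓝 0, M.collapse₁ (y i + t) = M.collapse₁ (y i) + t := by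
      simp only [collapse₁_eq]
      rcases lt_abs.1 h with h | h
      · have hc : ∀ᶠ t : ℝ in 𝓝 0, M.width / 2 < y i + t :=
          continuousAt_const.eventually_lt (by fun_prop : Continuous fun t : ℝ => y i + t).continuousAt
            (by simpa using h)
        filter_upwards [hc] with t ht
        rw [min_eq_right h.le, min_eq_right ht.le]; ring
      · have hc : ∀ᶠ t : ℝ in 𝓝 0, y i + t < -(M.width / 2) :=
          (by fun_prop : Continuous fun t : ℝ => y i + t).continuousAt.eventually_lt
            continuousAt_const (by simp only [add_zero]; linarith)
        filter_upwards [hc] with t ht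
        rw [min_eq_left (by linarith), min_eq_left (by linarith), max_eq_left (by linarith),
          max_eq_left (by linarith)]; ring
    filter_upwards [hc] with t ht
    change M.potential (M.collapse _) = M.potential _
    congr 1
    rw [collapse_update, ht]
    ext j
    by_cases hj : j = i
    · subst hj; simp [collapse]
    · simp [hj]
  rw [lineDeriv, lineDeriv, this.deriv_eq]

end SpikeSlab

/-- The state of the latent process. A coordinate is described by its position relative to its
velocity, and by its velocity. -/
abbrev LatentState (d : ℕ) : Type := Fin d → ℝ × Bool

namespace LatentState

variable {d : ℕ}

/-- The latent position. -/
def latentPosition (z : LatentState d) (i : Fin d) : ℝ := boolSign (z i).2 * (z i).1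

/-- The velocity. -/
def latentVelocity (z : LatentState d) (i : Fin d) : ℝ := boolSign (z i).2

/-- The motion between events. -/
def latentFlow (s : ℝ) (z : LatentState d) : LatentState d := fun i => ((z i).1 + s, (z i).2)

lemma latentPosition_flow (s : ℝ) (z : LatentState d) (i : Fin d) :
    latentPosition (latentFlow s z) i = latentPosition z i + latentVelocity z i * s := by
  simp only [latentPosition, latentFlow, latentVelocity]; ring

lemma abs_latentPosition (z : LatentState d) (i : Fin d) : |latentPosition z i| = |(z i).1| := by
  simp [latentPosition, abs_mul, abs_boolSign]

lemma norm_latentVelocity_le (z : LatentState d) : ‖latentVelocity z‖ ≤ 1 :=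
  (pi_norm_le_iff_of_nonneg zero_le_one).2 fun i => by simp [latentVelocity, abs_boolSign]

lemma norm_latentPosition (z : LatentState d) :
    ‖latentPosition z‖ = ‖fun i => (z i).1‖ := by
  simp only [Pi.norm_def]
  congr 2
  ext i
  exact abs_latentPosition z i

end LatentState

open LatentState

open Classical in
/-- The latent zig-zag process with refreshments at rate `r` of the positions in the universe. The
mark clocks have no effect. -/
def latentSystem {d : ℕ} (M : SpikeSlab d) (r : ℝ) : ClockSystem (Clock d) (LatentState d) where
  flow := latentFlow
  rate q z := match q with
    | .tick => 1
    | .bounce i => bounceRate M.latentPotential i (latentPosition z) (latentVelocity z)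
    | .mark i => if |latentPosition z i| < M.width / 2 then 1 else 0
    | .refresh i => if |latentPosition z i| < M.width / 2 then r else 0
  jump q m z := match q with
    | .tick => z
    | .bounce i => Function.update z i (-(z i).1, !(z i).2)
    | .mark _ => z
    | .refresh i => Function.update z i (boolSign (z i).2 * m, (z i).2)

section latentSystem

variable {d : ℕ} {M : SpikeSlab d} {r : ℝ}

/-- The bounce rate along the motion, as a continuous function, for coordinates that are outside
the universe. -/
def outerRate (M : SpikeSlab d) (i : Fin d) (z : LatentState d) (s : ℝ) : ℝ :=
  bounceRate M.potential i (M.collapse (latentPosition (latentFlow s z))) (latentVelocity z)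

lemma continuous_outerRate (hM : ContDiff ℝ 2 M.densityPart) (i : Fin d) (z : LatentState d) :
    Continuous (outerRate M i z) := by
  have h : Continuous fun s => latentPosition (latentFlow s z) :=
    continuous_pi fun j => by simp only [latentPosition_flow]; fun_prop
  exact (M.continuous_bounceRate hM i).comp
    ((M.continuous_collapse.comp h).prodMk continuous_const)

lemma measurableSet_abs_lt (b c : ℝ) : MeasurableSet {s : ℝ | |b + s| < c} :=
  measurableSet_lt (by fun_prop) measurable_const

/-- At the ends of the universe the latent potential need not be differentiable. The motion passes
each end at most once, so the value of the rate there does not affect the integral. -/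
lemma latentSystem_bounce (hM : ContDiff ℝ 2 M.densityPart) (i : Fin d) (z : LatentState d)
    {h : ℝ} (hh : 0 ≤ h) :
    IntervalIntegrable (fun s => (latentSystem M r).rate (.bounce i) ((latentSystem M r).flow s z))
      volume 0 h ∧ (latentSystem M r).hazard (.bounce i) z h =
      ∫ s in (0 : ℝ)..h, if |(z i).1 + s| < M.width / 2 then 0 else outerRate M i z s := by
  have hae : ∀ᵐ s ∂volume, s ∈ uIoc 0 h →
      (if |(z i).1 + s| < M.width / 2 then 0 else outerRate M i z s) =
      (latentSystem M r).rate (.bounce i) ((latentSystem M r).flow s z) := by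
    have h1 : ∀ᵐ s ∂(volume : Measure ℝ), s ≠ M.width / 2 - (z i).1 := by
      simp [ae_iff, measure_singleton]
    have h2 : ∀ᵐ s ∂(volume : Measure ℝ), s ≠ -(M.width / 2) - (z i).1 := by
      simp [ae_iff, measure_singleton]
    filter_upwards [h1, h2] with s h1 h2 _
    have habs : |latentPosition (latentFlow s z) i| = |(z i).1 + s| := abs_latentPosition _ _
    change _ = bounceRate _ _ (latentPosition (latentFlow s z)) (latentVelocity z)
    unfold outerRate
    rcases lt_trichotomy |(z i).1 + s| (M.width / 2) with hlt | heq | hgt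
    · rw [if_pos hlt, bounceRate, M.lineDeriv_latentPotential_of_lt (habs ▸ hlt)]
      simp
    · exfalso
      rcases abs_eq (by linarith [M.width_pos]) |>.1 heq with h3 | h3
      · exact h1 (by linarith)
      · exact h2 (by linarith)
    · rw [if_neg hgt.not_gt, bounceRate, bounceRate,
        M.lineDeriv_latentPotential_of_gt (habs ▸ hgt)]
  have hint : IntervalIntegrable
      (fun s => if |(z i).1 + s| < M.width / 2 then 0 else outerRate M i z s) volume 0 h := by
    have := ((continuous_outerRate hM i z).intervalIntegrable (μ := volume) 0 h)
    rw [intervalIntegrable_iff] at this ⊢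
    have h3 := this.indicator (measurableSet_abs_lt (z i).1 (M.width / 2)).compl
    convert h3 using 2 with s
    by_cases hs : |(z i).1 + s| < M.width / 2 <;> simp [indicator, hs]
  exact ⟨hint.congr_ae ((ae_restrict_iff' measurableSet_uIoc).2 hae),
    (intervalIntegral.integral_congr_ae hae).symm⟩

lemma intervalIntegrable_ite_abs_lt (b c x : ℝ) {h : ℝ} :
    IntervalIntegrable (fun s => if |b + s| < c then x else 0) volume 0 h := by
  have := (intervalIntegrable_const (μ := volume) (a := 0) (b := h) (c := x))
  rw [intervalIntegrable_iff] at this ⊢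
  have h3 := this.indicator (measurableSet_abs_lt b c)
  convert h3 using 2 with s
  by_cases hs : |b + s| < c <;> simp [indicator, hs]

lemma integral_ite_abs_lt_le (b c : ℝ) {x : ℝ} (hx : 0 ≤ x) {h : ℝ} (hh : 0 ≤ h) :
    ∫ s in (0 : ℝ)..h, (if |b + s| < c then x else 0) ≤ x * h := by
  calc _ ≤ ∫ s in (0 : ℝ)..h, x := by
        refine intervalIntegral.integral_mono_on hh (intervalIntegrable_ite_abs_lt b c x)
          intervalIntegrable_const fun s _ => ?_
        split_ifs
        · exact le_rfl
        · exact hx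
    _ = _ := by rw [intervalIntegral.integral_const, smul_eq_mul, sub_zero, mul_comm]

lemma latentSystem_mark (i : Fin d) (z : LatentState d) (h : ℝ) :
    (latentSystem M r).hazard (.mark i) z h =
      ∫ s in (0 : ℝ)..h, if |(z i).1 + s| < M.width / 2 then 1 else 0 := by
  refine intervalIntegral.integral_congr fun s _ => ?_
  exact if_congr (by rw [abs_latentPosition]; rfl) rfl rfl

lemma latentSystem_refresh (i : Fin d) (z : LatentState d) (h : ℝ) :
    (latentSystem M r).hazard (.refresh i) z h =
      ∫ s in (0 : ℝ)..h, if |(z i).1 + s| < M.width / 2 then r else 0 := by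
  refine intervalIntegral.integral_congr fun s _ => ?_
  exact if_congr (by rw [abs_latentPosition]; rfl) rfl rfl

lemma latentSystem_tick (z : LatentState d) (h : ℝ) :
    (latentSystem M r).hazard .tick z h = h := by
  simp [ClockSystem.hazard, latentSystem]

lemma latentSystem_regular (hM : ContDiff ℝ 2 M.densityPart) (hr : 0 ≤ r) :
    (latentSystem M r).Regular where
  flow_add s t z _ _ := by
    ext i
    · simp [latentSystem, latentFlow, add_assoc]
    · rfl
  rate_nonneg q z := by
    rcases q with _ | i | i | i <;> simp only [latentSystem]
    · exact zero_le_one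
    · exact bounceRate_nonneg _ _ _ _
    all_goals split_ifs <;> first | exact le_rfl | exact zero_le_one | exact hr
  rate_integrable q z h hh := by
    rcases q with _ | i | i | i
    · exact intervalIntegrable_const
    · exact (latentSystem_bounce hM i z hh).1
    · simp only [latentSystem, abs_latentPosition]
      exact intervalIntegrable_ite_abs_lt _ _ _
    · simp only [latentSystem, abs_latentPosition]
      exact intervalIntegrable_ite_abs_lt _ _ _
  exists_tick := ⟨.tick, fun _ => rfl⟩

/-- A refreshment may enlarge the position, but not beyond the universe. The maximum with half its
width is therefore a size that no jump increases. -/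
lemma latentSystem_tendsto_time (hM : ContDiff ℝ 2 M.densityPart) (hr : 0 ≤ r)
    {g : Clock d → ℕ → ℝ} {mk : Clock d → ℕ → ℝ} (z₀ : LatentState d) (hg : ∀ q k, 0 < g q k)
    (hsum : ∀ q, Tendsto (fun n => ∑ k ∈ Finset.range n, g q k) atTop atTop)
    (hmk : ∀ i k, |mk (.refresh i) k| ≤ M.width / 2) :
    Tendsto (fun n => ((latentSystem M r).run g mk z₀ n).time) atTop atTop := by
  have hw := M.width_pos
  have hle : ∀ (z : LatentState d) i, |(z i).1| ≤ ‖fun i => (z i).1‖ := fun z i =>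
    norm_le_pi_norm (fun i => (z i).1) i
  have hn : ∀ (z : LatentState d), 0 ≤ ‖fun i => (z i).1‖ := fun z => norm_nonneg _
  have hflow : ∀ s (z : LatentState d), 0 ≤ s →
      ‖fun i => (latentFlow s z i).1‖ ≤ ‖fun i => (z i).1‖ + s := by
    intro s z hs
    refine (pi_norm_le_iff_of_nonneg (by linarith [hn z])).2 fun i => ?_
    exact (abs_add_le _ _).trans (by rw [abs_of_nonneg hs]; linarith [hle z i])
  refine (latentSystem_regular hM hr).tendsto_run_time hg hsum
    (fun z => max ‖fun i => (z i).1‖ (M.width / 2)) (fun s z hs => ?_) (fun q k z => ?_)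
    fun K => ?_
  · refine max_le ((hflow s z hs).trans (by linarith [le_max_left ‖fun i => (z i).1‖ (M.width / 2)]))
      (by linarith [le_max_right ‖fun i => (z i).1‖ (M.width / 2)])
  · refine max_le ((pi_norm_le_iff_of_nonneg (by positivity)).2 fun j => ?_) (le_max_right _ _)
    have hj := (hle z j).trans (le_max_left _ (M.width / 2))
    rcases q with _ | i | i | i <;> simp only [latentSystem]
    · exact hj
    · by_cases h : j = i
      · subst h; simpa using hj
      · simpa [h] using hj
    · exact hj
    · by_cases h : j = i
      · subst h
        rw [Function.update_self, Real.norm_eq_abs, abs_mul, abs_boolSign, one_mul]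
        exact (hmk j k).trans (le_max_right _ _)
      · simpa [h] using hj
  · obtain ⟨R, hR0, hR⟩ := M.exists_bounceRate_le hM K
    refine ⟨R + 1 + r, fun q z h hh hK => ?_⟩
    have hK' := (add_le_add_left (le_max_left ‖fun i => (z i).1‖ (M.width / 2)) h).trans hK
    rcases q with _ | i | i | i
    · rw [latentSystem_tick]; nlinarith
    · have hb := (latentSystem_bounce (r := r) hM i z hh)
      have : (latentSystem M r).hazard (.bounce i) z h ≤ ∫ s in (0 : ℝ)..h, R := by
        rw [hb.2]
        refine intervalIntegral.integral_mono_on hh ?_ intervalIntegrable_const fun s hs => ?_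
        · have := ((continuous_outerRate hM i z).intervalIntegrable (μ := volume) 0 h)
          rw [intervalIntegrable_iff] at this ⊢
          have h3 := this.indicator (measurableSet_abs_lt (z i).1 (M.width / 2)).compl
          convert h3 using 2 with s
          by_cases hs : |(z i).1 + s| < M.width / 2 <;> simp [indicator, hs]
        · split_ifs
          · exact hR0
          · refine hR i _ _ ((M.norm_collapse_le _).trans ?_) (norm_latentVelocity_le _)
            rw [norm_latentPosition]
            exact (hflow s z hs.1).trans (by linarith [hs.2])
      rw [intervalIntegral.integral_const, smul_eq_mul] at this
      nlinarith
    · rw [latentSystem_mark]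
      have := integral_ite_abs_lt_le (z i).1 (M.width / 2) zero_le_one hh
      nlinarith
    · rw [latentSystem_refresh]
      have := integral_ite_abs_lt_le (z i).1 (M.width / 2) hr hh
      nlinarith

/-- The initial state of the latent process. -/
def latentInit (y₀ v₀ : Fin d → ℝ) : LatentState d := fun i => (v₀ i * y₀ i, decide (v₀ i = 1))

lemma latentPosition_latentInit {y₀ v₀ : Fin d → ℝ} (hv₀ : ∀ i, v₀ i = 1 ∨ v₀ i = -1) :
    latentPosition (latentInit y₀ v₀) = y₀ := by
  ext i
  simp only [latentPosition, latentInit, boolSign_decide (hv₀ i), ← mul_assoc]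
  rcases hv₀ i with h | h <;> rw [h] <;> ring

lemma latentSystem_velocity_jump (q : Clock d) (m : ℝ) (z : LatentState d) (i : Fin d) :
    latentVelocity ((latentSystem M r).jump q m z) i =
      (if q = .bounce i then -1 else 1) * latentVelocity z i := by
  rcases q with _ | j | j | j <;> simp only [latentSystem, latentVelocity]
  · simp
  · by_cases hj : j = i
    · subst hj; simp [boolSign_not]
    · simp [Function.update_of_ne (Ne.symm hj), hj]
  · simp
  · by_cases hj : j = i
    · subst hj; simp
    · simp [Function.update_of_ne (Ne.symm hj)]

lemma latentSystem_position_jump (q : Clock d) (m : ℝ) (z : LatentState d) (i : Fin d) :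
    latentPosition ((latentSystem M r).jump q m z) i =
      if q = .refresh i then m else latentPosition z i := by
  rcases q with _ | j | j | j <;> simp only [latentSystem, latentPosition]
  · simp
  · by_cases hj : j = i
    · subst hj; simp [boolSign_not]
    · simp [Function.update_of_ne (Ne.symm hj)]
  · simp
  · by_cases hj : j = i
    · subst hj; simp [← mul_assoc, boolSign_mul_self]
    · simp [Function.update_of_ne (Ne.symm hj), hj]

variable {g mk : Clock d → ℕ → ℝ}

lemma latentVelocity_run {y₀ v₀ : Fin d → ℝ} (hv₀ : ∀ i, v₀ i = 1 ∨ v₀ i = -1) (n : ℕ)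
    (i : Fin d) :
    latentVelocity ((latentSystem M r).run g mk (latentInit y₀ v₀) n).pos i =
      (-1) ^ ((latentSystem M r).run g mk (latentInit y₀ v₀) n).count (.bounce i) * v₀ i := by
  induction n with
  | zero => simp [ClockSystem.run, latentVelocity, latentInit, boolSign_decide (hv₀ i)]
  | succ n ih =>
    simp only [ClockSystem.run_succ, ClockSystem.step]
    rw [latentSystem_velocity_jump]
    change _ * latentVelocity (((latentSystem M r).run g mk (latentInit y₀ v₀) n).pos) i = _
    rw [ih]
    by_cases h : (latentSystem M r).first ((latentSystem M r).run g mk (latentInit y₀ v₀) n).pos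
      ((latentSystem M r).run g mk (latentInit y₀ v₀) n).resid = .bounce i
    · rw [if_pos h, if_pos h.symm, pow_succ]; ring
    · rw [if_neg h, if_neg (Ne.symm h)]; simp

lemma isLatentPath_latent (hM : ContDiff ℝ 2 M.densityPart) (hr : 0 ≤ r) {y₀ v₀ : Fin d → ℝ}
    (hv₀ : ∀ i, v₀ i = 1 ∨ v₀ i = -1) (hg : ∀ q k, 0 < g q k)
    (htime : Tendsto (fun n => ((latentSystem M r).run g mk (latentInit y₀ v₀) n).time)
      atTop atTop) :
    IsLatentPath M r y₀ v₀ (fun i => g (.bounce i)) (fun i => g (.refresh i))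
      (fun i => mk (.refresh i))
      (fun t => latentPosition ((latentSystem M r).path g mk (latentInit y₀ v₀) t))
      (fun t => latentVelocity ((latentSystem M r).path g mk (latentInit y₀ v₀) t)) := by
  classical
  set z₀ := latentInit y₀ v₀ with hz₀
  have hS := latentSystem_regular (M := M) (r := r) hM hr
  have hpath : ∀ {t : ℝ} {n : ℕ}, ((latentSystem M r).run g mk z₀ n).time ≤ t →
      t < ((latentSystem M r).run g mk z₀ (n + 1)).time → (latentSystem M r).path g mk z₀ t =
      latentFlow (t - ((latentSystem M r).run g mk z₀ n).time)
        ((latentSystem M r).run g mk z₀ n).pos := fun h1 h2 => ClockSystem.path_eq h1 h2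
  have href : ∀ i {t : ℝ} {n : ℕ}, ((latentSystem M r).run g mk z₀ n).time ≤ t →
      t < ((latentSystem M r).run g mk z₀ (n + 1)).time →
      refreshes M r (fun i => g (.refresh i))
        (fun t => latentPosition ((latentSystem M r).path g mk z₀ t)) i t =
      ((latentSystem M r).run g mk z₀ n).count (.refresh i) :=
    fun i t n h1 h2 => hS.pointCount_path hg (.refresh i) h1 h2
  have hstep : ∀ n i, (latentSystem M r).first ((latentSystem M r).run g mk z₀ n).pos
      ((latentSystem M r).run g mk z₀ n).resid ≠ .refresh i →
      latentPosition ((latentSystem M r).run g mk z₀ (n + 1)).pos i =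
        latentPosition ((latentSystem M r).run g mk z₀ n).pos i +
        latentVelocity ((latentSystem M r).run g mk z₀ n).pos i *
        (latentSystem M r).wait ((latentSystem M r).run g mk z₀ n).pos
          ((latentSystem M r).run g mk z₀ n).resid := by
    intro n i hf
    simp only [ClockSystem.run_succ, ClockSystem.step]
    rw [latentSystem_position_jump, if_neg hf]
    exact latentPosition_flow _ _ _
  have hfirst : ∀ n i, ((latentSystem M r).run g mk z₀ (n + 1)).count (.refresh i) =
      ((latentSystem M r).run g mk z₀ n).count (.refresh i) →
      (latentSystem M r).first ((latentSystem M r).run g mk z₀ n).pos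
      ((latentSystem M r).run g mk z₀ n).resid ≠ .refresh i := by
    intro n i hc hf
    simp [ClockSystem.run_succ, ClockSystem.step, hf] at hc
  have hmono : ∀ {a b : ℕ} (i : Fin d), a ≤ b →
      ((latentSystem M r).run g mk z₀ a).count (.refresh i) ≤
      ((latentSystem M r).run g mk z₀ b).count (.refresh i) := fun i h =>
    ClockSystem.run_count_mono (S := latentSystem M r) (g := g) (mk := mk) (z₀ := z₀)
      (.refresh i) h
  have htmono : ∀ {a b : ℕ}, a ≤ b → ((latentSystem M r).run g mk z₀ a).time ≤
      ((latentSystem M r).run g mk z₀ b).time := fun h =>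
    ClockSystem.run_time_mono (S := latentSystem M r) (g := g) (mk := mk) (z₀ := z₀) h
  have hindex : ∀ {s t : ℝ} {a b : ℕ}, s ≤ t → ((latentSystem M r).run g mk z₀ a).time ≤ s →
      t < ((latentSystem M r).run g mk z₀ (b + 1)).time → a ≤ b := by
    intro s t a b hst ha hb
    by_contra hc
    have := htmono (show b + 1 ≤ a by omega)
    linarith
  have hright : ∀ {t : ℝ} {n : ℕ}, ((latentSystem M r).run g mk z₀ n).time ≤ t →
      t < ((latentSystem M r).run g mk z₀ (n + 1)).time → ∀ᶠ s in 𝓝[≥] t,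
      (latentSystem M r).path g mk z₀ s =
      latentFlow (s - ((latentSystem M r).run g mk z₀ n).time)
        ((latentSystem M r).run g mk z₀ n).pos := by
    intro t n h1 h2
    filter_upwards [Ico_mem_nhdsGE h2] with s hs
    exact hpath (h1.trans hs.1) hs.2
  refine ⟨fun t ht => ?_, fun t ht => ?_, fun i t ht => ?_, ?_, fun i s t hs hst hc => ?_,
    fun i t n ht hlt hc => ?_⟩
  · obtain ⟨n, h1, h2⟩ := ClockSystem.exists_run_index htime ht
    have hc : Continuous fun s => latentPosition (latentFlow
        (s - ((latentSystem M r).run g mk z₀ n).time) ((latentSystem M r).run g mk z₀ n).pos) :=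
      continuous_pi fun i => by simp only [latentPosition_flow]; fun_prop
    refine hc.continuousWithinAt.congr_of_eventuallyEq ?_ (by rw [hpath h1 h2])
    filter_upwards [hright h1 h2] with s hs
    rw [hs]
  · obtain ⟨n, h1, h2⟩ := ClockSystem.exists_run_index htime ht
    refine (continuousWithinAt_const (b := latentVelocity
      ((latentSystem M r).run g mk z₀ n).pos)).congr_of_eventuallyEq ?_ (by rw [hpath h1 h2]; rfl)
    filter_upwards [hright h1 h2] with s hs
    rw [hs]; rfl
  · obtain ⟨n, h1, h2⟩ := ClockSystem.exists_run_index htime ht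
    have : latentBounces M (fun i => g (.bounce i))
        (fun t => latentPosition ((latentSystem M r).path g mk z₀ t))
        (fun t => latentVelocity ((latentSystem M r).path g mk z₀ t)) i t =
        ((latentSystem M r).run g mk z₀ n).count (.bounce i) :=
      hS.pointCount_path hg (.bounce i) h1 h2
    rw [this, hpath h1 h2]
    exact latentVelocity_run hv₀ n i
  · have h1 : (0 : ℝ) < ((latentSystem M r).run g mk z₀ (0 + 1)).time :=
      lt_add_of_pos_right _ (hS.wait_pos fun q => hg q 0)
    rw [hpath (n := 0) (t := 0) le_rfl h1]
    refine Eq.trans ?_ (latentPosition_latentInit hv₀)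
    ext i
    rw [latentPosition_flow]
    simp [ClockSystem.run, hz₀]
  · obtain ⟨n, h1, h2⟩ := ClockSystem.exists_run_index htime hs
    obtain ⟨m, k1, k2⟩ := ClockSystem.exists_run_index htime (hs.trans hst)
    rw [href i h1 h2, href i k1 k2] at hc
    have hnm := hindex hst h1 k2
    have hF : ∀ z h, 0 ≤ h → IntervalIntegrable
        (fun s => latentVelocity ((latentSystem M r).flow s z) i) volume 0 h := fun z h hh =>
      (intervalIntegrable_const (c := latentVelocity z i))
    obtain ⟨i1, e1⟩ := hS.path_integral (g := g) (mk := mk) (z₀ := z₀)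
      (fun z => latentVelocity z i) hF n h1 h2.le
    obtain ⟨i2, e2⟩ := hS.path_integral (g := g) (mk := mk) (z₀ := z₀)
      (fun z => latentVelocity z i) hF m k1 k2.le
    have hconst : ∀ z h, ∫ s in (0 : ℝ)..h, latentVelocity ((latentSystem M r).flow s z) i =
        latentVelocity z i * h := by
      intro z h
      change ∫ s in (0 : ℝ)..h, latentVelocity z i = _
      rw [intervalIntegral.integral_const, smul_eq_mul, sub_zero, mul_comm]
    simp only [hconst] at e1 e2
    rw [← intervalIntegral.integral_interval_sub_left i2 i1, e1, e2, hpath h1 h2, hpath k1 k2,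
      latentPosition_flow, latentPosition_flow]
    -- Position minus integrated velocity is the same at all events that are not refreshments of the
    -- coordinate, as bounces do not move it.
    have : ∀ j, n ≤ j → j ≤ m → latentPosition ((latentSystem M r).run g mk z₀ j).pos i -
        ∑ j ∈ Finset.range j, latentVelocity ((latentSystem M r).run g mk z₀ j).pos i *
        (latentSystem M r).wait ((latentSystem M r).run g mk z₀ j).pos
          ((latentSystem M r).run g mk z₀ j).resid =
        latentPosition ((latentSystem M r).run g mk z₀ n).pos i -
        ∑ j ∈ Finset.range n, latentVelocity ((latentSystem M r).run g mk z₀ j).pos i *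
        (latentSystem M r).wait ((latentSystem M r).run g mk z₀ j).pos
          ((latentSystem M r).run g mk z₀ j).resid := by
      intro j hj
      induction j, hj using Nat.le_induction with
      | base => intro _; rfl
      | succ j hj ih =>
        intro hjm
        rw [← ih (by omega), Finset.sum_range_succ, hstep j i (hfirst j i (by
          have a1 := hmono i hj
          have a2 := hmono i hjm
          have a3 := hmono i (Nat.le_add_right j 1)
          omega))]
        ring
    have := this m hnm le_rfl
    linarith
  · obtain ⟨N, k1, k2⟩ := ClockSystem.exists_run_index htime ht.le
    rw [href i k1 k2] at hc
    -- The first event after which the refreshment count is `n + 1` is the one with mark `n`. It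
    -- occurs at time `t`, since before `t` the count is at most `n`. Further events up to index `N`
    -- occur at the same instant and are not refreshments of this coordinate.
    have hex : ∃ j, n + 1 ≤ ((latentSystem M r).run g mk z₀ j).count (.refresh i) := ⟨N, hc.ge⟩
    have hfind := Nat.find_spec hex
    have hmin := fun k => Nat.find_min hex (m := k)
    have hfN : Nat.find hex ≤ N := Nat.find_min' hex hc.ge
    rcases hj : Nat.find hex with _ | j
    · rw [hj] at hfind
      simp [ClockSystem.run] at hfind
    rw [hj] at hfind hfN
    have hjn := hmin j (by omega)
    have htj : ((latentSystem M r).run g mk z₀ (j + 1)).time = t := by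
      refine le_antisymm ((htmono hfN).trans k1) ?_
      by_contra! hlt'
      have h0 := ClockSystem.run_time_nonneg (S := latentSystem M r) (g := g) (mk := mk)
        (z₀ := z₀) (j + 1)
      obtain ⟨l, l1, l2⟩ := ClockSystem.exists_run_index htime h0
      have := hlt _ h0 hlt'
      rw [href i l1 l2] at this
      have := hmono i (hindex le_rfl le_rfl l2)
      omega
    have hcount : ((latentSystem M r).run g mk z₀ (j + 1)).count (.refresh i) =
        ((latentSystem M r).run g mk z₀ j).count (.refresh i) + if .refresh i =
          (latentSystem M r).first ((latentSystem M r).run g mk z₀ j).pos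
          ((latentSystem M r).run g mk z₀ j).resid then 1 else 0 := rfl
    have hf : .refresh i = (latentSystem M r).first ((latentSystem M r).run g mk z₀ j).pos
          ((latentSystem M r).run g mk z₀ j).resid := by
      by_contra h
      rw [if_neg h] at hcount
      omega
    rw [if_pos hf] at hcount
    have hjc : ((latentSystem M r).run g mk z₀ j).count (.refresh i) = n := by omega
    have : ∀ k, j + 1 ≤ k → k ≤ N → latentPosition ((latentSystem M r).run g mk z₀ k).pos i =
        mk (.refresh i) n := by
      intro k hk
      induction k, hk using Nat.le_induction with
      | base =>
        intro _
        simp only [ClockSystem.run_succ, ClockSystem.step]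
        rw [latentSystem_position_jump, if_pos hf.symm, ← hf, hjc]
      | succ k hk ih =>
        intro hkN
        have a1 := hmono i hk
        have a2 := hmono i hkN
        have a3 := hmono i (Nat.le_add_right k 1)
        have b1 := htmono hk
        have b2 := htmono hkN
        have b3 : ((latentSystem M r).run g mk z₀ (k + 1)).time =
          ((latentSystem M r).run g mk z₀ k).time + (latentSystem M r).wait
          ((latentSystem M r).run g mk z₀ k).pos ((latentSystem M r).run g mk z₀ k).resid := rfl
        have hw0 := ClockSystem.wait_nonneg (S := latentSystem M r)
          ((latentSystem M r).run g mk z₀ k).pos ((latentSystem M r).run g mk z₀ k).resid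
        rw [hstep k i (hfirst k i (by omega)), ih (by omega),
          show (latentSystem M r).wait ((latentSystem M r).run g mk z₀ k).pos
            ((latentSystem M r).run g mk z₀ k).resid = 0 by linarith]
        ring
    rw [hpath k1 k2, latentPosition_flow, this N hfN le_rfl,
      show t - ((latentSystem M r).run g mk z₀ N).time = 0 by linarith [htmono hfN]]
    ring

end latentSystem

/-! ### The coupling of the sticky and of the latent process -/

/-- After its `n`-th refreshment, a coordinate that moves outwards leaves the universe before the
next refreshment. -/
def Escapes (w r : ℝ) (f u : ℕ → ℝ) (n : ℕ) : Prop := w / 2 - |u n| < f (n + 1) / r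

/-- The time, spent in the universe, at which a coordinate that moves outwards after its `n`-th
refreshment gets to the boundary of the universe. -/
def escapeTime (w r : ℝ) (f u : ℕ → ℝ) (n : ℕ) : ℝ :=
  (∑ k ∈ Finset.range (n + 1), f k) / r + (w / 2 - |u n|)

open Classical in
/-- The coupling of one coordinate of the sticky process with one coordinate of the latent
process. -/
structure CoordCoupled (w r : ℝ) (f u : ℕ → ℝ) (N m : ℕ) (ρ μ a b : ℝ) (v out : Bool) : Prop where
  -- Here `N` and `m` count refreshments and marks, `ρ` and `μ` are the times left on their clocks,
  -- and `a` and `b` are the sticky and the latent position relative to the velocity. The time spent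
  -- in the universe so far is `(∑ k ∈ Finset.range (N + 1), f k) / r - ρ`, and the next mark is due
  -- at the escape with index `m`.
  mark : μ = escapeTime w r f u (Nat.nth (Escapes w r f u) m) -
    (∑ k ∈ Finset.range (N + 1), f k) / r + ρ
  -- Outside, all escapes up to now have been used. The bound `ρ ≤ w` is kept for the next visit: a
  -- coordinate that returns will be refreshed before it can cross the universe.
  outside : out = true → w / 2 ≤ b ∧ a = b - w / 2 ∧ 0 < ρ ∧ ρ ≤ w ∧
    m = Nat.count (Escapes w r f u) N
  -- The remaining distance to the exit is `w / 2 - b`. Either the next refreshment comes in time,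
  -- or the last refreshment was an escape whose mark is still due. Before the universe is entered,
  -- that is for `w ≤ w / 2 - b`, the refreshment clock has time left.
  inside : out = false → b ≤ w / 2 ∧ a = min (b + w / 2) 0 ∧
    ((ρ ≤ w / 2 - b ∧ ρ ≤ w ∧ m = Nat.count (Escapes w r f u) N ∧ (w ≤ w / 2 - b → 0 < ρ)) ∨
      ∃ n, N = n + 1 ∧ Escapes w r f u n ∧ m = Nat.count (Escapes w r f u) n ∧
        w / 2 - b = w / 2 - boolSign v * u n - (f N / r - ρ) ∧ w / 2 - b ≤ w)

namespace CoordCoupled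

variable {w r : ℝ} {f u : ℕ → ℝ} {N m : ℕ} {ρ μ a b : ℝ} {v out : Bool}

-- If all escapes so far are used, the next one belongs to a refreshment still to come, and it takes
-- place strictly after that refreshment.
open Classical in
lemma lt_mark (h : CoordCoupled w r f u N m ρ μ a b v out) (hr : 0 < r) (hf : ∀ k, 0 ≤ f k)
    (hu : ∀ k, |u k| < w / 2) (hinf : {n | Escapes w r f u n}.Infinite)
    (hm : m = Nat.count (Escapes w r f u) N) : ρ < μ := by
  have hle : N ≤ Nat.nth (Escapes w r f u) m := by rw [hm]; exact Nat.le_nth_count hinf N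
  have hs : ∑ k ∈ Finset.range (N + 1), f k ≤
      ∑ k ∈ Finset.range (Nat.nth (Escapes w r f u) m + 1), f k :=
    Finset.sum_le_sum_of_subset_of_nonneg (Finset.range_subset_range.2 (by omega))
      fun k _ _ => hf k
  have hs' := div_le_div_of_nonneg_right hs hr.le
  have := hu (Nat.nth (Escapes w r f u) m)
  rw [h.mark, escapeTime]
  linarith

-- A pending escape is due `w / 2 - |u n|` after its refreshment, since which the time `f N / r - ρ`
-- has passed.
open Classical in
lemma mark_eq (h : CoordCoupled w r f u N m ρ μ a b v out) {n : ℕ} (hN : N = n + 1)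
    (hn : Escapes w r f u n) (hm : m = Nat.count (Escapes w r f u) n) :
    μ = w / 2 - |u n| - f N / r + ρ := by
  have : Nat.nth (Escapes w r f u) m = n := by rw [hm]; exact Nat.nth_count hn
  rw [h.mark, escapeTime, this, hN, Finset.sum_range_succ _ (n + 1), add_div]
  ring

/-- Both clocks lose the time `c` that is spent stuck, so their difference is kept. If the universe
is only being approached, part of the motion leaves the clocks untouched; once inside, distance and
clocks decrease alike. -/
lemma flow (h : CoordCoupled w r f u N m ρ μ a b v out) {s c : ℝ} (hs : 0 ≤ s)
    (hE : out = false → s ≤ w / 2 - b) (hw : 0 < w)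
    (hc : c = s - if out then s else min s (max (-a) 0)) :
    CoordCoupled w r f u N m (ρ - c) (μ - c) (if out then a + s else max a (min (a + s) 0))
      (b + s) v out := by
  refine ⟨by rw [h.mark]; ring, fun ho => ?_, fun ho => ?_⟩
  · obtain ⟨h1, h2, h3, h4, h5⟩ := h.outside ho
    simp only [ho, if_true, sub_self] at hc ⊢
    subst hc
    refine ⟨by linarith, by linarith, by linarith, by linarith, h5⟩
  · obtain ⟨h1, h2, h3⟩ := h.inside ho
    simp only [ho, Bool.false_eq_true, if_false] at hc ⊢
    have hE := hE ho
    refine ⟨by linarith, ?_, ?_⟩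
    · rw [h2]
      rcases le_total (b + w / 2) 0 with hb | hb
      · rw [min_eq_left hb, max_eq_right (le_min (by linarith) hb)]
        congr 1; ring
      · rw [min_eq_right hb, min_eq_right (by linarith), max_self, min_eq_right (by linarith)]
    · rcases h3 with ⟨k1, k2, k3, k4⟩ | ⟨n, k1, k2, k3, k4, k5⟩
      · refine Or.inl ⟨?_, ?_, k3, fun h => ?_⟩
        · rcases le_total (b + w / 2) 0 with hb | hb
          · rw [min_eq_left hb] at h2
            rw [h2, max_eq_left (by linarith)] at hc
            rcases le_total s (-(b + w / 2)) with hsb | hsb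
            · rw [min_eq_left hsb] at hc; linarith
            · rw [min_eq_right hsb] at hc; linarith
          · rw [min_eq_right hb] at h2
            rw [h2] at hc
            simp only [neg_zero, max_self, min_eq_right hs] at hc; linarith
        · have := min_le_left s (max (-a) 0); linarith
        · rw [min_eq_left (by linarith)] at h2
          rw [h2, max_eq_left (by linarith), min_eq_left (by linarith)] at hc
          have := k4 (by linarith)
          linarith
      · refine Or.inr ⟨n, k1, k2, k3, ?_, by linarith⟩
        rw [min_eq_right (by linarith)] at h2
        rw [h2] at hc
        simp only [neg_zero, max_self, min_eq_right hs] at hc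
        linarith

-- Bounces occur outside the universe only: `a < 0` means `b < -w / 2`, which rules out a pending
-- escape. In the reverse direction the coordinate has at least the distance `w` to the far end, and
-- `ρ ≤ w`.
open Classical in
lemma bounce (h : CoordCoupled w r f u N m ρ μ a b v out) (hw : 0 < w)
    (hst : out = false → a < 0) : CoordCoupled w r f u N m ρ μ (-a) (-b) (!v) (!out) := by
  refine ⟨h.mark, fun ho => ?_, fun ho => ?_⟩
  · have ho : out = false := by simpa using ho
    obtain ⟨h1, h2, h3⟩ := h.inside ho
    have ha := hst ho
    have hb : b + w / 2 < 0 := by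
      by_contra hc
      rw [h2, min_eq_right (not_lt.1 hc)] at ha
      exact lt_irrefl _ ha
    rw [min_eq_left hb.le] at h2
    rcases h3 with ⟨k1, k2, k3, k4⟩ | ⟨n, k1, k2, k3, k4, k5⟩
    · exact ⟨by linarith, by linarith, k4 (by linarith), k2, k3⟩
    · linarith
  · have ho : out = true := by simpa using ho
    obtain ⟨h1, h2, h3, h4, h5⟩ := h.outside ho
    refine ⟨by linarith, ?_, Or.inl ⟨by linarith, h4, h5, fun _ => h3⟩⟩
    rw [min_eq_left (by linarith)]; linarith

-- A pending escape would have been due before the refreshment, so none is pending. The new position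
-- either is an escape, whose mark becomes pending, or lies so far from the ends that the next
-- refreshment comes in time.
open Classical in
lemma refresh (h : CoordCoupled w r f u N m ρ μ a b v out) (hr : 0 < r) (hf : ∀ k, 0 < f k)
    (hu : ∀ k, |u k| < w / 2) (hρ : ρ = 0) (hμ : 0 ≤ μ) (hl : f (N + 1) / r ≤ w / 2) :
    CoordCoupled w r f u (N + 1) m (f (N + 1) / r) μ a (boolSign v * u N) v out := by
  have hfr : ∀ k, 0 < f k / r := fun k => div_pos (hf k) hr
  have habs : |boolSign v * u N| < w / 2 := by rw [abs_mul, abs_boolSign, one_mul]; exact hu N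
  refine ⟨?_, fun ho => ?_, fun ho => ?_⟩
  · rw [h.mark, Finset.sum_range_succ _ (N + 1), add_div, hρ]; ring
  · obtain ⟨_, _, h3, _⟩ := h.outside ho
    exact absurd hρ h3.ne'
  · obtain ⟨h1, h2, h3⟩ := h.inside ho
    rw [abs_lt] at habs
    rcases h3 with ⟨k1, k2, k3, k4⟩ | ⟨n, k1, k2, k3, k4, k5⟩
    · have hb : 0 ≤ b + w / 2 := by
        by_contra hc
        exact (k4 (by linarith)).ne' hρ
      refine ⟨habs.2.le, by rw [h2, min_eq_right hb, min_eq_right (by linarith)], ?_⟩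
      by_cases hN : Escapes w r f u N
      · exact Or.inr ⟨N, rfl, hN, k3, by ring, by linarith⟩
      · refine Or.inl ⟨?_, by linarith, ?_, fun _ => hfr _⟩
        · have h4 : f (N + 1) / r ≤ w / 2 - |u N| := not_lt.1 hN
          have h5 := le_abs_self (boolSign v * u N)
          rw [abs_mul, abs_boolSign, one_mul] at h5
          linarith
        · rw [Nat.count_succ, if_neg hN, add_zero, k3]
    · have := h.mark_eq k1 k2 k3
      have k6 : w / 2 - |u n| < f N / r := by rw [k1]; exact k2
      linarith

-- By `lt_mark` the clock can ring only for a pending escape, which also excludes `N = 0`. If the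
-- sign agrees with the velocity, the coordinate is at the exit at this very instant. Otherwise it
-- still has the distance `2 * |u n|` to go, and the refreshment is due within `|u n|` because the
-- current gap is at most `w / 2`.
open Classical in
lemma release (h : CoordCoupled w r f u N m ρ μ a b v out) (hr : 0 < r) (hf : ∀ k, 0 < f k)
    (hu : ∀ k, |u k| < w / 2) (hinf : {n | Escapes w r f u n}.Infinite) {σ : ℝ}
    (hσ : σ = 1 ∨ σ = -1) (hσu : σ * |u (Nat.nth (Escapes w r f u) m)| =
      u (Nat.nth (Escapes w r f u) m))
    (hρ : 0 ≤ ρ) (hρN : ρ ≤ f N / r) (hμ : μ = 0) (hl : f N / r ≤ w / 2 ∨ N = 0) :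
    CoordCoupled w r f u N (m + 1) ρ (escapeTime w r f u (Nat.nth (Escapes w r f u) (m + 1)) -
      escapeTime w r f u (Nat.nth (Escapes w r f u) m)) a b v
      (if σ = boolSign v then true else out) := by
  have hnn := fun k => (hf k).le
  have key : out = false ∧ ∃ n, N = n + 1 ∧ Escapes w r f u n ∧
      m = Nat.count (Escapes w r f u) n ∧
        w / 2 - b = w / 2 - boolSign v * u n - (f N / r - ρ) ∧ w / 2 - b ≤ w := by
    cases ho : out
    · obtain ⟨h1, h2, h3⟩ := h.inside ho
      rcases h3 with ⟨k1, k2, k3, k4⟩ | h3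
      · have := h.lt_mark hr hnn hu hinf k3
        linarith
      · exact ⟨rfl, h3⟩
    · have := h.lt_mark hr hnn hu hinf (h.outside ho).2.2.2.2
      linarith
  obtain ⟨ho, n, k1, k2, k3, k4, k5⟩ := key
  obtain ⟨h1, h2, -⟩ := h.inside ho
  have hmark := h.mark
  have hμ' := h.mark_eq k1 k2 k3
  have hn : Nat.nth (Escapes w r f u) m = n := by rw [k3]; exact Nat.nth_count k2
  have k6 : w / 2 - |u n| < f N / r := by rw [k1]; exact k2
  have hl' : f N / r ≤ w / 2 := hl.resolve_right (by omega)
  have hcount : m + 1 = Nat.count (Escapes w r f u) N := by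
    rw [k1, Nat.count_succ, if_pos k2, k3]
  have ha0 : a = 0 := by rw [h2, min_eq_right (by linarith)]
  rw [hn] at hσu
  have hun := hu n
  have habs0 := abs_nonneg (u n)
  have hvv := boolSign_mul_self v
  refine ⟨by rw [hμ] at hmark; linarith, fun hout => ?_, fun hout => ?_⟩
  · have hσv : σ = boolSign v := by
      by_contra hc
      rw [if_neg hc, ho] at hout
      simp at hout
    have hsu : boolSign v * u n = |u n| := by
      rw [← hσu, ← mul_assoc, hσv, hvv, one_mul, abs_mul, abs_boolSign, one_mul, abs_abs]
    refine ⟨by linarith, by linarith, by linarith, by linarith, hcount⟩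
  · have hσv : σ ≠ boolSign v := by
      intro hc
      rw [if_pos hc] at hout
      simp at hout
    have hσv' : boolSign v = -σ := by
      rcases hσ with h | h <;> rw [h] at hσv ⊢ <;> cases v <;> simp [boolSign] at hσv ⊢
    have hsu : boolSign v * u n = -|u n| := by
      rw [hσv', neg_mul, neg_inj]
      calc σ * u n = σ * (σ * |u n|) := by rw [hσu]
        _ = |u n| := by rcases hσ with h | h <;> rw [h] <;> ring
    refine ⟨h1, h2, Or.inl ⟨by linarith, by linarith, hcount, fun _ => by linarith⟩⟩

end CoordCoupled

namespace ClockSystem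

variable {Q Z Z' : Type} {S : ClockSystem Q Z} {S' : ClockSystem Q Z'} [Fintype Q] [DecidableEq Q]
  [Nonempty Q]

/-- The next event depends only on the hazards up to its own waiting time, so agreement up to the
waiting time of one system suffices. -/
lemma Regular.wait_first_congr (hS : S.Regular) (hS' : S'.Regular) {z : Z} {z' : Z'} {a : Q → ℝ}
    (h : ∀ q t, 0 ≤ t → t ≤ S.wait z a → S.hazard q z t = S'.hazard q z' t) :
    S'.wait z' a = S.wait z a ∧ S'.first z' a = S.first z a := by
  have hw : S'.wait z' a = S.wait z a := by
    apply le_antisymm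
    · obtain ⟨h0, q, hq⟩ := hS.wait_mem z a
      exact csInf_le (ringTimes_bddBelow z' a) ⟨h0, q, by rwa [← h q _ h0 le_rfl]⟩
    · by_contra! hc
      obtain ⟨h0, q, hq⟩ := hS'.wait_mem z' a
      change 0 ≤ S'.wait z' a at h0
      change a q ≤ S'.hazard q z' (S'.wait z' a) at hq
      rw [← h q _ h0 hc.le] at hq
      exact absurd hq (not_le.2 (lt_of_lt_wait h0 hc q))
  refine ⟨hw, (hS'.first_eq_iff z' a _).2 ?_⟩
  have h1 := hS.first_spec z a
  have h2 : ∀ q, S'.hazard q z' (S'.wait z' a) = S.hazard q z (S.wait z a) := fun q => by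
    rw [hw, h q _ (wait_nonneg _ _) le_rfl]
  refine ⟨by rw [h2]; exact h1.1, fun p hp => h1.2 p (by rwa [h2] at hp)⟩

end ClockSystem

section coupling

variable {d : ℕ} {M : SpikeSlab d} {r : ℝ}

/-- The geometric relation between the sticky state and the latent state. -/
def Aligned (w : ℝ) (z : StickyState d) (z' : LatentState d) : Prop :=
  ∀ i, (z i).2.1 = (z' i).2 ∧
    ((z i).2.2 = true → w / 2 ≤ (z' i).1 ∧ (z i).1 = (z' i).1 - w / 2) ∧
    ((z i).2.2 = false → (z' i).1 ≤ w / 2 ∧ (z i).1 = min ((z' i).1 + w / 2) 0)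

namespace Aligned

variable {z : StickyState d} {z' : LatentState d}

lemma flow {w : ℝ} (h : Aligned w z z') {s : ℝ} (hs : 0 ≤ s)
    (hE : ∀ i, (z i).2.2 = false → s ≤ w / 2 - (z' i).1) :
    Aligned w (StickyState.flow s z) (latentFlow s z') := by
  intro i
  obtain ⟨h1, h2, h3⟩ := h i
  refine ⟨h1, fun ho => ?_, fun ho => ?_⟩
  · obtain ⟨k1, k2⟩ := h2 ho
    rw [flow_mode] at ho
    simp only [StickyState.flow, ho, if_true, latentFlow]
    constructor <;> linarith
  · obtain ⟨k1, k2⟩ := h3 ho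
    rw [flow_mode] at ho
    simp only [StickyState.flow, ho, Bool.false_eq_true, if_false, latentFlow]
    refine ⟨by linarith [hE i ho], ?_⟩
    rcases le_total ((z' i).1 + w / 2) 0 with hb | hb
    · rw [min_eq_left hb] at k2
      rw [k2, max_eq_right (le_min (by linarith) hb)]
      congr 1; ring
    · rw [min_eq_right hb] at k2
      rw [k2, min_eq_right (by linarith), max_self, min_eq_right (by linarith)]

lemma velocity_eq {w : ℝ} (h : Aligned w z z') : velocity z = latentVelocity z' := by
  ext i; simp only [velocity, latentVelocity, (h i).1]

lemma position_eq (h : Aligned M.width z z') : position z = M.collapse (latentPosition z') := by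
  ext i
  obtain ⟨h1, h2, h3⟩ := h i
  have hv : boolSign (z' i).2 = 1 ∨ boolSign (z' i).2 = -1 := by
    cases (z' i).2 <;> simp [boolSign]
  obtain ⟨k1, k2, k3⟩ := M.mul_collapse₁ (y := latentPosition z' i) hv
  have hy : boolSign (z' i).2 * latentPosition z' i = (z' i).1 := by
    rw [latentPosition, ← mul_assoc, boolSign_mul_self, one_mul]
  have hc : M.collapse₁ (latentPosition z' i) =
      boolSign (z' i).2 * (boolSign (z' i).2 * M.collapse₁ (latentPosition z' i)) := by
    rw [← mul_assoc, boolSign_mul_self, one_mul]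
  rw [SpikeSlab.collapse, hc, position, h1]
  congr 1
  rw [abs_latentPosition, abs_le] at k1
  rw [hy] at k2 k3
  have hw := M.width_pos
  cases ho : (z i).2.2
  · obtain ⟨j1, j2⟩ := h3 ho
    rw [j2]
    rcases lt_or_ge (z' i).1 (-(M.width / 2)) with hb | hb
    · rw [k3 hb, min_eq_left (by linarith)]
    · rw [k1 ⟨hb, j1⟩, min_eq_right (by linarith)]
  · obtain ⟨j1, j2⟩ := h2 ho
    rw [j2]
    rcases j1.eq_or_lt with hb | hb
    · rw [k1 ⟨by linarith, hb.ge⟩, hb, sub_self]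
    · rw [k2 hb]

/-- The excluded instant is the entrance into the universe, at which the sticky coordinate is
already stuck while the latent one is not yet in the open interval. -/
lemma isStuck_flow_iff (h : Aligned M.width z z') {i : Fin d} {s : ℝ} (hs : 0 ≤ s)
    (hE : (z i).2.2 = false → s < M.width / 2 - (z' i).1) (hne : s ≠ -(M.width / 2) - (z' i).1) :
    IsStuck (StickyState.flow s z) i ↔ |(z' i).1 + s| < M.width / 2 := by
  obtain ⟨h1, h2, h3⟩ := h i
  rw [StickyState.isStuck_flow_iff z i hs, abs_lt]
  cases ho : (z i).2.2
  · obtain ⟨j1, j2⟩ := h3 ho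
    have hE := hE ho
    simp only [true_and]
    rw [j2]
    rcases le_total ((z' i).1 + M.width / 2) 0 with hb | hb
    · rw [min_eq_left hb]
      constructor
      · intro h
        exact ⟨lt_of_le_of_ne (by linarith) (fun h => hne (by linarith)), by linarith⟩
      · intro h; linarith [h.1]
    · rw [min_eq_right hb]
      refine iff_of_true (by linarith) ⟨lt_of_le_of_ne (by linarith) (fun h => hne (by linarith)),
        by linarith⟩
  · obtain ⟨j1, j2⟩ := h2 ho
    simp only [Bool.true_eq_false, false_and, false_iff, not_and, not_lt]
    intro; linarith

/-- Up to the first possible exit the motions stay aligned, so at almost every time the rates agree: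
collapsing gives the sticky position, and being in the universe means being stuck. -/
lemma hazard_eq (h : Aligned M.width z z') (hM : ContDiff ℝ 2 M.densityPart) {t : ℝ} (ht : 0 ≤ t)
    (hE : ∀ i, (z i).2.2 = false → t ≤ M.width / 2 - (z' i).1) (q : Clock d) :
    (stickySystem M r).hazard q z t = (latentSystem M r).hazard q z' t := by
  classical
  have key : ∀ i, ∀ᵐ s ∂volume, s ∈ uIoc 0 t →
      0 ≤ s ∧ s ≤ t ∧ (IsStuck (StickyState.flow s z) i ↔ |(z' i).1 + s| < M.width / 2) := by
    intro i
    have h1 : ∀ᵐ s ∂(volume : Measure ℝ), s ≠ t := by simp [ae_iff, measure_singleton]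
    have h2 : ∀ᵐ s ∂(volume : Measure ℝ), s ≠ -(M.width / 2) - (z' i).1 := by
      simp [ae_iff, measure_singleton]
    filter_upwards [h1, h2] with s h1 h2 hs
    rw [uIoc_of_le ht] at hs
    exact ⟨hs.1.le, hs.2, h.isStuck_flow_iff hs.1.le
      (fun ho => (lt_of_le_of_ne hs.2 h1).trans_le (hE i ho)) h2⟩
  rcases q with _ | i | i | i
  · rw [stickySystem_tick, latentSystem_tick]
  · rw [(latentSystem_bounce hM i z' ht).2]
    refine intervalIntegral.integral_congr_ae ?_
    filter_upwards [key i] with s hs hst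
    obtain ⟨h0, h1, h2⟩ := hs hst
    have hal := h.flow h0 (fun j hj => h1.trans (hE j hj))
    refine if_congr h2 rfl ?_
    rw [outerRate]
    change bounceRate _ i (position (StickyState.flow s z)) (velocity (StickyState.flow s z)) = _
    rw [hal.position_eq, hal.velocity_eq]
    rfl
  · rw [latentSystem_mark]
    refine intervalIntegral.integral_congr_ae ?_
    filter_upwards [key i] with s hs hst
    exact if_congr (hs hst).2.2 rfl rfl
  · rw [latentSystem_refresh]
    refine intervalIntegral.integral_congr_ae ?_
    filter_upwards [key i] with s hs hst
    exact if_congr (hs hst).2.2 rfl rfl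

end Aligned

open Classical in
/-- The relation between the gaps and marks of a sticky process and of a latent process, by which
the marks of the sticky process are the escape times of the latent process. -/
structure IsCoupling (M : SpikeSlab d) (r : ℝ) (g mk mk' : Clock d → ℕ → ℝ) : Prop where
  gap_pos : ∀ q k, 0 < g q k
  abs_refresh_lt : ∀ i k, |mk' (.refresh i) k| < M.width / 2
  infinite : ∀ i, {n | Escapes M.width r (g (.refresh i)) (mk' (.refresh i)) n}.Infinite
  mark_zero : ∀ i, g (.mark i) 0 = escapeTime M.width r (g (.refresh i)) (mk' (.refresh i))
    (Nat.nth (Escapes M.width r (g (.refresh i)) (mk' (.refresh i))) 0)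
  mark_succ : ∀ i m, g (.mark i) (m + 1) =
    escapeTime M.width r (g (.refresh i)) (mk' (.refresh i))
      (Nat.nth (Escapes M.width r (g (.refresh i)) (mk' (.refresh i))) (m + 1)) -
    escapeTime M.width r (g (.refresh i)) (mk' (.refresh i))
      (Nat.nth (Escapes M.width r (g (.refresh i)) (mk' (.refresh i))) m)
  sign : ∀ i m, mk (.mark i) m = 1 ∨ mk (.mark i) m = -1
  sign_mul : ∀ i m, mk (.mark i) m * |mk' (.refresh i)
      (Nat.nth (Escapes M.width r (g (.refresh i)) (mk' (.refresh i))) m)| =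
    mk' (.refresh i) (Nat.nth (Escapes M.width r (g (.refresh i)) (mk' (.refresh i))) m)

/-- The coupling of a state of the sticky process with a state of the latent process. -/
structure Coupled (M : SpikeSlab d) (r : ℝ) (g mk' : Clock d → ℕ → ℝ)
    (s : ClockState (Clock d) (StickyState d)) (s' : ClockState (Clock d) (LatentState d)) :
    Prop where
  time : s'.time = s.time
  resid : s'.resid = s.resid
  count : s'.count = s.count
  velocity : ∀ i, (s.pos i).2.1 = (s'.pos i).2
  coord : ∀ i, CoordCoupled M.width r (g (.refresh i)) (mk' (.refresh i)) (s.count (.refresh i))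
    (s.count (.mark i)) (s.resid (.refresh i) / r) (s.resid (.mark i)) (s.pos i).1 (s'.pos i).1
    (s.pos i).2.1 (s.pos i).2.2

namespace Coupled

variable {g mk mk' : Clock d → ℕ → ℝ} {s : ClockState (Clock d) (StickyState d)}
  {s' : ClockState (Clock d) (LatentState d)}

lemma aligned (h : Coupled M r g mk' s s') : Aligned M.width s.pos s'.pos := fun i =>
  ⟨h.velocity i, fun ho => ⟨((h.coord i).outside ho).1, ((h.coord i).outside ho).2.1⟩,
    fun ho => ⟨((h.coord i).inside ho).1, ((h.coord i).inside ho).2.1⟩⟩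

/-- Before a coordinate could reach the exit, its refreshment clock rings, or else the mark of a
pending escape, which is due in time because `boolSign v * u n ≤ |u n|`. Hence the flows may be
compared over the whole waiting time. -/
lemma wait_le (h : Coupled M r g mk' s s') (hM : ContDiff ℝ 2 M.densityPart) (hr : 0 < r)
    (i : Fin d) (ho : (s.pos i).2.2 = false) :
    (stickySystem M r).wait s.pos s.resid ≤ M.width / 2 - (s'.pos i).1 := by
  have hS := stickySystem_regular (M := M) (r := r) hM hr.le
  obtain ⟨h1, h2, h3⟩ := (h.coord i).inside ho
  have hE : 0 ≤ M.width / 2 - (s'.pos i).1 := by linarith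
  have hwidth := M.width_pos
  rw [hS.wait_le_iff _ _ hE]
  rcases h3 with ⟨k1, k2, k3, k4⟩ | ⟨n, k1, k2, k3, k4, k5⟩
  · refine ⟨.refresh i, ?_⟩
    rw [(stickySystem_refresh i _ hE).2, ← div_le_iff₀' hr]
    simp only [freeTime, ho, Bool.false_eq_true, if_false]
    rcases le_total ((s'.pos i).1 + M.width / 2) 0 with hb | hb
    · rw [min_eq_left hb] at h2
      rw [h2, max_eq_left (by linarith), min_eq_right (by linarith)]
      linarith
    · rw [min_eq_right hb] at h2
      rw [h2, neg_zero, max_self, min_eq_right hE]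
      linarith
  · refine ⟨.mark i, ?_⟩
    rw [(stickySystem_mark i _ hE).2]
    simp only [freeTime, ho, Bool.false_eq_true, if_false]
    rw [min_eq_right (by linarith)] at h2
    rw [h2, neg_zero, max_self, min_eq_right hE, (h.coord i).mark_eq k1 k2 k3]
    have h5 := le_abs_self (boolSign (s.pos i).2.1 * mk' (.refresh i) n)
    rw [abs_mul, abs_boolSign, one_mul] at h5
    linarith

lemma wait_first_eq (h : Coupled M r g mk' s s') (hM : ContDiff ℝ 2 M.densityPart) (hr : 0 < r) :
    (latentSystem M r).wait s'.pos s'.resid = (stickySystem M r).wait s.pos s.resid ∧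
    (latentSystem M r).first s'.pos s'.resid = (stickySystem M r).first s.pos s.resid := by
  rw [h.resid]
  exact (stickySystem_regular hM hr.le).wait_first_congr (latentSystem_regular hM hr.le)
    fun q t h0 ht => h.aligned.hazard_eq hM h0
      (fun i ho => ht.trans (h.wait_le hM hr i ho)) q

/-- Both systems wait for the same time and the same clock rings, so it remains to follow each
coordinate, by the flow and then by the transition that belongs to the event. -/
lemma step (h : Coupled M r g mk' s s') (hc : IsCoupling M r g mk mk')
    (hM : ContDiff ℝ 2 M.densityPart) (hr : 0 < r) (h0 : ∀ q, 0 ≤ s.resid q)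
    (hres : ∀ i, s.resid (.refresh i) ≤ g (.refresh i) (s.count (.refresh i)))
    (hl : ∀ i k, k + 1 ≤ ((stickySystem M r).step g mk s).count (.refresh i) →
      g (.refresh i) (k + 1) / r ≤ M.width / 2)
    (hexo : ∀ i, (s.pos i).2.2 = false → s.resid (.bounce i) ≠
      (stickySystem M r).hazard (.bounce i) s.pos (hitTime i s.pos)) :
    Coupled M r g mk' ((stickySystem M r).step g mk s) ((latentSystem M r).step g mk' s') := by
  obtain ⟨hw, hf⟩ := h.wait_first_eq hM hr
  have hS := stickySystem_regular (M := M) (r := r) hM hr.le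
  have hwait := h.wait_le hM hr
  have hle := hS.hazard_wait_le s.pos s.resid h0
  have hfst := hS.hazard_first s.pos s.resid h0
  have hW := ClockSystem.wait_nonneg (S := stickySystem M r) s.pos s.resid
  have hhaz : ∀ q, (latentSystem M r).hazard q s'.pos ((stickySystem M r).wait s.pos s.resid) =
      (stickySystem M r).hazard q s.pos ((stickySystem M r).wait s.pos s.resid) := fun q =>
    (h.aligned.hazard_eq hM hW hwait q).symm
  have hcount : ∀ q, ((stickySystem M r).step g mk s).count q = s.count q +
      if q = (stickySystem M r).first s.pos s.resid then 1 else 0 := fun _ => rfl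
  have hresid : ∀ q, ((stickySystem M r).step g mk s).resid q = s.resid q -
      (stickySystem M r).hazard q s.pos ((stickySystem M r).wait s.pos s.resid) +
      if q = (stickySystem M r).first s.pos s.resid then g q (s.count q + 1) else 0 := fun _ => rfl
  have hpos : ((stickySystem M r).step g mk s).pos = (stickySystem M r).jump
      ((stickySystem M r).first s.pos s.resid) (mk ((stickySystem M r).first s.pos s.resid)
        (s.count ((stickySystem M r).first s.pos s.resid)))
      (StickyState.flow ((stickySystem M r).wait s.pos s.resid) s.pos) := rfl
  have hpos' : ((latentSystem M r).step g mk' s').pos = (latentSystem M r).jump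
      ((stickySystem M r).first s.pos s.resid) (mk' ((stickySystem M r).first s.pos s.resid)
        (s.count ((stickySystem M r).first s.pos s.resid)))
      (latentFlow ((stickySystem M r).wait s.pos s.resid) s'.pos) := by
    rw [← hw, ← hf, ← h.count]; rfl
  set W := (stickySystem M r).wait s.pos s.resid with hWdef
  set q := (stickySystem M r).first s.pos s.resid with hqdef
  have hflow : ∀ i, CoordCoupled M.width r (g (.refresh i)) (mk' (.refresh i))
      (s.count (.refresh i)) (s.count (.mark i))
      ((s.resid (.refresh i) - (stickySystem M r).hazard (.refresh i) s.pos W) / r)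
      (s.resid (.mark i) - (stickySystem M r).hazard (.mark i) s.pos W)
      (StickyState.flow W s.pos i).1 (latentFlow W s'.pos i).1
      (StickyState.flow W s.pos i).2.1 (StickyState.flow W s.pos i).2.2 := by
    intro i
    have := (h.coord i).flow hW (fun ho => hwait i ho) M.width_pos
      (c := W - freeTime i s.pos W) rfl
    rw [(stickySystem_refresh i s.pos hW).2, (stickySystem_mark i s.pos hW).2, sub_div,
      mul_div_cancel_left₀ _ hr.ne']
    exact this
  have hrn : ∀ i, 0 ≤ (s.resid (.refresh i) -
      (stickySystem M r).hazard (.refresh i) s.pos W) / r := fun i =>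
    div_nonneg (sub_nonneg.2 (hle _)) hr.le
  refine ⟨?_, ?_, ?_, fun i => ?_, fun i => ?_⟩
  · change s'.time + (latentSystem M r).wait s'.pos s'.resid = s.time + W
    rw [hw, h.time]
  · ext p
    change s'.resid p - (latentSystem M r).hazard p s'.pos _ +
      (if p = (latentSystem M r).first s'.pos s'.resid then g p (s'.count p + 1) else 0) = _
    rw [hresid, hw, hf, h.resid, h.count, hhaz]
  · ext p
    change s'.count p + (if p = (latentSystem M r).first s'.pos s'.resid then 1 else 0) = _
    rw [hcount, hf, h.count]
  · have hv : (StickyState.flow W s.pos i).2.1 = (latentFlow W s'.pos i).2 := h.velocity i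
    rw [hpos, hpos']
    generalize StickyState.flow W s.pos = z at hv
    generalize latentFlow W s'.pos = z' at hv
    rcases q with _ | j | j | j <;> simp only [stickySystem, latentSystem]
    · exact hv
    · by_cases hj : i = j
      · subst hj; simp [hv]
      · simpa [hj] using hv
    · split_ifs
      · by_cases hj : i = j
        · subst hj; simpa using hv
        · simpa [hj] using hv
      · exact hv
    · by_cases hj : i = j
      · subst hj; simpa using hv
      · simpa [hj] using hv
  · have hfl := hflow i
    have hvel : (StickyState.flow W s.pos i).2.1 = (latentFlow W s'.pos i).2 := h.velocity i
    by_cases hb : q = .bounce i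
    -- A bounce due while the coordinate is stuck would have been due at the hitting time, contrary
    -- to `hexo`.
    · have hst : (StickyState.flow W s.pos i).2.2 = false → (StickyState.flow W s.pos i).1 < 0 := by
        intro ho
        by_contra hc
        have := hazard_bounce_of_isStuck (r := r) hM hW (⟨ho, not_lt.1 hc⟩ : IsStuck _ i)
        rw [hb] at hfst
        exact hexo i ho (by rw [← this, ← hfst])
      have := hfl.bounce M.width_pos hst
      rw [hcount, hcount, hresid, hresid, hpos, hpos', hb]
      simpa [stickySystem, latentSystem] using this
    by_cases hm : q = .mark i
    · have hμ : s.resid (.mark i) - (stickySystem M r).hazard (.mark i) s.pos W = 0 := by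
        rw [hm] at hfst; rw [hfst, sub_self]
      have := hfl.release hr (fun k => hc.gap_pos _ k) (hc.abs_refresh_lt i) (hc.infinite i)
        (hc.sign i _) (hc.sign_mul i _) (hrn i) ?_ hμ ?_
      · rw [hcount, hcount, hresid, hresid, hpos, hpos', hm]
        simp only [if_true, reduceCtorEq, if_false, add_zero]
        rw [hμ, zero_add, hc.mark_succ]
        convert this using 1 <;> simp only [stickySystem, latentSystem]
        · split_ifs <;> simp
        · split_ifs <;> simp
        · by_cases hv : mk (.mark i) (s.count (.mark i)) = boolSign (StickyState.flow W s.pos i).2.1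
          · rw [if_pos hv, if_pos (by exact hv)]; simp
          · rw [if_neg hv, if_neg (by exact hv)]
      · refine div_le_div_of_nonneg_right ?_ hr.le
        linarith [hres i, hS.hazard_nonneg (.refresh i) s.pos hW]
      · rcases hN : s.count (.refresh i) with _ | k
        · exact Or.inr rfl
        · refine Or.inl (hl i k ?_)
          rw [hcount, hN]; omega
    by_cases hrf : q = .refresh i
    · have hρ : (s.resid (.refresh i) - (stickySystem M r).hazard (.refresh i) s.pos W) / r = 0 := by
        rw [hrf] at hfst; rw [hfst, sub_self, zero_div]
      have := hfl.refresh hr (fun k => hc.gap_pos _ k) (hc.abs_refresh_lt i) hρ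
        (sub_nonneg.2 (hle _)) (hl i _ (by rw [hcount, hrf, if_pos rfl]))
      rw [hcount, hcount, hresid, hresid, hpos, hpos', hrf]
      simp only [if_true, reduceCtorEq, if_false, add_zero]
      have hρ' : s.resid (.refresh i) - (stickySystem M r).hazard (.refresh i) s.pos W = 0 := by
        rw [hrf] at hfst; rw [hfst, sub_self]
      rw [hρ', zero_add]
      rw [hvel] at this
      simpa [stickySystem, latentSystem, hvel] using this
    · rw [hcount, hcount, hresid, hresid, hpos, hpos', if_neg (Ne.symm hrf), if_neg (Ne.symm hm),
        if_neg (Ne.symm hrf), if_neg (Ne.symm hm), stickySystem_jump_of_ne hb hm]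
      simp only [add_zero]
      have : (latentSystem M r).jump q (mk' q (s.count q)) (latentFlow W s'.pos) i =
          latentFlow W s'.pos i := by
        rcases q with _ | j | j | j <;> simp only [latentSystem]
        · rw [Function.update_of_ne fun h => hb (by rw [h])]
        · rw [Function.update_of_ne fun h => hrf (by rw [h])]
      rw [this]
      exact hfl

end Coupled

variable {g mk mk' : Clock d → ℕ → ℝ} {y₀ v₀ : Fin d → ℝ}

/-- The first refreshment gap has to be short enough that the coordinate cannot cross the universe,
or what is left of it from the starting point, without a refreshment. -/
lemma coupled_init (hc : IsCoupling M r g mk mk') (hr : 0 < r)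
    (hv₀ : ∀ i, v₀ i = 1 ∨ v₀ i = -1) (h0 : ∀ i, g (.refresh i) 0 / r ≤ M.width)
    (h0' : ∀ i, v₀ i * y₀ i < M.width / 2 →
      g (.refresh i) 0 / r ≤ M.width / 2 - v₀ i * y₀ i) :
    Coupled M r g mk' ((stickySystem M r).run g mk (stickyInit M y₀ v₀) 0)
      ((latentSystem M r).run g mk' (latentInit y₀ v₀) 0) := by
  have hw := M.width_pos
  refine ⟨rfl, rfl, rfl, fun i => rfl, fun i => ?_⟩
  obtain ⟨k1, k2, k3⟩ := M.mul_collapse₁ (y := y₀ i) (hv₀ i)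
  rw [abs_eq_of_sign (hv₀ i), abs_le] at k1
  have hpos : 0 < g (.refresh i) 0 / r := div_pos (hc.gap_pos _ _) hr
  simp only [ClockSystem.run, stickyInit, latentInit]
  refine ⟨by simp [hc.mark_zero], fun ho => ?_, fun ho => ?_⟩
  · have ho : M.width / 2 ≤ v₀ i * y₀ i := by simpa using ho
    refine ⟨ho, ?_, hpos, h0 i, by simp⟩
    rcases ho.eq_or_lt with hb | hb
    · rw [k1 ⟨by linarith, hb.ge⟩, hb, sub_self]
    · rw [k2 hb]
  · have ho : v₀ i * y₀ i < M.width / 2 := by simpa using ho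
    refine ⟨ho.le, ?_, Or.inl ⟨h0' i ho, h0 i, by simp, fun _ => hpos⟩⟩
    rcases lt_or_ge (v₀ i * y₀ i) (-(M.width / 2)) with hb | hb
    · rw [k3 hb, min_eq_left (by linarith)]
    · rw [k1 ⟨hb, ho.le⟩, min_eq_right (by linarith)]

/-- The refreshment clocks never run faster than `r`. Up to a time horizon only finitely many gaps
matter, and their smallness is what has to be assumed. -/
lemma sum_refresh_le (hM : ContDiff ℝ 2 M.densityPart) (hr : 0 ≤ r) (hg : ∀ q k, 0 ≤ g q k)
    {z₀ : StickyState d} (n : ℕ) (i : Fin d) :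
    ∑ k ∈ Finset.range (((stickySystem M r).run g mk z₀ n).count (.refresh i)),
      g (.refresh i) k ≤ r * ((stickySystem M r).run g mk z₀ n).time := by
  have hS := stickySystem_regular (M := M) (r := r) hM hr
  have h1 : ∀ m, ∑ j ∈ Finset.range m, (stickySystem M r).hazard (.refresh i)
      ((stickySystem M r).run g mk z₀ j).pos ((stickySystem M r).wait
        ((stickySystem M r).run g mk z₀ j).pos ((stickySystem M r).run g mk z₀ j).resid) ≤
      r * ((stickySystem M r).run g mk z₀ m).time := by
    intro m
    induction m with
    | zero => simp [ClockSystem.run]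
    | succ m ih =>
      have hw := ClockSystem.wait_nonneg (S := stickySystem M r)
        ((stickySystem M r).run g mk z₀ m).pos ((stickySystem M r).run g mk z₀ m).resid
      rw [Finset.sum_range_succ, (stickySystem_refresh i _ hw).2]
      have h3 := mul_nonneg hr (freeTime_nonneg i ((stickySystem M r).run g mk z₀ m).pos hw)
      change _ ≤ r * (((stickySystem M r).run g mk z₀ m).time + _)
      rw [mul_sub, mul_add]
      linarith
  have h2 := h1 n
  rw [ClockSystem.sum_hazard, Finset.sum_range_succ] at h2
  linarith [(hS.run_resid (mk := mk) (z₀ := z₀) hg n (.refresh i)).2]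

lemma coupled_run (hc : IsCoupling M r g mk mk') (hM : ContDiff ℝ 2 M.densityPart) (hr : 0 < r)
    (hv₀ : ∀ i, v₀ i = 1 ∨ v₀ i = -1) (h0 : ∀ i, g (.refresh i) 0 / r ≤ M.width)
    (h0' : ∀ i, v₀ i * y₀ i < M.width / 2 →
      g (.refresh i) 0 / r ≤ M.width / 2 - v₀ i * y₀ i) {T : ℝ}
    (hl : ∀ i k, ∑ j ∈ Finset.range (k + 1), g (.refresh i) j ≤ r * T →
      g (.refresh i) (k + 1) / r ≤ M.width / 2)
    (hexo : ∀ n i, ((stickySystem M r).run g mk (stickyInit M y₀ v₀) n).time ≤ T →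
      (((stickySystem M r).run g mk (stickyInit M y₀ v₀) n).pos i).2.2 = false →
      ((stickySystem M r).run g mk (stickyInit M y₀ v₀) n).resid (.bounce i) ≠
      (stickySystem M r).hazard (.bounce i) ((stickySystem M r).run g mk (stickyInit M y₀ v₀) n).pos
        (hitTime i ((stickySystem M r).run g mk (stickyInit M y₀ v₀) n).pos))
    (n : ℕ) (hn : ((stickySystem M r).run g mk (stickyInit M y₀ v₀) n).time ≤ T) :
    Coupled M r g mk' ((stickySystem M r).run g mk (stickyInit M y₀ v₀) n)
      ((latentSystem M r).run g mk' (latentInit y₀ v₀) n) := by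
  have hS := stickySystem_regular (M := M) (r := r) hM hr.le
  have hg := fun q k => (hc.gap_pos q k).le
  induction n with
  | zero => exact coupled_init hc hr hv₀ h0 h0'
  | succ n ih =>
    have hn' := (ClockSystem.run_time_mono (S := stickySystem M r) (g := g) (mk := mk)
      (z₀ := stickyInit M y₀ v₀) (Nat.le_succ n)).trans hn
    have hres := hS.run_resid (mk := mk) (z₀ := stickyInit M y₀ v₀) hg n
    refine (ih hn').step hc hM hr (fun q => (hres q).1) (fun i => (hres _).2) (fun i k hk => ?_)
      (fun i => hexo n i hn')
    -- A gap handed out by time `T` begins at a partial sum of at most `r * T`, so `hl` applies to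
    -- it.
    refine hl i k (le_trans ?_ ((sum_refresh_le (mk := mk) (z₀ := stickyInit M y₀ v₀) hM hr.le hg
      (n + 1) i).trans (mul_le_mul_of_nonneg_left hn hr.le)))
    exact Finset.sum_le_sum_of_subset_of_nonneg (Finset.range_subset_range.2 hk)
      fun j _ _ => hg _ j

lemma coupled_path (hc : IsCoupling M r g mk mk') (hM : ContDiff ℝ 2 M.densityPart) (hr : 0 < r)
    {T : ℝ} (htime : Tendsto (fun n =>
      ((stickySystem M r).run g mk (stickyInit M y₀ v₀) n).time) atTop atTop)
    (hcoup : ∀ n, ((stickySystem M r).run g mk (stickyInit M y₀ v₀) n).time ≤ T →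
      Coupled M r g mk' ((stickySystem M r).run g mk (stickyInit M y₀ v₀) n)
      ((latentSystem M r).run g mk' (latentInit y₀ v₀) n)) {t : ℝ} (h0 : 0 ≤ t) (hT : t ≤ T) :
    M.collapse (latentPosition ((latentSystem M r).path g mk' (latentInit y₀ v₀) t)) =
      position ((stickySystem M r).path g mk (stickyInit M y₀ v₀) t) ∧
    latentVelocity ((latentSystem M r).path g mk' (latentInit y₀ v₀) t) =
      velocity ((stickySystem M r).path g mk (stickyInit M y₀ v₀) t) := by
  obtain ⟨n, h1, h2⟩ := ClockSystem.exists_run_index htime h0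
  have h := hcoup n (h1.trans hT)
  have e1 : ((latentSystem M r).run g mk' (latentInit y₀ v₀) (n + 1)).time =
      ((stickySystem M r).run g mk (stickyInit M y₀ v₀) (n + 1)).time := by
    change _ + (latentSystem M r).wait _ _ = _ + (stickySystem M r).wait _ _
    rw [h.time, (h.wait_first_eq hM hr).1]
  rw [ClockSystem.path_eq h1 h2, ClockSystem.path_eq (by rw [h.time]; exact h1)
    (by rw [e1]; exact h2), h.time]
  have hal := h.aligned.flow (sub_nonneg.2 h1) fun i ho => by
    refine le_trans ?_ (h.wait_le hM hr i ho)
    change t < _ + (stickySystem M r).wait _ _ at h2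
    linarith
  exact ⟨hal.position_eq.symm, hal.velocity_eq.symm⟩

end coupling

/-! ### The refreshment clocks of the sticky process have no effect -/

section dummy

variable {d : ℕ} {M : SpikeSlab d} {r : ℝ} {g mk : Clock d → ℕ → ℝ} {z₀ : StickyState d}

lemma stickySystem_hazard_congr {q : Clock d} (hq : ∀ i, q ≠ .refresh i) (z : StickyState d)
    (h : ℝ) : (stickySystem M r).hazard q z h = (stickySystem M 0).hazard q z h := by
  rcases q with _ | i | i | i
  · rfl
  · rfl
  · rfl
  · exact absurd rfl (hq i)

lemma stickySystem_zero_refresh (i : Fin d) (z : StickyState d) (h : ℝ) :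
    (stickySystem M 0).hazard (.refresh i) z h = 0 := by
  simp [ClockSystem.hazard, stickySystem]

/-- A clock of speed zero never uses up its positive amount. -/
lemma stickySystem_zero_first_ne (hM : ContDiff ℝ 2 M.densityPart) (hg : ∀ q k, 0 < g q k)
    (n : ℕ) : ((∀ i, 0 < ((stickySystem M 0).run g mk z₀ n).resid (.refresh i))) ∧
    ∀ i, (stickySystem M 0).first ((stickySystem M 0).run g mk z₀ n).pos
      ((stickySystem M 0).run g mk z₀ n).resid ≠ .refresh i := by
  have hS := stickySystem_regular (M := M) (r := 0) hM le_rfl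
  have hr : ∀ n i, 0 < ((stickySystem M 0).run g mk z₀ n).resid (.refresh i) →
      (stickySystem M 0).first ((stickySystem M 0).run g mk z₀ n).pos
      ((stickySystem M 0).run g mk z₀ n).resid ≠ .refresh i := by
    intro n i h hf
    have := (hS.first_spec ((stickySystem M 0).run g mk z₀ n).pos
      ((stickySystem M 0).run g mk z₀ n).resid).1
    rw [hf, stickySystem_zero_refresh] at this
    linarith
  suffices h : ∀ i, 0 < ((stickySystem M 0).run g mk z₀ n).resid (.refresh i) from
    ⟨h, fun i => hr n i (h i)⟩
  intro i
  induction n with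
  | zero => exact hg _ _
  | succ n ih =>
    simp only [ClockSystem.run_succ, ClockSystem.step]
    rw [stickySystem_zero_refresh, if_neg (hr n i ih).symm]
    linarith

/-- A state of the sticky process whose refreshment clocks run is on the way between two states of
the sticky process whose refreshment clocks do not run. -/
structure Between (M : SpikeSlab d) (s : ClockState (Clock d) (StickyState d)) (h : ℝ)
    (s' : ClockState (Clock d) (StickyState d)) : Prop where
  nonneg : 0 ≤ h
  le : h ≤ (stickySystem M 0).wait s.pos s.resid
  time : s'.time = s.time + h
  pos : s'.pos = StickyState.flow h s.pos
  resid : ∀ q, (∀ i, q ≠ .refresh i) →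
    s'.resid q = s.resid q - (stickySystem M 0).hazard q s.pos h
  count : ∀ q, (∀ i, q ≠ .refresh i) → s'.count q = s.count q

lemma Between.wait_le (hM : ContDiff ℝ 2 M.densityPart) (hr : 0 ≤ r)
    {s s' : ClockState (Clock d) (StickyState d)} {h : ℝ} (hb : Between M s h s')
    (hfirst : ∀ i, (stickySystem M 0).first s.pos s.resid ≠ .refresh i) :
    (stickySystem M r).wait s'.pos s'.resid ≤ (stickySystem M 0).wait s.pos s.resid - h := by
  have hS := stickySystem_regular (M := M) (r := r) hM hr
  have hS0 := stickySystem_regular (M := M) (r := 0) hM le_rfl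
  rw [hS.wait_le_iff _ _ (sub_nonneg.2 hb.le)]
  refine ⟨(stickySystem M 0).first s.pos s.resid, ?_⟩
  have h1 := (hS0.first_spec s.pos s.resid).1
  rw [stickySystem_hazard_congr hfirst, hb.resid _ hfirst, hb.pos]
  have h2 := hS0.hazard_add ((stickySystem M 0).first s.pos s.resid) s.pos hb.nonneg
    (sub_nonneg.2 hb.le)
  rw [add_sub_cancel] at h2
  change _ ≤ (stickySystem M 0).hazard _ ((stickySystem M 0).flow h s.pos) _
  linarith

/-- A dummy event merely interrupts a piece of motion. At any other event the clocks that matter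
have used up the same amounts in both systems, so the same clock ends the same piece. -/
lemma exists_sticky_between (hM : ContDiff ℝ 2 M.densityPart) (hr : 0 ≤ r) (hg : ∀ q k, 0 < g q k)
    (n : ℕ) : ∃ m h, Between M ((stickySystem M 0).run g mk z₀ m) h
      ((stickySystem M r).run g mk z₀ n) := by
  have hS := stickySystem_regular (M := M) (r := r) hM hr
  have hS0 := stickySystem_regular (M := M) (r := 0) hM le_rfl
  induction n with
  | zero =>
    exact ⟨0, 0, le_rfl, ClockSystem.wait_nonneg _ _, (add_zero _).symm,
      (StickyState.flow_zero _).symm, fun q _ => by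
        rw [ClockSystem.hazard_zero, sub_zero]; rfl, fun q _ => rfl⟩
  | succ n ih =>
    obtain ⟨m, h, hb⟩ := ih
    obtain ⟨hpos, hfirst⟩ := stickySystem_zero_first_ne (mk := mk) (z₀ := z₀) hM hg m
    have hwle := hb.wait_le hM hr hfirst
    have hres0 := hS0.run_resid (mk := mk) (z₀ := z₀) (fun q k => (hg q k).le) m
    have hres := hS.run_resid (mk := mk) (z₀ := z₀) (fun q k => (hg q k).le) n
    have hW := ClockSystem.wait_nonneg (S := stickySystem M r) ((stickySystem M r).run g mk z₀ n).pos
      ((stickySystem M r).run g mk z₀ n).resid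
    have hf := hS.first_spec ((stickySystem M r).run g mk z₀ n).pos
      ((stickySystem M r).run g mk z₀ n).resid
    rw [ClockSystem.run_succ]
    generalize (stickySystem M r).run g mk z₀ n = s' at *
    have hrun := ClockSystem.run_succ (S := stickySystem M 0) (g := g) (mk := mk) (z₀ := z₀) m
    generalize hs : (stickySystem M 0).run g mk z₀ m = s at *
    have hadd : ∀ q, (∀ i, q ≠ .refresh i) →
        (stickySystem M 0).hazard q s.pos (h + (stickySystem M r).wait s'.pos s'.resid) =
        (stickySystem M 0).hazard q s.pos h +
        (stickySystem M r).hazard q s'.pos ((stickySystem M r).wait s'.pos s'.resid) := by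
      intro q hq
      rw [hS0.hazard_add q s.pos hb.nonneg hW, stickySystem_hazard_congr (r := r) hq s'.pos, hb.pos]
      rfl
    have hflow : StickyState.flow ((stickySystem M r).wait s'.pos s'.resid) s'.pos =
        StickyState.flow (h + (stickySystem M r).wait s'.pos s'.resid) s.pos := by
      rw [← StickyState.flow_add s.pos hb.nonneg hW, ← hb.pos]
    by_cases hq : ∃ i, (stickySystem M r).first s'.pos s'.resid = .refresh i
    · obtain ⟨i, hi⟩ := hq
      refine ⟨m, h + (stickySystem M r).wait s'.pos s'.resid, ?_⟩
      rw [hs]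
      refine ⟨by linarith [hb.nonneg], by linarith, ?_, ?_, fun q hq => ?_, fun q hq => ?_⟩
      · change s'.time + _ = _
        rw [hb.time]; ring
      · change (stickySystem M r).jump _ _ (StickyState.flow _ _) = _
        rw [hi, hflow]
        rfl
      · change s'.resid q - (stickySystem M r).hazard q s'.pos _ + ite _ _ _ = _
        rw [if_neg (by rw [hi]; exact hq i), hadd q hq, hb.resid q hq]
        ring
      · change s'.count q + ite _ _ _ = _
        rw [if_neg (by rw [hi]; exact hq i), hb.count q hq, add_zero]
    · push Not at hq
      have hge : (stickySystem M 0).wait s.pos s.resid ≤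
          h + (stickySystem M r).wait s'.pos s'.resid := by
        rw [hS0.wait_le_iff _ _ (by linarith [hb.nonneg])]
        refine ⟨(stickySystem M r).first s'.pos s'.resid, ?_⟩
        rw [hadd _ hq]
        have := hf.1
        rw [hb.resid _ hq] at this
        linarith
      have heq : (stickySystem M 0).wait s.pos s.resid =
          h + (stickySystem M r).wait s'.pos s'.resid := le_antisymm hge (by linarith)
      have hfeq : (stickySystem M 0).first s.pos s.resid =
          (stickySystem M r).first s'.pos s'.resid := by
        rw [hS0.first_eq_iff]
        refine ⟨?_, fun p hp => ?_⟩
        · rw [heq, hadd _ hq]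
          have := hf.1
          rw [hb.resid _ hq] at this
          linarith
        · have hp' : ∀ i, p ≠ .refresh i := by
            rintro i rfl
            rw [stickySystem_zero_refresh] at hp
            exact absurd (hpos i) (not_lt.2 hp)
          refine hf.2 p ?_
          rw [heq, hadd _ hp'] at hp
          rw [hb.resid _ hp']
          linarith
      refine ⟨m + 1, 0, le_rfl, ClockSystem.wait_nonneg _ _, ?_, ?_, fun q hq' => ?_, fun q hq' => ?_⟩
      · rw [hrun]
        change s'.time + _ = s.time + _ + 0
        rw [hb.time, heq]; ring
      · rw [hrun, StickyState.flow_zero]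
        change (stickySystem M r).jump _ _ (StickyState.flow _ _) =
          (stickySystem M 0).jump _ _ (StickyState.flow _ _)
        rw [hflow, heq, hfeq, hb.count _ hq]
        rfl
      · rw [hrun, ClockSystem.hazard_zero, sub_zero]
        change s'.resid q - (stickySystem M r).hazard q s'.pos _ + ite _ _ _ =
          s.resid q - (stickySystem M 0).hazard q s.pos _ + ite _ _ _
        rw [heq, hfeq, hadd q hq', hb.resid q hq', hb.count q hq']
        ring
      · rw [hrun]
        change s'.count q + ite _ _ _ = s.count q + ite _ _ _
        rw [hfeq, hb.count q hq']

/-- The paths of the sticky process do not depend on the rate of the refreshment clocks. -/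
lemma stickySystem_path_eq (hM : ContDiff ℝ 2 M.densityPart) (hr : 0 ≤ r) (hg : ∀ q k, 0 < g q k)
    (htime : Tendsto (fun n => ((stickySystem M r).run g mk z₀ n).time) atTop atTop) {t : ℝ}
    (ht : 0 ≤ t) : (stickySystem M r).path g mk z₀ t = (stickySystem M 0).path g mk z₀ t := by
  obtain ⟨n, h1, h2⟩ := ClockSystem.exists_run_index htime ht
  obtain ⟨m, h, hb⟩ := exists_sticky_between (mk := mk) (z₀ := z₀) hM hr hg n
  have hw := hb.wait_le hM hr (stickySystem_zero_first_ne (mk := mk) (z₀ := z₀) hM hg m).2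
  have hb1 := hb.time
  have hb2 := hb.nonneg
  rw [ClockSystem.path_eq h1 h2, ClockSystem.path_eq (n := m) (by linarith), hb.pos]
  · change StickyState.flow _ (StickyState.flow _ _) = StickyState.flow _ _
    rw [StickyState.flow_add _ hb2 (by linarith), hb1]
    congr 1
    ring
  · change t < _ + (stickySystem M r).wait _ _ at h2
    change t < _ + (stickySystem M 0).wait _ _
    linarith

/-- If the hit is still ahead, the remaining amount and the hazard up to the hit have decreased
equally on the way. If it has passed, the hazard to come is zero, and the remaining amount is
nonzero because it was not used up exactly at the hit. -/
lemma bounce_ne_of_between (hM : ContDiff ℝ 2 M.densityPart)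
    {s s' : ClockState (Clock d) (StickyState d)} {h : ℝ} (hb : Between M s h s') {i : Fin d}
    (hi : (s'.pos i).2.2 = false) (hne : s.resid (.bounce i) ≠
      (stickySystem M 0).hazard (.bounce i) s.pos (hitTime i s.pos)) :
    s'.resid (.bounce i) ≠ (stickySystem M r).hazard (.bounce i) s'.pos (hitTime i s'.pos) := by
  have hS0 := stickySystem_regular (M := M) (r := 0) hM le_rfl
  have hq : ∀ j, Clock.bounce i ≠ .refresh j := by simp
  rw [stickySystem_hazard_congr hq, hb.resid _ hq, hb.pos]
  rw [hb.pos, flow_mode] at hi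
  have hflow : (StickyState.flow h s.pos i).1 = max (s.pos i).1 (min ((s.pos i).1 + h) 0) := by
    simp [StickyState.flow, hi]
  have h0 := hb.nonneg
  rcases le_total h (hitTime i s.pos) with hh | hh
  · have : hitTime i (StickyState.flow h s.pos) = hitTime i s.pos - h := by
      simp only [hitTime] at hh ⊢
      rw [hflow]
      generalize (s.pos i).1 = a at *
      rcases le_total a 0 with ha | ha
      · rw [max_eq_left (show 0 ≤ -a by linarith)] at hh ⊢
        rw [min_eq_left (show a + h ≤ 0 by linarith), max_eq_right (show a ≤ a + h by linarith),
          max_eq_left (by linarith)]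
        ring
      · rw [max_eq_right (show -a ≤ 0 by linarith)] at hh ⊢
        rw [max_eq_left (show min (a + h) 0 ≤ a from min_le_of_right_le ha),
          max_eq_right (show -a ≤ 0 by linarith)]
        linarith
    rw [this]
    have h2 := hS0.hazard_add (.bounce i) s.pos h0 (sub_nonneg.2 hh)
    rw [add_sub_cancel] at h2
    intro hc
    apply hne
    rw [h2]
    change _ = (stickySystem M 0).hazard _ ((stickySystem M 0).flow h s.pos) _ at hc
    linarith
  · have hst : IsStuck (StickyState.flow h s.pos) i := by
      rw [isStuck_flow_iff _ _ h0]
      refine ⟨hi, ?_⟩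
      have := (le_max_left (-(s.pos i).1) 0).trans hh
      linarith
    have : hitTime i (StickyState.flow h s.pos) = 0 := by
      simp only [hitTime]; exact max_eq_right (by linarith [hst.2])
    rw [this, ClockSystem.hazard_zero, hazard_bounce_of_isStuck hM h0 hst]
    exact sub_ne_zero.2 hne

variable {y₀ v₀ : Fin d → ℝ} {mk' : Clock d → ℕ → ℝ}

/-- Up to a time horizon, the latent process collapses to the sticky process. -/
theorem collapse_latent_path (hc : IsCoupling M r g mk mk') (hM : ContDiff ℝ 2 M.densityPart)
    (hr : 0 < r) (hv₀ : ∀ i, v₀ i = 1 ∨ v₀ i = -1)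
    (hsum : ∀ q, Tendsto (fun n => ∑ k ∈ Finset.range n, g q k) atTop atTop)
    (h0 : ∀ i, g (.refresh i) 0 / r ≤ M.width)
    (h0' : ∀ i, v₀ i * y₀ i < M.width / 2 →
      g (.refresh i) 0 / r ≤ M.width / 2 - v₀ i * y₀ i) {T : ℝ}
    (hl : ∀ i k, ∑ j ∈ Finset.range (k + 1), g (.refresh i) j ≤ r * T →
      g (.refresh i) (k + 1) / r ≤ M.width / 2)
    (hexo : ∀ n i, ((stickySystem M 0).run g mk (stickyInit M y₀ v₀) n).time ≤ T →
      ((stickySystem M 0).run g mk (stickyInit M y₀ v₀) n).resid (.bounce i) ≠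
      (stickySystem M 0).hazard (.bounce i) ((stickySystem M 0).run g mk (stickyInit M y₀ v₀) n).pos
        (hitTime i ((stickySystem M 0).run g mk (stickyInit M y₀ v₀) n).pos))
    {t : ℝ} (ht : 0 ≤ t) (hT : t ≤ T) :
    M.collapse (latentPosition ((latentSystem M r).path g mk' (latentInit y₀ v₀) t)) =
      position ((stickySystem M 0).path g mk (stickyInit M y₀ v₀) t) ∧
    latentVelocity ((latentSystem M r).path g mk' (latentInit y₀ v₀) t) =
      velocity ((stickySystem M 0).path g mk (stickyInit M y₀ v₀) t) := by
  have htime := stickySystem_tendsto_time hM hr.le mk (stickyInit M y₀ v₀) hc.gap_pos hsum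
  -- The coupling with the latent process needs the dummy clocks. The later comparison of two sticky
  -- runs, event by event as `r` grows, has to do without them, for their rate grows with `r`.
  rw [← stickySystem_path_eq hM hr.le hc.gap_pos htime ht]
  refine coupled_path hc hM hr htime (coupled_run hc hM hr hv₀ h0 h0' hl fun n i hn hi => ?_) ht hT
  obtain ⟨m, h, hb⟩ := exists_sticky_between (mk := mk) (z₀ := stickyInit M y₀ v₀) hM hr.le hc.gap_pos n
  refine bounce_ne_of_between hM hb hi (hexo m i ?_)
  linarith [hb.time, hb.nonneg]

end dummy

/-! ### Time changes and the Skorokhod distance -/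

/-- A piecewise linear time change. -/
lemma exists_piecewise_linear {a b : ℕ → ℝ} {m m' : ℝ} (N : ℕ) (ha : ∀ k < N, a k < a (k + 1))
    (h1 : ∀ k < N, m * (a (k + 1) - a k) ≤ b (k + 1) - b k)
    (h2 : ∀ k < N, b (k + 1) - b k ≤ m' * (a (k + 1) - a k)) :
    ∃ κ : ℝ → ℝ, (∀ k < N, ∀ t, a k ≤ t → t < a (k + 1) →
        κ t = b k + (b (k + 1) - b k) / (a (k + 1) - a k) * (t - a k)) ∧
      κ (a N) = b N ∧ (∀ s t, a 0 ≤ s → s ≤ t → t ≤ a N →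
        m * (t - s) ≤ κ t - κ s ∧ κ t - κ s ≤ m' * (t - s)) := by
  induction N with
  | zero =>
    refine ⟨fun _ => b 0, by simp, rfl, fun s t h1 h2 h3 => ?_⟩
    have : s = t := by linarith
    subst this; simp
  | succ N ih =>
    obtain ⟨κ, k1, k2, k3⟩ := ih (fun k hk => ha k (by omega)) (fun k hk => h1 k (by omega))
      (fun k hk => h2 k (by omega))
    have haN := ha N (by omega)
    have hmono : ∀ k ≤ N, a k ≤ a N := by
      have : ∀ j k, k ≤ j → j ≤ N → a k ≤ a j := by
        intro j k hj
        induction j, hj using Nat.le_induction with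
        | base => intro _; exact le_rfl
        | succ j hj ih => intro hjn; exact (ih (by omega)).trans (ha j (by omega)).le
      exact fun k hk => this N k hk le_rfl
    set σ := (b (N + 1) - b N) / (a (N + 1) - a N) with hσ
    have hpos : 0 < a (N + 1) - a N := sub_pos.2 haN
    have hσ1 : m ≤ σ := (le_div_iff₀ hpos).2 (h1 N (by omega))
    have hσ2 : σ ≤ m' := (div_le_iff₀ hpos).2 (h2 N (by omega))
    refine ⟨fun t => if t < a N then κ t else b N + σ * (t - a N), fun k hk t ht ht' => ?_, ?_,
      fun s t hs hst ht => ?_⟩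
    · rcases Nat.lt_succ_iff_lt_or_eq.1 hk with hk | rfl
      · have : t < a N := ht'.trans_le (hmono _ (by omega))
        simp only [if_pos this, k1 k hk t ht ht']
      · simp only [if_neg (not_lt.2 ht), hσ]
    · simp only [if_neg (not_lt.2 haN.le), hσ]
      rw [div_mul_cancel₀ _ hpos.ne']; ring
    · have e : ∀ x, 0 ≤ x → m * x ≤ σ * x ∧ σ * x ≤ m' * x := fun x hx =>
        ⟨mul_le_mul_of_nonneg_right hσ1 hx, mul_le_mul_of_nonneg_right hσ2 hx⟩
      by_cases c1 : t < a N
      · simp only [if_pos c1, if_pos (hst.trans_lt c1)]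
        exact k3 s t hs hst c1.le
      · by_cases c2 : s < a N
        · simp only [if_neg c1, if_pos c2]
          have h3 := k3 s (a N) hs c2.le le_rfl
          have h4 := e (t - a N) (by linarith)
          rw [k2] at h3
          constructor <;> linarith
        · simp only [if_neg c1, if_neg c2]
          have h4 := e (t - s) (by linarith)
          constructor <;> linarith

lemma skorokhodDist_le {E : Type*} [PseudoEMetricSpace E] {T : ℝ} {z z' : ℝ → E}
    {κ : ℝ → ℝ} {δ η : ℝ} (h0 : κ 0 = 0) (hT : κ T = T)
    (hκ : ∀ s t, 0 ≤ s → s ≤ t → t ≤ T → Real.exp (-δ) * (t - s) ≤ κ t - κ s ∧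
      κ t - κ s ≤ Real.exp δ * (t - s))
    (hz : ∀ t, 0 ≤ t → t ≤ T → edist (z t) (z' (κ t)) ≤ ENNReal.ofReal η) :
    skorokhodDist T z z' ≤ max (ENNReal.ofReal δ) (ENNReal.ofReal η) := by
  have hmono : StrictMonoOn κ (Icc 0 T) := by
    intro s hs t ht hst
    have := (hκ s t hs.1 hst.le ht.2).1
    have h2 : 0 < Real.exp (-δ) * (t - s) := mul_pos (Real.exp_pos _) (by linarith)
    linarith
  refine (iInf₂_le κ ⟨hmono, h0, hT⟩).trans (max_le_max ?_ ?_)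
  · have key : ∀ s t, 0 ≤ s → s < t → t ≤ T → |Real.log ((κ t - κ s) / (t - s))| ≤ δ := by
      intro s t hs hst ht
      obtain ⟨h1, h2⟩ := hκ s t hs hst.le ht
      have hp : 0 < t - s := by linarith
      rw [← le_div_iff₀ hp] at h1
      rw [← div_le_iff₀ hp] at h2
      have h3 : 0 < (κ t - κ s) / (t - s) := (Real.exp_pos _).trans_le h1
      rw [abs_le]
      exact ⟨(Real.le_log_iff_exp_le h3).2 h1, (Real.log_le_iff_le_exp h3).2 h2⟩
    refine iSup₂_le fun t₁ h₁ => iSup₂_le fun t₂ h₂ => iSup_le fun hne => ?_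
    refine ENNReal.ofReal_le_ofReal ?_
    rcases lt_or_gt_of_ne hne with h | h
    · rw [← neg_sub (κ t₂), ← neg_sub t₂, neg_div_neg_eq]
      exact key t₁ t₂ h₁.1 h h₂.2
    · exact key t₂ t₁ h₂.1 h h₁.2
  · exact iSup₂_le fun t ht => hz t ht.1 ht.2

lemma skorokhodDist_congr_left {E : Type*} [PseudoEMetricSpace E] {T : ℝ} {z z₁ z' : ℝ → E}
    (h : ∀ t, 0 ≤ t → t ≤ T → z t = z₁ t) : skorokhodDist T z z' = skorokhodDist T z₁ z' := by
  unfold skorokhodDist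
  refine iInf_congr fun κ => iInf_congr fun _ => congrArg _ (iSup_congr fun t => iSup_congr
    fun ht => ?_)
  rw [h t ht.1 ht.2]

/-! ### Skorokhod distance of two sticky runs -/

section run

variable {d : ℕ}

lemma abs_max_min_sub_le (a a' h h' : ℝ) :
    |max a (min (a + h) 0) - max a' (min (a' + h') 0)| ≤ |a - a'| + |h - h'| := by
  have h1 := abs_max_sub_max_le_max a (min (a + h) 0) a' (min (a' + h') 0)
  have h2 := abs_min_sub_min_le_max (a + h) 0 (a' + h') 0
  have h3 : |a + h - (a' + h')| ≤ |a - a'| + |h - h'| := by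
    rw [show a + h - (a' + h') = (a - a') + (h - h') by ring]; exact abs_add_le _ _
  refine h1.trans (max_le (by linarith [abs_nonneg (h - h')]) (h2.trans (max_le h3 ?_)))
  simp only [sub_self, abs_zero]
  positivity

lemma dist_flow_le {z z' : StickyState d} (hm : ∀ i, (z i).2 = (z' i).2) {δ : ℝ}
    (hδ : ∀ i, |(z i).1 - (z' i).1| ≤ δ) (h h' : ℝ) (hδ0 : 0 ≤ δ) :
    dist (position (StickyState.flow h z), velocity (StickyState.flow h z))
      (position (StickyState.flow h' z'), velocity (StickyState.flow h' z')) ≤ δ + |h - h'| := by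
  have hv : velocity (StickyState.flow h z) = velocity (StickyState.flow h' z') := by
    ext i
    simp only [velocity, flow_mode, hm i]
  rw [Prod.dist_eq, hv, dist_self]
  have h0 := abs_nonneg (h - h')
  refine max_le ((dist_pi_le_iff (by linarith)).2 fun i => ?_) (by linarith)
  have hm1 : (z i).2.1 = (z' i).2.1 := by rw [hm]
  have hm2 : (z i).2.2 = (z' i).2.2 := by rw [hm]
  simp only [position, flow_mode, hm1, Real.dist_eq]
  rw [← mul_sub, abs_mul, abs_boolSign, one_mul]
  simp only [StickyState.flow, hm2]
  split_ifs
  · rw [show (z i).1 + h - ((z' i).1 + h') = ((z i).1 - (z' i).1) + (h - h') by ring]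
    exact (abs_add_le _ _).trans (by linarith [hδ i])
  · exact (abs_max_min_sub_le _ _ _ _).trans (by linarith [hδ i])

variable {M : SpikeSlab d} {mk : Clock d → ℕ → ℝ} {z₀ : StickyState d}

/-- The time change maps event times linearly to event times and fixes `T`. Corresponding pieces of
motion have the same modes and starting points within `δ`; the times elapsed in them differ by at
most `T` times the difference of the extreme slopes `exp δ` and `exp (-δ)`. -/
lemma skorokhodDist_run_le {g g' : Clock d → ℕ → ℝ} {T δ : ℝ} {N : ℕ} (hδ : 0 ≤ δ)
    (hA : ∀ k < N, ((stickySystem M 0).run g' mk z₀ k).time <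
      ((stickySystem M 0).run g' mk z₀ (k + 1)).time)
    (hAT : ((stickySystem M 0).run g' mk z₀ N).time < T)
    (hAT' : T < ((stickySystem M 0).run g' mk z₀ (N + 1)).time)
    (hB : ∀ k < N, ((stickySystem M 0).run g mk z₀ k).time <
      ((stickySystem M 0).run g mk z₀ (k + 1)).time)
    (hBT : ((stickySystem M 0).run g mk z₀ N).time < T)
    (hBT' : T < ((stickySystem M 0).run g mk z₀ (N + 1)).time)
    (hlow : ∀ k < N, Real.exp (-δ) * (((stickySystem M 0).run g mk z₀ (k + 1)).time -
      ((stickySystem M 0).run g mk z₀ k).time) ≤ ((stickySystem M 0).run g' mk z₀ (k + 1)).time -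
      ((stickySystem M 0).run g' mk z₀ k).time)
    (hup : ∀ k < N, ((stickySystem M 0).run g' mk z₀ (k + 1)).time -
      ((stickySystem M 0).run g' mk z₀ k).time ≤ Real.exp δ *
      (((stickySystem M 0).run g mk z₀ (k + 1)).time - ((stickySystem M 0).run g mk z₀ k).time))
    (hlowT : Real.exp (-δ) * (T - ((stickySystem M 0).run g mk z₀ N).time) ≤
      T - ((stickySystem M 0).run g' mk z₀ N).time)
    (hupT : T - ((stickySystem M 0).run g' mk z₀ N).time ≤
      Real.exp δ * (T - ((stickySystem M 0).run g mk z₀ N).time))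
    (hmode : ∀ k ≤ N, ∀ i, (((stickySystem M 0).run g mk z₀ k).pos i).2 =
      (((stickySystem M 0).run g' mk z₀ k).pos i).2)
    (hclose : ∀ k ≤ N, ∀ i, |(((stickySystem M 0).run g mk z₀ k).pos i).1 -
      (((stickySystem M 0).run g' mk z₀ k).pos i).1| ≤ δ) :
    skorokhodDist T
      (fun t => (position ((stickySystem M 0).path g mk z₀ t),
        velocity ((stickySystem M 0).path g mk z₀ t)))
      (fun t => (position ((stickySystem M 0).path g' mk z₀ t),
        velocity ((stickySystem M 0).path g' mk z₀ t))) ≤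
    max (ENNReal.ofReal δ) (ENNReal.ofReal (δ + T * (Real.exp δ - Real.exp (-δ)))) := by
  -- The horizon `T` replaces the event `N + 1` as the last node, so that the time change maps `[0,
  -- T]` to itself.
  set s : ℕ → ℝ := fun k => if k ≤ N then ((stickySystem M 0).run g mk z₀ k).time else T with hs
  set t : ℕ → ℝ := fun k => if k ≤ N then ((stickySystem M 0).run g' mk z₀ k).time else T with ht
  have hs1 : ∀ k ≤ N, s k = ((stickySystem M 0).run g mk z₀ k).time := fun k hk => if_pos hk
  have ht1 : ∀ k ≤ N, t k = ((stickySystem M 0).run g' mk z₀ k).time := fun k hk => if_pos hk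
  have hsN : s (N + 1) = T := if_neg (by omega)
  have htN : t (N + 1) = T := if_neg (by omega)
  have hslt : ∀ k < N + 1, s k < s (k + 1) := by
    intro k hk
    rcases Nat.lt_succ_iff_lt_or_eq.1 hk with hk | rfl
    · rw [hs1 k hk.le, hs1 (k + 1) hk]; exact hB k hk
    · rw [hs1 k le_rfl, hsN]; exact hBT
  have htlt : ∀ k < N + 1, t k < t (k + 1) := by
    intro k hk
    rcases Nat.lt_succ_iff_lt_or_eq.1 hk with hk | rfl
    · rw [ht1 k hk.le, ht1 (k + 1) hk]; exact hA k hk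
    · rw [ht1 k le_rfl, htN]; exact hAT
  have hl : ∀ k < N + 1, Real.exp (-δ) * (s (k + 1) - s k) ≤ t (k + 1) - t k := by
    intro k hk
    rcases Nat.lt_succ_iff_lt_or_eq.1 hk with hk | rfl
    · rw [hs1 k hk.le, hs1 (k + 1) hk, ht1 k hk.le, ht1 (k + 1) hk]; exact hlow k hk
    · rw [hs1 k le_rfl, hsN, ht1 k le_rfl, htN]; exact hlowT
  have hu : ∀ k < N + 1, t (k + 1) - t k ≤ Real.exp δ * (s (k + 1) - s k) := by
    intro k hk
    rcases Nat.lt_succ_iff_lt_or_eq.1 hk with hk | rfl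
    · rw [hs1 k hk.le, hs1 (k + 1) hk, ht1 k hk.le, ht1 (k + 1) hk]; exact hup k hk
    · rw [hs1 k le_rfl, hsN, ht1 k le_rfl, htN]; exact hupT
  obtain ⟨κ, k1, k2, k3⟩ := exists_piecewise_linear (N + 1) hslt hl hu
  have hs0 : s 0 = 0 := hs1 0 (Nat.zero_le _)
  have ht0 : t 0 = 0 := ht1 0 (Nat.zero_le _)
  rw [hsN, htN] at k2
  rw [hs0, hsN] at k3
  have hT0 : 0 < T := (ClockSystem.run_time_nonneg (S := stickySystem M 0) (g := g') (mk := mk)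
    (z₀ := z₀) N).trans_lt hAT
  have hκ0 : κ 0 = 0 := by
    have := k1 0 (by omega) 0 hs0.le (by rw [← hs0]; exact hslt 0 (by omega))
    rw [this, hs0, ht0]; simp
  have hem : Real.exp (-δ) ≤ 1 := Real.exp_le_one_iff.2 (by linarith)
  have hep : 1 ≤ Real.exp δ := Real.one_le_exp hδ
  refine skorokhodDist_le hκ0 k2 k3 fun x hx0 hxT => ?_
  have hex : ∃ k ≤ N, s k ≤ x ∧ (x < s (k + 1) ∨ (k = N ∧ x = T)) := by
    rcases hxT.eq_or_lt with rfl | hxT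
    · exact ⟨N, le_rfl, by rw [hs1 N le_rfl]; exact hBT.le, Or.inr ⟨rfl, rfl⟩⟩
    · have hex : ∃ k, x < s (k + 1) := ⟨N, by rw [hsN]; exact hxT⟩
      classical
      have hfN : Nat.find hex ≤ N := Nat.find_min' hex (by rw [hsN]; exact hxT)
      refine ⟨Nat.find hex, hfN, ?_, Or.inl (Nat.find_spec hex)⟩
      rcases h : Nat.find hex with _ | m
      · rw [hs0]; exact hx0
      · exact not_lt.1 (Nat.find_min hex (m := m) (by omega))
  obtain ⟨k, hk, hsk, hxk⟩ := hex
  have hsx : 0 ≤ x - s k := by linarith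
  have hκx : κ x = t k + (t (k + 1) - t k) / (s (k + 1) - s k) * (x - s k) ∧
      ((stickySystem M 0).run g mk z₀ k).time ≤ x ∧
      x < ((stickySystem M 0).run g mk z₀ (k + 1)).time ∧
      ((stickySystem M 0).run g' mk z₀ k).time ≤ κ x ∧
      κ x < ((stickySystem M 0).run g' mk z₀ (k + 1)).time := by
    have hps := sub_pos.2 (hslt k (by omega))
    have hpt := sub_pos.2 (htlt k (by omega))
    rw [← hs1 k hk, ← ht1 k hk]
    rcases hxk with hxk | ⟨rfl, rfl⟩
    · have e := k1 k (by omega) x hsk hxk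
      refine ⟨e, hsk, ?_, ?_, ?_⟩
      · rcases hk.eq_or_lt with rfl | hk'
        · rw [hsN] at hxk; exact hxk.trans hBT'
        · rw [← hs1 (k + 1) hk']; exact hxk
      · rw [e]
        have := mul_nonneg (div_nonneg hpt.le hps.le) hsx
        linarith
      · have h2 : κ x < t (k + 1) := by
          rw [e, div_mul_eq_mul_div, ← lt_sub_iff_add_lt', div_lt_iff₀ hps]
          exact mul_lt_mul_of_pos_left (by linarith) hpt
        rcases hk.eq_or_lt with rfl | hk'
        · rw [htN] at h2; exact h2.trans hAT'
        · rw [← ht1 (k + 1) hk']; exact h2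
    · rw [k2, hsN, htN, hs1 k le_rfl, ht1 k le_rfl]
      refine ⟨?_, hBT.le, hBT', hAT.le, hAT'⟩
      rw [div_mul_cancel₀ _ (by linarith)]; ring
  obtain ⟨e, e1, e2, e3, e4⟩ := hκx
  rw [ClockSystem.path_eq e1 e2, ClockSystem.path_eq e3 e4, edist_dist]
  refine ENNReal.ofReal_le_ofReal ?_
  refine (dist_flow_le (hmode k hk) (hclose k hk) _ _ hδ).trans ?_
  gcongr
  have hps := sub_pos.2 (hslt k (by omega))
  have hr1 : Real.exp (-δ) ≤ (t (k + 1) - t k) / (s (k + 1) - s k) :=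
    (le_div_iff₀ hps).2 (hl k (by omega))
  have hr2 : (t (k + 1) - t k) / (s (k + 1) - s k) ≤ Real.exp δ :=
    (div_le_iff₀ hps).2 (hu k (by omega))
  rw [e, ← hs1 k hk, ← ht1 k hk]
  have hxT' : x - s k ≤ T := by
    have : 0 ≤ s k := by rw [hs1 k hk]; exact ClockSystem.run_time_nonneg k
    linarith
  have : |1 - (t (k + 1) - t k) / (s (k + 1) - s k)| ≤ Real.exp δ - Real.exp (-δ) := by
    rw [abs_le]; constructor <;> linarith
  calc |x - s k - (t k + (t (k + 1) - t k) / (s (k + 1) - s k) * (x - s k) - t k)|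
      = (x - s k) * |1 - (t (k + 1) - t k) / (s (k + 1) - s k)| := by
        rw [← abs_of_nonneg hsx, ← abs_mul, abs_of_nonneg hsx]; congr 1; ring
    _ ≤ T * (Real.exp δ - Real.exp (-δ)) := by
        apply mul_le_mul hxT' this (abs_nonneg _) hT0.le

end run

/-! ### Products of infinitely many probability measures -/

section infinitePi

variable {E : Type*} [MeasurableSpace E]

lemma measurePreserving_sumElim {α β : Type*} (μ : α ⊕ β → Measure E)
    [∀ i, IsProbabilityMeasure (μ i)] :
    MeasurePreserving (fun p : (α → E) × (β → E) => (Sum.elim p.1 p.2 : α ⊕ β → E))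
      ((Measure.infinitePi fun a => μ (.inl a)).prod (Measure.infinitePi fun b => μ (.inr b)))
      (Measure.infinitePi μ) := by
  have hmeas : Measurable (fun p : (α → E) × (β → E) => (Sum.elim p.1 p.2 : α ⊕ β → E)) := by
    refine measurable_pi_lambda _ fun i => ?_
    rcases i with a | b
    · exact (measurable_pi_apply a).comp measurable_fst
    · exact (measurable_pi_apply b).comp measurable_snd
  refine ⟨hmeas, Measure.eq_infinitePi μ fun s t ht => ?_⟩
  rw [Measure.map_apply hmeas (MeasurableSet.pi s.countable_toSet fun i _ => ht i)]
  have : (fun p : (α → E) × (β → E) => (Sum.elim p.1 p.2 : α ⊕ β → E)) ⁻¹' ((s : Set (α ⊕ β)).pi t) =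
      ((s.toLeft : Set α).pi fun a => t (.inl a)) ×ˢ ((s.toRight : Set β).pi fun b => t (.inr b)) := by
    ext ⟨x, y⟩
    simp [Set.mem_pi]
  rw [this, Measure.prod_prod, Measure.infinitePi_pi _ (fun i _ => ht _),
    Measure.infinitePi_pi _ (fun i _ => ht _)]
  refine (Finset.prod_disjSum _ _ fun i => μ i (t i)).symm.trans ?_
  rw [Finset.toLeft_disjSum_toRight]

lemma measurePreserving_sumSplit {α β : Type*} (μ : α ⊕ β → Measure E)
    [∀ i, IsProbabilityMeasure (μ i)] :
    MeasurePreserving (fun ω : α ⊕ β → E => ((fun a => ω (.inl a), fun b => ω (.inr b)) :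
      (α → E) × (β → E))) (Measure.infinitePi μ)
      ((Measure.infinitePi fun a => μ (.inl a)).prod (Measure.infinitePi fun b => μ (.inr b))) := by
  have hmeas : Measurable (fun ω : α ⊕ β → E => ((fun a => ω (.inl a), fun b => ω (.inr b)) :
      (α → E) × (β → E))) :=
    (measurable_pi_lambda _ fun a => measurable_pi_apply _).prodMk
      (measurable_pi_lambda _ fun a => measurable_pi_apply _)
  refine ⟨hmeas, ?_⟩
  rw [← (measurePreserving_sumElim μ).map_eq, Measure.map_map hmeas
    (measurePreserving_sumElim μ).measurable]
  convert Measure.map_id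
  rfl

/-- The sequence with first entry `x` that goes on with `s`. -/
def consSeq (x : E) (s : ℕ → E) : ℕ → E := fun n => Nat.casesOn n x s

@[simp] lemma consSeq_zero (x : E) (s : ℕ → E) : consSeq x s 0 = x := rfl

@[simp] lemma consSeq_succ (x : E) (s : ℕ → E) (n : ℕ) : consSeq x s (n + 1) = s n := rfl

lemma measurable_consSeq : Measurable fun p : E × (ℕ → E) => consSeq p.1 p.2 := by
  refine measurable_pi_lambda _ fun n => ?_
  cases n with
  | zero => exact measurable_fst
  | succ n => exact (measurable_pi_apply n).comp measurable_snd

lemma measurable_seqTail : Measurable fun (ω : ℕ → E) n => ω (n + 1) :=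
  measurable_pi_lambda _ fun _ => measurable_pi_apply _

lemma measurePreserving_consSeq (μ : Measure E) [IsProbabilityMeasure μ] :
    MeasurePreserving (fun p : E × (ℕ → E) => consSeq p.1 p.2)
      (μ.prod (Measure.infinitePi fun _ => μ)) (Measure.infinitePi fun _ => μ) := by
  refine ⟨measurable_consSeq, Measure.eq_infinitePi _ fun s t ht => ?_⟩
  rw [Measure.map_apply measurable_consSeq (MeasurableSet.pi s.countable_toSet fun i _ => ht i)]
  obtain ⟨N, hN⟩ : ∃ N, s ⊆ Finset.range (N + 1) :=
    ⟨s.sup id, fun i hi => Finset.mem_range.2 (Nat.lt_succ_of_le (Finset.le_sup (f := id) hi))⟩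
  classical
  let t' : ℕ → Set E := fun n => if n ∈ s then t n else univ
  have ht' : ∀ n, MeasurableSet (t' n) := fun n => by
    dsimp only [t']; split_ifs; exacts [ht n, MeasurableSet.univ]
  have h1 : (fun p : E × (ℕ → E) => consSeq p.1 p.2) ⁻¹' ((s : Set ℕ).pi t) =
      t' 0 ×ˢ ((Finset.range N : Set ℕ).pi fun n => t' (n + 1)) := by
    ext ⟨x, y⟩
    simp only [mem_preimage, Set.mem_pi, Finset.mem_coe, mem_prod, Finset.mem_range, t']
    constructor
    · intro h
      refine ⟨?_, fun n _ => ?_⟩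
      · split_ifs with h0
        · exact h 0 h0
        · trivial
      · split_ifs with h0
        · exact h _ h0
        · trivial
    · rintro ⟨h0, h⟩ n hn
      cases n with
      | zero => simpa [hn] using h0
      | succ n =>
        have := Finset.mem_range.1 (hN hn)
        simpa [hn] using h n (by omega)
  have h2 : ∏ i ∈ s, μ (t i) = ∏ i ∈ Finset.range (N + 1), μ (t' i) := by
    rw [← Finset.prod_subset hN fun i _ hi => by simp [t', hi]]
    exact Finset.prod_congr rfl fun i hi => by simp [t', hi]
  rw [h1, h2, Measure.prod_prod, Measure.infinitePi_pi _ (fun i _ => ht' _),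
    Finset.prod_range_succ', mul_comm]

lemma measurePreserving_headTail (μ : Measure E) [IsProbabilityMeasure μ] :
    MeasurePreserving (fun ω : ℕ → E => (ω 0, fun n => ω (n + 1)))
      (Measure.infinitePi fun _ => μ) (μ.prod (Measure.infinitePi fun _ => μ)) := by
  have hmeas : Measurable (fun ω : ℕ → E => (ω 0, fun n => ω (n + 1))) :=
    (measurable_pi_apply 0).prodMk measurable_seqTail
  refine ⟨hmeas, ?_⟩
  conv_lhs => rw [← (measurePreserving_consSeq μ).map_eq]
  rw [Measure.map_map hmeas measurable_consSeq]
  convert Measure.map_id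
  rfl

end infinitePi

/-! ### Machines that restore the law of their state -/

section restart

variable {S E : Type*} [MeasurableSpace S] [MeasurableSpace E]

/-- The states of a machine, whose transitions output a value and a new state. -/
def machineState (T : ℕ → S → E × S) (s : S) : ℕ → S
  | 0 => s
  | n + 1 => (T n (machineState T s n)).2

/-- The outputs of a machine. -/
def machineOutput (T : ℕ → S → E × S) (s : S) (n : ℕ) : E := (T n (machineState T s n)).1

lemma measurable_machineState {T : ℕ → S → E × S} (hT : ∀ n, Measurable (T n)) (n : ℕ) :
    Measurable fun s => machineState T s n := by
  induction n with
  | zero => exact measurable_id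
  | succ n ih => exact ((hT n).comp ih).snd

lemma measurable_machineOutput {T : ℕ → S → E × S} (hT : ∀ n, Measurable (T n)) (n : ℕ) :
    Measurable fun s => machineOutput T s n :=
  ((hT n).comp (measurable_machineState hT n)).fst

lemma machineState_succ' (T : ℕ → S → E × S) (s : S) (n : ℕ) :
    machineState T s (n + 1) = machineState (fun k => T (k + 1)) (T 0 s).2 n := by
  induction n with
  | zero => rfl
  | succ n ih => rw [machineState, ih]; rfl

lemma machineOutput_succ' (T : ℕ → S → E × S) (s : S) (n : ℕ) :
    machineOutput T s (n + 1) = machineOutput (fun k => T (k + 1)) (T 0 s).2 n := by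
  rw [machineOutput, machineState_succ']; rfl

/-- If every transition outputs a variable with law `ν` and restores independently the law of the
state, then the outputs are independent with law `ν`. -/
lemma measurePreserving_machineOutput {T : ℕ → S → E × S} {μ : Measure S} {ν : Measure E}
    [IsProbabilityMeasure μ] [IsProbabilityMeasure ν]
    (hT : ∀ n, MeasurePreserving (T n) μ (ν.prod μ)) :
    MeasurePreserving (machineOutput T) μ (Measure.infinitePi fun _ => ν) := by
  have hmeas : Measurable (machineOutput T) :=
    measurable_pi_lambda _ fun n => measurable_machineOutput (fun n => (hT n).measurable) n
  -- The claim is made for all machines at once: after the first transition the shifted machine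
  -- starts from a state with law `μ` that is independent of the first output.
  have key : ∀ (N : ℕ) (T : ℕ → S → E × S) (A : ℕ → Set E),
      (∀ n, MeasurePreserving (T n) μ (ν.prod μ)) → (∀ n, MeasurableSet (A n)) →
      μ {s | ∀ k < N, machineOutput T s k ∈ A k} = ∏ k ∈ Finset.range N, ν (A k) := by
    intro N
    induction N with
    | zero => intro T A _ _; simp
    | succ N ih =>
      intro T A hT hA
      have hB : MeasurableSet {s | ∀ k < N, machineOutput (fun k => T (k + 1)) s k ∈ A (k + 1)} := by
        have : {s | ∀ k < N, machineOutput (fun k => T (k + 1)) s k ∈ A (k + 1)} =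
            ⋂ k ∈ Finset.range N, {s | machineOutput (fun k => T (k + 1)) s k ∈ A (k + 1)} := by
          ext; simp
        rw [this]
        exact Finset.measurableSet_biInter _ fun k _ =>
          measurable_machineOutput (fun n => (hT (n + 1)).measurable) k (hA _)
      have : {s | ∀ k < N + 1, machineOutput T s k ∈ A k} =
          T 0 ⁻¹' (A 0 ×ˢ {s | ∀ k < N, machineOutput (fun k => T (k + 1)) s k ∈ A (k + 1)}) := by
        ext s
        simp only [mem_ofPred_eq, mem_preimage, mem_prod]
        constructor
        · intro h
          exact ⟨h 0 (by omega), fun k hk => machineOutput_succ' T s k ▸ h (k + 1) (by omega)⟩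
        · rintro ⟨h0, h⟩ k hk
          cases k with
          | zero => exact h0
          | succ k => rw [machineOutput_succ']; exact h k (by omega)
      rw [this, (hT 0).measure_preimage ((hA 0).prod hB).nullMeasurableSet, Measure.prod_prod,
        ih _ (fun k => A (k + 1)) (fun n => hT (n + 1)) (fun n => hA (n + 1)),
        Finset.prod_range_succ', mul_comm]
  refine ⟨hmeas, Measure.eq_infinitePi _ fun s t ht => ?_⟩
  rw [Measure.map_apply hmeas (MeasurableSet.pi s.countable_toSet fun i _ => ht i)]
  obtain ⟨N, hN⟩ : ∃ N, s ⊆ Finset.range N :=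
    ⟨s.sup id + 1, fun i hi => Finset.mem_range.2 (Nat.lt_succ_of_le (Finset.le_sup (f := id) hi))⟩
  classical
  let t' : ℕ → Set E := fun n => if n ∈ s then t n else univ
  have ht' : ∀ n, MeasurableSet (t' n) := fun n => by
    dsimp only [t']; split_ifs; exacts [ht n, MeasurableSet.univ]
  have h1 : machineOutput T ⁻¹' ((s : Set ℕ).pi t) = {ω | ∀ k < N, machineOutput T ω k ∈ t' k} := by
    ext ω
    simp only [mem_preimage, Set.mem_pi, Finset.mem_coe, mem_ofPred_eq, t']
    constructor
    · intro h k _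
      split_ifs with h0
      · exact h k h0
      · trivial
    · intro h k hk
      simpa [hk] using h k (Finset.mem_range.1 (hN hk))
  rw [h1, key N T t' hT ht', ← Finset.prod_subset hN fun i _ hi => by simp [t', hi]]
  exact Finset.prod_congr rfl fun i hi => by simp [t', hi]

end restart

/-! ### Sign changes along a selection rule -/

section signs

variable {ι : Type*} [DecidableEq ι]

/-- The family `ω` with the opposite entry at `a`. -/
def negAt (a : ι) (ω : ι → ℝ) : ι → ℝ := Function.update ω a (-ω a)

lemma negAt_negAt (a : ι) (ω : ι → ℝ) : negAt a (negAt a ω) = ω := by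
  simp [negAt]

lemma measurable_negAt (a : ι) : Measurable (negAt a : (ι → ℝ) → ι → ℝ) := by
  refine measurable_pi_lambda _ fun b => ?_
  by_cases h : b = a
  · subst h; simp only [negAt, Function.update_self]; exact (measurable_pi_apply b).neg
  · simp only [negAt, Function.update_of_ne h]; exact measurable_pi_apply b

lemma measurePreserving_negAt (μ : ι → Measure ℝ) [∀ i, IsProbabilityMeasure (μ i)] {a : ι}
    (ha : (μ a).map (fun x => -x) = μ a) :
    MeasurePreserving (negAt a) (Measure.infinitePi μ) (Measure.infinitePi μ) := by
  have h := Measure.infinitePi_map_pi μ (f := fun i x => if i = a then -x else x)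
    (fun i => by by_cases h : i = a <;> simp [h, measurable_neg, measurable_id'])
  refine ⟨measurable_negAt a, ?_⟩
  convert h using 2
  · ext ω b
    by_cases h : b = a
    · subst h; simp [negAt]
    · simp [negAt, h]
  · ext i : 1
    by_cases h : i = a
    · subst h; simp [ha]
    · simp [h]

variable (A : ℕ → (ι → ℝ) → Option ι)

open Classical in
/-- The entries of `ω` that are among the first `n` choices of the selection rule `A` change their
signs. -/
def flipSignsUpTo (n : ℕ) (ω : ι → ℝ) (b : ι) : ℝ := if ∃ k < n, A k ω = some b then -ω b else ω b

open Classical in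
/-- The entries of `ω` that are chosen by the selection rule `A` change their signs. -/
def flipSigns (ω : ι → ℝ) (b : ι) : ℝ := if ∃ k, A k ω = some b then -ω b else ω b

variable {A}

/-- If the choice of an entry does not depend on its sign, and no entry is chosen twice, then
changing the signs of the chosen entries preserves a product of symmetric laws. -/
lemma measurePreserving_flipSigns [Countable ι] (μ : ι → Measure ℝ)
    [∀ i, IsProbabilityMeasure (μ i)]
    (hmeas : ∀ n a, MeasurableSet {ω | A n ω = some a})
    (hflip : ∀ n a ω, A n ω = some a → ∀ k ≤ n, A k (negAt a ω) = A k ω)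
    (hinj : ∀ n m a ω, A n ω = some a → A m ω = some a → n = m)
    (hsymm : ∀ n a ω, A n ω = some a → (μ a).map (fun x => -x) = μ a) :
    MeasurePreserving (flipSigns A) (Measure.infinitePi μ) (Measure.infinitePi μ) := by
  classical
  set P := Measure.infinitePi μ
  -- `F n` reverses the `n`-th choice only. The event that a given entry is chosen is invariant
  -- under reversing this entry, so `F n` preserves the measure on each of these events.
  let F : ℕ → (ι → ℝ) → ι → ℝ := fun n ω => (A n ω).elim ω fun a => negAt a ω
  have hnone : ∀ n, MeasurableSet {ω | A n ω = none} := by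
    intro n
    have : {ω | A n ω = none} = (⋃ a, {ω | A n ω = some a})ᶜ := by
      ext ω; simp [Option.eq_none_iff_forall_ne_some]
    rw [this]
    exact (MeasurableSet.iUnion fun a => hmeas n a).compl
  have hFpre : ∀ n B, F n ⁻¹' B = ({ω | A n ω = none} ∩ B) ∪
      ⋃ a, ({ω | A n ω = some a} ∩ negAt a ⁻¹' B) := by
    intro n B
    ext ω
    simp only [mem_preimage, mem_union, mem_inter_iff, mem_ofPred_eq, mem_iUnion, F]
    rcases h : A n ω with _ | a <;> simp [eq_comm]
  have hFm : ∀ n, Measurable (F n) := by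
    intro n B hB
    rw [hFpre]
    exact ((hnone n).inter hB).union (MeasurableSet.iUnion fun a =>
      (hmeas n a).inter (measurable_negAt a hB))
  have hF : ∀ n, MeasurePreserving (F n) P P := by
    intro n
    refine ⟨hFm n, Measure.ext fun B hB => ?_⟩
    rw [Measure.map_apply (hFm n) hB, hFpre]
    have hB' : B = ({ω | A n ω = none} ∩ B) ∪ ⋃ a, ({ω | A n ω = some a} ∩ B) := by
      ext ω
      simp only [mem_union, mem_inter_iff, mem_ofPred_eq, mem_iUnion]
      rcases h : A n ω with _ | a <;> simp
    conv_rhs => rw [hB']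
    have hdis : ∀ C : ι → Set (ι → ℝ), Disjoint ({ω | A n ω = none} ∩ B)
        (⋃ a, ({ω | A n ω = some a} ∩ C a)) := by
      intro C
      rw [Set.disjoint_left]
      rintro ω ⟨h1, -⟩ h2
      simp only [mem_iUnion, mem_inter_iff, mem_ofPred_eq] at h1 h2
      obtain ⟨a, h2, -⟩ := h2
      simp [h1] at h2
    have hdis2 : ∀ C : ι → Set (ι → ℝ), Pairwise (Function.onFun Disjoint
        fun a => {ω | A n ω = some a} ∩ C a) := by
      intro C a b hab
      simp only [Function.onFun]
      rw [Set.disjoint_left]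
      rintro ω ⟨h1, -⟩ ⟨h2, -⟩
      simp only [mem_ofPred_eq] at h1 h2
      rw [h1] at h2
      exact hab (Option.some.inj h2)
    rw [measure_union (hdis fun a => negAt a ⁻¹' B) (MeasurableSet.iUnion fun a =>
        (hmeas n a).inter (measurable_negAt a hB)), measure_union (hdis fun _ => B)
        (MeasurableSet.iUnion fun a => (hmeas n a).inter hB),
      measure_iUnion (hdis2 fun a => negAt a ⁻¹' B) (fun a => (hmeas n a).inter
        (measurable_negAt a hB)), measure_iUnion (hdis2 fun _ => B) (fun a => (hmeas n a).inter hB)]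
    congr 1
    refine tsum_congr fun a => ?_
    -- Symmetry is available only for entries that are chosen somewhere; the others contribute the
    -- empty event.
    by_cases hne : ∃ ω, A n ω = some a
    · obtain ⟨ω, hω⟩ := hne
      rw [← (measurePreserving_negAt μ (hsymm n a ω hω)).measure_preimage
        ((hmeas n a).inter hB).nullMeasurableSet]
      congr 1
      ext ω'
      simp only [mem_inter_iff, mem_preimage, mem_ofPred_eq]
      refine and_congr_left fun _ => ⟨fun h => ?_, fun h => ?_⟩
      · rw [hflip n a ω' h n le_rfl]; exact h
      · have := hflip n a _ h n le_rfl
        rw [negAt_negAt] at this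
        rw [this]; exact h
    · push Not at hne
      have h1 : {ω | A n ω = some a} = ∅ := by ext ω; simp [hne]
      rw [h1]; simp
  -- The `n`-th reversal can be carried out first: it alters no earlier choice, and its entry is not
  -- among the earlier ones.
  have hcomp : ∀ n, flipSignsUpTo A (n + 1) = flipSignsUpTo A n ∘ F n := by
    intro n
    ext ω b
    rcases h : A n ω with _ | a
    · have h0 : F n ω = ω := by simp [F, h]
      rw [Function.comp, h0, flipSignsUpTo, flipSignsUpTo]
      have : (∃ k < n + 1, A k ω = some b) ↔ ∃ k < n, A k ω = some b := by
        constructor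
        · rintro ⟨k, hk, h'⟩
          rcases (Nat.lt_succ_iff.1 hk).eq_or_lt with rfl | hk
          · simp [h] at h'
          · exact ⟨k, hk, h'⟩
        · rintro ⟨k, hk, h'⟩; exact ⟨k, by omega, h'⟩
      simp only [this]
    · have h0 : F n ω = negAt a ω := by simp [F, h]
      rw [Function.comp, h0, flipSignsUpTo, flipSignsUpTo]
      have h1 : ∀ k < n, A k (negAt a ω) = A k ω := fun k hk => hflip n a ω h k hk.le
      have h2 : (∃ k < n, A k (negAt a ω) = some b) ↔ ∃ k < n, A k ω = some b :=
        exists_congr fun k => and_congr_right fun hk => by rw [h1 k hk]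
      simp only [h2]
      by_cases hb : b = a
      · subst hb
        have h3 : ¬ ∃ k < n, A k ω = some b := by
          rintro ⟨k, hk, h'⟩
          exact hk.ne (hinj k n b ω h' h)
        rw [if_pos ⟨n, n.lt_succ_self, h⟩, if_neg h3]
        simp [negAt]
      · have h3 : (∃ k < n + 1, A k ω = some b) ↔ ∃ k < n, A k ω = some b := by
          constructor
          · rintro ⟨k, hk, h'⟩
            rcases (Nat.lt_succ_iff.1 hk).eq_or_lt with rfl | hk
            · rw [h] at h'; exact absurd (Option.some.inj h').symm hb
            · exact ⟨k, hk, h'⟩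
          · rintro ⟨k, hk, h'⟩; exact ⟨k, by omega, h'⟩
        simp only [h3, negAt, Function.update_of_ne hb]
  have hn : ∀ n, MeasurePreserving (flipSignsUpTo A n) P P := by
    intro n
    induction n with
    | zero =>
      convert MeasurePreserving.id P
      ext ω b
      simp [flipSignsUpTo]
    | succ n ih => rw [hcomp]; exact ih.comp (hF n)
  have hm : Measurable (flipSigns A) := by
    refine measurable_pi_lambda _ fun b => ?_
    refine Measurable.ite ?_ (measurable_pi_apply b).neg (measurable_pi_apply b)
    have : {ω | ∃ k, A k ω = some b} = ⋃ k, {ω | A k ω = some b} := by ext; simp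
    rw [this]
    exact MeasurableSet.iUnion fun k => hmeas k b
  refine ⟨hm, Measure.eq_infinitePi _ fun s t ht => ?_⟩
  have hbox := MeasurableSet.pi s.countable_toSet fun i _ => ht i
  rw [Measure.map_apply hm hbox]
  -- On finitely many entries the first `n` reversals eventually amount to all of them. The
  -- probabilities of a box converge, and they do not depend on `n`.
  have hlim := tendsto_measure_of_tendsto_indicator_of_isFiniteMeasure atTop (A := flipSigns A ⁻¹'
    ((s : Set ι).pi t)) (As := fun n => flipSignsUpTo A n ⁻¹' ((s : Set ι).pi t)) P
    (fun n => (hn n).measurable hbox) (fun ω => by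
      have : ∀ b ∈ s, ∀ᶠ n in atTop, flipSignsUpTo A n ω b = flipSigns A ω b := by
        intro b _
        by_cases h : ∃ k, A k ω = some b
        · obtain ⟨k, hk⟩ := h
          filter_upwards [eventually_gt_atTop k] with n hn
          rw [flipSignsUpTo, flipSigns, if_pos ⟨k, hn, hk⟩, if_pos ⟨k, hk⟩]
        · refine Eventually.of_forall fun n => ?_
          rw [flipSignsUpTo, flipSigns, if_neg h, if_neg fun ⟨k, _, hk⟩ => h ⟨k, hk⟩]
      filter_upwards [(Finset.eventually_all s).2 this] with n hn
      simp only [mem_preimage, Set.mem_pi, Finset.mem_coe]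
      exact forall₂_congr fun b hb => by rw [hn b hb])
  have hconst : ∀ n, P (flipSignsUpTo A n ⁻¹' ((s : Set ι).pi t)) = ∏ i ∈ s, μ i (t i) := fun n => by
    rw [(hn n).measure_preimage hbox.nullMeasurableSet, Measure.infinitePi_pi _ fun i _ => ht i]
  simp only [hconst] at hlim
  exact (tendsto_nhds_unique tendsto_const_nhds hlim).symm

end signs

/-! ### The laws of one coordinate -/

section expMeasure

variable {a : ℝ}

lemma expMeasure_Iic (ha : 0 < a) (x : ℝ) :
    expMeasure a (Iic x) = ENNReal.ofReal (if 0 ≤ x then 1 - Real.exp (-(a * x)) else 0) := by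
  have := isProbabilityMeasure_expMeasure ha
  rw [← ofReal_cdf, cdf_expMeasure_eq ha]

lemma nullSingletonClass_expMeasure (a : ℝ) : NullSingletonClass (expMeasure a) := by
  unfold expMeasure gammaMeasure
  infer_instance

lemma ae_expMeasure_pos (ha : 0 < a) : ∀ᵐ x ∂expMeasure a, 0 < x := by
  rw [ae_iff]
  have : {x : ℝ | ¬ 0 < x} = Iic 0 := by ext; simp
  rw [this, expMeasure_Iic ha]
  simp

lemma expMeasure_Ici (ha : 0 < a) {x : ℝ} (hx : 0 ≤ x) :
    expMeasure a (Ici x) = ENNReal.ofReal (Real.exp (-(a * x))) := by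
  have := isProbabilityMeasure_expMeasure ha
  have := nullSingletonClass_expMeasure a
  have h1 : expMeasure a (Iio x) = expMeasure a (Iic x) := measure_congr Iio_ae_eq_Iic
  rw [← compl_Iio, prob_compl_eq_one_sub measurableSet_Iio, h1, expMeasure_Iic ha, if_pos hx,
    ← ENNReal.ofReal_one, ← ENNReal.ofReal_sub]
  · congr 1; ring
  · rw [sub_nonneg, Real.exp_le_one_iff]; nlinarith

/-- The left side is the distribution function of a sum of independent exponential variables with
rates `2 * a` and `a`. -/
lemma lintegral_expMeasure_Iic_sub (ha : 0 < a) {x : ℝ} (hx : 0 ≤ x) :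
    ∫⁻ s, expMeasure a (Iic (x - s)) ∂expMeasure (2 * a) =
      ENNReal.ofReal ((1 - Real.exp (-(a * x))) ^ 2) := by
  have hm : Measurable fun s : ℝ => expMeasure a (Iic (x - s)) := by
    simp only [expMeasure_Iic ha]
    refine ENNReal.measurable_ofReal.comp (Measurable.ite ?_ ?_ measurable_const)
    · exact measurableSet_le measurable_const (measurable_const.sub measurable_id)
    · fun_prop
  have hd : expMeasure (2 * a) = volume.withDensity (exponentialPDF (2 * a)) := rfl
  have hpm : Measurable (exponentialPDF (2 * a)) :=
    (measurable_exponentialPDFReal (2 * a)).ennreal_ofReal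
  rw [hd, lintegral_withDensity_eq_lintegral_mul _ hpm hm]
  let F : ℝ → ℝ := fun s => 2 * a * Real.exp (-(2 * a * s)) * (1 - Real.exp (-(a * (x - s))))
  have hF : (exponentialPDF (2 * a) * fun s : ℝ => expMeasure a (Iic (x - s))) =
      (Icc 0 x).indicator fun s => ENNReal.ofReal (F s) := by
    ext s
    simp only [Pi.mul_apply, exponentialPDF_eq, expMeasure_Iic ha, indicator, mem_Icc, F]
    by_cases h0 : 0 ≤ s
    · by_cases h1 : s ≤ x
      · rw [if_pos h0, if_pos (by linarith), if_pos ⟨h0, h1⟩, ← ENNReal.ofReal_mul (by positivity)]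
      · rw [if_neg (show ¬ 0 ≤ x - s by linarith), if_neg (fun hs : 0 ≤ s ∧ s ≤ x => h1 hs.2)]
        simp
    · rw [if_neg h0, if_neg (fun hs : 0 ≤ s ∧ s ≤ x => h0 hs.1)]; simp
  have hFc : Continuous F := by fun_prop
  rw [hF, lintegral_indicator measurableSet_Icc, ← ofReal_integral_eq_lintegral_ofReal]
  · rw [integral_Icc_eq_integral_Ioc, ← intervalIntegral.integral_of_le hx]
    rw [intervalIntegral.integral_eq_sub_of_hasDerivAt (f := fun s => -Real.exp (-(2 * a * s)) +
      2 * Real.exp (-(a * x)) * Real.exp (-(a * s)))]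
    · congr 1
      have : Real.exp (-(2 * a * x)) = Real.exp (-(a * x)) * Real.exp (-(a * x)) := by
        rw [← Real.exp_add]; congr 1; ring
      rw [this]
      simp
      ring
    · intro s _
      have h1 : HasDerivAt (fun s => -Real.exp (-(2 * a * s))) (2 * a * Real.exp (-(2 * a * s))) s :=
        hasDerivAt_neg_exp_mul_exp
      have h2 : HasDerivAt (fun s => -Real.exp (-(a * s))) (a * Real.exp (-(a * s))) s :=
        hasDerivAt_neg_exp_mul_exp
      convert h1.sub (h2.const_mul (2 * Real.exp (-(a * x)))) using 1
      · ext s; simp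
      · have : Real.exp (-(2 * a * s)) * Real.exp (-(a * (x - s))) =
            Real.exp (-(a * x)) * Real.exp (-(a * s)) := by
          rw [← Real.exp_add, ← Real.exp_add]; congr 1; ring
        simp only [F]
        linear_combination (-2 * a) * this
    · exact hFc.intervalIntegrable _ _
  · exact hFc.continuousOn.integrableOn_Icc
  · refine (ae_restrict_iff' measurableSet_Icc).2 (Eventually.of_forall fun s hs => ?_)
    refine mul_nonneg (by positivity) ?_
    rw [sub_nonneg, Real.exp_le_one_iff]
    have := mul_nonneg ha.le (sub_nonneg.2 hs.2)
    linarith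

/-- An exponential variable arises from one of twice the rate, to which an independent copy of the
original variable is added with probability `1 / 2`. -/
lemma expMeasure_eq_mixture (ha : 0 < a) {A : Set ℝ} (hA : MeasurableSet A) :
    expMeasure a A = 2⁻¹ * expMeasure (2 * a) A +
      2⁻¹ * ∫⁻ s, expMeasure a {t | s + t ∈ A} ∂expMeasure (2 * a) := by
  have := isProbabilityMeasure_expMeasure ha
  have := isProbabilityMeasure_expMeasure (show 0 < 2 * a by linarith)
  have hadd : Measurable fun p : ℝ × ℝ => p.1 + p.2 := measurable_add
  have hmap : ∀ B, MeasurableSet B → (((expMeasure (2 * a)).prod (expMeasure a)).map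
      fun p => p.1 + p.2) B = ∫⁻ s, expMeasure a {t | s + t ∈ B} ∂expMeasure (2 * a) := by
    intro B hB
    rw [Measure.map_apply hadd hB, Measure.prod_apply (hadd hB)]
    rfl
  have : expMeasure a = (2⁻¹ : ℝ≥0∞) • expMeasure (2 * a) + (2⁻¹ : ℝ≥0∞) •
      (((expMeasure (2 * a)).prod (expMeasure a)).map fun p => p.1 + p.2) := by
    refine Measure.ext_of_Iic _ _ fun x => ?_
    rw [Measure.add_apply, Measure.smul_apply, Measure.smul_apply, hmap _ measurableSet_Iic]
    have h1 : ∀ s, {t : ℝ | s + t ∈ Iic x} = Iic (x - s) := fun s => by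
      ext t; simp [le_sub_iff_add_le']
    simp only [h1]
    rcases lt_or_ge x 0 with hx | hx
    · have h2 : ∫⁻ s, expMeasure a (Iic (x - s)) ∂expMeasure (2 * a) = 0 := by
        rw [← lintegral_zero (μ := expMeasure (2 * a))]
        refine lintegral_congr_ae ?_
        filter_upwards [ae_expMeasure_pos (show 0 < 2 * a by linarith)] with s hs
        rw [expMeasure_Iic ha, if_neg (by linarith)]; simp
      rw [h2, expMeasure_Iic ha, expMeasure_Iic (by linarith), if_neg (by linarith),
        if_neg (by linarith)]
      simp
    · rw [lintegral_expMeasure_Iic_sub ha hx, expMeasure_Iic ha, expMeasure_Iic (by linarith),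
        if_pos hx, if_pos hx, smul_eq_mul, smul_eq_mul, ← mul_add, ← ENNReal.ofReal_add]
      · have h2 : (2⁻¹ : ℝ≥0∞) = ENNReal.ofReal 2⁻¹ := by
          rw [ENNReal.ofReal_inv_of_pos two_pos]; simp
        rw [h2, ← ENNReal.ofReal_mul (by norm_num)]
        congr 1
        -- With `E = exp (-(a * x))` this is `(1 - E ^ 2) / 2 + (1 - E) ^ 2 / 2 = 1 - E`.
        have : Real.exp (-(2 * a * x)) = Real.exp (-(a * x)) * Real.exp (-(a * x)) := by
          rw [← Real.exp_add]; congr 1; ring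
        rw [this]; ring
      · rw [sub_nonneg, Real.exp_le_one_iff]
        have := mul_nonneg ha.le hx
        linarith
      · positivity
  conv_lhs => rw [this]
  rw [Measure.add_apply, Measure.smul_apply, Measure.smul_apply, hmap _ hA]
  rfl

end expMeasure

/-! ### The symmetric uniform distribution -/

section uniform

/-- The uniform distribution on `(-h, h)`. -/
def symmUniform (h : ℝ) : Measure ℝ := cond volume (Ioo (-h) h)

variable {h : ℝ}

lemma isProbabilityMeasure_symmUniform (hh : 0 < h) : IsProbabilityMeasure (symmUniform h) := by
  refine cond_isProbabilityMeasure_of_finite ?_ ?_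
  · simp; linarith
  · simp

lemma symmUniform_apply (h : ℝ) (A : Set ℝ) :
    symmUniform h A = (ENNReal.ofReal (2 * h))⁻¹ * volume (Ioo (-h) h ∩ A) := by
  rw [symmUniform, cond_apply measurableSet_Ioo, Real.volume_Ioo]
  congr 3; ring

lemma symmUniform_apply' (h : ℝ) (A : Set ℝ) :
    symmUniform h A = (ENNReal.ofReal (2 * h))⁻¹ * volume (Icc (-h) h ∩ A) := by
  rw [symmUniform_apply]
  congr 1
  exact measure_congr (Ioo_ae_eq_Icc.inter (ae_eq_refl _))

lemma nullSingletonClass_symmUniform (h : ℝ) : NullSingletonClass (symmUniform h) :=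
  ⟨fun x => by
    rw [symmUniform_apply]
    simp [measure_mono_null (inter_subset_right : Ioo (-h) h ∩ {x} ⊆ {x})]⟩

lemma ae_symmUniform (h : ℝ) : ∀ᵐ x ∂symmUniform h, |x| < h ∧ x ≠ 0 := by
  have := nullSingletonClass_symmUniform h
  have h1 : ∀ᵐ x ∂symmUniform h, x ≠ 0 := by simp [ae_iff]
  have h2 : ∀ᵐ x ∂symmUniform h, |x| < h := by
    rw [ae_iff, symmUniform_apply]
    have : Ioo (-h) h ∩ {x | ¬ |x| < h} = ∅ := by
      ext x; simp only [mem_inter_iff, mem_Ioo, mem_ofPred_eq, mem_empty_iff_false, abs_lt]; tauto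
    rw [this]; simp
  filter_upwards [h1, h2] with x h1 h2 using ⟨h2, h1⟩

/-- This treats long refreshment gaps, for which the factor of the machine is not positive: almost
surely the pending mark is then used at once. -/
lemma symmUniform_abs_le_of_nonpos {c : ℝ} (hc : c ≤ 0) (hh : 0 < h) :
    symmUniform h {x | |x| ≤ c * h} = 0 := by
  have := nullSingletonClass_symmUniform h
  refine measure_mono_null (t := {0}) (fun x hx => ?_) (measure_singleton 0)
  have hx : |x| ≤ c * h := hx
  have : |x| ≤ 0 := hx.trans (mul_nonpos_of_nonpos_of_nonneg hc hh.le)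
  simpa using this

/-- Conditionally on `|x| ≤ c h`, the variable `x / c` is again uniform. -/
lemma symmUniform_scale {c : ℝ} (hc : 0 < c) (hc1 : c ≤ 1) (hh : 0 < h) (B : Set ℝ) :
    symmUniform h {x | |x| ≤ c * h ∧ x / c ∈ B} = ENNReal.ofReal c * symmUniform h B := by
  rw [symmUniform_apply', symmUniform_apply']
  have : Icc (-h) h ∩ {x | |x| ≤ c * h ∧ x / c ∈ B} = (fun x => c⁻¹ * x) ⁻¹' (Icc (-h) h ∩ B) := by
    ext x
    have h1 : |x| ≤ c * h ↔ c⁻¹ * x ∈ Icc (-h) h := by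
      rw [mem_Icc, ← abs_le, abs_mul, abs_of_pos (inv_pos.2 hc), inv_mul_le_iff₀ hc]
    simp only [mem_inter_iff, mem_preimage, mem_ofPred_eq, ← h1, div_eq_inv_mul]
    refine ⟨fun h => h.2, fun hx => ⟨?_, hx⟩⟩
    rw [mem_Icc, ← abs_le]
    exact hx.1.trans (by nlinarith)
  rw [this, Real.volume_preimage_mul_left (inv_ne_zero hc.ne'), inv_inv, abs_of_pos hc]
  ring

lemma symmUniform_scale' {c : ℝ} (hc : 0 < c) (hc1 : c ≤ 1) (hh : 0 < h) (A : Set ℝ) :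
    ENNReal.ofReal c * symmUniform h {x | c * x ∈ A} = symmUniform h {x | |x| ≤ c * h ∧ x ∈ A} := by
  rw [← symmUniform_scale hc hc1 hh]
  congr 1
  ext x
  simp only [mem_ofPred_eq]
  rw [mul_div_cancel₀ _ hc.ne']

/-- The uniform distribution in terms of an exponential variable and a sign. -/
lemma symmUniform_eq (hh : 0 < h) : symmUniform h =
    (2⁻¹ : ℝ≥0∞) • (expMeasure (1 / h)).map (fun s => h * Real.exp (-s / h)) +
    (2⁻¹ : ℝ≥0∞) • (expMeasure (1 / h)).map (fun s => -(h * Real.exp (-s / h))) := by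
  have h1h : 0 < 1 / h := by positivity
  have hm : Measurable fun s : ℝ => h * Real.exp (-s / h) := by fun_prop
  -- The variable `h * exp (-s / h)` is at most `x` exactly when `s` is at least `-h * log (x / h)`,
  -- which for `0 < x ≤ h` has probability `x / h`.
  have hV : (expMeasure (1 / h)).map (fun s => h * Real.exp (-s / h)) =
      (ENNReal.ofReal h)⁻¹ • volume.restrict (Ioc 0 h) := by
    have := isProbabilityMeasure_expMeasure h1h
    have : IsProbabilityMeasure ((expMeasure (1 / h)).map (fun s => h * Real.exp (-s / h))) :=
      Measure.isProbabilityMeasure_map hm.aemeasurable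
    refine Measure.ext_of_Iic _ _ fun x => ?_
    rw [Measure.map_apply hm measurableSet_Iic, Measure.smul_apply,
      Measure.restrict_apply measurableSet_Iic, smul_eq_mul]
    rcases le_or_gt x 0 with hx | hx
    · have e1 : (fun s : ℝ => h * Real.exp (-s / h)) ⁻¹' Iic x = ∅ := by
        ext s
        have := mul_pos hh (Real.exp_pos (-s / h))
        simp only [mem_preimage, mem_Iic, mem_empty_iff_false, iff_false, not_le]
        linarith
      have e2 : Iic x ∩ Ioc 0 h = ∅ := by
        ext s; simp only [mem_inter_iff, mem_Iic, mem_Ioc, mem_empty_iff_false]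
        constructor
        · rintro ⟨h1, h2, h3⟩; linarith
        · exact False.elim
      simp [e1, e2]
    · have e2 : Iic x ∩ Ioc 0 h = Ioc 0 (min x h) := by
        ext s; simp only [mem_inter_iff, mem_Iic, mem_Ioc, le_min_iff]; tauto
      have e1 : (fun s : ℝ => h * Real.exp (-s / h)) ⁻¹' Iic x = Ici (-h * Real.log (x / h)) := by
        ext s
        simp only [mem_preimage, mem_Iic, mem_Ici]
        rw [← le_div_iff₀' hh, ← Real.le_log_iff_exp_le (by positivity), div_le_iff₀ hh]
        constructor <;> intro h <;> linarith
      rw [e1, e2, Real.volume_Ioc, sub_zero, ← ENNReal.ofReal_inv_of_pos hh,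
        ← ENNReal.ofReal_mul (by positivity)]
      rcases le_total x h with hxh | hxh
      · rw [expMeasure_Ici h1h, min_eq_left hxh]
        · have : -(1 / h * (-h * Real.log (x / h))) = Real.log (x / h) := by field_simp
          rw [this, Real.exp_log (by positivity), div_eq_inv_mul]
        · have := Real.log_nonpos (x := x / h) (by positivity) (by rwa [div_le_one hh])
          nlinarith
      · rw [min_eq_right hxh, inv_mul_cancel₀ hh.ne', ENNReal.ofReal_one]
        have hlog := Real.log_nonneg (x := x / h) (by rwa [le_div_iff₀ hh, one_mul])
        have : (Ioi (0 : ℝ)) ⊆ Ici (-h * Real.log (x / h)) := fun s (hs : 0 < s) => by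
          have := mul_nonneg hh.le hlog
          simp only [mem_Ici]; linarith
        refine le_antisymm prob_le_one ?_
        calc (1 : ℝ≥0∞) = expMeasure (1 / h) (Ioi 0) := by
              rw [(prob_compl_eq_zero_iff measurableSet_Ioi).1]
              exact ae_expMeasure_pos h1h
          _ ≤ _ := measure_mono this
  have hV' : (expMeasure (1 / h)).map (fun s => -(h * Real.exp (-s / h))) =
      (ENNReal.ofReal h)⁻¹ • volume.restrict (Ico (-h) 0) := by
    have : (fun s : ℝ => -(h * Real.exp (-s / h))) = (fun x => -x) ∘ fun s => h * Real.exp (-s / h) :=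
      rfl
    rw [this, ← Measure.map_map measurable_neg hm, hV, Measure.map_smul]
    congr 1
    ext A hA
    rw [Measure.map_apply measurable_neg hA, Measure.restrict_apply (measurable_neg hA),
      Measure.restrict_apply hA]
    have : (fun x : ℝ => -x) ⁻¹' A ∩ Ioc 0 h = (fun x : ℝ => -x) ⁻¹' (A ∩ Ico (-h) 0) := by
      ext x
      simp only [mem_inter_iff, mem_preimage, mem_Ioc, mem_Ico, neg_le_neg_iff, Left.neg_neg_iff]
      tauto
    rw [this]
    exact Measure.measure_preimage_neg _ _
  rw [hV, hV']
  ext A hA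
  rw [symmUniform_apply', Measure.add_apply, Measure.smul_apply, Measure.smul_apply,
    Measure.smul_apply, Measure.smul_apply, Measure.restrict_apply hA, Measure.restrict_apply hA]
  have e : volume (Icc (-h) h ∩ A) = volume (A ∩ Ioc 0 h) + volume (A ∩ Ico (-h) 0) := by
    have e1 : Icc (-h) h ∩ A = (Icc 0 h ∩ A) ∪ (A ∩ Ico (-h) 0) := by
      ext x
      simp only [mem_union, mem_inter_iff, mem_Icc, mem_Ico]
      constructor
      · rintro ⟨⟨h1, h2⟩, h3⟩
        rcases lt_or_ge x 0 with hx | hx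
        · exact Or.inr ⟨h3, h1, hx⟩
        · exact Or.inl ⟨⟨hx, h2⟩, h3⟩
      · rintro (⟨⟨h1, h2⟩, h3⟩ | ⟨h3, h1, h2⟩)
        · exact ⟨⟨by linarith, h2⟩, h3⟩
        · exact ⟨⟨h1, by linarith⟩, h3⟩
    rw [e1, measure_union _ (hA.inter measurableSet_Ico), inter_comm A (Ioc 0 h)]
    · congr 1
      exact measure_congr (Ioc_ae_eq_Icc.symm.inter (ae_eq_refl _))
    · rw [Set.disjoint_left]
      rintro x ⟨⟨h1, -⟩, -⟩ ⟨-, -, h2⟩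
      linarith
  rw [e, ENNReal.ofReal_mul two_pos.le, ENNReal.mul_inv (by simp) (by simp)]
  simp only [smul_eq_mul, ENNReal.ofReal_ofNat]
  ring

end uniform

/-! ### The machine that turns marks into refreshed positions -/

section latentMachine

/-- One refreshment: the pending mark `ξ 0` is used if it is far enough from the centre, otherwise
the position comes from `φ 0` and the mark is rescaled. -/
def refreshStep (h c : ℝ) (s : (ℕ → ℝ) × (ℕ → ℝ)) : ℝ × (ℕ → ℝ) × (ℕ → ℝ) :=
  if c * h < |s.1 0| then (s.1 0, fun n => s.1 (n + 1), fun n => s.2 (n + 1))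
  else (c * s.2 0, consSeq (s.1 0 / c) (fun n => s.1 (n + 1)), fun n => s.2 (n + 1))

lemma measurable_refreshStep_uncurry (h : ℝ) :
    Measurable fun p : ℝ × (ℕ → ℝ) × (ℕ → ℝ) => refreshStep h p.1 p.2 := by
  have h1 : Measurable fun p : ℝ × (ℕ → ℝ) × (ℕ → ℝ) => p.2.1 := measurable_snd.fst
  have h2 : Measurable fun p : ℝ × (ℕ → ℝ) × (ℕ → ℝ) => p.2.2 := measurable_snd.snd
  have h10 := (measurable_pi_apply (X := fun _ : ℕ => ℝ) 0).comp h1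
  have h20 := (measurable_pi_apply (X := fun _ : ℕ => ℝ) 0).comp h2
  refine Measurable.ite (measurableSet_lt (measurable_fst.mul_const h) h10.abs) ?_ ?_
  · exact h10.prodMk ((measurable_seqTail.comp h1).prodMk (measurable_seqTail.comp h2))
  · exact (measurable_fst.mul h20).prodMk ((measurable_consSeq.comp ((h10.div measurable_fst).prodMk
      (measurable_seqTail.comp h1))).prodMk (measurable_seqTail.comp h2))

lemma measurable_refreshStep (h c : ℝ) : Measurable (refreshStep h c) :=
  (measurable_refreshStep_uncurry h).comp measurable_prodMk_left

/-- The output is `ξ 0` beyond the threshold `c * h`, and below it a fresh uniform variable scaled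
to `[-c * h, c * h]`; altogether it is uniform. In the second case `ξ 0 / c` is uniform again and
independent of the output, so the state has its old law, independently of the output. -/
lemma measurePreserving_refreshStep {h c : ℝ} (hh : 0 < h) (hc : c ≤ 1) :
    MeasurePreserving (refreshStep h c)
      ((Measure.infinitePi fun _ : ℕ => symmUniform h).prod
        (Measure.infinitePi fun _ : ℕ => symmUniform h))
      ((symmUniform h).prod ((Measure.infinitePi fun _ : ℕ => symmUniform h).prod
        (Measure.infinitePi fun _ : ℕ => symmUniform h))) := by
  have := isProbabilityMeasure_symmUniform hh
  set U := symmUniform h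
  set I := Measure.infinitePi fun _ : ℕ => U
  have hHT : MeasurePreserving (fun ω : ℕ → ℝ => (ω 0, fun n => ω (n + 1))) I (U.prod I) :=
    measurePreserving_headTail U
  refine ⟨measurable_refreshStep h c, Measure.ext_prod₃ fun {A B C} hA hB hC => ?_⟩
  rw [Measure.map_apply (measurable_refreshStep h c) (hA.prod (hB.prod hC)), Measure.prod_prod,
    Measure.prod_prod]
  let S1 : Set (ℕ → ℝ) := {ω | c * h < |ω 0| ∧ ω 0 ∈ A ∧ (fun n => ω (n + 1)) ∈ B}
  let S2 : Set (ℕ → ℝ) := {ω | |ω 0| ≤ c * h ∧ consSeq (ω 0 / c) (fun n => ω (n + 1)) ∈ B}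
  let R1 : Set (ℝ × (ℕ → ℝ)) := {x | c * h < |x| ∧ x ∈ A} ×ˢ B
  let R2 : Set (ℝ × (ℕ → ℝ)) := {p | |p.1| ≤ c * h ∧ consSeq (p.1 / c) p.2 ∈ B}
  have hlt : MeasurableSet {x : ℝ | c * h < |x|} := measurableSet_lt measurable_const measurable_abs
  have hle : MeasurableSet {x : ℝ | |x| ≤ c * h} := measurableSet_le measurable_abs measurable_const
  have hR1 : MeasurableSet R1 := (hlt.inter hA).prod hB
  have hR2 : MeasurableSet R2 := (measurable_fst hle).inter
    (measurable_consSeq.comp ((measurable_fst.div_const c).prodMk measurable_snd) hB)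
  have hS1 : MeasurableSet S1 := hHT.measurable hR1 |>.congr (by ext; simp [R1, S1, and_assoc])
  have hS2 : MeasurableSet S2 := hHT.measurable hR2
  have e1 : I S1 = U {x | c * h < |x| ∧ x ∈ A} * I B := by
    rw [← Measure.prod_prod, ← hHT.measure_preimage hR1.nullMeasurableSet]
    congr 1; ext; simp [R1, S1, and_assoc]
  have e2 : I S2 = ∫⁻ s, U {x | |x| ≤ c * h ∧ consSeq (x / c) s ∈ B} ∂I := by
    change I ((fun ω : ℕ → ℝ => (ω 0, fun n => ω (n + 1))) ⁻¹' R2) = _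
    rw [hHT.measure_preimage hR2.nullMeasurableSet, Measure.prod_apply_symm hR2]
    rfl
  -- For `0 < c` both sides are `c` times the probability of `c * x ∈ A` times `I B`; for `c ≤ 0`
  -- both vanish.
  have e3 : I S2 * U {x | c * x ∈ A} = U {x | |x| ≤ c * h ∧ x ∈ A} * I B := by
    rcases le_or_gt c 0 with hc0 | hc0
    · have h0 := symmUniform_abs_le_of_nonpos hc0 hh
      have h1 : U {x | |x| ≤ c * h ∧ x ∈ A} = 0 := measure_mono_null (fun x hx => hx.1) h0
      have h2 : I S2 = 0 := by
        rw [e2]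
        refine (lintegral_congr fun s => ?_).trans lintegral_zero
        exact measure_mono_null (fun x hx => hx.1) h0
      rw [h1, h2, zero_mul, zero_mul]
    · have h2 : I S2 = ENNReal.ofReal c * I B := by
        have hcons : MeasurableSet ((fun p : ℝ × (ℕ → ℝ) => consSeq p.1 p.2) ⁻¹' B) :=
          measurable_consSeq hB
        have h3 : ∀ s, U {x | |x| ≤ c * h ∧ consSeq (x / c) s ∈ B} =
            ENNReal.ofReal c * U {x | consSeq x s ∈ B} := fun s =>
          symmUniform_scale hc0 hc hh {x | consSeq x s ∈ B}
        rw [e2]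
        simp only [h3]
        rw [lintegral_const_mul' _ _ ENNReal.ofReal_ne_top]
        congr 1
        rw [← (measurePreserving_consSeq U).measure_preimage hB.nullMeasurableSet,
          Measure.prod_apply_symm hcons]
        rfl
      rw [h2, ← symmUniform_scale' hc0 hc hh A]
      ring
  have hset : refreshStep h c ⁻¹' (A ×ˢ B ×ˢ C) =
      (S1 ×ˢ ((fun ω : ℕ → ℝ => fun n => ω (n + 1)) ⁻¹' C)) ∪
      (S2 ×ˢ {φ | c * φ 0 ∈ A ∧ (fun n => φ (n + 1)) ∈ C}) := by
    ext ⟨ξ, φ⟩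
    simp only [mem_preimage, refreshStep, mem_union, mem_prod, S1, S2, mem_ofPred_eq]
    split_ifs with hlt
    · simp [hlt, and_assoc]
    · simp only [hlt, not_lt.1 hlt, false_and, true_and, false_or]
      tauto
  have hC1 : MeasurableSet ((fun ω : ℕ → ℝ => fun n => ω (n + 1)) ⁻¹' C) := measurable_seqTail hC
  have hcA : MeasurableSet {x : ℝ | c * x ∈ A} := (measurable_const_mul c) hA
  have hC2 : MeasurableSet {φ : ℕ → ℝ | c * φ 0 ∈ A ∧ (fun n => φ (n + 1)) ∈ C} :=
    hHT.measurable (hcA.prod hC)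
  have f1 : I ((fun ω : ℕ → ℝ => fun n => ω (n + 1)) ⁻¹' C) = I C := by
    have h1 := hHT.measure_preimage (s := univ ×ˢ C) (MeasurableSet.univ.prod hC).nullMeasurableSet
    rw [Measure.prod_prod, measure_univ, one_mul] at h1
    rw [← h1]
    congr 1; ext; simp
  have f2 : I {φ : ℕ → ℝ | c * φ 0 ∈ A ∧ (fun n => φ (n + 1)) ∈ C} = U {x | c * x ∈ A} * I C := by
    rw [← Measure.prod_prod, ← hHT.measure_preimage (hcA.prod hC).nullMeasurableSet]
    rfl
  rw [hset, measure_union _ (hS2.prod hC2), Measure.prod_prod, Measure.prod_prod, e1, f1, f2,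
    ← mul_assoc, e3, ← add_mul, ← add_mul, ← mul_assoc]
  · congr 2
    rw [← measure_union (s₂ := {x | |x| ≤ c * h ∧ x ∈ A}) _ (hle.inter hA)]
    · congr 1
      ext x
      simp only [mem_union, mem_ofPred_eq]
      rcases lt_or_ge (c * h) |x| with hx | hx
      · simp [hx]
      · simp [hx]
    · rw [Set.disjoint_left]
      rintro x ⟨h1, -⟩ ⟨h2, -⟩
      exact absurd h1 (not_lt.2 h2)
  · rw [Set.disjoint_left]
    rintro x ⟨⟨h1, -⟩, -⟩ ⟨⟨h2, -⟩, -⟩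
    exact absurd h1 (not_lt.2 h2)

/-- The factor of the machine for the gaps `f` between refreshments at rate `r`. -/
def refreshFactor (h r : ℝ) (f : ℕ → ℝ) (n : ℕ) : ℝ := 1 - f (n + 1) / (r * h)

/-- The refreshed positions. -/
def refreshedPos (h r : ℝ) (f : ℕ → ℝ) (s : (ℕ → ℝ) × (ℕ → ℝ)) : ℕ → ℝ :=
  machineOutput (fun n => refreshStep h (refreshFactor h r f n)) s

lemma measurable_refreshedPos (h r : ℝ) :
    Measurable fun p : (ℕ → ℝ) × (ℕ → ℝ) × (ℕ → ℝ) => refreshedPos h r p.1 p.2 := by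
  have hc : ∀ n, Measurable fun p : (ℕ → ℝ) × (ℕ → ℝ) × (ℕ → ℝ) => refreshFactor h r p.1 n := by
    intro n
    exact measurable_const.sub (((measurable_pi_apply (n + 1)).comp measurable_fst).div_const _)
  have hs : ∀ n, Measurable fun p : (ℕ → ℝ) × (ℕ → ℝ) × (ℕ → ℝ) =>
      machineState (fun n => refreshStep h (refreshFactor h r p.1 n)) p.2 n := by
    intro n
    induction n with
    | zero => exact measurable_snd
    | succ n ih => exact ((measurable_refreshStep_uncurry h).comp ((hc n).prodMk ih)).snd
  exact measurable_pi_lambda _ fun n =>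
    ((measurable_refreshStep_uncurry h).comp ((hc n).prodMk (hs n))).fst

/-- The refreshed positions are independent and uniform, also jointly with the refreshment times. -/
lemma measurePreserving_refreshedPos {h r : ℝ} (hh : 0 < h) (hr : 0 < r) :
    MeasurePreserving (fun p : (ℕ → ℝ) × (ℕ → ℝ) × (ℕ → ℝ) => (p.1, refreshedPos h r p.1 p.2))
      ((Measure.infinitePi fun _ : ℕ => expMeasure 1).prod
        ((Measure.infinitePi fun _ : ℕ => symmUniform h).prod
          (Measure.infinitePi fun _ : ℕ => symmUniform h)))
      ((Measure.infinitePi fun _ : ℕ => expMeasure 1).prod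
        (Measure.infinitePi fun _ : ℕ => symmUniform h)) := by
  have := isProbabilityMeasure_symmUniform hh
  have := isProbabilityMeasure_expMeasure one_pos
  -- For fixed refreshment gaps the factors are constants, at most `1` as the gaps are positive; the
  -- machine then yields the conditional law of the positions, which does not depend on the gaps.
  refine MeasurePreserving.skew_product (MeasurePreserving.id _)
    (g := fun f s => refreshedPos h r f s) (measurable_refreshedPos h r) ?_
  have hpos : ∀ᵐ f ∂(Measure.infinitePi fun _ : ℕ => expMeasure 1), ∀ n, 0 < f n := by
    rw [ae_all_iff]
    intro n
    exact (measurePreserving_eval_infinitePi (fun _ : ℕ => expMeasure 1) n).quasiMeasurePreserving.ae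
      (ae_expMeasure_pos one_pos)
  filter_upwards [hpos] with f hf
  refine (measurePreserving_machineOutput fun n => measurePreserving_refreshStep hh ?_).map_eq
  have : 0 ≤ f (n + 1) / (r * h) := by have := hf (n + 1); positivity
  unfold refreshFactor
  linarith

end latentMachine

/-! ### The law of the sticking times -/

section sticking

/-- The mark gap that belongs to a signed mark. -/
def markGap (h x : ℝ) : ℝ := -h * Real.log (|x| / h)

lemma measurable_markGap (h : ℝ) : Measurable (markGap h) :=
  (Real.measurable_log.comp (measurable_abs.div_const h)).const_mul (-h)

lemma markGap_exp {h : ℝ} (hh : 0 < h) (s : ℝ) : markGap h (h * Real.exp (-s / h)) = s := by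
  rw [markGap, abs_of_pos (by positivity), mul_div_cancel_left₀ _ hh.ne', Real.log_exp]
  field_simp

lemma markGap_neg (h x : ℝ) : markGap h (-x) = markGap h x := by simp [markGap]

/-- The index of the first positive mark. -/
def firstPos (ξ : ℕ → ℝ) : ℕ := sInf {n | 0 < ξ n}

/-- The total gap up to the first positive mark, and the subsequent marks. -/
def stickStep (h : ℝ) (ξ : ℕ → ℝ) : ℝ × (ℕ → ℝ) :=
  (∑ j ∈ Finset.range (firstPos ξ + 1), markGap h (ξ j), fun n => ξ (n + (firstPos ξ + 1)))

lemma firstPos_of_pos {ξ : ℕ → ℝ} (h : 0 < ξ 0) : firstPos ξ = 0 :=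
  Nat.sInf_eq_zero.2 (Or.inl h)

lemma firstPos_consSeq {x : ℝ} {s : ℕ → ℝ} (hx : x ≤ 0) (hs : ∃ n, 0 < s n) :
    firstPos (consSeq x s) = firstPos s + 1 := by
  have h1 : 0 < s (firstPos s) := Nat.sInf_mem hs
  apply le_antisymm
  · exact Nat.sInf_le (show 0 < consSeq x s (firstPos s + 1) from h1)
  · have hne : {n | 0 < consSeq x s n}.Nonempty := ⟨firstPos s + 1, h1⟩
    have h2 : 0 < consSeq x s (firstPos (consSeq x s)) := Nat.sInf_mem hne
    rcases h : firstPos (consSeq x s) with _ | m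
    · rw [h] at h2; exact absurd h2 (not_lt.2 hx)
    · rw [h] at h2
      exact Nat.succ_le_succ (Nat.sInf_le h2)

lemma measurable_firstPos : Measurable firstPos := by
  refine measurable_to_countable' fun n => ?_
  have h1 : ∀ k, MeasurableSet {ξ : ℕ → ℝ | 0 < ξ k} := fun k =>
    measurableSet_lt measurable_const (measurable_pi_apply k)
  have hlt : ∀ m, MeasurableSet {ξ : ℕ → ℝ | ∀ k < m, ¬ 0 < ξ k} := fun m => by
    have : {ξ : ℕ → ℝ | ∀ k < m, ¬ 0 < ξ k} = ⋂ k ∈ Finset.range m, {ξ | 0 < ξ k}ᶜ := by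
      ext; simp
    rw [this]
    exact Finset.measurableSet_biInter _ fun k _ => (h1 k).compl
  have hnone : MeasurableSet {ξ : ℕ → ℝ | ∀ k, ¬ 0 < ξ k} := by
    have : {ξ : ℕ → ℝ | ∀ k, ¬ 0 < ξ k} = ⋂ k, {ξ | 0 < ξ k}ᶜ := by ext; simp
    rw [this]
    exact MeasurableSet.iInter fun k => (h1 k).compl
  have key : ∀ ξ : ℕ → ℝ, firstPos ξ = n ↔
      (0 < ξ n ∧ ∀ k < n, ¬ 0 < ξ k) ∨ (n = 0 ∧ ∀ k, ¬ 0 < ξ k) := by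
    intro ξ
    constructor
    · rintro rfl
      by_cases hex : ∃ k, 0 < ξ k
      · exact Or.inl ⟨Nat.sInf_mem hex, fun k hk h => absurd (Nat.sInf_le h) (not_le.2 hk)⟩
      · refine Or.inr ⟨Nat.sInf_eq_zero.2 (Or.inr ?_), not_exists.1 hex⟩
        ext k; simpa using not_exists.1 hex k
    · rintro (⟨h1, h2⟩ | ⟨rfl, h2⟩)
      · refine le_antisymm (Nat.sInf_le h1) (le_csInf ⟨n, h1⟩ fun k hk => ?_)
        by_contra hc
        exact h2 k (not_le.1 hc) hk
      · exact Nat.sInf_eq_zero.2 (Or.inr (by ext k; simpa using h2 k))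
  have : firstPos ⁻¹' {n} = ({ξ | 0 < ξ n} ∩ {ξ | ∀ k < n, ¬ 0 < ξ k}) ∪
      ({ξ | n = 0} ∩ {ξ | ∀ k, ¬ 0 < ξ k}) := by
    ext ξ
    exact key ξ
  rw [this]
  exact ((h1 n).inter (hlt n)).union ((MeasurableSet.const _).inter hnone)

lemma measurable_stickStep (h : ℝ) : Measurable (stickStep h) := by
  have hcomp : ∀ {β : Type} [MeasurableSpace β] (F : ℕ → (ℕ → ℝ) → β), (∀ m, Measurable (F m)) →
      Measurable fun ξ : ℕ → ℝ => F (firstPos ξ) ξ := by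
    intro β _ F hF
    have : Measurable fun p : ℕ × (ℕ → ℝ) => F p.1 p.2 :=
      measurable_from_prod_countable_right fun m => hF m
    exact this.comp (measurable_firstPos.prodMk measurable_id)
  refine (hcomp (fun m ξ => ∑ j ∈ Finset.range (m + 1), markGap h (ξ j)) fun m => ?_).prodMk
    (hcomp (fun m ξ => fun n => ξ (n + (m + 1))) fun m => ?_)
  · exact Finset.measurable_sum _ fun j _ => (measurable_markGap h).comp (measurable_pi_apply j)
  · exact measurable_pi_lambda _ fun n => measurable_pi_apply _

lemma stickStep_consSeq_of_pos {h x : ℝ} (hx : 0 < x) (s : ℕ → ℝ) :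
    stickStep h (consSeq x s) = (markGap h x, s) := by
  have : firstPos (consSeq x s) = 0 := firstPos_of_pos hx
  simp [stickStep, this]

lemma stickStep_consSeq_of_nonpos {h x : ℝ} (hx : x ≤ 0) {s : ℕ → ℝ} (hs : ∃ n, 0 < s n) :
    stickStep h (consSeq x s) = (markGap h x + (stickStep h s).1, (stickStep h s).2) := by
  rw [stickStep, firstPos_consSeq hx hs, Finset.sum_range_succ']
  simp only [consSeq_succ, consSeq_zero, stickStep]
  rw [add_comm]
  rfl

variable {h : ℝ}

lemma symmUniform_nonpos (hh : 0 < h) : symmUniform h {x | ¬ 0 < x} = 2⁻¹ := by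
  have h1h : 0 < 1 / h := by positivity
  have := isProbabilityMeasure_expMeasure h1h
  have hm : MeasurableSet {x : ℝ | ¬ 0 < x} := (measurableSet_lt measurable_const measurable_id).compl
  rw [symmUniform_eq hh, Measure.add_apply, Measure.smul_apply, Measure.smul_apply,
    Measure.map_apply (by fun_prop) hm, Measure.map_apply (by fun_prop) hm]
  have e1 : (fun s : ℝ => h * Real.exp (-s / h)) ⁻¹' {x | ¬ 0 < x} = ∅ := by
    ext s
    simp only [mem_preimage, mem_ofPred_eq, mem_empty_iff_false, iff_false, not_not]
    positivity
  have e2 : (fun s : ℝ => -(h * Real.exp (-s / h))) ⁻¹' {x | ¬ 0 < x} = univ := by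
    ext s
    have : 0 < h * Real.exp (-s / h) := by positivity
    simp only [mem_preimage, mem_ofPred_eq, mem_univ, iff_true]
    linarith
  rw [e1, e2, measure_univ]
  simp

/-- A run of `N` consecutive marks without a positive one has probability `2⁻¹ ^ N`. -/
lemma ae_infinite_pos (hh : 0 < h) :
    ∀ᵐ ξ ∂(Measure.infinitePi fun _ : ℕ => symmUniform h), {n | 0 < ξ n}.Infinite := by
  have := isProbabilityMeasure_symmUniform hh
  have hk : ∀ k, ∀ᵐ ξ ∂(Measure.infinitePi fun _ : ℕ => symmUniform h), ∃ n ≥ k, 0 < ξ n := by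
    intro k
    rw [ae_iff]
    have hle : ∀ N : ℕ, (Measure.infinitePi fun _ : ℕ => symmUniform h)
        {ξ | ¬ ∃ n ≥ k, 0 < ξ n} ≤ (2⁻¹ : ℝ≥0∞) ^ N := by
      intro N
      have hm : MeasurableSet {x : ℝ | ¬ 0 < x} :=
        (measurableSet_lt measurable_const measurable_id).compl
      calc _ ≤ (Measure.infinitePi fun _ : ℕ => symmUniform h)
            ((Finset.Ico k (k + N) : Set ℕ).pi fun _ => {x | ¬ 0 < x}) := by
            refine measure_mono fun ξ hξ n hn => ?_
            simp only [Finset.coe_Ico, mem_Ico] at hn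
            simp only [mem_ofPred_eq, not_exists, not_and] at hξ
            exact hξ n hn.1
        _ = _ := by
            rw [Measure.infinitePi_pi _ fun _ _ => hm, symmUniform_nonpos hh]
            simp
    refine le_antisymm (ge_of_tendsto' (ENNReal.tendsto_pow_atTop_nhds_zero_of_lt_one ?_) hle) bot_le
    exact ENNReal.inv_lt_one.2 (by norm_num)
  filter_upwards [ae_all_iff.2 hk] with ξ hξ
  rw [Set.infinite_iff_exists_gt]
  intro k
  obtain ⟨n, hn, hn'⟩ := hξ (k + 1)
  exact ⟨n, hn', by omega⟩

/-- Two families of values that satisfy the same contractive equation are equal. -/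
lemma le_of_mixture {lam : Measure ℝ} [IsProbabilityMeasure lam] {b m m' : Set ℝ → ℝ≥0∞}
    (h1 : ∀ A, MeasurableSet A → m A ≤ 1)
    (h : ∀ A, MeasurableSet A → m A = 2⁻¹ * b A + 2⁻¹ * ∫⁻ s, m {t | s + t ∈ A} ∂lam)
    (h' : ∀ A, MeasurableSet A → m' A = 2⁻¹ * b A + 2⁻¹ * ∫⁻ s, m' {t | s + t ∈ A} ∂lam)
    {A : Set ℝ} (hA : MeasurableSet A) : m A ≤ m' A := by
  -- Each use of the equation halves the error, which at the start is at most `1`.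
  have key : ∀ n : ℕ, ∀ A, MeasurableSet A → m A ≤ m' A + 2⁻¹ ^ n := by
    intro n
    induction n with
    | zero => intro A hA; simpa using (h1 A hA).trans le_add_self
    | succ n ih =>
      intro A hA
      rw [h A hA, h' A hA]
      calc 2⁻¹ * b A + 2⁻¹ * ∫⁻ s, m {t | s + t ∈ A} ∂lam
          ≤ 2⁻¹ * b A + 2⁻¹ * ∫⁻ s, (m' {t | s + t ∈ A} + 2⁻¹ ^ n) ∂lam := by
            gcongr with s
            exact ih _ ((measurable_const_add s) hA)
        _ = _ := by
            rw [lintegral_add_right _ measurable_const, lintegral_const, measure_univ, mul_one,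
              mul_add, ← add_assoc, pow_succ' (2⁻¹ : ℝ≥0∞)]
  have hlim : Tendsto (fun n : ℕ => m' A + (2⁻¹ : ℝ≥0∞) ^ n) atTop (𝓝 (m' A + 0)) :=
    tendsto_const_nhds.add (ENNReal.tendsto_pow_atTop_nhds_zero_of_lt_one
      (ENNReal.inv_lt_one.2 (by norm_num)))
  rw [add_zero] at hlim
  exact ge_of_tendsto' hlim fun n => key n A hA

/-- Conditioning on the first mark: with probability `1 / 2` it is positive and its own gap is the
total; otherwise its gap is added to an independent copy of the total. By `expMeasure_eq_mixture`
the exponential law with mean `2 * h` solves the same equation, whose solution is unique by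
`le_of_mixture`. The event `B` of the subsequent marks is carried along, which gives the
independence as well. -/
lemma measurePreserving_stickStep (hh : 0 < h) :
    MeasurePreserving (stickStep h) (Measure.infinitePi fun _ : ℕ => symmUniform h)
      ((expMeasure (1 / (2 * h))).prod (Measure.infinitePi fun _ : ℕ => symmUniform h)) := by
  have := isProbabilityMeasure_symmUniform hh
  have ha : 0 < 1 / (2 * h) := by positivity
  have h2a : 2 * (1 / (2 * h)) = 1 / h := by field_simp
  have h1h : 0 < 1 / h := by positivity
  have := isProbabilityMeasure_expMeasure ha
  have := isProbabilityMeasure_expMeasure h1h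
  set U := symmUniform h with hU
  set I := Measure.infinitePi fun _ : ℕ => U with hI
  refine ⟨measurable_stickStep h, (Measure.prod_eq fun A B hA hB => ?_).symm⟩
  rw [Measure.map_apply (measurable_stickStep h) (hA.prod hB)]
  set lam := expMeasure (1 / h)
  set b : Set ℝ → ℝ≥0∞ := fun A => lam A * I B
  set m : Set ℝ → ℝ≥0∞ := fun A => I (stickStep h ⁻¹' (A ×ˢ B))
  set m' : Set ℝ → ℝ≥0∞ := fun A => expMeasure (1 / (2 * h)) A * I B
  have hm' : ∀ A, MeasurableSet A → m' A = 2⁻¹ * b A + 2⁻¹ * ∫⁻ s, m' {t | s + t ∈ A} ∂lam := by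
    intro A hA
    simp only [m', b]
    rw [lintegral_mul_const' _ _ (measure_ne_top _ _), ← mul_assoc, ← mul_assoc, ← add_mul]
    congr 1
    rw [expMeasure_eq_mixture ha hA, h2a]
  have hm : ∀ A, MeasurableSet A → m A = 2⁻¹ * b A + 2⁻¹ * ∫⁻ s, m {t | s + t ∈ A} ∂lam := by
    intro A hA
    have hD := measurable_stickStep h (hA.prod hB)
    have hD' := measurable_consSeq hD
    simp only [m, b]
    rw [← (measurePreserving_consSeq U).measure_preimage hD.nullMeasurableSet,
      Measure.prod_apply hD']
    have hφ : Measurable fun x => I (Prod.mk x ⁻¹' ((fun p : ℝ × (ℕ → ℝ) => consSeq p.1 p.2) ⁻¹'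
      (stickStep h ⁻¹' (A ×ˢ B)))) := measurable_measure_prodMk_left hD'
    rw [show ∫⁻ x, I (Prod.mk x ⁻¹' ((fun p : ℝ × (ℕ → ℝ) => consSeq p.1 p.2) ⁻¹'
      (stickStep h ⁻¹' (A ×ˢ B)))) ∂U = ∫⁻ x, I (Prod.mk x ⁻¹' ((fun p : ℝ × (ℕ → ℝ) =>
      consSeq p.1 p.2) ⁻¹' (stickStep h ⁻¹' (A ×ˢ B)))) ∂((2⁻¹ : ℝ≥0∞) •
      lam.map (fun s => h * Real.exp (-s / h)) +
      (2⁻¹ : ℝ≥0∞) • lam.map (fun s => -(h * Real.exp (-s / h)))) from by rw [← symmUniform_eq hh]]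
    rw [lintegral_add_measure, lintegral_smul_measure, lintegral_smul_measure,
      lintegral_map hφ (by fun_prop), lintegral_map hφ (by fun_prop), smul_eq_mul, smul_eq_mul]
    congr 2
    · have : ∀ s, I (Prod.mk (h * Real.exp (-s / h)) ⁻¹' ((fun p : ℝ × (ℕ → ℝ) =>
          consSeq p.1 p.2) ⁻¹' (stickStep h ⁻¹' (A ×ˢ B)))) = A.indicator (fun _ => I B) s := by
        intro s
        have hset : Prod.mk (h * Real.exp (-s / h)) ⁻¹' ((fun p : ℝ × (ℕ → ℝ) =>
          consSeq p.1 p.2) ⁻¹' (stickStep h ⁻¹' (A ×ˢ B))) = {t | s ∈ A ∧ t ∈ B} := by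
          ext t
          simp only [mem_preimage, mem_ofPred_eq]
          rw [stickStep_consSeq_of_pos (by positivity), markGap_exp hh]
          rfl
        rw [hset]
        by_cases hs : s ∈ A <;> simp [hs]
      simp only [this]
      rw [lintegral_indicator hA, setLIntegral_const, mul_comm]
    · refine lintegral_congr fun s => ?_
      refine measure_congr ?_
      filter_upwards [ae_infinite_pos hh] with t ht
      obtain ⟨n, hn⟩ := ht.nonempty
      rw [eq_iff_iff]
      change stickStep h (consSeq (-(h * Real.exp (-s / h))) t) ∈ A ×ˢ B ↔
        stickStep h t ∈ {t | s + t ∈ A} ×ˢ B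
      rw [stickStep_consSeq_of_nonpos (neg_nonpos.2 (by positivity)) ⟨n, hn⟩, markGap_neg,
        markGap_exp hh]
      rfl
  refine le_antisymm (le_of_mixture (fun A _ => prob_le_one) hm hm' hA) (le_of_mixture
    (fun A _ => ?_) hm' hm hA)
  exact mul_le_one' prob_le_one prob_le_one

/-- The sticking times in terms of the signed marks. -/
def stickTimes (h : ℝ) : (ℕ → ℝ) → ℕ → ℝ := machineOutput fun _ => stickStep h

lemma measurePreserving_stickTimes (hh : 0 < h) :
    MeasurePreserving (stickTimes h) (Measure.infinitePi fun _ : ℕ => symmUniform h)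
      (Measure.infinitePi fun _ : ℕ => expMeasure (1 / (2 * h))) := by
  have := isProbabilityMeasure_symmUniform hh
  have := isProbabilityMeasure_expMeasure (show 0 < 1 / (2 * h) by positivity)
  exact measurePreserving_machineOutput fun _ => measurePreserving_stickStep hh

open Classical in
lemma stickTimes_eq (h : ℝ) {ξ : ℕ → ℝ} (hξ : {n | 0 < ξ n}.Infinite) (k : ℕ) :
    stickTimes h ξ k = compoundGap (fun n => markGap h (ξ n)) (fun n => 0 < ξ n) k := by
  set p : ℕ → Prop := fun n => 0 < ξ n
  -- `N k` is the number of marks consumed by the first `k` transitions: the index following the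
  -- last positive mark that was used.
  let N : ℕ → ℕ := fun k => if k = 0 then 0 else Nat.nth p (k - 1) + 1
  have hcount : ∀ k, Nat.count p (N k) = k := by
    intro k
    cases k with
    | zero => simp [N]
    | succ k =>
      simp only [N, Nat.succ_ne_zero, if_false, Nat.add_sub_cancel]
      rw [Nat.count_succ, Nat.count_nth_of_infinite hξ, if_pos (Nat.nth_mem_of_infinite hξ k)]
  have hfirst : ∀ k, firstPos (fun j => ξ (j + N k)) + N k = Nat.nth p k := by
    intro k
    have h1 : Nat.nth p k = sInf {i | p i ∧ N k ≤ i} := by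
      conv_lhs => rw [← hcount k]
      exact Nat.nth_count_eq_sInf _ _
    have hle : N k ≤ Nat.nth p k := by
      conv_rhs => rw [← hcount k]
      exact Nat.le_nth_count hξ _
    have hmem := Nat.nth_mem_of_infinite hξ k
    have hne : {j | 0 < ξ (j + N k)}.Nonempty := ⟨Nat.nth p k - N k, by
      simpa [Nat.sub_add_cancel hle] using hmem⟩
    apply le_antisymm
    · have : firstPos (fun j => ξ (j + N k)) ≤ Nat.nth p k - N k :=
        Nat.sInf_le (by simpa [Nat.sub_add_cancel hle] using hmem)
      omega
    · rw [h1]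
      exact Nat.sInf_le ⟨Nat.sInf_mem hne, by omega⟩
  have hstate : ∀ k, machineState (fun _ => stickStep h) ξ k = fun j => ξ (j + N k) := by
    intro k
    induction k with
    | zero => simp [machineState, N]
    | succ k ih =>
      rw [machineState, ih, stickStep]
      ext j
      simp only
      congr 1
      have := hfirst k
      simp only [N, Nat.succ_ne_zero, if_false, Nat.add_sub_cancel] at this ⊢
      omega
  rw [stickTimes, machineOutput, hstate, stickStep, compoundGap]
  simp only
  have h1 : Nat.nth p k + 1 = N k + (firstPos (fun j => ξ (j + N k)) + 1) := by
    have := hfirst k; omega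
  rw [h1, Finset.sum_range_add _ (N k)]
  have h2 : (if k = 0 then 0 else ∑ j ∈ Finset.range (Nat.nth p (k - 1) + 1), markGap h (ξ j)) =
      ∑ j ∈ Finset.range (N k), markGap h (ξ j) := by
    by_cases hk : k = 0 <;> simp [N, hk]
  rw [h2, add_sub_cancel_left]
  exact Finset.sum_congr rfl fun j _ => by rw [add_comm]

end sticking

/-! ### The escapes of the machine -/

section escapes

/-- The gaps between the successive escape times. -/
def escapeGap (w r : ℝ) (f u : ℕ → ℝ) (m : ℕ) : ℝ :=
  escapeTime w r f u (Nat.nth (Escapes w r f u) m) -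
    if m = 0 then 0 else escapeTime w r f u (Nat.nth (Escapes w r f u) (m - 1))

lemma sum_escapeGap (w r : ℝ) (f u : ℕ → ℝ) (m : ℕ) :
    ∑ j ∈ Finset.range (m + 1), escapeGap w r f u j =
      escapeTime w r f u (Nat.nth (Escapes w r f u) m) := by
  induction m with
  | zero => simp [escapeGap]
  | succ m ih => rw [Finset.sum_range_succ, ih]; simp [escapeGap]

variable {w r : ℝ} {f u : ℕ → ℝ}

lemma escapeTime_ge (hr : 0 < r) (hf : ∀ k, 0 < f k) (hu : ∀ k, |u k| < w / 2) (n : ℕ) :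
    (∑ k ∈ Finset.range (n + 1), f k) / r < escapeTime w r f u n := by
  have := hu n
  unfold escapeTime
  linarith

/-- An escape takes place before the next refreshment, and the following escape after it. -/
lemma escapeGap_pos (hr : 0 < r) (hf : ∀ k, 0 < f k) (hu : ∀ k, |u k| < w / 2)
    (hinf : {n | Escapes w r f u n}.Infinite) (m : ℕ) : 0 < escapeGap w r f u m := by
  cases m with
  | zero =>
    simp only [escapeGap, if_true, sub_zero]
    refine lt_of_le_of_lt ?_ (escapeTime_ge hr hf hu _)
    exact div_nonneg (Finset.sum_nonneg fun k _ => (hf k).le) hr.le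
  | succ m =>
    simp only [escapeGap, Nat.succ_ne_zero, if_false, Nat.add_sub_cancel, sub_pos]
    have hlt : Nat.nth (Escapes w r f u) m < Nat.nth (Escapes w r f u) (m + 1) :=
      Nat.nth_strictMono hinf m.lt_succ_self
    have hmem : Escapes w r f u (Nat.nth (Escapes w r f u) m) := Nat.nth_mem_of_infinite hinf m
    set n := Nat.nth (Escapes w r f u) m
    set n' := Nat.nth (Escapes w r f u) (m + 1)
    refine lt_of_lt_of_le ?_ (escapeTime_ge hr hf hu n').le
    have h1 : (∑ k ∈ Finset.range (n + 1 + 1), f k) / r ≤ (∑ k ∈ Finset.range (n' + 1), f k) / r := by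
      exact div_le_div_of_nonneg_right (Finset.sum_le_sum_of_subset_of_nonneg
        (Finset.range_subset_range.2 (by omega)) fun k _ _ => (hf k).le) hr.le
    refine lt_of_lt_of_le ?_ h1
    rw [Finset.sum_range_succ _ (n + 1), add_div, escapeTime]
    have : w / 2 - |u n| < f (n + 1) / r := hmem
    linarith

lemma tendsto_sum_escapeGap (hr : 0 < r) (hf : ∀ k, 0 < f k) (hu : ∀ k, |u k| < w / 2)
    (hinf : {n | Escapes w r f u n}.Infinite)
    (hsum : Tendsto (fun n => ∑ k ∈ Finset.range n, f k) atTop atTop) :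
    Tendsto (fun n => ∑ k ∈ Finset.range n, escapeGap w r f u k) atTop atTop := by
  rw [← tendsto_add_atTop_iff_nat 1]
  have h1 : Tendsto (fun n => (∑ k ∈ Finset.range (n + 1), f k) / r) atTop atTop :=
    ((tendsto_add_atTop_iff_nat 1).2 hsum).atTop_div_const hr
  refine tendsto_atTop_mono (fun m => ?_) h1
  rw [sum_escapeGap]
  refine le_trans ?_ (escapeTime_ge hr hf hu _).le
  have : m ≤ Nat.nth (Escapes w r f u) m := (Nat.nth_strictMono hinf).le_apply
  exact div_le_div_of_nonneg_right (Finset.sum_le_sum_of_subset_of_nonneg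
    (Finset.range_subset_range.2 (by omega)) fun k _ _ => (hf k).le) hr.le

end escapes

/-! ### Convergence of the escape times for frequent refreshments -/

section machine

lemma refreshStep_of_lt {h c : ℝ} {s : (ℕ → ℝ) × (ℕ → ℝ)} (hs : c * h < |s.1 0|) :
    refreshStep h c s = (s.1 0, fun n => s.1 (n + 1), fun n => s.2 (n + 1)) := if_pos hs

lemma refreshStep_of_not_lt {h c : ℝ} {s : (ℕ → ℝ) × (ℕ → ℝ)} (hs : ¬ c * h < |s.1 0|) :
    refreshStep h c s = (c * s.2 0, consSeq (s.1 0 / c) (fun n => s.1 (n + 1)),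
      fun n => s.2 (n + 1)) := if_neg hs

/-- A position `c * φ 0` is never beyond the threshold, so the escapes are exactly the refreshments
that use the pending mark. -/
lemma escapes_refreshStep_iff {h c : ℝ} {s : (ℕ → ℝ) × (ℕ → ℝ)} (hφ : |s.2 0| ≤ h) :
    h - |(refreshStep h c s).1| < h - c * h ↔ c * h < |s.1 0| := by
  unfold refreshStep
  split_ifs with hlt
  · simp [hlt]
  · simp only [hlt, iff_false, not_lt]
    have h1 := (abs_nonneg _).trans (not_lt.1 hlt)
    have h0 := (abs_nonneg _).trans hφ
    rw [abs_mul]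
    rcases h0.eq_or_lt with h0 | h0
    · have : |s.2 0| = 0 := le_antisymm (hφ.trans h0.symm.le) (abs_nonneg _)
      rw [this, ← h0]; simp
    · have hc : 0 ≤ c := nonneg_of_mul_nonneg_left h1 h0
      rw [abs_of_nonneg hc]
      have := mul_le_mul_of_nonneg_left hφ hc
      linarith

variable {w r : ℝ} {f ξ φ : ℕ → ℝ}

/-- The pending mark before the `n`-th refreshment. -/
def pendingMark (w r : ℝ) (f ξ φ : ℕ → ℝ) (n : ℕ) : ℝ :=
  (machineState (fun n => refreshStep (w / 2) (refreshFactor (w / 2) r f n)) (ξ, φ) n).1 0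

lemma refreshFactor_mul (hw : 0 < w) (hr : 0 < r) (n : ℕ) :
    refreshFactor (w / 2) r f n * (w / 2) = w / 2 - f (n + 1) / r := by
  unfold refreshFactor
  field_simp

lemma machineState_snd (n : ℕ) :
    (machineState (fun n => refreshStep (w / 2) (refreshFactor (w / 2) r f n)) (ξ, φ) n).2 =
      fun j => φ (j + n) := by
  induction n with
  | zero => rfl
  | succ n ih =>
    rw [machineState, refreshStep]
    split_ifs <;> (simp only [ih]; ext j; congr 1; omega)

lemma escapes_iff (hw : 0 < w) (hr : 0 < r) (hφ : ∀ n, |φ n| ≤ w / 2) (n : ℕ) :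
    Escapes w r f (refreshedPos (w / 2) r f (ξ, φ)) n ↔
      refreshFactor (w / 2) r f n * (w / 2) < |pendingMark w r f ξ φ n| := by
  have h := escapes_refreshStep_iff (h := w / 2) (c := refreshFactor (w / 2) r f n)
    (s := machineState (fun n => refreshStep (w / 2) (refreshFactor (w / 2) r f n)) (ξ, φ) n)
    (by rw [machineState_snd]; exact hφ _)
  rw [refreshFactor_mul hw hr] at h ⊢
  have e : w / 2 - (w / 2 - f (n + 1) / r) = f (n + 1) / r := by ring
  rw [e] at h
  exact h

-- Each escape consumes one mark, and rescaling touches only the head of the sequence; behind the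
-- head the original marks are intact.
open Classical in
lemma machineState_fst (hw : 0 < w) (hr : 0 < r) (hφ : ∀ n, |φ n| ≤ w / 2) (n j : ℕ) :
    (machineState (fun n => refreshStep (w / 2) (refreshFactor (w / 2) r f n)) (ξ, φ) n).1 (j + 1) =
      ξ (Nat.count (Escapes w r f (refreshedPos (w / 2) r f (ξ, φ))) n + (j + 1)) := by
  induction n generalizing j with
  | zero => simp [machineState]
  | succ n ih =>
    rw [machineState, Nat.count_succ]
    have h := escapes_iff (f := f) (ξ := ξ) hw hr hφ n
    by_cases he : Escapes w r f (refreshedPos (w / 2) r f (ξ, φ)) n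
    · rw [refreshStep_of_lt (by exact h.1 he), if_pos he]
      simp only [ih]
      congr 1; omega
    · rw [refreshStep_of_not_lt (by exact fun hc => he (h.2 hc)), if_neg he]
      simp only [consSeq_succ, ih]
      congr 1

open Classical in
lemma pendingMark_succ_of_escapes (hw : 0 < w) (hr : 0 < r) (hφ : ∀ n, |φ n| ≤ w / 2) {n : ℕ}
    (he : Escapes w r f (refreshedPos (w / 2) r f (ξ, φ)) n) :
    pendingMark w r f ξ φ (n + 1) =
      ξ (Nat.count (Escapes w r f (refreshedPos (w / 2) r f (ξ, φ))) n + 1) := by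
  rw [pendingMark, machineState, refreshStep_of_lt (by exact (escapes_iff hw hr hφ n).1 he)]
  exact machineState_fst hw hr hφ n 0

lemma pendingMark_succ_of_not_escapes (hw : 0 < w) (hr : 0 < r) (hφ : ∀ n, |φ n| ≤ w / 2) {n : ℕ}
    (he : ¬ Escapes w r f (refreshedPos (w / 2) r f (ξ, φ)) n) :
    pendingMark w r f ξ φ (n + 1) = pendingMark w r f ξ φ n / refreshFactor (w / 2) r f n := by
  rw [pendingMark, machineState, refreshStep_of_not_lt
    (by exact fun hc => he ((escapes_iff hw hr hφ n).2 hc))]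
  rfl

lemma refreshedPos_of_escapes (hw : 0 < w) (hr : 0 < r) (hφ : ∀ n, |φ n| ≤ w / 2) {n : ℕ}
    (he : Escapes w r f (refreshedPos (w / 2) r f (ξ, φ)) n) :
    refreshedPos (w / 2) r f (ξ, φ) n = pendingMark w r f ξ φ n := by
  rw [refreshedPos, machineOutput, refreshStep_of_lt (by exact (escapes_iff hw hr hφ n).1 he)]
  rfl

-- The pending mark arises from an original mark by division by positive factors, so its sign
-- survives. It is divided by `c` only if its modulus is at most `c * (w / 2)`, hence it stays in
-- the closed universe.
open Classical in
lemma pendingMark_spec (hw : 0 < w) (hr : 0 < r) (hφ : ∀ n, |φ n| ≤ w / 2)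
    (hξ : ∀ n, |ξ n| ≤ w / 2 ∧ ξ n ≠ 0) (n : ℕ) :
    |pendingMark w r f ξ φ n| ≤ w / 2 ∧ ∃ q > 0, pendingMark w r f ξ φ n =
      ξ (Nat.count (Escapes w r f (refreshedPos (w / 2) r f (ξ, φ))) n) * q := by
  induction n with
  | zero => exact ⟨(hξ 0).1, 1, one_pos, by simp [pendingMark, machineState]⟩
  | succ n ih =>
    obtain ⟨h1, q, hq, h2⟩ := ih
    by_cases he : Escapes w r f (refreshedPos (w / 2) r f (ξ, φ)) n
    · rw [pendingMark_succ_of_escapes hw hr hφ he, Nat.count_succ, if_pos he]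
      exact ⟨(hξ _).1, 1, one_pos, by simp⟩
    · rw [pendingMark_succ_of_not_escapes hw hr hφ he, Nat.count_succ, if_neg he, add_zero]
      have hlt := not_lt.1 (mt (escapes_iff hw hr hφ n).2 he)
      have hpos : 0 < |pendingMark w r f ξ φ n| := by
        rw [h2]; exact abs_pos.2 (mul_ne_zero (hξ _).2 hq.ne')
      have hc : 0 < refreshFactor (w / 2) r f n :=
        pos_of_mul_pos_left (hpos.trans_le hlt) (by positivity)
      refine ⟨?_, q / refreshFactor (w / 2) r f n, by positivity, by rw [h2]; ring⟩
      rw [abs_div, abs_of_pos hc, div_le_iff₀ hc]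
      linarith

lemma pendingMark_ne_zero (hw : 0 < w) (hr : 0 < r) (hφ : ∀ n, |φ n| ≤ w / 2)
    (hξ : ∀ n, |ξ n| ≤ w / 2 ∧ ξ n ≠ 0) (n : ℕ) : pendingMark w r f ξ φ n ≠ 0 := by
  obtain ⟨-, q, hq, h2⟩ := pendingMark_spec (f := f) hw hr hφ hξ n
  rw [h2]; exact mul_ne_zero (hξ _).2 hq.ne'

lemma markGap_nonneg {h x : ℝ} (hh : 0 < h) (hx : |x| ≤ h) : 0 ≤ markGap h x := by
  have := Real.log_nonpos (x := |x| / h) (by positivity) (by rwa [div_le_one hh])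
  unfold markGap
  nlinarith

/-- The decrease of the pending mark gap during a time `l` without escape. -/
def gapDecrease (h l : ℝ) : ℝ := -h * Real.log (1 - l / h)

lemma le_gapDecrease {h l : ℝ} (hh : 0 < h) (hl : l < h) : l ≤ gapDecrease h l := by
  have := Real.log_le_sub_one_of_pos (x := 1 - l / h) (by rw [sub_pos, div_lt_one hh]; exact hl)
  have h2 : h * Real.log (1 - l / h) ≤ h * (-(l / h)) := by gcongr; linarith
  have h3 : h * (l / h) = l := by field_simp
  unfold gapDecrease
  linarith

/-- The decrease is `l` up to a quadratic error; `l ≤ h / 2` keeps the logarithm away from its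
singularity. -/
lemma gapDecrease_le {h l : ℝ} (hh : 0 < h) (hl0 : 0 ≤ l) (hl : l ≤ h / 2) :
    gapDecrease h l ≤ l + 2 / h * l * l ∧ gapDecrease h l ≤ 2 * l := by
  have hy : l / h ≤ 1 / 2 := by rw [div_le_iff₀ hh]; linarith
  have hy0 : 0 ≤ l / h := by positivity
  have h1 := Real.one_sub_inv_le_log_of_pos (x := 1 - l / h) (by linarith)
  have h2 : -Real.log (1 - l / h) ≤ l / h + 2 * (l / h) * (l / h) := by
    have h3 : (1 - l / h)⁻¹ ≤ 1 + l / h + 2 * (l / h) * (l / h) := by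
      rw [inv_le_iff_one_le_mul₀' (by linarith)]
      nlinarith [mul_nonneg hy0 hy0, mul_nonneg (mul_nonneg hy0 hy0) (sub_nonneg.2 hy)]
    linarith
  have h4 : gapDecrease h l ≤ h * (l / h + 2 * (l / h) * (l / h)) := by
    unfold gapDecrease; nlinarith
  have h5 : h * (l / h + 2 * (l / h) * (l / h)) = l + 2 / h * l * l := by field_simp
  refine ⟨by linarith, h4.trans ?_⟩
  rw [h5]
  have : 2 / h * l = 2 * (l / h) := by ring
  rw [this]
  nlinarith

/-- The logarithm turns the rescaling of the mark into a subtraction from its gap. -/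
lemma markGap_succ_of_not_escapes (hw : 0 < w) (hr : 0 < r) (hφ : ∀ n, |φ n| ≤ w / 2)
    (hξ : ∀ n, |ξ n| ≤ w / 2 ∧ ξ n ≠ 0) {n : ℕ}
    (he : ¬ Escapes w r f (refreshedPos (w / 2) r f (ξ, φ)) n) :
    f (n + 1) / r < w / 2 ∧ markGap (w / 2) (pendingMark w r f ξ φ (n + 1)) =
      markGap (w / 2) (pendingMark w r f ξ φ n) - gapDecrease (w / 2) (f (n + 1) / r) := by
  have hx := pendingMark_ne_zero (f := f) hw hr hφ hξ n
  have hlt := not_lt.1 (mt (escapes_iff hw hr hφ n).2 he)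
  have hpos := abs_pos.2 hx
  have hmul := refreshFactor_mul (f := f) hw hr n
  have hl : f (n + 1) / r < w / 2 := by linarith
  refine ⟨hl, ?_⟩
  have hc : refreshFactor (w / 2) r f n = 1 - f (n + 1) / r / (w / 2) := by
    unfold refreshFactor; rw [div_div]
  have hc0 : 0 < 1 - f (n + 1) / r / (w / 2) := by
    rw [sub_pos, div_lt_one (by positivity)]; exact hl
  rw [pendingMark_succ_of_not_escapes hw hr hφ he, hc]
  unfold markGap gapDecrease
  rw [abs_div, abs_of_pos hc0, div_right_comm, Real.log_div (by positivity) hc0.ne']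
  ring

/-- An escape occurs when the pending gap is less than the decrease that the next time interval
would bring. -/
lemma markGap_le_of_escapes (hw : 0 < w) (hr : 0 < r) (hφ : ∀ n, |φ n| ≤ w / 2)
    (hξ : ∀ n, |ξ n| ≤ w / 2 ∧ ξ n ≠ 0) {n : ℕ}
    (he : Escapes w r f (refreshedPos (w / 2) r f (ξ, φ)) n) (hl : f (n + 1) / r < w / 2) :
    markGap (w / 2) (pendingMark w r f ξ φ n) ≤ gapDecrease (w / 2) (f (n + 1) / r) := by
  have hlt := (escapes_iff hw hr hφ n).1 he
  rw [refreshFactor_mul hw hr] at hlt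
  have hw2 : 0 < w / 2 := by positivity
  unfold markGap gapDecrease
  have : Real.log (1 - f (n + 1) / r / (w / 2)) ≤ Real.log (|pendingMark w r f ξ φ n| / (w / 2)) := by
    apply Real.log_le_log
    · rw [sub_pos, div_lt_one hw2]; exact hl
    · rw [le_div_iff₀ hw2, sub_mul, div_mul_cancel₀ _ hw2.ne', one_mul]; exact hlt.le
  nlinarith

/-- There are infinitely many escapes. -/
lemma infinite_escapes (hw : 0 < w) (hr : 0 < r) (hφ : ∀ n, |φ n| ≤ w / 2)
    (hξ : ∀ n, |ξ n| ≤ w / 2 ∧ ξ n ≠ 0)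
    (hsum : Tendsto (fun n => ∑ k ∈ Finset.range n, f k) atTop atTop) :
    {n | Escapes w r f (refreshedPos (w / 2) r f (ξ, φ)) n}.Infinite := by
  intro hfin
  obtain ⟨n₀, hn₀⟩ := hfin.bddAbove
  have hne : ∀ n ≥ n₀ + 1, ¬ Escapes w r f (refreshedPos (w / 2) r f (ξ, φ)) n := fun n hn he => by
    have : n ≤ n₀ := hn₀ he
    omega
  -- Without escapes the pending gap would decrease by at least the elapsed time, which is
  -- unbounded, although it stays nonnegative.
  have hdec : ∀ j, markGap (w / 2) (pendingMark w r f ξ φ (n₀ + 1 + j)) +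
      (∑ k ∈ Finset.range (n₀ + 2 + j), f k) / r ≤
      markGap (w / 2) (pendingMark w r f ξ φ (n₀ + 1)) + (∑ k ∈ Finset.range (n₀ + 2), f k) / r := by
    intro j
    induction j with
    | zero => simp
    | succ j ih =>
      obtain ⟨h1, h2⟩ := markGap_succ_of_not_escapes hw hr hφ hξ (hne (n₀ + 1 + j) (by omega))
      have h3 := le_gapDecrease (by positivity) h1
      have h4 : (∑ k ∈ Finset.range (n₀ + 2 + (j + 1)), f k) / r =
          (∑ k ∈ Finset.range (n₀ + 2 + j), f k) / r + f (n₀ + 1 + j + 1) / r := by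
        rw [show n₀ + 2 + (j + 1) = n₀ + 2 + j + 1 by ring, Finset.sum_range_succ, add_div,
          show n₀ + 1 + j + 1 = n₀ + 2 + j by ring]
      rw [show n₀ + 1 + (j + 1) = n₀ + 1 + j + 1 by ring, h4]
      linarith
  have hlim : Tendsto (fun j => (∑ k ∈ Finset.range (n₀ + 2 + j), f k) / r) atTop atTop := by
    have := (tendsto_add_atTop_iff_nat (n₀ + 2)).2 hsum
    refine (this.congr fun j => ?_).atTop_div_const hr
    rw [add_comm]
  obtain ⟨j, hj⟩ := (hlim.eventually_gt_atTop (markGap (w / 2) (pendingMark w r f ξ φ (n₀ + 1)) +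
    (∑ k ∈ Finset.range (n₀ + 2), f k) / r)).exists
  have := markGap_nonneg (show 0 < w / 2 by positivity)
    (pendingMark_spec (f := f) hw hr hφ hξ (n₀ + 1 + j)).1
  linarith [hdec j]

/-- The signs of the escaping positions are those of the marks. -/
lemma sign_mul_refreshedPos (hw : 0 < w) (hr : 0 < r) (hφ : ∀ n, |φ n| ≤ w / 2)
    (hξ : ∀ n, |ξ n| ≤ w / 2 ∧ ξ n ≠ 0)
    (hinf : {n | Escapes w r f (refreshedPos (w / 2) r f (ξ, φ)) n}.Infinite) {m : ℕ} {σ : ℝ}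
    (hσ : σ * |ξ m| = ξ m) :
    σ * |refreshedPos (w / 2) r f (ξ, φ)
      (Nat.nth (Escapes w r f (refreshedPos (w / 2) r f (ξ, φ))) m)| =
    refreshedPos (w / 2) r f (ξ, φ)
      (Nat.nth (Escapes w r f (refreshedPos (w / 2) r f (ξ, φ))) m) := by
  classical
  have hmem : Escapes w r f (refreshedPos (w / 2) r f (ξ, φ))
    (Nat.nth (Escapes w r f (refreshedPos (w / 2) r f (ξ, φ))) m) := Nat.nth_mem_of_infinite hinf m
  rw [refreshedPos_of_escapes hw hr hφ hmem]
  obtain ⟨-, q, hq, h2⟩ := pendingMark_spec (f := f) hw hr hφ hξ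
    (Nat.nth (Escapes w r f (refreshedPos (w / 2) r f (ξ, φ))) m)
  rw [Nat.count_nth_of_infinite hinf] at h2
  rw [h2, abs_mul, abs_of_pos hq, ← mul_assoc, hσ]

open Classical in
/-- The time and the pending mark gap balance the sum of the marks. -/
lemma abs_balance_le (hw : 0 < w) (hr : 0 < r) (hf : ∀ k, 0 < f k) (hφ : ∀ n, |φ n| ≤ w / 2)
    (hξ : ∀ n, |ξ n| ≤ w / 2 ∧ ξ n ≠ 0) {δ : ℝ} (hδ : δ ≤ w / 4)
    (n : ℕ) (hl : ∀ k < n, f (k + 1) / r ≤ δ) (h0 : f 0 / r ≤ δ) :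
    |(∑ k ∈ Finset.range (n + 1), f k) / r + markGap (w / 2) (pendingMark w r f ξ φ n) -
      ∑ j ∈ Finset.range (Nat.count (Escapes w r f (refreshedPos (w / 2) r f (ξ, φ))) n + 1),
        markGap (w / 2) (ξ j)| ≤
    δ + 2 / (w / 2) * δ * ((∑ k ∈ Finset.range (n + 1), f k) / r) +
      2 * δ * Nat.count (Escapes w r f (refreshedPos (w / 2) r f (ξ, φ))) n := by
  have hfr : ∀ k, 0 < f k / r := fun k => div_pos (hf k) hr
  induction n with
  | zero =>
    have hδ0 : 0 ≤ δ := (hfr 0).le.trans h0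
    have h1 : |f 0 / r| ≤ δ := by rw [abs_of_pos (hfr 0)]; exact h0
    simp only [zero_add, Finset.range_one, Finset.sum_singleton, Nat.count_zero, pendingMark,
      machineState, add_sub_cancel_right, Nat.cast_zero, mul_zero, add_zero]
    have : 0 ≤ 2 / (w / 2) * δ * (f 0 / r) := by have := hfr 0; positivity
    linarith
  | succ n ih =>
    have ih := ih fun k hk => hl k (by omega)
    have hln := hl n (by omega)
    have hl0 := hfr (n + 1)
    have hlw : f (n + 1) / r ≤ w / 2 / 2 := by linarith
    obtain ⟨g1, g2⟩ := gapDecrease_le (show 0 < w / 2 by positivity) hl0.le hlw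
    have hδ0 : 0 ≤ δ := hl0.le.trans hln
    have hA := markGap_nonneg (show 0 < w / 2 by positivity)
      (pendingMark_spec (f := f) hw hr hφ hξ n).1
    rw [Finset.sum_range_succ _ (n + 1), add_div, Nat.count_succ]
    set C := (∑ k ∈ Finset.range (n + 1), f k) / r
    set l := f (n + 1) / r
    have hκ : 0 ≤ 2 / (w / 2) * δ * l := by positivity
    -- At an escape the old pending gap, at most `2 * l`, is dropped, while the next mark gap enters
    -- both sides; this costs at most `2 * δ`. Without escape the time gains `l` and the pending gap
    -- loses between `l` and `l + 2 / (w / 2) * l * l`.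
    by_cases he : Escapes w r f (refreshedPos (w / 2) r f (ξ, φ)) n
    · have h1 := markGap_le_of_escapes hw hr hφ hξ he (by linarith)
      rw [pendingMark_succ_of_escapes hw hr hφ he, if_pos he, Finset.sum_range_succ _ (_ + 1)]
      push_cast
      rw [abs_le] at ih ⊢
      constructor <;> nlinarith [ih.1, ih.2]
    · obtain ⟨h1, h2⟩ := markGap_succ_of_not_escapes hw hr hφ hξ he
      rw [h2, if_neg he]
      have h3 := le_gapDecrease (show 0 < w / 2 by positivity) h1
      have h4 : 2 / (w / 2) * l * l ≤ 2 / (w / 2) * δ * l := by gcongr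
      simp only [add_zero]
      rw [abs_le] at ih ⊢
      constructor <;> nlinarith [ih.1, ih.2]

/-- The escape times are close to the sums of the marks if the refreshments are frequent. -/
lemma abs_escapeTime_sub_le (hw : 0 < w) (hr : 0 < r) (hf : ∀ k, 0 < f k)
    (hφ : ∀ n, |φ n| ≤ w / 2) (hξ : ∀ n, |ξ n| ≤ w / 2 ∧ ξ n ≠ 0)
    (hinf : {n | Escapes w r f (refreshedPos (w / 2) r f (ξ, φ)) n}.Infinite) {m : ℕ} {δ K : ℝ}
    (hδ : δ ≤ w / 4) (hK0 : 0 ≤ K) (h0 : f 0 / r ≤ δ)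
    (hl : ∀ n, (∑ k ∈ Finset.range (n + 1), f k) / r ≤ K → f (n + 1) / r ≤ δ)
    (hK : ∑ j ∈ Finset.range (m + 1), markGap (w / 2) (ξ j) +
      (δ + 2 / (w / 2) * δ * (K + δ) + 2 * δ * m) ≤ K) :
    |escapeTime w r f (refreshedPos (w / 2) r f (ξ, φ))
      (Nat.nth (Escapes w r f (refreshedPos (w / 2) r f (ξ, φ))) m) -
      ∑ j ∈ Finset.range (m + 1), markGap (w / 2) (ξ j)| ≤
      δ + 2 / (w / 2) * δ * (K + δ) + 2 * δ * m + 2 * δ := by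
  classical
  have hw2 : 0 < w / 2 := by positivity
  have hfr : ∀ k, 0 < f k / r := fun k => div_pos (hf k) hr
  have hδ0 : 0 ≤ δ := (hfr 0).le.trans h0
  have hη : ∀ j, 0 ≤ markGap (w / 2) (ξ j) := fun j => markGap_nonneg hw2 (hξ j).1
  have hP0 : 0 ≤ ∑ j ∈ Finset.range (m + 1), markGap (w / 2) (ξ j) :=
    Finset.sum_nonneg fun j _ => hη j
  set u := refreshedPos (w / 2) r f (ξ, φ) with hu
  set N := Nat.nth (Escapes w r f u) m with hN
  have hcount : ∀ n ≤ N, Nat.count (Escapes w r f u) n ≤ m := by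
    intro n hn
    have := Nat.count_monotone (Escapes w r f u) hn
    rwa [hN, Nat.count_nth_of_infinite hinf] at this
  -- A bootstrap: the gaps are known to be small only up to time `K`, but as long as this holds, the
  -- balance together with `hK` keeps the next time below `K`.
  have hC : ∀ n ≤ N, ∀ k ≤ n, (∑ k ∈ Finset.range (k + 1), f k) / r ≤ K := by
    intro n
    induction n with
    | zero =>
      intro _ k hk
      obtain rfl : k = 0 := by omega
      simp only [zero_add, Finset.range_one, Finset.sum_singleton]
      by_contra hc
      have : 0 ≤ 2 / (w / 2) * δ * (K + δ) + 2 * δ * m := by positivity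
      linarith
    | succ n ih =>
      intro hn k hk
      rcases Nat.lt_or_ge k (n + 1) with hk' | hk'
      · exact ih (by omega) k (by omega)
      obtain rfl : k = n + 1 := by omega
      have hb := abs_balance_le hw hr hf hφ hξ hδ (n + 1) (fun j hj => hl j (ih (by omega) j (by omega)))
        h0
      have hCn := ih (by omega) n le_rfl
      have hln := hl n hCn
      have hA := markGap_nonneg hw2 (pendingMark_spec (f := f) hw hr hφ hξ (n + 1)).1
      have hc := hcount (n + 1) hn
      have hP : ∑ j ∈ Finset.range (Nat.count (Escapes w r f u) (n + 1) + 1), markGap (w / 2) (ξ j) ≤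
          ∑ j ∈ Finset.range (m + 1), markGap (w / 2) (ξ j) :=
        Finset.sum_le_sum_of_subset_of_nonneg (Finset.range_subset_range.2 (by omega)) fun j _ _ => hη j
      have hCs : (∑ k ∈ Finset.range (n + 1 + 1), f k) / r ≤ K + δ := by
        rw [Finset.sum_range_succ, add_div]; linarith
      have h1 : 2 / (w / 2) * δ * ((∑ k ∈ Finset.range (n + 1 + 1), f k) / r) ≤
          2 / (w / 2) * δ * (K + δ) := by gcongr
      have h2 : 2 * δ * (Nat.count (Escapes w r f u) (n + 1) : ℝ) ≤ 2 * δ * m := by gcongr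
      have := (abs_le.1 hb).2
      linarith
  have hb := abs_balance_le hw hr hf hφ hξ hδ N (fun j hj => hl j (hC N le_rfl j hj.le)) h0
  have hcN : Nat.count (Escapes w r f u) N = m := by rw [hN, Nat.count_nth_of_infinite hinf]
  have hmem : Escapes w r f u N := Nat.nth_mem_of_infinite hinf m
  have hCN := hC N le_rfl N le_rfl
  have hlN := hl N hCN
  rw [← hu, hcN] at hb
  have hA := markGap_nonneg hw2 (pendingMark_spec (f := f) hw hr hφ hξ N).1
  have hA' := markGap_le_of_escapes hw hr hφ hξ hmem (by linarith)
  have hA'' := (gapDecrease_le hw2 (hfr (N + 1)).le (by linarith)).2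
  have hx := (pendingMark_spec (f := f) hw hr hφ hξ N).1
  have hx0 := pendingMark_ne_zero (f := f) hw hr hφ hξ N
  -- By `log y ≤ y - 1` the way from the escaping position to the boundary is at most the pending
  -- gap, hence at most `2 * δ`.
  have hxA : w / 2 - |pendingMark w r f ξ φ N| ≤ markGap (w / 2) (pendingMark w r f ξ φ N) := by
    have h1 := Real.log_le_sub_one_of_pos (x := |pendingMark w r f ξ φ N| / (w / 2)) (by positivity)
    have h2 := mul_le_mul_of_nonneg_left h1 hw2.le
    rw [mul_sub, mul_div_cancel₀ _ hw2.ne'] at h2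
    unfold markGap
    linarith
  rw [escapeTime, hu, refreshedPos_of_escapes hw hr hφ hmem]
  have h1 : 2 / (w / 2) * δ * ((∑ k ∈ Finset.range (N + 1), f k) / r) ≤
      2 / (w / 2) * δ * (K + δ) := by gcongr; linarith
  rw [abs_le] at hb ⊢
  constructor <;> linarith [hb.1, hb.2]

/-- The gaps of a law of large numbers are small on any time scale. -/
lemma eventually_gap_le (hf : ∀ k, 0 < f k)
    (hlln : Tendsto (fun n : ℕ => (∑ k ∈ Finset.range n, f k) / n) atTop (𝓝 1)) (K : ℝ) {δ : ℝ}
    (hδ : 0 < δ) :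
    ∀ᶠ r : ℝ in atTop, ∀ n, ∑ k ∈ Finset.range n, f k ≤ r * K → f n / r ≤ δ := by
  wlog hK : 0 < K generalizing K
  · filter_upwards [this 1 one_pos, eventually_gt_atTop 0] with r h hr n hn
    exact h n (hn.trans (by nlinarith [not_lt.1 hK]))
  -- The law of large numbers at `n` and at `n + 1` shows that a single gap is of smaller order than
  -- `n`.
  have h1 : Tendsto (fun n : ℕ => f n / (n + 1 : ℕ)) atTop (𝓝 0) := by
    have ha := (tendsto_add_atTop_iff_nat 1).2 hlln
    have hb : Tendsto (fun n : ℕ => (∑ k ∈ Finset.range n, f k) / (n + 1 : ℕ)) atTop (𝓝 1) := by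
      have := hlln.mul (tendsto_natCast_div_add_atTop (1 : ℝ))
      rw [mul_one] at this
      refine this.congr' ?_
      filter_upwards [eventually_gt_atTop 0] with n hn
      have : (n : ℝ) ≠ 0 := by positivity
      push_cast
      field_simp
    have := ha.sub hb
    rw [sub_self] at this
    refine this.congr fun n => ?_
    rw [Finset.sum_range_succ]; ring
  -- For large `n` in question, `n + 1` is at most four times the partial sum, hence at most `4 * r
  -- * K`, and the second bound gives `f n ≤ δ * r`. The finitely many other gaps are small relative
  -- to large `r`.
  have h2 : ∀ᶠ n : ℕ in atTop, (n + 1 : ℕ) ≤ 4 * ∑ k ∈ Finset.range n, f k ∧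
      f n ≤ δ / (4 * K) * (n + 1 : ℕ) := by
    filter_upwards [hlln.eventually_const_lt (show (1 / 2 : ℝ) < 1 by norm_num),
      h1.eventually_lt_const (show 0 < δ / (4 * K) by positivity), eventually_gt_atTop 0]
      with n h3 h4 hn
    rw [lt_div_iff₀ (by positivity)] at h3
    rw [div_lt_iff₀ (by positivity)] at h4
    refine ⟨?_, h4.le⟩
    have : (1 : ℝ) ≤ n := by exact_mod_cast hn
    push_cast
    linarith
  obtain ⟨n₀, hn₀⟩ := eventually_atTop.1 h2
  have h3 : ∀ᶠ r : ℝ in atTop, ∀ n ∈ Finset.range n₀, f n / r ≤ δ := by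
    refine (Finset.eventually_all _).2 fun n _ => ?_
    filter_upwards [eventually_ge_atTop (f n / δ), eventually_gt_atTop 0] with r hr hr0
    rw [div_le_iff₀ hr0]
    rwa [div_le_iff₀ hδ, mul_comm] at hr
  filter_upwards [h3, eventually_gt_atTop 0] with r h3 hr n hn
  rcases lt_or_ge n n₀ with hlt | hge
  · exact h3 n (Finset.mem_range.2 hlt)
  · obtain ⟨h4, h5⟩ := hn₀ n hge
    rw [div_le_iff₀ hr]
    calc f n ≤ δ / (4 * K) * (n + 1 : ℕ) := h5
      _ ≤ δ / (4 * K) * (4 * (r * K)) := by gcongr; linarith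
      _ = δ * r := by field_simp

/-- As the refreshments become more frequent, the gaps between the escapes tend to those of the
marks. -/
lemma tendsto_escapeGap (hw : 0 < w) (hf : ∀ k, 0 < f k) (hφ : ∀ n, |φ n| ≤ w / 2)
    (hξ : ∀ n, |ξ n| ≤ w / 2 ∧ ξ n ≠ 0)
    (hlln : Tendsto (fun n : ℕ => (∑ k ∈ Finset.range n, f k) / n) atTop (𝓝 1))
    (hsum : Tendsto (fun n => ∑ k ∈ Finset.range n, f k) atTop atTop) (m : ℕ) :
    Tendsto (fun r => escapeGap w r f (refreshedPos (w / 2) r f (ξ, φ)) m) atTop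
      (𝓝 (markGap (w / 2) (ξ m))) := by
  have key : ∀ m, Tendsto (fun r => escapeTime w r f (refreshedPos (w / 2) r f (ξ, φ))
      (Nat.nth (Escapes w r f (refreshedPos (w / 2) r f (ξ, φ))) m)) atTop
      (𝓝 (∑ j ∈ Finset.range (m + 1), markGap (w / 2) (ξ j))) := by
    intro m
    set P := ∑ j ∈ Finset.range (m + 1), markGap (w / 2) (ξ j)
    have hP0 : 0 ≤ P := Finset.sum_nonneg fun j _ => markGap_nonneg (by positivity) (hξ j).1
    rw [Metric.tendsto_nhds]
    intro ε hε
    have hcont : Continuous fun δ : ℝ =>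
        δ + 2 / (w / 2) * δ * (P + 1 + δ) + 2 * δ * m + 2 * δ := by fun_prop
    -- The total error vanishes with `δ`. Being below `1`, it fits between `P` and the horizon `P +
    -- 1`.
    have hsmall : ∀ᶠ δ in 𝓝[>] (0 : ℝ),
        δ + 2 / (w / 2) * δ * (P + 1 + δ) + 2 * δ * m + 2 * δ < min ε 1 :=
      (hcont.continuousAt.eventually_lt continuousAt_const (by simpa using hε)).filter_mono
        nhdsWithin_le_nhds
    have hsmall' : ∀ᶠ δ in 𝓝[>] (0 : ℝ), δ < w / 4 :=
      (eventually_lt_nhds (by positivity)).filter_mono nhdsWithin_le_nhds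
    obtain ⟨δ, hδ1, hδ2, hδ0⟩ := (hsmall.and (hsmall'.and (eventually_mem_nhdsWithin
      (a := (0 : ℝ)) (s := Ioi 0)))).exists
    have hδ0 : 0 < δ := hδ0
    have hmin := lt_min_iff.1 hδ1
    have h0 : ∀ᶠ r : ℝ in atTop, f 0 / r ≤ δ := by
      filter_upwards [eventually_gap_le hf hlln 1 hδ0, eventually_gt_atTop 0] with r h hr
      exact h 0 (by simp; linarith)
    filter_upwards [h0, eventually_gap_le hf hlln (P + 1) hδ0, eventually_gt_atTop 0] with r h0 hl hr
    rw [Real.dist_eq]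
    refine lt_of_le_of_lt (abs_escapeTime_sub_le hw hr hf hφ hξ
      (infinite_escapes hw hr hφ hξ hsum) hδ2.le (by linarith) h0 (fun n hn => hl (n + 1) ?_) ?_) hmin.1
    · rwa [div_le_iff₀' hr] at hn
    · linarith [hmin.2]
  cases m with
  | zero => simpa [escapeGap] using key 0
  | succ m =>
    have := (key (m + 1)).sub (key m)
    rw [Finset.sum_range_succ _ (m + 1), add_sub_cancel_left] at this
    refine this.congr fun r => ?_
    simp [escapeGap]

end machine

/-! ### The sources of randomness -/

section sources

/-- The streams of random numbers that belong to one coordinate: for the bounces, the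
refreshments, the marks and the refreshed positions. -/
abbrev StreamIndex : Type := ℕ ⊕ (ℕ ⊕ (ℕ ⊕ ℕ))

/-- The laws of the streams, with exponential gaps between the marks. -/
def streamLaw (h : ℝ) : StreamIndex → Measure ℝ
  | .inl _ => expMeasure 1
  | .inr (.inl _) => expMeasure 1
  | .inr (.inr (.inl _)) => expMeasure (1 / h)
  | .inr (.inr (.inr _)) => symmUniform h

/-- The laws of the streams, with uniform marks. -/
def markedStreamLaw (h : ℝ) : StreamIndex → Measure ℝ
  | .inl _ => expMeasure 1
  | .inr (.inl _) => expMeasure 1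
  | .inr (.inr (.inl _)) => symmUniform h
  | .inr (.inr (.inr _)) => symmUniform h

/-- The law of a fair sign. -/
def fairSign : Measure ℝ := (2⁻¹ : ℝ≥0∞) • Measure.dirac 1 + (2⁻¹ : ℝ≥0∞) • Measure.dirac (-1)

instance : IsProbabilityMeasure fairSign :=
  ⟨by simp [fairSign, ENNReal.inv_two_add_inv_two]⟩

lemma fairSign_map_neg : fairSign.map (fun x => -x) = fairSign := by
  have h : ∀ x : ℝ, (Measure.dirac x).map (fun x => -x) = Measure.dirac (-x) := fun x =>
    Measure.map_dirac' measurable_neg x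
  rw [fairSign, Measure.map_add _ _ measurable_neg, Measure.map_smul, Measure.map_smul, h, h,
    neg_neg, add_comm]

lemma ae_fairSign : ∀ᵐ x ∂fairSign, x = 1 ∨ x = -1 := by
  have hm : MeasurableSet {x : ℝ | ¬ (x = 1 ∨ x = -1)} :=
    ((measurableSet_singleton 1).union (measurableSet_singleton (-1))).compl
  rw [ae_iff, fairSign, Measure.add_apply, Measure.smul_apply, Measure.smul_apply,
    Measure.dirac_apply' _ hm, Measure.dirac_apply' _ hm]
  simp

/-- The indices of the random numbers: streams for each coordinate and for the timekeeping, together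
with signs. -/
abbrev Source (d : ℕ) : Type := (Option (Fin d) × StreamIndex) × Fin 2

variable {d : ℕ} {h : ℝ}

/-- The laws of the random numbers. -/
def sourceLaw (h : ℝ) (p : Source d) : Measure ℝ := if p.2 = 0 then streamLaw h p.1.2 else fairSign

lemma isProbabilityMeasure_streamLaw (hh : 0 < h) (k : StreamIndex) :
    IsProbabilityMeasure (streamLaw h k) := by
  rcases k with _ | _ | _ | _
  · exact isProbabilityMeasure_expMeasure one_pos
  · exact isProbabilityMeasure_expMeasure one_pos
  · exact isProbabilityMeasure_expMeasure (by positivity)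
  · exact isProbabilityMeasure_symmUniform hh

lemma isProbabilityMeasure_markedStreamLaw (hh : 0 < h) (k : StreamIndex) :
    IsProbabilityMeasure (markedStreamLaw h k) := by
  rcases k with _ | _ | _ | _
  · exact isProbabilityMeasure_expMeasure one_pos
  · exact isProbabilityMeasure_expMeasure one_pos
  · exact isProbabilityMeasure_symmUniform hh
  · exact isProbabilityMeasure_symmUniform hh

lemma isProbabilityMeasure_sourceLaw (hh : 0 < h) (p : Source d) :
    IsProbabilityMeasure (sourceLaw h p) := by
  unfold sourceLaw
  split_ifs
  · exact isProbabilityMeasure_streamLaw hh _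
  · infer_instance

/-- A mark with its sign. -/
def signMark (h : ℝ) : StreamIndex → (Fin 2 → ℝ) → ℝ
  | .inr (.inr (.inl _)), x => x 1 * (h * Real.exp (-x 0 / h))
  | .inl _, x => x 0
  | .inr (.inl _), x => x 0
  | .inr (.inr (.inr _)), x => x 0

lemma measurable_signMark (h : ℝ) (k : StreamIndex) : Measurable (signMark h k) := by
  rcases k with _ | _ | _ | _ <;> unfold signMark <;> fun_prop

lemma map_signMark (hh : 0 < h) (k : StreamIndex) :
    (Measure.infinitePi fun b : Fin 2 => if b = 0 then streamLaw h k else fairSign).map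
      (signMark h k) = markedStreamLaw h k := by
  have hp := isProbabilityMeasure_streamLaw hh k
  have hpp : ∀ b : Fin 2, IsProbabilityMeasure (if b = 0 then streamLaw h k else fairSign) := by
    intro b; split_ifs <;> infer_instance
  have h0 := Measure.infinitePi_map_eval
    (fun b : Fin 2 => if b = 0 then streamLaw h k else fairSign) 0
  rw [if_pos rfl] at h0
  rcases k with _ | _ | m | _
  · exact h0
  · exact h0
  · have h1 := Measure.infinitePi_map_eval_prod
      (P := fun b : Fin 2 => if b = 0 then streamLaw h (.inr (.inr (.inl m))) else fairSign)
      (show (0 : Fin 2) ≠ 1 by decide)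
    have hm : Measurable fun p : ℝ × ℝ => p.2 * (h * Real.exp (-p.1 / h)) := by fun_prop
    have hcomp : signMark h (.inr (.inr (.inl m))) =
        (fun p : ℝ × ℝ => p.2 * (h * Real.exp (-p.1 / h))) ∘ fun x : Fin 2 → ℝ => (x 0, x 1) := rfl
    rw [hcomp, ← Measure.map_map hm (by fun_prop), h1]
    simp only [if_pos, one_ne_zero, if_false]
    change ((expMeasure (1 / h)).prod fairSign).map _ = symmUniform h
    have := isProbabilityMeasure_expMeasure (show 0 < 1 / h by positivity)
    rw [fairSign, Measure.prod_add, Measure.prod_smul_right, Measure.prod_smul_right,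
      Measure.prod_dirac, Measure.prod_dirac, Measure.map_add _ _ hm, Measure.map_smul,
      Measure.map_smul, Measure.map_map hm (by fun_prop), Measure.map_map hm (by fun_prop),
      symmUniform_eq hh]
    congr 3
    · ext s; simp
    · ext s; simp
  · exact h0

/-- The random numbers with signed marks. -/
def signMarks (h : ℝ) (ω : Source d → ℝ) (j : Option (Fin d) × StreamIndex) : ℝ :=
  signMark h j.2 fun b => ω (j, b)

lemma measurePreserving_signMarks (hh : 0 < h) :
    MeasurePreserving (signMarks h) (Measure.infinitePi (sourceLaw (d := d) h))
      (Measure.infinitePi fun j : Option (Fin d) × StreamIndex => markedStreamLaw h j.2) := by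
  have h1 : ∀ p : Source d, IsProbabilityMeasure (sourceLaw h p) := isProbabilityMeasure_sourceLaw hh
  have h2 : ∀ (j : Option (Fin d) × StreamIndex) (b : Fin 2),
      IsProbabilityMeasure (if b = 0 then streamLaw h j.2 else fairSign) :=
    fun j b => h1 (j, b)
  have h3 := Measure.infinitePi_map_curry
    (fun (j : Option (Fin d) × StreamIndex) (b : Fin 2) =>
      if b = 0 then streamLaw h j.2 else fairSign)
  have h4 := Measure.infinitePi_map_pi (fun j : Option (Fin d) × StreamIndex =>
    Measure.infinitePi fun b : Fin 2 => if b = 0 then streamLaw h j.2 else fairSign)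
    (f := fun j => signMark h j.2) (fun j => measurable_signMark h j.2)
  have hm : Measurable (fun (x : Option (Fin d) × StreamIndex → Fin 2 → ℝ) j =>
      signMark h j.2 (x j)) :=
    measurable_pi_lambda _ fun j => (measurable_signMark h j.2).comp (measurable_pi_apply j)
  have hm' : Measurable (signMarks (d := d) h) :=
    measurable_pi_lambda _ fun j => (measurable_signMark h j.2).comp
      (measurable_pi_lambda _ fun b => measurable_pi_apply _)
  refine ⟨hm', ?_⟩
  rw [← h3, Measure.map_map hm (MeasurableEquiv.measurable _)] at h4
  simp only [map_signMark hh] at h4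
  exact h4

/-- A measure preserving transformation of the streams of one coordinate yields independent
families for all the coordinates. -/
lemma measurePreserving_blocks {K K' : Type} {ν : K → Measure ℝ} {ν' : K' → Measure ℝ}
    [∀ k, IsProbabilityMeasure (ν k)] [∀ k, IsProbabilityMeasure (ν' k)]
    {Θ : (K → ℝ) → K' → ℝ}
    (hΘ : MeasurePreserving Θ (Measure.infinitePi ν) (Measure.infinitePi ν')) :
    MeasurePreserving (fun (ω : Option (Fin d) × K → ℝ) (p : Fin d × K') =>
        Θ (fun k => ω (some p.1, k)) p.2)
      (Measure.infinitePi fun j => ν j.2) (Measure.infinitePi fun p => ν' p.2) := by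
  have h1 := Measure.infinitePi_map_curry (fun (_ : Option (Fin d)) (k : K) => ν k)
  have h2 := Measure.map_infinitePi_infinitePi_of_inj
    (P := fun _ : Option (Fin d) => Measure.infinitePi ν) (Option.some_injective (Fin d))
  have h3 := Measure.infinitePi_map_pi (fun _ : Fin d => Measure.infinitePi ν)
    (f := fun _ => Θ) (fun _ => hΘ.measurable)
  have h4 := Measure.infinitePi_map_curry_symm (fun (_ : Fin d) (k : K') => ν' k)
  simp only [hΘ.map_eq] at h3
  have m1 : Measurable fun (x : Option (Fin d) → K → ℝ) (i : Fin d) => x (some i) :=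
    measurable_pi_lambda _ fun i => measurable_pi_apply _
  have m2 : Measurable fun (x : Fin d → K → ℝ) (i : Fin d) => Θ (x i) :=
    measurable_pi_lambda _ fun i => hΘ.measurable.comp (measurable_pi_apply i)
  rw [← h3, ← h2, ← h1, Measure.map_map m1 (MeasurableEquiv.measurable _),
    Measure.map_map m2 (m1.comp (MeasurableEquiv.measurable _)),
    Measure.map_map (MeasurableEquiv.measurable _)
      (m2.comp (m1.comp (MeasurableEquiv.measurable _)))] at h4
  exact ⟨(MeasurableEquiv.measurable (MeasurableEquiv.curry (Fin d) K' ℝ).symm).comp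
    (m2.comp (m1.comp (MeasurableEquiv.measurable (MeasurableEquiv.curry _ _ _)))), h4⟩

/-- The bounce gaps and the sticking times of one coordinate. -/
def stickyBlock (h : ℝ) (x : StreamIndex → ℝ) : ℕ ⊕ ℕ → ℝ :=
  Sum.elim (fun k => x (.inl k)) (stickTimes h fun m => x (.inr (.inr (.inl m))))

lemma measurePreserving_stickyBlock (hh : 0 < h) :
    MeasurePreserving (stickyBlock h) (Measure.infinitePi (markedStreamLaw h))
      (Measure.infinitePi (Sum.elim (fun _ : ℕ => expMeasure 1)
        (fun _ : ℕ => expMeasure (1 / (2 * h))))) := by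
  have := isProbabilityMeasure_markedStreamLaw hh
  have i1 := isProbabilityMeasure_expMeasure one_pos
  have i2 := isProbabilityMeasure_expMeasure (show 0 < 1 / (2 * h) by positivity)
  have i3 := isProbabilityMeasure_symmUniform hh
  have i4 : ∀ k : ℕ ⊕ ℕ, IsProbabilityMeasure ((Sum.elim (fun _ : ℕ => expMeasure 1)
        (fun _ : ℕ => expMeasure (1 / (2 * h))) : ℕ ⊕ ℕ → Measure ℝ) k) := by
    rintro (k | k) <;> assumption
  have s1 := measurePreserving_sumSplit (markedStreamLaw h)
  have s2 := measurePreserving_sumSplit fun k => markedStreamLaw h (.inr k)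
  have s3 := measurePreserving_sumSplit fun k => markedStreamLaw h (.inr (.inr k))
  have s4 := measurePreserving_sumElim (Sum.elim (fun _ : ℕ => expMeasure 1)
        (fun _ : ℕ => expMeasure (1 / (2 * h))))
  have t1 := (measurePreserving_stickTimes hh).comp (measurePreserving_fst.comp
    (s3.comp (measurePreserving_snd.comp s2)))
  exact s4.comp (((MeasurePreserving.id _).prod t1).comp s1)

/-- The bounce gaps, the refreshment gaps and the refreshed positions of one coordinate. -/
def latentBlock (h r : ℝ) (x : StreamIndex → ℝ) : ℕ ⊕ (ℕ ⊕ ℕ) → ℝ :=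
  Sum.elim (fun k => x (.inl k)) (Sum.elim (fun k => x (.inr (.inl k)))
    (refreshedPos h r (fun k => x (.inr (.inl k))) (fun m => x (.inr (.inr (.inl m))),
      fun m => x (.inr (.inr (.inr m))))))

lemma measurePreserving_latentBlock (hh : 0 < h) {r : ℝ} (hr : 0 < r) :
    MeasurePreserving (latentBlock h r) (Measure.infinitePi (markedStreamLaw h))
      (Measure.infinitePi (Sum.elim (fun _ : ℕ => expMeasure 1)
        (Sum.elim (fun _ : ℕ => expMeasure 1) (fun _ : ℕ => symmUniform h)))) := by
  have := isProbabilityMeasure_markedStreamLaw hh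
  have i1 := isProbabilityMeasure_expMeasure one_pos
  have i3 := isProbabilityMeasure_symmUniform hh
  have i4 : ∀ k : ℕ ⊕ ℕ, IsProbabilityMeasure ((Sum.elim (fun _ : ℕ => expMeasure 1)
        (fun _ : ℕ => symmUniform h) : ℕ ⊕ ℕ → Measure ℝ) k) := by
    rintro (k | k) <;> assumption
  have i5 : ∀ k : ℕ ⊕ (ℕ ⊕ ℕ), IsProbabilityMeasure ((Sum.elim (fun _ : ℕ => expMeasure 1)
        (Sum.elim (fun _ : ℕ => expMeasure 1) (fun _ : ℕ => symmUniform h)) :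
        ℕ ⊕ (ℕ ⊕ ℕ) → Measure ℝ) k) := by
    rintro (k | k | k) <;> assumption
  have s1 := measurePreserving_sumSplit (markedStreamLaw h)
  have s2 := measurePreserving_sumSplit fun k => markedStreamLaw h (.inr k)
  have s3 := measurePreserving_sumSplit fun k => markedStreamLaw h (.inr (.inr k))
  have e1 := measurePreserving_sumElim (Sum.elim (fun _ : ℕ => expMeasure 1)
        (Sum.elim (fun _ : ℕ => expMeasure 1) (fun _ : ℕ => symmUniform h)))
  have e2 := measurePreserving_sumElim (Sum.elim (fun _ : ℕ => expMeasure 1)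
        (fun _ : ℕ => symmUniform h))
  have t1 := (measurePreserving_refreshedPos hh hr).comp (((MeasurePreserving.id _).prod s3).comp s2)
  exact e1.comp (((MeasurePreserving.id _).prod (e2.comp t1)).comp s1)

/-- A measure preserving map to a product consists of independent variables. -/
lemma hasLaw_and_iIndepFun_of_measurePreserving {Ω J : Type} [MeasurableSpace Ω] {P : Measure Ω}
    {ν : J → Measure ℝ} [∀ j, IsProbabilityMeasure (ν j)] {X : Ω → J → ℝ}
    (hX : MeasurePreserving X P (Measure.infinitePi ν)) :
    (∀ j, HasLaw (fun ω => X ω j) (ν j) P) ∧ iIndepFun (fun j ω => X ω j) P := by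
  have : IsProbabilityMeasure P := ⟨by
    have := hX.measure_preimage (s := univ) MeasurableSet.univ.nullMeasurableSet
    rwa [preimage_univ, measure_univ (μ := Measure.infinitePi ν)] at this⟩
  have hm : ∀ j, Measurable fun ω => X ω j := fun j => (measurable_pi_apply j).comp hX.measurable
  have hlaw : ∀ j, P.map (fun ω => X ω j) = ν j := by
    intro j
    rw [← Measure.infinitePi_map_eval ν j, ← hX.map_eq, Measure.map_map (measurable_pi_apply j)
      hX.measurable]
    rfl
  refine ⟨fun j => ⟨(hm j).aemeasurable, hlaw j⟩, ?_⟩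
  rw [iIndepFun_iff_map_fun_eq_infinitePi_map hm]
  simp only [hlaw]
  exact hX.map_eq

end sources

/-! ### The random numbers that drive the samplers -/

section drive

variable {d : ℕ}

/-- The source of the gaps of the clocks. -/
def clockSource : Clock d → ℕ → Source d
  | .tick, k => ((none, .inl k), 0)
  | .bounce i, k => ((some i, .inl k), 0)
  | .refresh i, k => ((some i, .inr (.inl k)), 0)
  | .mark i, k => ((some i, .inr (.inr (.inl k))), 0)

/-- The source of the signs of the marks. -/
def coin (i : Fin d) (m : ℕ) : Source d := ((some i, .inr (.inr (.inl m))), 1)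

/-- The source of the additional random positions. -/
def freshSource (i : Fin d) (k : ℕ) : Source d := ((some i, .inr (.inr (.inr k))), 0)

/-- The gaps of the clocks of the sticky process. -/
def sourceGap (ω : Source d → ℝ) (q : Clock d) (k : ℕ) : ℝ := ω (clockSource q k)

/-- The marks of the sticky process. -/
def sourceMark (ω : Source d → ℝ) : Clock d → ℕ → ℝ
  | .mark i, m => ω (coin i m)
  | _, _ => 0

lemma clockSource_inj {q p : Clock d} {k j : ℕ} :
    clockSource q k = clockSource p j ↔ q = p ∧ k = j := by
  rcases q with _ | i | i | i <;> rcases p with _ | l | l | l <;> simp [clockSource]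

lemma clockSource_ne_coin (q : Clock d) (k : ℕ) (i : Fin d) (m : ℕ) :
    clockSource q k ≠ coin i m := by
  rcases q with _ | i | i | i <;> simp [clockSource, coin]

lemma coin_inj {i j : Fin d} {m k : ℕ} : coin i m = coin j k ↔ i = j ∧ m = k := by simp [coin]

lemma sourceGap_update (ω : Source d → ℝ) (q : Clock d) (k : ℕ) (x : ℝ) (p : Clock d) (j : ℕ) :
    sourceGap (Function.update ω (clockSource q k) x) p j =
      if p = q ∧ j = k then x else sourceGap ω p j := by
  simp only [sourceGap, Function.update_apply, clockSource_inj]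

lemma sourceMark_update (ω : Source d → ℝ) (q : Clock d) (k : ℕ) (x : ℝ) :
    sourceMark (Function.update ω (clockSource q k) x) = sourceMark ω := by
  ext p j
  rcases p with _ | i | i | i <;> simp only [sourceMark]
  exact Function.update_of_ne (clockSource_ne_coin q k i j).symm _ _

lemma measurable_sourceGap (q : Clock d) (k : ℕ) :
    Measurable fun ω : Source d → ℝ => sourceGap ω q k := measurable_pi_apply _

lemma measurable_sourceMark (q : Clock d) (k : ℕ) :
    Measurable fun ω : Source d → ℝ => sourceMark ω q k := by
  rcases q with _ | i | i | i <;> simp only [sourceMark]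
  · exact measurable_const
  · exact measurable_const
  · exact measurable_pi_apply _
  · exact measurable_const

/-- The mean gaps of the clocks. -/
def meanGap (h : ℝ) : Clock d → ℝ
  | .mark _ => h
  | _ => 1

variable {h : ℝ}

lemma meanGap_pos (hh : 0 < h) (q : Clock d) : 0 < meanGap h q := by
  rcases q with _ | i | i | i <;> first | exact one_pos | exact hh

lemma sourceLaw_clockSource (h : ℝ) (q : Clock d) (k : ℕ) :
    sourceLaw h (clockSource q k) = expMeasure (1 / meanGap h q) := by
  rcases q with _ | i | i | i <;> simp [sourceLaw, clockSource, streamLaw, meanGap]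

lemma integral_id_expMeasure {a : ℝ} (ha : 0 < a) :
    Integrable (fun x => x) (expMeasure a) ∧ ∫ x, x ∂expMeasure a = 1 / a := by
  have hG := Real.integral_rpow_mul_exp_neg_mul_Ioi (a := 2) (r := a) two_pos ha
  have hG2 : Real.Gamma 2 = 1 := by simp
  rw [hG2, mul_one] at hG
  have hval : (1 / a) ^ (2 : ℝ) = 1 / a * (1 / a) := by
    rw [show (2 : ℝ) = ((2 : ℕ) : ℝ) by norm_num, Real.rpow_natCast]; ring
  rw [hval] at hG
  -- The integral was computed to be nonzero, which forces integrability, since the integral of a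
  -- non-integrable function is `0` by convention.
  have hint : IntegrableOn (fun t : ℝ => t ^ ((2 : ℝ) - 1) * Real.exp (-(a * t))) (Ioi 0) := by
    by_contra hc
    rw [integral_undef hc] at hG
    have : 0 < 1 / a * (1 / a) := by positivity
    linarith
  have hdens : ∀ x, 0 < x → exponentialPDFReal a x * x =
      a * (x ^ ((2 : ℝ) - 1) * Real.exp (-(a * x))) := by
    intro x hx
    simp only [exponentialPDFReal, gammaPDFReal, if_pos hx.le]
    norm_num
    ring
  have hzero : ∀ x ∉ Ioi (0 : ℝ), exponentialPDFReal a x * x = 0 := by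
    intro x hx
    have hx : x ≤ 0 := not_lt.1 hx
    rcases hx.eq_or_lt with h | h
    · simp [h]
    · simp [exponentialPDFReal, gammaPDFReal, not_le.2 h]
  have hI : IntegrableOn (fun x => exponentialPDFReal a x * x) (Ioi 0) :=
    IntegrableOn.congr_fun (hint.const_mul a) (fun x hx => (hdens x hx).symm) measurableSet_Ioi
  have hI' : Integrable fun x => exponentialPDFReal a x * x :=
    (integrableOn_iff_integrable_of_support_subset fun x hx => by
      by_contra hc; exact hx (hzero x hc)).1 hI
  have hpdf : expMeasure a = volume.withDensity fun x => ENNReal.ofReal (exponentialPDFReal a x) :=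
    rfl
  have hm : Measurable fun x => ENNReal.ofReal (exponentialPDFReal a x) :=
    (measurable_exponentialPDFReal a).ennreal_ofReal
  have htop : ∀ᵐ x ∂(volume : Measure ℝ), ENNReal.ofReal (exponentialPDFReal a x) < ∞ :=
    Eventually.of_forall fun _ => ENNReal.ofReal_lt_top
  have hto : ∀ x, (ENNReal.ofReal (exponentialPDFReal a x)).toReal = exponentialPDFReal a x :=
    fun x => ENNReal.toReal_ofReal (exponentialPDFReal_nonneg ha x)
  constructor
  · rw [hpdf, integrable_withDensity_iff hm htop]
    simpa only [hto, mul_comm] using hI'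
  · rw [hpdf, integral_withDensity_eq_integral_toReal_smul hm htop]
    simp only [hto, smul_eq_mul]
    rw [← setIntegral_eq_integral_of_forall_compl_eq_zero hzero,
      setIntegral_congr_fun measurableSet_Ioi fun x hx => hdens x hx, integral_const_mul, hG]
    field_simp

lemma ae_infinitePi_eval {ι : Type*} (μ : ι → Measure ℝ) [∀ i, IsProbabilityMeasure (μ i)] (i : ι)
    {p : ℝ → Prop} (hp : ∀ᵐ x ∂μ i, p x) : ∀ᵐ ω ∂Measure.infinitePi μ, p (ω i) := by
  rw [← Measure.infinitePi_map_eval μ i] at hp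
  exact ae_of_ae_map (measurable_pi_apply i).aemeasurable hp

/-- The strong law of large numbers for an exponential stream. -/
lemma ae_tendsto_average {ι : Type*} (μ : ι → Measure ℝ) [∀ i, IsProbabilityMeasure (μ i)]
    {src : ℕ → ι} (hsrc : Function.Injective src) {a : ℝ} (ha : 0 < a)
    (hμ : ∀ k, μ (src k) = expMeasure a) :
    ∀ᵐ ω : ι → ℝ ∂Measure.infinitePi μ,
      Tendsto (fun n : ℕ => (∑ k ∈ Finset.range n, ω (src k)) / n) atTop (𝓝 (1 / a)) := by
  have hmap : ∀ k, (Measure.infinitePi μ).map (fun ω => ω (src k)) = expMeasure a := fun k =>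
    (Measure.infinitePi_map_eval μ (src k)).trans (hμ k)
  have hmeas : ∀ k, Measurable fun ω : ι → ℝ => ω (src k) := fun k => measurable_pi_apply _
  obtain ⟨h1, h2⟩ := integral_id_expMeasure ha
  have hint : Integrable (fun ω : ι → ℝ => ω (src 0)) (Measure.infinitePi μ) := by
    rw [← hmap 0] at h1
    exact h1.comp_measurable (hmeas 0)
  have hval : ∫ ω, ω (src 0) ∂Measure.infinitePi μ = 1 / a := by
    rw [← h2, ← hmap 0]
    exact (integral_map (hmeas 0).aemeasurable measurable_id.aestronglyMeasurable).symm
  have := strong_law_ae_real (μ := Measure.infinitePi μ) (fun k ω => ω (src k)) hint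
    (fun k j hkj => (iIndepFun_infinitePi (P := μ) (X := fun _ x => x)
      (fun _ => measurable_id)).indepFun (hsrc.ne hkj))
    (fun k => ⟨(hmeas k).aemeasurable, (hmeas 0).aemeasurable, by rw [hmap, hmap]⟩)
  rwa [hval] at this

lemma tendsto_sum_of_average {f : ℕ → ℝ} {c : ℝ} (hc : 0 < c)
    (h : Tendsto (fun n : ℕ => (∑ k ∈ Finset.range n, f k) / n) atTop (𝓝 c)) :
    Tendsto (fun n => ∑ k ∈ Finset.range n, f k) atTop atTop := by
  have := h.pos_mul_atTop hc tendsto_natCast_atTop_atTop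
  refine this.congr' ?_
  filter_upwards [eventually_gt_atTop 0] with n hn
  have : (n : ℝ) ≠ 0 := by positivity
  field_simp

/-- The properties of the random numbers that hold almost surely. -/
structure IsTypical (h : ℝ) (ω : Source d → ℝ) : Prop where
  gap_pos : ∀ q k, 0 < sourceGap ω q k
  coin_sign : ∀ i m, ω (coin i m) = 1 ∨ ω (coin i m) = -1
  fresh : ∀ i k, |ω (freshSource i k)| < h
  average : ∀ q, Tendsto (fun n : ℕ => (∑ k ∈ Finset.range n, sourceGap ω q k) / n) atTop
    (𝓝 (meanGap h q))

lemma ae_isTypical (hh : 0 < h) :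
    ∀ᵐ ω ∂Measure.infinitePi (sourceLaw (d := d) h), IsTypical h ω := by
  have hp := isProbabilityMeasure_sourceLaw (d := d) hh
  have h1 : ∀ᵐ ω ∂Measure.infinitePi (sourceLaw (d := d) h), ∀ q k, 0 < sourceGap ω q k := by
    simp only [ae_all_iff]
    intro q k
    refine ae_infinitePi_eval _ (clockSource q k) ?_
    rw [sourceLaw_clockSource]
    exact ae_expMeasure_pos (one_div_pos.2 (meanGap_pos hh q))
  have h2 : ∀ᵐ ω ∂Measure.infinitePi (sourceLaw (d := d) h), ∀ i m,
      ω (coin i m) = 1 ∨ ω (coin i m) = -1 := by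
    simp only [ae_all_iff]
    intro i m
    refine ae_infinitePi_eval _ (coin i m) (p := fun x => x = 1 ∨ x = -1) ?_
    exact ae_fairSign
  have h3 : ∀ᵐ ω ∂Measure.infinitePi (sourceLaw (d := d) h), ∀ (i : Fin d) (k : ℕ),
      |ω (freshSource i k)| < h := by
    simp only [ae_all_iff]
    intro i k
    refine ae_infinitePi_eval _ (freshSource i k) (p := fun x => |x| < h) ?_
    filter_upwards [ae_symmUniform h] with x hx using hx.1
  have h4 : ∀ᵐ ω ∂Measure.infinitePi (sourceLaw (d := d) h), ∀ q,
      Tendsto (fun n : ℕ => (∑ k ∈ Finset.range n, sourceGap ω q k) / n) atTop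
        (𝓝 (meanGap h q)) := by
    rw [eventually_all]
    intro q
    have := ae_tendsto_average (sourceLaw (d := d) h) (src := clockSource q)
      (fun k j hkj => (clockSource_inj.1 hkj).2) (one_div_pos.2 (meanGap_pos hh q))
      (sourceLaw_clockSource h q)
    rwa [one_div_one_div] at this
  filter_upwards [h1, h2, h3, h4] with ω h1 h2 h3 h4 using ⟨h1, h2, h3, h4⟩

lemma IsTypical.tendsto_sum {ω : Source d → ℝ} (hω : IsTypical h ω) (hh : 0 < h) (q : Clock d) :
    Tendsto (fun n => ∑ k ∈ Finset.range n, sourceGap ω q k) atTop atTop :=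
  tendsto_sum_of_average (meanGap_pos hh q) (hω.average q)

lemma nullSingletonClass_clockSource (h : ℝ) (q : Clock d) (k : ℕ) :
    NullSingletonClass (sourceLaw h (clockSource q k)) := by
  rw [sourceLaw_clockSource]; exact nullSingletonClass_expMeasure _

end drive

/-! ### The original sampler -/

section original

variable {d : ℕ} {M : SpikeSlab d}

/-- Runs with the same gaps agree as long as the marks that have been used agree. -/
lemma ClockSystem.run_congr_mark {Q Z : Type} {S : ClockSystem Q Z} [Fintype Q] [DecidableEq Q]
    [Nonempty Q] {g mk mk' : Q → ℕ → ℝ} {z₀ : Z} {q : Q} {k n : ℕ}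
    (h : ∀ p j, ¬ (p = q ∧ j = k) → mk p j = mk' p j) (hn : (S.run g mk z₀ n).count q ≤ k) :
    S.run g mk z₀ n = S.run g mk' z₀ n := by
  induction n with
  | zero => rfl
  | succ n ih =>
    have hle := run_count_mono (S := S) (g := g) (mk := mk) (z₀ := z₀) q n.le_succ
    have ih := ih (hle.trans hn)
    rw [run_succ, run_succ, ← ih]
    have : mk (S.first (S.run g mk z₀ n).pos (S.run g mk z₀ n).resid)
        ((S.run g mk z₀ n).count (S.first (S.run g mk z₀ n).pos (S.run g mk z₀ n).resid)) =
        mk' (S.first (S.run g mk z₀ n).pos (S.run g mk z₀ n).resid)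
        ((S.run g mk z₀ n).count (S.first (S.run g mk z₀ n).pos (S.run g mk z₀ n).resid)) := by
      refine h _ _ ?_
      -- Using the exceptional mark would raise the count of its clock above `k`.
      rintro ⟨h1, h2⟩
      rw [h1] at h2
      rw [run_succ] at hn
      simp only [step, h1, if_true, h2] at hn
      omega
    simp only [step, this]

variable (M) in
/-- The states of the original sampler after its events. -/
abbrev originalRun (y₀ v₀ : Fin d → ℝ) (ω : Source d → ℝ) (n : ℕ) :
    ClockState (Clock d) (StickyState d) :=
  (stickySystem M 0).run (sourceGap ω) (sourceMark ω) (stickyInit M y₀ v₀) n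

variable (M) in
/-- The clock that causes the next event of the original sampler. -/
abbrev originalFirst (y₀ v₀ : Fin d → ℝ) (ω : Source d → ℝ) (n : ℕ) : Clock d :=
  (stickySystem M 0).first (originalRun M y₀ v₀ ω n).pos (originalRun M y₀ v₀ ω n).resid

open Classical in
variable (M) in
/-- The sign that is used at the `n`-th event if this is a mark of a coordinate with a negative
velocity. -/
def usedCoin (y₀ v₀ : Fin d → ℝ) (n : ℕ) (ω : Source d → ℝ) : Option (Source d) :=
  match originalFirst M y₀ v₀ ω n with
  | .mark i => if velocity (originalRun M y₀ v₀ ω n).pos i = -1 then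
      some (coin i ((originalRun M y₀ v₀ ω n).count (.mark i))) else none
  | _ => none

variable {y₀ v₀ : Fin d → ℝ} {h : ℝ}

lemma usedCoin_eq_some_iff {n : ℕ} {ω : Source d → ℝ} {a : Source d} :
    usedCoin M y₀ v₀ n ω = some a ↔ ∃ i m, a = coin i m ∧ originalFirst M y₀ v₀ ω n = .mark i ∧
      velocity (originalRun M y₀ v₀ ω n).pos i = -1 ∧
      (originalRun M y₀ v₀ ω n).count (.mark i) = m := by
  unfold usedCoin
  rcases hq : originalFirst M y₀ v₀ ω n with _ | i | i | i
  · simp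
  · simp
  · simp only [Clock.mark.injEq]
    split_ifs with hv
    · constructor
      · intro h; exact ⟨i, _, (Option.some.inj h).symm, rfl, hv, rfl⟩
      · rintro ⟨j, m, rfl, rfl, -, rfl⟩; rfl
    · simp only [false_iff]
      rintro ⟨j, m, -, rfl, h, -⟩; exact hv h
  · simp

/-- Every mark raises the count of its clock, so no coin is used twice. -/
lemma originalRun_mark_unique {n m : ℕ} {ω : Source d → ℝ} {i : Fin d}
    (hn : originalFirst M y₀ v₀ ω n = .mark i) (hm : originalFirst M y₀ v₀ ω m = .mark i)
    (h : (originalRun M y₀ v₀ ω n).count (.mark i) = (originalRun M y₀ v₀ ω m).count (.mark i)) :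
    n = m := by
  have key : ∀ {n m : ℕ}, originalFirst M y₀ v₀ ω n = .mark i → n < m →
      (originalRun M y₀ v₀ ω n).count (.mark i) < (originalRun M y₀ v₀ ω m).count (.mark i) := by
    intro n m hn hlt
    have h1 : (originalRun M y₀ v₀ ω (n + 1)).count (.mark i) =
        (originalRun M y₀ v₀ ω n).count (.mark i) + 1 := by
      have hn' : (stickySystem M 0).first (originalRun M y₀ v₀ ω n).pos
        (originalRun M y₀ v₀ ω n).resid = .mark i := hn
      change ((stickySystem M 0).step _ _ (originalRun M y₀ v₀ ω n)).count _ = _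
      simp only [ClockSystem.step, hn', if_true]
    have h2 := ClockSystem.run_count_mono (S := stickySystem M 0) (g := sourceGap ω)
      (mk := sourceMark ω) (z₀ := stickyInit M y₀ v₀) (.mark i) (show n + 1 ≤ m from hlt)
    simp only at h2
    change (originalRun M y₀ v₀ ω (n + 1)).count _ ≤ (originalRun M y₀ v₀ ω m).count _ at h2
    omega
  rcases lt_trichotomy n m with hlt | rfl | hlt
  · have := key hn hlt; omega
  · rfl
  · have := key hm hlt; omega

lemma measurable_originalRun (hM : ContDiff ℝ 2 M.densityPart) (y₀ v₀ : Fin d → ℝ) (n : ℕ) :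
    (Measurable fun ω => (originalRun M y₀ v₀ ω n).time) ∧
    (Measurable fun ω => (originalRun M y₀ v₀ ω n).pos) ∧
    (∀ q, Measurable fun ω => (originalRun M y₀ v₀ ω n).resid q) ∧
    (∀ q, Measurable fun ω => (originalRun M y₀ v₀ ω n).count q) :=
  (stickySystem_isContinuous hM).measurable_run (stickySystem_regular hM le_rfl)
    measurable_sourceGap measurable_sourceMark _ n

/-- The states before a mark involve only earlier coins, so a coin does not influence whether it is
itself chosen. -/
lemma measurePreserving_flipSigns_usedCoin (hM : ContDiff ℝ 2 M.densityPart) (y₀ v₀ : Fin d → ℝ)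
    (hh : 0 < h) :
    MeasurePreserving (flipSigns (usedCoin M y₀ v₀)) (Measure.infinitePi (sourceLaw (d := d) h))
      (Measure.infinitePi (sourceLaw (d := d) h)) := by
  have hp := isProbabilityMeasure_sourceLaw (d := d) hh
  refine measurePreserving_flipSigns _ (fun n a => ?_) (fun n a ω ha k hk => ?_)
    (fun n m a ω hn hm => ?_) (fun n a ω ha => ?_)
  · obtain ⟨-, hpos, hres, hc⟩ := measurable_originalRun hM y₀ v₀ n
    have : {ω | usedCoin M y₀ v₀ n ω = some a} = ⋃ i : Fin d, ⋃ m : ℕ, ({_ω | a = coin i m} ∩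
        ({ω | originalFirst M y₀ v₀ ω n = .mark i} ∩
        ({ω | velocity (originalRun M y₀ v₀ ω n).pos i = -1} ∩
        {ω | (originalRun M y₀ v₀ ω n).count (.mark i) = m}))) := by
      ext ω
      simp only [mem_ofPred_eq, mem_iUnion, mem_inter_iff, usedCoin_eq_some_iff]
    rw [this]
    refine MeasurableSet.iUnion fun i => MeasurableSet.iUnion fun m =>
      (MeasurableSet.const _).inter (MeasurableSet.inter ?_ (MeasurableSet.inter ?_ ?_))
    · exact (stickySystem_isContinuous hM).measurableSet_first (stickySystem_regular hM le_rfl)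
        hpos hres _
    · exact ((continuous_apply i).comp continuous_velocity).measurable.comp hpos
        (measurableSet_singleton _)
    · exact hc _ (measurableSet_singleton m)
  · obtain ⟨i, m, rfl, h1, h2, h3⟩ := usedCoin_eq_some_iff.1 ha
    have hg : sourceGap (negAt (coin i m) ω) = sourceGap ω := by
      ext q j; exact Function.update_of_ne (clockSource_ne_coin q j i m) _ _
    have hrun : originalRun M y₀ v₀ (negAt (coin i m) ω) k = originalRun M y₀ v₀ ω k := by
      unfold originalRun
      rw [hg]
      refine (ClockSystem.run_congr_mark (q := .mark i) (k := m) (fun p j hpj => ?_) ?_).symm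
      · rcases p with _ | l | l | l <;> simp only [sourceMark]
        refine (Function.update_of_ne (fun hc => hpj ?_) _ _).symm
        obtain ⟨rfl, rfl⟩ := coin_inj.1 hc
        exact ⟨rfl, rfl⟩
      · rw [← h3]
        exact ClockSystem.run_count_mono _ hk
    simp only [usedCoin, originalFirst, hrun]
  · obtain ⟨i, k, rfl, h1, -, h3⟩ := usedCoin_eq_some_iff.1 hn
    obtain ⟨j, l, h4, h5, -, h6⟩ := usedCoin_eq_some_iff.1 hm
    obtain ⟨rfl, rfl⟩ := coin_inj.1 h4
    exact originalRun_mark_unique h1 h5 (h3.trans h6.symm)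
  · obtain ⟨i, m, rfl, -⟩ := usedCoin_eq_some_iff.1 ha
    exact fairSign_map_neg

variable (M) in
/-- The mark stream that yields the sticking times of the original sampler. -/
def releaseMarks (h : ℝ) (y₀ v₀ : Fin d → ℝ) (ω : Source d → ℝ) (i : Fin d) (m : ℕ) : ℝ :=
  signMarks h (flipSigns (usedCoin M y₀ v₀) ω) (some i, .inr (.inr (.inl m)))

lemma flipSigns_clockSource (ω : Source d → ℝ) (q : Clock d) (k : ℕ) :
    flipSigns (usedCoin M y₀ v₀) ω (clockSource q k) = sourceGap ω q k := by
  refine if_neg ?_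
  rintro ⟨n, hn⟩
  obtain ⟨i, m, h, -⟩ := usedCoin_eq_some_iff.1 hn
  exact clockSource_ne_coin q k i m h

lemma releaseMarks_eq (ω : Source d → ℝ) (i : Fin d) (m : ℕ) : releaseMarks M h y₀ v₀ ω i m =
    flipSigns (usedCoin M y₀ v₀) ω (coin i m) * (h * Real.exp (-sourceGap ω (.mark i) m / h)) := by
  rw [← flipSigns_clockSource (M := M) (y₀ := y₀) (v₀ := v₀)]
  rfl

lemma flipSigns_coin_sign {ω : Source d → ℝ} (hω : IsTypical h ω) (i : Fin d) (m : ℕ) :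
    flipSigns (usedCoin M y₀ v₀) ω (coin i m) = 1 ∨
      flipSigns (usedCoin M y₀ v₀) ω (coin i m) = -1 := by
  unfold flipSigns
  rcases hω.coin_sign i m with h | h <;> split_ifs <;> simp [h]

lemma markGap_releaseMarks (hh : 0 < h) {ω : Source d → ℝ} (hω : IsTypical h ω) (i : Fin d)
    (m : ℕ) : markGap h (releaseMarks M h y₀ v₀ ω i m) = sourceGap ω (.mark i) m := by
  rw [releaseMarks_eq]
  rcases flipSigns_coin_sign (M := M) (y₀ := y₀) (v₀ := v₀) hω i m with h' | h' <;> rw [h']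
  · rw [one_mul, markGap_exp hh]
  · rw [neg_one_mul, markGap_neg, markGap_exp hh]

/-- The reversal multiplies a coin by the velocity at the time of its use, so that agreement with
the velocity becomes positivity. -/
lemma releaseMarks_pos_iff (hh : 0 < h) {ω : Source d → ℝ} (hω : IsTypical h ω) {n : ℕ}
    {i : Fin d} (hn : originalFirst M y₀ v₀ ω n = .mark i) :
    0 < releaseMarks M h y₀ v₀ ω i ((originalRun M y₀ v₀ ω n).count (.mark i)) ↔
      sourceMark ω (.mark i) ((originalRun M y₀ v₀ ω n).count (.mark i)) =
        velocity (originalRun M y₀ v₀ ω n).pos i := by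
  have hpos : 0 < h * Real.exp (-sourceGap ω (.mark i)
      ((originalRun M y₀ v₀ ω n).count (.mark i)) / h) := by positivity
  rw [releaseMarks_eq, mul_pos_iff_of_pos_right hpos]
  have hv : velocity (originalRun M y₀ v₀ ω n).pos i = 1 ∨
      velocity (originalRun M y₀ v₀ ω n).pos i = -1 := by
    unfold velocity boolSign; split_ifs <;> simp
  have hc := hω.coin_sign i ((originalRun M y₀ v₀ ω n).count (.mark i))
  simp only [sourceMark]
  rcases hv with hv | hv
  · have : ¬ ∃ k, usedCoin M y₀ v₀ k ω =
        some (coin i ((originalRun M y₀ v₀ ω n).count (.mark i))) := by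
      rintro ⟨k, hk⟩
      obtain ⟨j, l, h4, h5, h7, h6⟩ := usedCoin_eq_some_iff.1 hk
      obtain ⟨rfl, rfl⟩ := coin_inj.1 h4
      rw [originalRun_mark_unique h5 hn h6, hv] at h7
      norm_num at h7
    rw [flipSigns, if_neg this, hv]
    rcases hc with h | h <;> rw [h] <;> norm_num
  · have : ∃ k, usedCoin M y₀ v₀ k ω =
        some (coin i ((originalRun M y₀ v₀ ω n).count (.mark i))) :=
      ⟨n, usedCoin_eq_some_iff.2 ⟨i, _, rfl, hn, hv, rfl⟩⟩
    rw [flipSigns, if_pos this, hv]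
    rcases hc with h | h <;> rw [h] <;> norm_num

lemma ae_tieFree_originalRun (hM : ContDiff ℝ 2 M.densityPart) (y₀ v₀ : Fin d → ℝ) (hh : 0 < h) :
    ∀ᵐ ω ∂Measure.infinitePi (sourceLaw (d := d) h), ∀ n, (stickySystem M 0).TieFree
      (originalRun M y₀ v₀ ω n).pos (originalRun M y₀ v₀ ω n).resid := by
  have hp := isProbabilityMeasure_sourceLaw (d := d) hh
  refine ClockSystem.ae_tieFree (stickySystem_regular hM le_rfl) (stickySystem_isContinuous hM)
    (sourceLaw h) clockSource (nullSingletonClass_clockSource h) sourceGap_update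
    sourceMark_update measurable_sourceGap measurable_sourceMark ?_ _
  filter_upwards [ae_isTypical hh] with ω hω q k using (hω.gap_pos q k).le

lemma continuous_hitTime (i : Fin d) : Continuous (hitTime (d := d) i) := by
  unfold hitTime; fun_prop

/-- The hazard up to the hit is determined by the position alone, and the remaining amount of the
bounce clock avoids such values. -/
lemma ae_noBounceAtHit (hM : ContDiff ℝ 2 M.densityPart) (y₀ v₀ : Fin d → ℝ) (hh : 0 < h) :
    ∀ᵐ ω ∂Measure.infinitePi (sourceLaw (d := d) h),
      NoBounceAtHit M 0 (sourceGap ω) (sourceMark ω) (stickyInit M y₀ v₀) := by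
  have hp := isProbabilityMeasure_sourceLaw (d := d) hh
  unfold NoBounceAtHit
  simp only [ae_all_iff]
  intro n i
  obtain ⟨-, hpos, hres, hc⟩ := measurable_originalRun hM y₀ v₀ n
  have := nullSingletonClass_clockSource (d := d) h (.bounce i)
  have hhit : Measurable fun ω => hitTime i (originalRun M y₀ v₀ ω n).pos :=
    (continuous_hitTime i).measurable.comp hpos
  exact ClockSystem.ae_resid_ne (stickySystem_regular hM le_rfl) (sourceLaw h)
    (clockSource (.bounce i)) (fun ω => sourceGap_update ω _) (fun ω => sourceMark_update ω _) _
    (fun s => (stickySystem M 0).hazard (.bounce i) s.pos (hitTime i s.pos))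
    (fun s s' _ hs _ _ => by simp only [hs]) n
    ((stickySystem_isContinuous hM).measurable_hazard hpos hhit (fun _ => le_max_right _ _) _)
    (hres _) (hc _)

/-- An event at time `T` would require that the remaining amount of the ringing clock equals its
hazard over the time left until `T`. -/
lemma ae_time_originalRun_ne (hM : ContDiff ℝ 2 M.densityPart) (y₀ v₀ : Fin d → ℝ) (hh : 0 < h)
    {T : ℝ} (hT : 0 < T) : ∀ᵐ ω ∂Measure.infinitePi (sourceLaw (d := d) h),
      ∀ n, (originalRun M y₀ v₀ ω n).time ≠ T := by
  have hp := isProbabilityMeasure_sourceLaw (d := d) hh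
  have hS := stickySystem_regular (M := M) hM le_rfl
  have key : ∀ᵐ ω ∂Measure.infinitePi (sourceLaw (d := d) h), ∀ n q,
      (originalRun M y₀ v₀ ω n).resid q ≠ (stickySystem M 0).hazard q (originalRun M y₀ v₀ ω n).pos
        (max (T - (originalRun M y₀ v₀ ω n).time) 0) := by
    rw [ae_all_iff]; intro n
    rw [eventually_all]; intro q
    obtain ⟨ht, hpos, hres, hc⟩ := measurable_originalRun hM y₀ v₀ n
    have := nullSingletonClass_clockSource (d := d) h q
    exact ClockSystem.ae_resid_ne hS (sourceLaw h)
      (clockSource q) (fun ω => sourceGap_update ω _) (fun ω => sourceMark_update ω _) _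
      (fun s => (stickySystem M 0).hazard q s.pos (max (T - s.time) 0))
      (fun s s' ht hs _ _ => by simp only [hs, ht]) n
      ((stickySystem_isContinuous hM).measurable_hazard hpos
        ((ht.const_sub T).max measurable_const) (fun _ => le_max_right _ _) _) (hres _) (hc _)
  filter_upwards [key, ae_isTypical hh] with ω hω htyp n hn
  rcases n with _ | n
  · exact hT.ne hn
  · refine hω n (originalFirst M y₀ v₀ ω n) ?_
    have hres := fun q => (hS.run_resid (mk := sourceMark ω) (z₀ := stickyInit M y₀ v₀)
      (fun q k => (htyp.gap_pos q k).le) n q).1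
    have hw : max (T - (originalRun M y₀ v₀ ω n).time) 0 = (stickySystem M 0).wait
        (originalRun M y₀ v₀ ω n).pos (originalRun M y₀ v₀ ω n).resid := by
      have hn' : (originalRun M y₀ v₀ ω n).time + (stickySystem M 0).wait
        (originalRun M y₀ v₀ ω n).pos (originalRun M y₀ v₀ ω n).resid = T := hn
      rw [← hn', add_sub_cancel_left]
      exact max_eq_left (ClockSystem.wait_nonneg _ _)
    rw [hw]
    exact (hS.hazard_first _ _ hres).symm

lemma ae_infinite_releaseMarks (hM : ContDiff ℝ 2 M.densityPart) (y₀ v₀ : Fin d → ℝ) (hh : 0 < h) :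
    ∀ᵐ ω ∂Measure.infinitePi (sourceLaw (d := d) h),
      ∀ i, {m | 0 < releaseMarks M h y₀ v₀ ω i m}.Infinite := by
  have hp := isProbabilityMeasure_sourceLaw (d := d) hh
  have hp' : ∀ j : Option (Fin d) × StreamIndex, IsProbabilityMeasure (markedStreamLaw h j.2) :=
    fun j => isProbabilityMeasure_markedStreamLaw hh j.2
  rw [ae_all_iff]
  intro i
  have hinj : Function.Injective fun m : ℕ =>
      ((some i, .inr (.inr (.inl m))) : Option (Fin d) × StreamIndex) := by
    intro m k hmk; simpa using hmk
  have h1 := Measure.map_infinitePi_infinitePi_of_inj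
    (P := fun j : Option (Fin d) × StreamIndex => markedStreamLaw h j.2) hinj
  have h2 : MeasurePreserving (fun ω m => releaseMarks M h y₀ v₀ ω i m)
      (Measure.infinitePi (sourceLaw (d := d) h))
      (Measure.infinitePi fun _ : ℕ => symmUniform h) :=
    (MeasurePreserving.mk (measurable_pi_lambda _ fun m => measurable_pi_apply _) h1).comp
      ((measurePreserving_signMarks hh).comp (measurePreserving_flipSigns_usedCoin hM y₀ v₀ hh))
  exact h2.quasiMeasurePreserving.ae (ae_infinite_pos hh)

/-- The bounce gaps and the sticking times are a measure preserving image of the random numbers with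
reversed coins. As the reversal preserves the law, they are independent with the required laws,
although the reversal itself depends on the path. -/
theorem isOriginalSticky_position (hM : ContDiff ℝ 2 M.densityPart)
    (hv₀ : ∀ i, v₀ i = 1 ∨ v₀ i = -1) :
    IsOriginalSticky M (M.collapse y₀) v₀ (fun i => M.startsStuck (y₀ i) (v₀ i))
      (Measure.infinitePi (sourceLaw (d := d) (M.width / 2)))
      (fun ω t => position ((stickySystem M 0).path (sourceGap ω) (sourceMark ω)
        (stickyInit M y₀ v₀) t))
      (fun ω t => velocity ((stickySystem M 0).path (sourceGap ω) (sourceMark ω)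
        (stickyInit M y₀ v₀) t)) := by
  have hh : 0 < M.width / 2 := half_pos M.width_pos
  have hp := isProbabilityMeasure_sourceLaw (d := d) hh
  have hp' := isProbabilityMeasure_markedStreamLaw hh
  have hq : ∀ k : ℕ ⊕ ℕ, IsProbabilityMeasure ((Sum.elim (fun _ : ℕ => expMeasure 1)
      (fun _ : ℕ => expMeasure (1 / (2 * (M.width / 2)))) : ℕ ⊕ ℕ → Measure ℝ) k) := by
    rintro (k | k)
    · exact isProbabilityMeasure_expMeasure one_pos
    · exact isProbabilityMeasure_expMeasure (by have := M.width_pos; positivity)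
  have hX := (measurePreserving_blocks (d := d) (measurePreserving_stickyBlock hh)).comp
    ((measurePreserving_signMarks hh).comp (measurePreserving_flipSigns_usedCoin hM y₀ v₀ hh))
  obtain ⟨hlaw, hind⟩ := hasLaw_and_iIndepFun_of_measurePreserving hX
  have hwidth : 2 * (M.width / 2) = M.width := by ring
  refine ⟨fun i k ω => sourceGap ω (.bounce i) k,
    fun i k ω => stickTimes (M.width / 2) (releaseMarks M (M.width / 2) y₀ v₀ ω i) k,
    fun i k => ?_, fun i k => ?_, ?_, ?_⟩
  · have := hlaw (i, .inl k)
    refine this.congr (Eventually.of_forall fun ω => ?_)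
    exact (flipSigns_clockSource (M := M) (y₀ := y₀) (v₀ := v₀) ω (.bounce i) k).symm
  · have := hlaw (i, .inr k)
    simp only [Sum.elim_inr, hwidth] at this
    exact this
  · have hinj : Function.Injective (Sum.elim (fun a : Fin d × ℕ => ((a.1, .inl a.2) : Fin d × (ℕ ⊕ ℕ)))
        (fun a : Fin d × ℕ => (a.1, .inr a.2))) := by
      rintro (⟨i, k⟩ | ⟨i, k⟩) (⟨j, l⟩ | ⟨j, l⟩) h <;> simp_all
    have h := hind.precomp hinj
    convert h using 1
    ext q ω
    rcases q with ⟨i, k⟩ | ⟨i, k⟩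
    · exact (flipSigns_clockSource (M := M) (y₀ := y₀) (v₀ := v₀) ω (.bounce i) k).symm
    · rfl
  · filter_upwards [ae_isTypical hh, ae_tieFree_originalRun hM y₀ v₀ hh,
      ae_noBounceAtHit hM y₀ v₀ hh, ae_infinite_releaseMarks hM y₀ v₀ hh] with ω hω htf hexo hinf
    refine ⟨fun t i => IsStuck ((stickySystem M 0).path (sourceGap ω) (sourceMark ω)
      (stickyInit M y₀ v₀) t) i, ?_⟩
    have := isOriginalPath_sticky hM le_rfl hv₀ hω.gap_pos
      (stickySystem_tendsto_time hM le_rfl _ _ hω.gap_pos (hω.tendsto_sum hh)) htf hexo hinf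
      fun n i hn => releaseMarks_pos_iff hh hω hn
    convert this using 3 with i k
    rw [stickTimes_eq _ (hinf i)]
    simp only [markGap_releaseMarks hh hω]

end original

/-! ### The latent sampler -/

section latent

variable {d : ℕ} (M : SpikeSlab d)

/-- The signed marks, spread over the universe. -/
def universeMark (ω : Source d → ℝ) (i : Fin d) (m : ℕ) : ℝ :=
  signMarks (M.width / 2) ω (some i, .inr (.inr (.inl m)))

/-- The marks of the latent sampler, which are the refreshed positions. -/
def latentMark (r : ℝ) (ω : Source d → ℝ) : Clock d → ℕ → ℝ
  | .refresh i, k => refreshedPos (M.width / 2) r (sourceGap ω (.refresh i))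
      (universeMark M ω i, fun m => ω (freshSource i m)) k
  | _, _ => 0

/-- The gaps of the clocks of the latent sampler. -/
def latentGap (r : ℝ) (ω : Source d → ℝ) : Clock d → ℕ → ℝ
  | .mark i, m => escapeGap M.width r (sourceGap ω (.refresh i)) (latentMark M r ω (.refresh i)) m
  | q, k => sourceGap ω q k

variable {M} {r : ℝ} {ω : Source d → ℝ}

/-- In contrast to `releaseMarks`, the coins are not reversed: the sign is the side of the universe
on which the escape takes place. The gap agrees with the exponential mark gap of the sticky process.
-/
lemma universeMark_spec (hω : IsTypical (M.width / 2) ω) (i : Fin d) (m : ℕ) :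
    |universeMark M ω i m| < M.width / 2 ∧ universeMark M ω i m ≠ 0 ∧
      markGap (M.width / 2) (universeMark M ω i m) = sourceGap ω (.mark i) m ∧
      ω (coin i m) * |universeMark M ω i m| = universeMark M ω i m := by
  have hh : 0 < M.width / 2 := half_pos M.width_pos
  have hg := hω.gap_pos (.mark i) m
  set c := M.width / 2 * Real.exp (-sourceGap ω (.mark i) m / (M.width / 2)) with hc
  have hdef : universeMark M ω i m = ω (coin i m) * c := rfl
  have hc0 : 0 < c := by positivity
  have hc1 : c < M.width / 2 := by
    refine mul_lt_of_lt_one_right hh (Real.exp_lt_one_iff.2 ?_)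
    exact div_neg_of_neg_of_pos (neg_neg_of_pos hg) hh
  have hgap : markGap (M.width / 2) c = sourceGap ω (.mark i) m := markGap_exp hh _
  rw [hdef]
  rcases hω.coin_sign i m with h | h <;> rw [h]
  · rw [one_mul, one_mul, abs_of_pos hc0]
    exact ⟨hc1, hc0.ne', hgap, rfl⟩
  · rw [neg_one_mul, abs_neg, abs_of_pos hc0, markGap_neg, neg_one_mul]
    exact ⟨hc1, neg_ne_zero.2 hc0.ne', hgap, rfl⟩

lemma universeMark_le (hω : IsTypical (M.width / 2) ω) (i : Fin d) (m : ℕ) :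
    |universeMark M ω i m| ≤ M.width / 2 ∧ universeMark M ω i m ≠ 0 :=
  ⟨(universeMark_spec hω i m).1.le, (universeMark_spec hω i m).2.1⟩

lemma isCoupling_latentGap (hr : 0 < r) (hω : IsTypical (M.width / 2) ω)
    (hu : ∀ i k, |latentMark M r ω (.refresh i) k| < M.width / 2) :
    IsCoupling M r (latentGap M r ω) (sourceMark ω) (latentMark M r ω) := by
  have hh : 0 < M.width / 2 := half_pos M.width_pos
  have hinf : ∀ i, {n | Escapes M.width r (sourceGap ω (.refresh i))
      (latentMark M r ω (.refresh i)) n}.Infinite := fun i =>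
    infinite_escapes M.width_pos hr (fun n => (hω.fresh i n).le) (universeMark_le hω i)
      (hω.tendsto_sum hh _)
  refine ⟨fun q k => ?_, hu, hinf, fun i => ?_, fun i m => ?_, hω.coin_sign, fun i m => ?_⟩
  · rcases q with _ | i | i | i
    · exact hω.gap_pos _ _
    · exact hω.gap_pos _ _
    · exact escapeGap_pos hr (hω.gap_pos _) (hu i) (hinf i) k
    · exact hω.gap_pos _ _
  · simp only [latentGap, escapeGap, if_true, sub_zero]
    rfl
  · simp only [latentGap, escapeGap, Nat.succ_ne_zero, if_false, Nat.add_sub_cancel]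
    rfl
  · exact sign_mul_refreshedPos M.width_pos hr (fun n => (hω.fresh i n).le) (universeMark_le hω i)
      (hinf i) (universeMark_spec hω i m).2.2.2

lemma tendsto_sum_latentGap (hr : 0 < r) (hω : IsTypical (M.width / 2) ω)
    (hc : IsCoupling M r (latentGap M r ω) (sourceMark ω) (latentMark M r ω)) (q : Clock d) :
    Tendsto (fun n => ∑ k ∈ Finset.range n, latentGap M r ω q k) atTop atTop := by
  have hsum := hω.tendsto_sum (half_pos M.width_pos)
  rcases q with _ | i | i | i
  · exact hsum _
  · exact hsum _
  · exact tendsto_sum_escapeGap hr (hω.gap_pos _) (hc.abs_refresh_lt i) (hc.infinite i) (hsum _)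
  · exact hsum _

lemma tendsto_latentGap (hω : IsTypical (M.width / 2) ω) (q : Clock d) (k : ℕ) :
    Tendsto (fun r => latentGap M r ω q k) atTop (𝓝 (sourceGap ω q k)) := by
  have hsum := hω.tendsto_sum (half_pos M.width_pos)
  rcases q with _ | i | i | i
  · exact tendsto_const_nhds
  · exact tendsto_const_nhds
  · have := tendsto_escapeGap M.width_pos (hω.gap_pos (.refresh i))
      (fun n => (hω.fresh i n).le) (universeMark_le hω i) (hω.average (.refresh i)) (hsum _) k
    rwa [(universeMark_spec hω i k).2.2.1] at this
  · exact tendsto_const_nhds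

lemma measurePreserving_latentMark (hr : 0 < r) :
    MeasurePreserving (fun (ω : Source d → ℝ) (p : Fin d × (ℕ ⊕ (ℕ ⊕ ℕ))) =>
        (Sum.elim (sourceGap ω (.bounce p.1)) (Sum.elim (sourceGap ω (.refresh p.1))
          (latentMark M r ω (.refresh p.1))) : ℕ ⊕ (ℕ ⊕ ℕ) → ℝ) p.2)
      (Measure.infinitePi (sourceLaw (d := d) (M.width / 2)))
      (Measure.infinitePi fun p : Fin d × (ℕ ⊕ (ℕ ⊕ ℕ)) => (Sum.elim (fun _ => expMeasure 1)
        (Sum.elim (fun _ => expMeasure 1) (fun _ => symmUniform (M.width / 2))) :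
          ℕ ⊕ (ℕ ⊕ ℕ) → Measure ℝ) p.2) := by
  have hh : 0 < M.width / 2 := half_pos M.width_pos
  have hp' := isProbabilityMeasure_markedStreamLaw hh
  have hq : ∀ k : ℕ ⊕ (ℕ ⊕ ℕ), IsProbabilityMeasure ((Sum.elim (fun _ => expMeasure 1)
        (Sum.elim (fun _ => expMeasure 1) (fun _ => symmUniform (M.width / 2))) :
          ℕ ⊕ (ℕ ⊕ ℕ) → Measure ℝ) k) := by
    rintro (k | k | k)
    · exact isProbabilityMeasure_expMeasure one_pos
    · exact isProbabilityMeasure_expMeasure one_pos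
    · exact isProbabilityMeasure_symmUniform hh
  have := (measurePreserving_blocks (d := d) (measurePreserving_latentBlock hh hr)).comp
    (measurePreserving_signMarks hh)
  exact this

lemma hasLaw_and_iIndepFun_latentMark (hr : 0 < r) :
    (∀ j : Fin d × (ℕ ⊕ (ℕ ⊕ ℕ)), HasLaw (fun ω : Source d → ℝ =>
      (Sum.elim (sourceGap ω (.bounce j.1)) (Sum.elim (sourceGap ω (.refresh j.1))
        (latentMark M r ω (.refresh j.1))) : ℕ ⊕ (ℕ ⊕ ℕ) → ℝ) j.2)
      ((Sum.elim (fun _ => expMeasure 1) (Sum.elim (fun _ => expMeasure 1)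
        (fun _ => symmUniform (M.width / 2))) : ℕ ⊕ (ℕ ⊕ ℕ) → Measure ℝ) j.2)
      (Measure.infinitePi (sourceLaw (M.width / 2)))) ∧
    iIndepFun (fun (j : Fin d × (ℕ ⊕ (ℕ ⊕ ℕ))) (ω : Source d → ℝ) =>
      (Sum.elim (sourceGap ω (.bounce j.1)) (Sum.elim (sourceGap ω (.refresh j.1))
        (latentMark M r ω (.refresh j.1))) : ℕ ⊕ (ℕ ⊕ ℕ) → ℝ) j.2)
      (Measure.infinitePi (sourceLaw (M.width / 2))) := by
  have hh : 0 < M.width / 2 := half_pos M.width_pos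
  have hq : ∀ k : ℕ ⊕ (ℕ ⊕ ℕ), IsProbabilityMeasure ((Sum.elim (fun _ => expMeasure 1)
        (Sum.elim (fun _ => expMeasure 1) (fun _ => symmUniform (M.width / 2))) :
          ℕ ⊕ (ℕ ⊕ ℕ) → Measure ℝ) k) := by
    rintro (k | k | k)
    · exact isProbabilityMeasure_expMeasure one_pos
    · exact isProbabilityMeasure_expMeasure one_pos
    · exact isProbabilityMeasure_symmUniform hh
  exact hasLaw_and_iIndepFun_of_measurePreserving (measurePreserving_latentMark (M := M) hr)

lemma ae_isCoupling_latentGap (hr : 0 < r) :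
    ∀ᵐ ω ∂Measure.infinitePi (sourceLaw (d := d) (M.width / 2)),
      IsCoupling M r (latentGap M r ω) (sourceMark ω) (latentMark M r ω) := by
  have hh : 0 < M.width / 2 := half_pos M.width_pos
  have hu : ∀ᵐ ω ∂Measure.infinitePi (sourceLaw (d := d) (M.width / 2)), ∀ i k,
      |latentMark M r ω (.refresh i) k| < M.width / 2 := by
    simp only [ae_all_iff]
    intro i k
    have h1 := (hasLaw_and_iIndepFun_latentMark (M := M) hr).1 (i, .inr (.inr k))
    have h2 := ae_symmUniform (M.width / 2)
    have h3 := h1.map_eq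
    simp only [Sum.elim_inr] at h3
    rw [← h3] at h2
    filter_upwards [ae_of_ae_map h1.aemeasurable h2] with ω hω using hω.1
  filter_upwards [ae_isTypical hh, hu] with ω hω hu using isCoupling_latentGap hr hω hu

theorem isLatentSticky_latentPosition (hM : ContDiff ℝ 2 M.densityPart) (hr : 0 < r)
    {y₀ v₀ : Fin d → ℝ} (hv₀ : ∀ i, v₀ i = 1 ∨ v₀ i = -1) :
    IsLatentSticky M r y₀ v₀ (Measure.infinitePi (sourceLaw (d := d) (M.width / 2)))
      (fun ω t => M.collapse (latentPosition ((latentSystem M r).path (latentGap M r ω)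
        (latentMark M r ω) (latentInit y₀ v₀) t)))
      (fun ω t => latentVelocity ((latentSystem M r).path (latentGap M r ω)
        (latentMark M r ω) (latentInit y₀ v₀) t)) := by
  obtain ⟨hlaw, hind⟩ := hasLaw_and_iIndepFun_latentMark (M := M) (d := d) hr
  refine ⟨fun i k ω => sourceGap ω (.bounce i) k, fun i k ω => sourceGap ω (.refresh i) k,
    fun i k ω => latentMark M r ω (.refresh i) k, fun i k => hlaw (i, .inl k),
    fun i k => hlaw (i, .inr (.inl k)), fun i k => hlaw (i, .inr (.inr k)), ?_, ?_⟩
  · have hinj : Function.Injective (Sum.elim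
        (fun a : Fin d × ℕ => ((a.1, .inl a.2) : Fin d × (ℕ ⊕ (ℕ ⊕ ℕ))))
        (Sum.elim (fun a : Fin d × ℕ => (a.1, .inr (.inl a.2)))
          (fun a : Fin d × ℕ => (a.1, .inr (.inr a.2))))) := by
      rintro (⟨i, k⟩ | ⟨i, k⟩ | ⟨i, k⟩) (⟨j, l⟩ | ⟨j, l⟩ | ⟨j, l⟩) h <;> simp_all
    have h := hind.precomp hinj
    convert h using 1
    ext q ω
    rcases q with ⟨i, k⟩ | ⟨i, k⟩ | ⟨i, k⟩ <;> rfl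
  · filter_upwards [ae_isTypical (half_pos M.width_pos), ae_isCoupling_latentGap hr] with ω hω hc
    exact ⟨_, isLatentPath_latent (g := latentGap M r ω) (mk := latentMark M r ω) hM hr.le hv₀
      hc.gap_pos (latentSystem_tendsto_time hM hr.le _ hc.gap_pos (tendsto_sum_latentGap hr hω hc)
        fun i k => (hc.abs_refresh_lt i k).le), fun t _ => rfl⟩

end latent

/-! ### Convergence -/

section measurability

variable {Ω : Type*} [MeasurableSpace Ω]

open Classical in
lemma measurable_count {p : Ω → ℕ → Prop} (hp : ∀ n, MeasurableSet {ω | p ω n}) (n : ℕ) :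
    Measurable fun ω => Nat.count (p ω) n := by
  induction n with
  | zero => simp only [Nat.count_zero]; exact measurable_const
  | succ n ih =>
    simp only [Nat.count_succ]
    exact ih.add (Measurable.ite (hp n) measurable_const measurable_const)

lemma measurable_nth {p : Ω → ℕ → Prop} (hp : ∀ n, MeasurableSet {ω | p ω n}) (m : ℕ) :
    Measurable fun ω => Nat.nth (p ω) m := by
  classical
  have key : ∀ n, n ≠ 0 → MeasurableSet {ω | Nat.nth (p ω) m = n} := by
    intro n hn
    have : {ω | Nat.nth (p ω) m = n} = {ω | p ω n} ∩ {ω | Nat.count (p ω) n = m} := by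
      ext ω
      simp only [mem_ofPred_eq, mem_inter_iff]
      constructor
      · rintro rfl
        have hm : ∀ hf : {n | p ω n}.Finite, m < hf.toFinset.card := by
          intro hf
          by_contra hc
          exact hn (Nat.nth_of_card_le hf (not_lt.1 hc))
        exact ⟨Nat.nth_mem m hm, Nat.count_nth hm⟩
      · rintro ⟨h1, rfl⟩; exact Nat.nth_count h1
    rw [this]
    exact (hp n).inter (measurable_count hp n (measurableSet_singleton m))
  refine measurable_to_countable' fun n => ?_
  -- `Nat.nth` takes the value `0` also by default, when there are too few indices; this value is
  -- treated through the complement.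
  by_cases hn : n = 0
  · subst hn
    have : (fun ω => Nat.nth (p ω) m) ⁻¹' {0} = (⋃ n, {ω | Nat.nth (p ω) m = n + 1})ᶜ := by
      ext ω
      simp only [mem_preimage, mem_singleton_iff, mem_compl_iff, mem_iUnion, mem_ofPred_eq,
        not_exists]
      constructor
      · intro h n; omega
      · intro h
        by_contra hc
        exact h (Nat.nth (p ω) m - 1) (by omega)
    rw [this]
    exact (MeasurableSet.iUnion fun n => key _ n.succ_ne_zero).compl
  · exact key n hn

lemma measurable_escapeGap {w r : ℝ} {f u : Ω → ℕ → ℝ} (hf : ∀ k, Measurable fun ω => f ω k)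
    (hu : ∀ k, Measurable fun ω => u ω k) (m : ℕ) :
    Measurable fun ω => escapeGap w r (f ω) (u ω) m := by
  have he : ∀ n, MeasurableSet {ω | Escapes w r (f ω) (u ω) n} := fun n =>
    measurableSet_lt (((hu n).abs).const_sub _) ((hf (n + 1)).div_const r)
  have ht : ∀ n, Measurable fun ω => escapeTime w r (f ω) (u ω) n := fun n =>
    ((Finset.measurable_fun_sum _ fun k _ => hf k).div_const r).add (((hu n).abs).const_sub _)
  have hn : ∀ m, Measurable fun ω =>
      escapeTime w r (f ω) (u ω) (Nat.nth (Escapes w r (f ω) (u ω)) m) := fun m =>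
    measurable_of_pieces (E := fun n => {ω | Nat.nth (Escapes w r (f ω) (u ω)) m = n})
      (fun n => measurable_nth he m (measurableSet_singleton n)) (fun ω => ⟨_, rfl⟩) ht
      fun n ω hω => by rw [show Nat.nth (Escapes w r (f ω) (u ω)) m = n from hω]
  unfold escapeGap
  refine (hn m).sub ?_
  split_ifs
  · exact measurable_const
  · exact hn _

end measurability

section convergence

variable {d : ℕ} {M : SpikeSlab d} {r : ℝ}

lemma measurable_latentGap (hr : 0 < r) (q : Clock d) (k : ℕ) :
    Measurable fun ω => latentGap M r ω q k := by
  rcases q with _ | i | i | i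
  · exact measurable_sourceGap _ _
  · exact measurable_sourceGap _ _
  · exact measurable_escapeGap (fun k => measurable_sourceGap _ k) (fun k =>
      (measurable_pi_apply ((i, .inr (.inr k)) : Fin d × (ℕ ⊕ (ℕ ⊕ ℕ)))).comp
        (measurePreserving_latentMark (M := M) hr).measurable) k
  · exact measurable_sourceGap _ _

/-- Two runs are close to each other up to time `T`. -/
def RunsClose (T δ : ℝ) (N : ℕ) (s s' : ℕ → ClockState (Clock d) (StickyState d)) : Prop :=
  (∀ k < N, ((s k).time < (s (k + 1)).time ∧ (s' k).time < (s' (k + 1)).time) ∧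
    Real.exp (-δ) * ((s k.succ).time - (s k).time) ≤ (s' (k + 1)).time - (s' k).time ∧
    (s' (k + 1)).time - (s' k).time ≤ Real.exp δ * ((s (k + 1)).time - (s k).time)) ∧
  ((s N).time < T ∧ T < (s (N + 1)).time ∧ (s' N).time < T ∧ T < (s' (N + 1)).time) ∧
  (Real.exp (-δ) * (T - (s N).time) ≤ T - (s' N).time ∧
    T - (s' N).time ≤ Real.exp δ * (T - (s N).time)) ∧
  ∀ k ≤ N, ∀ i, ((s k).pos i).2 = ((s' k).pos i).2 ∧ |((s k).pos i).1 - ((s' k).pos i).1| ≤ δ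

lemma measurableSet_runsClose {Ω : Type*} [MeasurableSpace Ω] {T δ : ℝ} {N : ℕ}
    {s s' : Ω → ℕ → ClockState (Clock d) (StickyState d)}
    (hs : ∀ k, Measurable fun ω => (s ω k).time) (hs' : ∀ k, Measurable fun ω => (s' ω k).time)
    (hp : ∀ k, Measurable fun ω => (s ω k).pos) (hp' : ∀ k, Measurable fun ω => (s' ω k).pos) :
    MeasurableSet {ω | RunsClose T δ N (s ω) (s' ω)} := by
  have hd : ∀ k, Measurable fun ω => (s ω (k + 1)).time - (s ω k).time := fun k =>
    (hs (k + 1)).sub (hs k)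
  have hd' : ∀ k, Measurable fun ω => (s' ω (k + 1)).time - (s' ω k).time := fun k =>
    (hs' (k + 1)).sub (hs' k)
  have hc : ∀ k i, Measurable fun ω => (s ω k).pos i := fun k i => (measurable_pi_apply i).comp (hp k)
  have hc' : ∀ k i, Measurable fun ω => (s' ω k).pos i := fun k i =>
    (measurable_pi_apply i).comp (hp' k)
  rw [measurableSet_setOfPred]
  unfold RunsClose
  refine (Measurable.forall fun k => Measurable.imp measurable_const ?_).and (.and ?_ (.and ?_ ?_))
  · exact ((measurableSet_setOfPred.1 (measurableSet_lt (hs k) (hs (k + 1)))).and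
      (measurableSet_setOfPred.1 (measurableSet_lt (hs' k) (hs' (k + 1))))).and
      ((measurableSet_setOfPred.1 (measurableSet_le ((hd k).const_mul _) (hd' k))).and
      (measurableSet_setOfPred.1 (measurableSet_le (hd' k) ((hd k).const_mul _))))
  · exact (measurableSet_setOfPred.1 (measurableSet_lt (hs N) measurable_const)).and
      ((measurableSet_setOfPred.1 (measurableSet_lt measurable_const (hs (N + 1)))).and
      ((measurableSet_setOfPred.1 (measurableSet_lt (hs' N) measurable_const)).and
      (measurableSet_setOfPred.1 (measurableSet_lt measurable_const (hs' (N + 1))))))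
  · exact (measurableSet_setOfPred.1 (measurableSet_le (((hs N).const_sub T).const_mul _)
      ((hs' N).const_sub T))).and (measurableSet_setOfPred.1 (measurableSet_le ((hs' N).const_sub T)
      (((hs N).const_sub T).const_mul _)))
  · refine Measurable.forall fun k => Measurable.imp measurable_const (Measurable.forall fun i => ?_)
    exact (measurableSet_setOfPred.1 (measurableSet_eq_fun (hc k i).snd (hc' k i).snd)).and
      (measurableSet_setOfPred.1 (measurableSet_le ((hc k i).fst.sub (hc' k i).fst).abs
        measurable_const))

lemma RunsClose.skorokhodDist_le {g g' mk : Clock d → ℕ → ℝ} {z₀ : StickyState d} {T δ : ℝ} {N : ℕ}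
    (hδ : 0 ≤ δ) (h : RunsClose T δ N ((stickySystem M 0).run g mk z₀)
      ((stickySystem M 0).run g' mk z₀)) :
    skorokhodDist T
      (fun t => (position ((stickySystem M 0).path g mk z₀ t),
        velocity ((stickySystem M 0).path g mk z₀ t)))
      (fun t => (position ((stickySystem M 0).path g' mk z₀ t),
        velocity ((stickySystem M 0).path g' mk z₀ t))) ≤
    max (ENNReal.ofReal δ) (ENNReal.ofReal (δ + T * (Real.exp δ - Real.exp (-δ)))) := by
  obtain ⟨h1, ⟨h2, h3, h4, h5⟩, ⟨h6, h7⟩, h8⟩ := h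
  exact skorokhodDist_run_le hδ (fun k hk => (h1 k hk).1.2) h4 h5 (fun k hk => (h1 k hk).1.1) h2 h3
    (fun k hk => (h1 k hk).2.1) (fun k hk => (h1 k hk).2.2) h6 h7 (fun k hk i => (h8 k hk i).1)
    (fun k hk i => (h8 k hk i).2)

/-- Runs whose events converge are eventually close. -/
lemma eventually_runsClose {ι : Type*} {l : Filter ι}
    {s : ι → ℕ → ClockState (Clock d) (StickyState d)}
    {s' : ℕ → ClockState (Clock d) (StickyState d)} {T δ : ℝ} {N : ℕ}
    (hlt : ∀ k < N, (s' k).time < (s' (k + 1)).time) (hT : (s' N).time < T)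
    (hT' : T < (s' (N + 1)).time)
    (htime : ∀ k, Tendsto (fun j => (s j k).time) l (𝓝 (s' k).time))
    (hpos : ∀ k, Tendsto (fun j => (s j k).pos) l (𝓝 (s' k).pos)) (hδ : 0 < δ) :
    ∀ᶠ j in l, RunsClose T δ N (s j) s' := by
  have hem : Real.exp (-δ) < 1 := Real.exp_lt_one_iff.2 (by linarith)
  have hep : 1 < Real.exp δ := Real.one_lt_exp_iff.2 hδ
  have hratio : ∀ {x : ι → ℝ} {y : ℝ}, 0 < y → Tendsto x l (𝓝 y) →
      ∀ᶠ j in l, Real.exp (-δ) * x j ≤ y ∧ y ≤ Real.exp δ * x j ∧ 0 < x j := by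
    intro x y hy hx
    have h1 := (hx.const_mul (Real.exp (-δ))).eventually_lt_const
      (show Real.exp (-δ) * y < y by nlinarith)
    have h2 := (hx.const_mul (Real.exp δ)).eventually_const_lt
      (show y < Real.exp δ * y by nlinarith)
    filter_upwards [h1, h2, hx.eventually_const_lt hy] with j h1 h2 h3
    exact ⟨h1.le, h2.le, h3⟩
  have hstep := (Finset.eventually_all (Finset.range N)).2 fun k hk =>
    hratio (sub_pos.2 (hlt k (Finset.mem_range.1 hk))) ((htime (k + 1)).sub (htime k))
  have hlast := hratio (sub_pos.2 hT) ((htime N).const_sub T)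
  have hnext := (htime (N + 1)).eventually_const_lt hT'
  have hcoord : ∀ k i, ∀ᶠ j in l, ((s j k).pos i).2 = ((s' k).pos i).2 ∧
      |((s j k).pos i).1 - ((s' k).pos i).1| ≤ δ := by
    intro k i
    have h := (tendsto_pi_nhds.1 (hpos k) i)
    have h1 := (continuous_fst.tendsto _).comp h
    have h2 := (continuous_snd.tendsto _).comp h
    rw [nhds_discrete, tendsto_pure] at h2
    filter_upwards [h2, (Metric.tendsto_nhds.1 h1) δ hδ] with j h2 h1
    exact ⟨h2, h1.le⟩
  have hcoords := (Finset.eventually_all (Finset.range (N + 1))).2 fun k _ =>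
    eventually_all.2 (hcoord k)
  filter_upwards [hstep, hlast, hnext, hcoords] with j h1 h2 h3 h4
  refine ⟨fun k hk => ?_, ⟨sub_pos.1 h2.2.2, h3, hT, hT'⟩, ⟨h2.1, h2.2.1⟩,
    fun k hk i => h4 k (Finset.mem_range.2 (by omega)) i⟩
  have := h1 k (Finset.mem_range.2 hk)
  exact ⟨⟨sub_pos.1 this.2.2, hlt k hk⟩, this.1, this.2.1⟩

variable (M) in
/-- The event that the two samplers are close to each other up to time `T`. -/
def CloseEvent (y₀ v₀ : Fin d → ℝ) (T δ r : ℝ) (ω : Source d → ℝ) : Prop :=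
  ((∀ i, sourceGap ω (.refresh i) 0 / r ≤ M.width) ∧
  (∀ i, v₀ i * y₀ i < M.width / 2 →
    sourceGap ω (.refresh i) 0 / r ≤ M.width / 2 - v₀ i * y₀ i) ∧
  ∀ i k, ∑ j ∈ Finset.range (k + 1), sourceGap ω (.refresh i) j ≤ r * T →
    sourceGap ω (.refresh i) (k + 1) / r ≤ M.width / 2) ∧
  ∃ N, RunsClose T δ N
    ((stickySystem M 0).run (latentGap M r ω) (sourceMark ω) (stickyInit M y₀ v₀))
    (originalRun M y₀ v₀ ω) ∧
  ∀ n ≤ N, ∀ i, ((stickySystem M 0).run (latentGap M r ω) (sourceMark ω)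
      (stickyInit M y₀ v₀) n).resid (.bounce i) ≠
    (stickySystem M 0).hazard (.bounce i) ((stickySystem M 0).run (latentGap M r ω) (sourceMark ω)
      (stickyInit M y₀ v₀) n).pos (hitTime i ((stickySystem M 0).run (latentGap M r ω)
        (sourceMark ω) (stickyInit M y₀ v₀) n).pos)

variable {y₀ v₀ : Fin d → ℝ} {T δ : ℝ}

lemma measurableSet_closeEvent (hM : ContDiff ℝ 2 M.densityPart) (hr : 0 < r) :
    MeasurableSet {ω | CloseEvent M y₀ v₀ T δ r ω} := by
  have hC := stickySystem_isContinuous (M := M) (r := 0) hM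
  have hrun := fun n => hC.measurable_run (stickySystem_regular hM le_rfl)
    (measurable_latentGap (M := M) hr) measurable_sourceMark (stickyInit M y₀ v₀) n
  have horig := measurable_originalRun hM y₀ v₀
  have hg : ∀ i k, Measurable fun ω : Source d → ℝ => sourceGap ω (.refresh i) k / r := fun i k =>
    (measurable_sourceGap _ _).div_const r
  rw [measurableSet_setOfPred]
  unfold CloseEvent
  refine .and (.and ?_ (.and ?_ ?_)) (.exists fun N => .and ?_ ?_)
  · exact Measurable.forall fun i => measurableSet_setOfPred.1 (measurableSet_le (hg i 0) measurable_const)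
  · exact Measurable.forall fun i => Measurable.imp measurable_const
      (measurableSet_setOfPred.1 (measurableSet_le (hg i 0) measurable_const))
  · exact Measurable.forall fun i => Measurable.forall fun k => Measurable.imp
      (measurableSet_setOfPred.1 (measurableSet_le
        (Finset.measurable_fun_sum _ fun j _ => measurable_sourceGap _ j) measurable_const))
      (measurableSet_setOfPred.1 (measurableSet_le (hg i (k + 1)) measurable_const))
  · exact measurableSet_setOfPred.1 (measurableSet_runsClose (fun k => (hrun k).1) (fun k => (horig k).1)
      (fun k => (hrun k).2.1) (fun k => (horig k).2.1))
  · refine Measurable.forall fun n => Measurable.imp measurable_const (Measurable.forall fun i => ?_)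
    refine (measurableSet_setOfPred.1 (measurableSet_eq_fun ((hrun n).2.2.1 _) ?_)).not
    exact hC.measurable_hazard (hrun n).2.1
      ((continuous_hitTime i).measurable.comp (hrun n).2.1) (fun _ => le_max_right _ _) _

lemma skorokhodDist_le_of_closeEvent (hM : ContDiff ℝ 2 M.densityPart)
    (hv₀ : ∀ i, v₀ i = 1 ∨ v₀ i = -1) (hr : 0 < r) (hδ : 0 ≤ δ) {ω : Source d → ℝ}
    (hω : IsTypical (M.width / 2) ω)
    (hc : IsCoupling M r (latentGap M r ω) (sourceMark ω) (latentMark M r ω))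
    (h : CloseEvent M y₀ v₀ T δ r ω) :
    skorokhodDist T
      (fun t => (M.collapse (latentPosition ((latentSystem M r).path (latentGap M r ω)
        (latentMark M r ω) (latentInit y₀ v₀) t)), latentVelocity ((latentSystem M r).path
        (latentGap M r ω) (latentMark M r ω) (latentInit y₀ v₀) t)))
      (fun t => (position ((stickySystem M 0).path (sourceGap ω) (sourceMark ω)
        (stickyInit M y₀ v₀) t), velocity ((stickySystem M 0).path (sourceGap ω) (sourceMark ω)
        (stickyInit M y₀ v₀) t))) ≤
    max (ENNReal.ofReal δ) (ENNReal.ofReal (δ + T * (Real.exp δ - Real.exp (-δ)))) := by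
  obtain ⟨⟨h1, h2, h3⟩, N, h4, h5⟩ := h
  rw [skorokhodDist_congr_left fun t ht htT => ?_]
  · exact h4.skorokhodDist_le hδ
  · have := collapse_latent_path hc hM hr hv₀ (tendsto_sum_latentGap hr hω hc) h1 h2 h3
      (fun n i hn => h5 n ?_ i) ht htT
    · exact Prod.ext this.1 this.2
    · by_contra hnN
      have hle := ClockSystem.run_time_mono (S := stickySystem M 0) (g := latentGap M r ω)
        (mk := sourceMark ω) (z₀ := stickyInit M y₀ v₀) (show N + 1 ≤ n by omega)
      have := h4.2.1.2.1
      simp only at hle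
      linarith

/-- Only finitely many events occur up to `T`. Their states converge, and the limiting run satisfies
the strict conditions because ties, bounces at hits and an event at `T` are excluded almost surely.
The conditions on the refreshment gaps hold for large `r` by `eventually_gap_le`. -/
lemma ae_eventually_closeEvent (hM : ContDiff ℝ 2 M.densityPart) (y₀ v₀ : Fin d → ℝ) (hT : 0 < T)
    (hδ : 0 < δ) : ∀ᵐ ω ∂Measure.infinitePi (sourceLaw (d := d) (M.width / 2)),
      ∀ᶠ r in atTop, CloseEvent M y₀ v₀ T δ r ω := by
  have hh : 0 < M.width / 2 := half_pos M.width_pos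
  have hS := stickySystem_regular (M := M) hM le_rfl
  have hC := stickySystem_isContinuous (M := M) (r := 0) hM
  filter_upwards [ae_isTypical hh, ae_tieFree_originalRun hM y₀ v₀ hh,
    ae_noBounceAtHit hM y₀ v₀ hh, ae_time_originalRun_ne hM y₀ v₀ hh hT] with ω hω htf hexo hne
  have hfirst : ∀ c : ℝ, 0 < c → ∀ i, ∀ᶠ r in atTop, sourceGap ω (.refresh i) 0 / r ≤ c :=
    fun c hc i => (tendsto_const_nhds.div_atTop tendsto_id).eventually_le_const hc
  have hrun := fun n => hC.tendsto_run hS (mk := sourceMark ω) (tendsto_latentGap hω)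
    (stickyInit M y₀ v₀) n fun j _ => htf j
  obtain ⟨N, hN, hN'⟩ := ClockSystem.exists_run_index (stickySystem_tendsto_time hM le_rfl
    (sourceMark ω) (stickyInit M y₀ v₀) hω.gap_pos (hω.tendsto_sum hh)) hT.le
  have hlt : ∀ n, (originalRun M y₀ v₀ ω n).time < (originalRun M y₀ v₀ ω (n + 1)).time := fun n =>
    lt_add_of_pos_right _ (hS.wait_pos (hS.run_resid_pos hω.gap_pos htf n))
  have hclose := eventually_runsClose (s := fun r => (stickySystem M 0).run (latentGap M r ω)
    (sourceMark ω) (stickyInit M y₀ v₀)) (s' := originalRun M y₀ v₀ ω) (fun k _ => hlt k)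
    (lt_of_le_of_ne hN (hne N)) hN' (fun k => (hrun k).1) (fun k => (hrun k).2.1) hδ
  have hbounce : ∀ n i, ∀ᶠ r in atTop, ((stickySystem M 0).run (latentGap M r ω) (sourceMark ω)
      (stickyInit M y₀ v₀) n).resid (.bounce i) ≠ (stickySystem M 0).hazard (.bounce i)
        ((stickySystem M 0).run (latentGap M r ω) (sourceMark ω) (stickyInit M y₀ v₀) n).pos
        (hitTime i ((stickySystem M 0).run (latentGap M r ω) (sourceMark ω)
          (stickyInit M y₀ v₀) n).pos) := by
    intro n i
    have h1 := hC.tendsto_hazard (hrun n).2.1 (((continuous_hitTime i).tendsto _).comp (hrun n).2.1)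
      (fun _ => le_max_right _ _) (le_max_right _ _) (.bounce i)
    have h2 := ((hrun n).2.2.1 (.bounce i)).sub h1
    filter_upwards [h2.eventually_ne (sub_ne_zero.2 (hexo n i))] with r hr
    exact sub_ne_zero.1 hr
  have hbounces := (Finset.eventually_all (Finset.range (N + 1))).2 fun n _ =>
    eventually_all.2 (hbounce n)
  have hgap : ∀ i, ∀ᶠ r : ℝ in atTop, ∀ n, ∑ k ∈ Finset.range n, sourceGap ω (.refresh i) k ≤ r * T →
      sourceGap ω (.refresh i) n / r ≤ M.width / 2 := fun i =>
    eventually_gap_le (hω.gap_pos _) (hω.average (.refresh i)) T hh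
  have hstart : ∀ i, ∀ᶠ r in atTop, v₀ i * y₀ i < M.width / 2 →
      sourceGap ω (.refresh i) 0 / r ≤ M.width / 2 - v₀ i * y₀ i := by
    intro i
    by_cases h : v₀ i * y₀ i < M.width / 2
    · filter_upwards [hfirst _ (sub_pos.2 h) i] with r hr _ using hr
    · exact Eventually.of_forall fun r h' => absurd h' h
  filter_upwards [eventually_all.2 (hfirst _ M.width_pos), eventually_all.2 hstart,
    eventually_all.2 hgap, hclose, hbounces] with r h1 h2 h3 h4 h5
  exact ⟨⟨h1, h2, fun i k => h3 i (k + 1)⟩, N, h4, fun n hn => h5 n (Finset.mem_range.2 (by omega))⟩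

lemma exists_dilation_bound (T : ℝ) {ε : ℝ} (hε : 0 < ε) :
    ∃ δ, 0 < δ ∧ δ ≤ ε ∧ δ + T * (Real.exp δ - Real.exp (-δ)) ≤ ε := by
  have hc : Continuous fun δ : ℝ => δ + T * (Real.exp δ - Real.exp (-δ)) := by fun_prop
  have h1 : ∀ᶠ δ in 𝓝[>] (0 : ℝ), δ + T * (Real.exp δ - Real.exp (-δ)) < ε :=
    (hc.continuousAt.eventually_lt continuousAt_const (by simpa using hε)).filter_mono
      nhdsWithin_le_nhds
  have h2 : ∀ᶠ δ in 𝓝[>] (0 : ℝ), δ < ε :=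
    (eventually_lt_nhds hε).filter_mono nhdsWithin_le_nhds
  obtain ⟨δ, h⟩ := (h1.and (h2.and (eventually_mem_nhdsWithin (a := (0 : ℝ)) (s := Ioi 0)))).exists
  exact ⟨δ, h.2.2, h.2.1.le, h.1.le⟩

/-- The latent sampler converges to the original sampler in probability. -/
theorem tendsto_measure_skorokhodDist (hM : ContDiff ℝ 2 M.densityPart)
    (hv₀ : ∀ i, v₀ i = 1 ∨ v₀ i = -1) (hT : 0 < T) {ε : ℝ} (hε : 0 < ε) :
    Tendsto (fun r : ℝ => Measure.infinitePi (sourceLaw (d := d) (M.width / 2))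
      {ω | ENNReal.ofReal ε < skorokhodDist T
        (fun t => (M.collapse (latentPosition ((latentSystem M r).path (latentGap M r ω)
          (latentMark M r ω) (latentInit y₀ v₀) t)), latentVelocity ((latentSystem M r).path
          (latentGap M r ω) (latentMark M r ω) (latentInit y₀ v₀) t)))
        (fun t => (position ((stickySystem M 0).path (sourceGap ω) (sourceMark ω)
          (stickyInit M y₀ v₀) t), velocity ((stickySystem M 0).path (sourceGap ω) (sourceMark ω)
          (stickyInit M y₀ v₀) t)))}) atTop (𝓝 0) := by
  have hh : 0 < M.width / 2 := half_pos M.width_pos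
  have hp := isProbabilityMeasure_sourceLaw (d := d) hh
  obtain ⟨δ, hδ, h1, h2⟩ := exists_dilation_bound T hε
  -- The measurability of the Skorokhod distance is not needed: the event of a large distance is
  -- contained, up to a null set, in the complement of the measurable event `CloseEvent`, whose
  -- probability tends to `0` by almost sure convergence of indicators.
  have hlim : Tendsto (fun r : ℝ => Measure.infinitePi (sourceLaw (d := d) (M.width / 2))
      {ω | 0 < r ∧ ¬ CloseEvent M y₀ v₀ T δ r ω}) atTop (𝓝 0) := by
    rw [← measure_empty (μ := Measure.infinitePi (sourceLaw (d := d) (M.width / 2)))]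
    refine tendsto_measure_of_ae_tendsto_indicator_of_isFiniteMeasure atTop MeasurableSet.empty
      (fun r => ?_) ?_
    · by_cases hr : 0 < r
      · simp only [hr, true_and]
        exact (measurableSet_closeEvent hM hr).compl
      · simp only [hr, false_and]
        exact MeasurableSet.const _
    · filter_upwards [ae_eventually_closeEvent hM y₀ v₀ hT hδ] with ω hω
      filter_upwards [hω] with r hr
      simp [hr]
  refine tendsto_of_tendsto_of_tendsto_of_le_of_le' tendsto_const_nhds hlim
    (Eventually.of_forall fun r => zero_le) ?_
  filter_upwards [eventually_gt_atTop 0] with r hr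
  refine measure_mono_ae ?_
  filter_upwards [ae_isTypical hh, ae_isCoupling_latentGap hr] with ω hω hc hbad
  refine ⟨hr, fun hclose => ?_⟩
  refine absurd ((skorokhodDist_le_of_closeEvent hM hv₀ hr hδ.le hω hc hclose).trans
    (max_le (ENNReal.ofReal_le_ofReal h1) (ENNReal.ofReal_le_ofReal h2))) (not_le.2 hbad)

end convergence

end

theorem theorem1 {d : ℕ} (M : SpikeSlab d) (hM : ContDiff ℝ 2 M.densityPart)
    (y₀ v₀ : Fin d → ℝ) (hv₀ : ∀ i, v₀ i = 1 ∨ v₀ i = -1) :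
    ∃ (Ω : Type) (_ : MeasurableSpace Ω) (P : Measure Ω) (_ : IsProbabilityMeasure P)
      (XO VO : Ω → ℝ → Fin d → ℝ) (XL VL : ℝ → Ω → ℝ → Fin d → ℝ),
      IsOriginalSticky M (M.collapse y₀) v₀ (fun i => M.startsStuck (y₀ i) (v₀ i)) P XO VO ∧
      (∀ r : ℝ, 0 < r → IsLatentSticky M r y₀ v₀ P (XL r) (VL r)) ∧
      ∀ T : ℝ, 0 < T → ∀ ε : ℝ, 0 < ε →
        Tendsto (fun r : ℝ =>
            P {ω | ENNReal.ofReal ε <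
              skorokhodDist T (fun t => (XL r ω t, VL r ω t)) (fun t => (XO ω t, VO ω t))})
          atTop (𝓝 0) := by
  have hp := isProbabilityMeasure_sourceLaw (d := d) (half_pos M.width_pos)
  exact ⟨Source d → ℝ, inferInstance, Measure.infinitePi (sourceLaw (M.width / 2)), inferInstance,
    _, _, _, _, isOriginalSticky_position hM hv₀,
    fun r hr => isLatentSticky_latentPosition hM hr hv₀,
    fun T hT ε hε => tendsto_measure_skorokhodDist hM hv₀ hT hε⟩
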